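/- **Setting.** Let $c=\sqrt{\pi}$. A mode is the Hilbert space $\mathcal H=L^2(\mathbb R)$ of wave functions in position representation, with quadratures $\hat q,\hat p$, $[\hat q,\hat p]=i$, and displacements $\hat V(v_1,v_2)=e^{-i(v_1\hat p-v_2\hat q)}$, i.e. $(\hat V(v_1,v_2)\psi)(x)=e^{i(v_2x-v_1v_2/2)}\psi(x-v_1)$. Let $\hat F=e^{i\pi\hat n/2}$, $(\hat F\psi)(x)=(2\pi)^{-1/2}\int e^{ixy}\psi(y)\,dy$ (it implements the logical Hadamard), and let $\mathrm{SUM}=e^{-i\hat q_1\hat p_2}$, $\psi(x_1,x_2)\mapsto\psi(x_1,x_2-x_1)$. For $\gamma=(\gamma_0,\gamma_1)$ the ideal GKP codeword is $|\overline\gamma\rangle=\sum_{n\in\mathbb Z}\gamma_{n\bmod 2}|cn\rangle_q$; in particular $|\overline\mu\rangle$, $\mu\in\{0,1\}$. *Stabilizer subsystem decomposition.* For $|z_1|,|z_2|<c/2$ put $|\mu;z\rangle=c^{-1/2}\hat V(z)|\overline\mu\rangle$. The generalized vectors $|\mu;z\rangle$ form a complete orthonormal system of $\mathcal H$, which gives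 $\mathcal H\cong\mathbb C^2\otimes\mathcal H_S$ with $\mathcal H_S=L^2([-c/2,c/2)^2)$. The $r$-filter ($0<r\le c/2$) is the projection $\hat\Pi_r=\sum_\mu\int_{|z_1|,|z_2|<r}|\mu;z\rangle\langle\mu;z|\,dz$; as a map it is $\rho\mapsto\hat\Pi_r\rho\hat\Pi_r$. The ideal GKP decoder is $\mathcal D(\rho)=\mathrm{Tr}_S\rho=\sum_{\mu,\nu}|\mu\rangle\langle\nu|\int\langle\mu;z|\rho|\nu;z\rangle\,dz$. *Noisy components.* An $s$-preparation of $|\overline 0\rangle$ prepares a countable mixture of normalized vectors $\int f(z)\hat V(z)|\overline 0\rangle\,dz$ with $f$ integrable and supported in $[-s,s)^2$. An $s$-parameterized noise channel $\mathcal N^s$ on one mode (on two modes) is a quantum channel whose Kraus operators are generalized linear combinations of displacements $\hat V(z)$ (of $\hat V(z)\otimes\hat V(z')$) with all displacement parameters in $[-s,s)$; here a generalized linear combination is an element of the closed linear span in the weak operator topology. For $s=0$ the only displacement allowed is the identity. An $s$-gate is the ideal unitary followed by some $\mathcal N^s$. An $s$-measurement of $\overline Z$ (of $\overline X$) is some $\mathcal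 N^s$ followed by measuring $\hat q$ (measuring $\hat p$), the outcome $t$ being replaced by the parity of the integer nearest to $t/c$. *The Knill-type error-correction gadget.* Mode 1 carries the input. Modes 2 and 3 are given $s_0$-preparations of $|\overline 0\rangle$, and an $s_H$-gate $\hat F$ is applied to mode 2. Then there follow an $s_\oplus$-gate $\mathrm{SUM}$ with control 2 and target 3, an $s_I$-waiting step (an $s_I$-gate for the identity) on mode 3, an $s_\oplus$-gate $\mathrm{SUM}$ with control 1 and target 2, another $s_I$-waiting step on mode 3, an $s_X$-measurement of $\overline X$ on mode 1 with outcome $a\in\{0,1\}$ and an $s_Z$-measurement of $\overline Z$ on mode 2 with outcome $b\in\{0,1\}$. The preparations and noise channels at different locations may differ. The output is mode 3; for the input $\rho$ let $\mathcal E_{a,b}(\rho)$ be its unnormalized state for outcomes $a,b$ (so its trace is the probability of the outcomes). Outcomes $(a,b)$ carry the Pauli frame $P_{a,b}=X^bZ^a$. Put $$s=2s_0+s_H+s_\oplus+\max\{s_\oplus+\max\{s_X,s_Z\},\,2s_I\}.$$ **Proposition (fault-tolerance condition for the $s$-error-correction gadget).** For every such gadget and every density operator $\rho$ on $\mathcal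 H$: (A) If $s<\sqrt\pi/2$, then $\hat\Pi_s\,\mathcal E_{a,b}(\rho)\,\hat\Pi_s=\mathcal E_{a,b}(\rho)$ for all $a,b\in\{0,1\}$. (B) If $r>0$ and $r+s<\sqrt\pi/2$, then, with $\rho_r=\hat\Pi_r\rho\hat\Pi_r$, $$\mathcal D(\mathcal E_{a,b}(\rho_r))=\tfrac14\,P_{a,b}\,\mathcal D(\rho_r)\,P_{a,b}^\dagger\qquad\text{for all }a,b\in\{0,1\};$$ hence, after undoing the Pauli frame, decoding the output equals decoding the input: $$\sum_{a,b}P_{a,b}^\dagger\,\mathcal D(\mathcal E_{a,b}(\rho_r))\,P_{a,b}=\mathcal D(\rho_r).$$ -/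

import Mathlib

open MeasureTheory
namespace GKP
noncomputable section

/-- The Hilbert space of square-integrable (position-representation) wave functions on `X`. -/
abbrev L2 (X : Type) [MeasureSpace X] : Type := Lp ℂ 2 (volume : Measure X)

section Multiplication
variable {X : Type} [MeasurableSpace X] {μ : Measure X}

theorem memLp_mul_of_le_one {m : X → ℂ} (hm : Measurable m) (hb : ∀ x, ‖m x‖ ≤ 1)
    (f : Lp ℂ 2 μ) : MemLp (fun x => m x * f x) 2 μ :=
  (Lp.memLp f).of_le (hm.aestronglyMeasurable.mul (Lp.aestronglyMeasurable f))
    (.of_forall fun x => by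
      rw [norm_mul]; exact mul_le_of_le_one_left (norm_nonneg _) (hb x))

/-- Multiplication by a measurable function `m` with `|m| ≤ 1`. -/
def mulOp (m : X → ℂ) (hm : Measurable m) (hb : ∀ x, ‖m x‖ ≤ 1) :
    Lp ℂ 2 μ →L[ℂ] Lp ℂ 2 μ :=
  LinearMap.mkContinuous
    { toFun := fun f => (memLp_mul_of_le_one hm hb f).toLp _
      map_add' := fun f g => by
        rw [← MemLp.toLp_add]
        refine MemLp.toLp_congr _ _ ?_
        filter_upwards [Lp.coeFn_add f g] with x hx
        rw [hx]; simp only [Pi.add_apply, mul_add]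
      map_smul' := fun a f => by
        rw [RingHom.id_apply, ← MemLp.toLp_const_smul]
        refine MemLp.toLp_congr _ _ ?_
        filter_upwards [Lp.coeFn_smul a f] with x hx
        simp [hx, mul_left_comm] }
    1 (fun f => by
      rw [one_mul]
      refine Lp.norm_le_norm_of_ae_le ?_
      filter_upwards [MemLp.coeFn_toLp (memLp_mul_of_le_one hm hb f)] with x hx
      rw [LinearMap.coe_mk, AddHom.coe_mk, hx, norm_mul]
      exact mul_le_of_le_one_left (norm_nonneg _) (hb x))

end Multiplication

section Tensor
variable {X Y : Type} [MeasureSpace X] [MeasureSpace Y]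
  [SFinite (volume : Measure X)] [SFinite (volume : Measure Y)]

theorem memLp_tmul (f : L2 X) (g : L2 Y) :
    MemLp (fun z : X × Y => f z.1 * g z.2) 2 (volume : Measure (X × Y)) := by
  have hm : AEStronglyMeasurable (fun z : X × Y => f z.1 * g z.2) (volume : Measure (X × Y)) :=
    (Lp.aestronglyMeasurable f).comp_fst.mul (Lp.aestronglyMeasurable g).comp_snd
  rw [memLp_two_iff_integrable_sq_norm hm]
  have h1 := (memLp_two_iff_integrable_sq_norm (Lp.aestronglyMeasurable f)).1 (Lp.memLp f)
  have h2 := (memLp_two_iff_integrable_sq_norm (Lp.aestronglyMeasurable g)).1 (Lp.memLp g)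
  simp only [norm_mul, mul_pow]
  exact h1.mul_prod h2

/-- The product vector `f ⊗ g`, that is `(x, y) ↦ f x * g y`. -/
def tmul (f : L2 X) (g : L2 Y) : L2 (X × Y) := (memLp_tmul f g).toLp _

theorem tmul_add_left (f f' : L2 X) (g : L2 Y) : tmul (f + f') g = tmul f g + tmul f' g := by
  unfold tmul
  rw [← MemLp.toLp_add]
  refine MemLp.toLp_congr _ _ ?_
  filter_upwards [Measure.quasiMeasurePreserving_fst.ae_eq_comp (Lp.coeFn_add f f')] with z hz
  have : (f + f' : L2 X) z.1 = f z.1 + f' z.1 := hz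
  simp only [this, Pi.add_apply, add_mul]

theorem tmul_add_right (f : L2 X) (g g' : L2 Y) : tmul f (g + g') = tmul f g + tmul f g' := by
  unfold tmul
  rw [← MemLp.toLp_add]
  refine MemLp.toLp_congr _ _ ?_
  filter_upwards [Measure.quasiMeasurePreserving_snd.ae_eq_comp (Lp.coeFn_add g g')] with z hz
  have : (g + g' : L2 Y) z.2 = g z.2 + g' z.2 := hz
  simp only [this, Pi.add_apply, mul_add]

theorem tmul_smul_left (a : ℂ) (f : L2 X) (g : L2 Y) : tmul (a • f) g = a • tmul f g := by
  unfold tmul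
  rw [← MemLp.toLp_const_smul]
  refine MemLp.toLp_congr _ _ ?_
  filter_upwards [Measure.quasiMeasurePreserving_fst.ae_eq_comp (Lp.coeFn_smul a f)] with z hz
  have : (a • f : L2 X) z.1 = a * f z.1 := hz
  simp [this, mul_assoc]

theorem tmul_smul_right (a : ℂ) (f : L2 X) (g : L2 Y) : tmul f (a • g) = a • tmul f g := by
  unfold tmul
  rw [← MemLp.toLp_const_smul]
  refine MemLp.toLp_congr _ _ ?_
  filter_upwards [Measure.quasiMeasurePreserving_snd.ae_eq_comp (Lp.coeFn_smul a g)] with z hz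
  have : (a • g : L2 Y) z.2 = a * g z.2 := hz
  simp [this, mul_left_comm]

theorem inner_tmul (f f' : L2 X) (g g' : L2 Y) :
    inner ℂ (tmul f g) (tmul f' g') = inner ℂ f f' * inner ℂ g g' := by
  rw [L2.inner_def, L2.inner_def, L2.inner_def, ← integral_prod_mul]
  refine integral_congr_ae ?_
  filter_upwards [MemLp.coeFn_toLp (memLp_tmul f g), MemLp.coeFn_toLp (memLp_tmul f' g')]
    with z h1 h2
  simp only [tmul, h1, h2, RCLike.inner_apply, map_mul]
  ring

theorem norm_tmul (f : L2 X) (g : L2 Y) : ‖tmul f g‖ = ‖f‖ * ‖g‖ := by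
  have h := inner_tmul f f g g
  simp only [inner_self_eq_norm_sq_to_K] at h
  have h' : ‖tmul f g‖ ^ 2 = (‖f‖ * ‖g‖) ^ 2 := by
    rw [mul_pow]; exact_mod_cast h
  exact (pow_left_inj₀ (norm_nonneg _) (by positivity) two_ne_zero).1 h'

/-- `f ↦ f ⊗ g`. -/
def tmulRight (g : L2 Y) : L2 X →L[ℂ] L2 (X × Y) :=
  LinearMap.mkContinuous
    { toFun := fun f => tmul f g
      map_add' := fun f f' => tmul_add_left f f' g
      map_smul' := fun a f => tmul_smul_left a f g }
    ‖g‖ (fun f => by simp [norm_tmul, mul_comm])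

/-- `g ↦ f ⊗ g`. -/
def tmulLeft (f : L2 X) : L2 Y →L[ℂ] L2 (X × Y) :=
  LinearMap.mkContinuous
    { toFun := fun g => tmul f g
      map_add' := fun g g' => tmul_add_right f g g'
      map_smul' := fun a g => tmul_smul_right a f g }
    ‖f‖ (fun g => by simp [norm_tmul])
end Tensor

section Trace
variable (E : Type) [NormedAddCommGroup E] [InnerProductSpace ℂ E] [CompleteSpace E]

/-- Index set of a chosen orthonormal basis of `E`. -/
def onbIndex : Set E := (exists_hilbertBasis ℂ E).choose
/-- A chosen orthonormal basis of `E`. -/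
def onb : HilbertBasis (onbIndex E) ℂ E := (exists_hilbertBasis ℂ E).choose_spec.choose

variable {E}
/-- The trace of an operator (used for trace-class operators only). -/
def opTrace (A : E →L[ℂ] E) : ℂ := ∑' i : onbIndex E, inner ℂ (onb E i) (A (onb E i))

/-- Density operators: positive operators of trace one. -/
def IsDensityOperator (ρ : E →L[ℂ] E) : Prop :=
  ρ.IsPositive ∧ HasSum (fun i : onbIndex E => inner ℂ (onb E i) (ρ (onb E i))) 1
end Trace

section Ampliation
variable {ι : Type} {E G : Type} [NormedAddCommGroup E] [InnerProductSpace ℂ E] [CompleteSpace E]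
  [NormedAddCommGroup G] [InnerProductSpace ℂ G] [CompleteSpace G]

theorem memlp_map (A : E →L[ℂ] E) (f : lp (fun _ : ι => E) 2) :
    Memℓp (fun i => A (f i)) 2 :=
  ((lp.memℓp f).norm.const_mul ‖A‖).mono' fun i => by
    simpa using A.le_opNorm (f i)

/-- `A` applied to every entry of a square-summable family. -/
def lpMap (A : E →L[ℂ] E) : lp (fun _ : ι => E) 2 →L[ℂ] lp (fun _ : ι => E) 2 :=
  LinearMap.mkContinuous
    { toFun := fun f => ⟨fun i => A (f i), memlp_map A f⟩
      map_add' := fun f g => by ext i; simp; rfl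
      map_smul' := fun a f => by ext i; simp }
    ‖A‖ (fun f => by
      have h : ‖(‖A‖ : ℂ) • f‖ = ‖A‖ * ‖f‖ := by rw [norm_smul]; simp
      rw [← h]
      refine lp.norm_mono two_ne_zero fun i => ?_
      rw [lp.coeFn_smul, Pi.smul_apply, norm_smul]
      simpa using A.le_opNorm (f i))


/-- The operator acting as `A` on each of the orthogonal copies `R i` of `E` in `G`
(here these copies span `G`). -/
def ampliate {R : ι → E →ₗᵢ[ℂ] G} (hR : OrthogonalFamily ℂ (fun _ : ι => E) R)
    (A : E →L[ℂ] E) : G →L[ℂ] G :=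
  hR.linearIsometry.toContinuousLinearMap ∘L lpMap A ∘L
    ContinuousLinearMap.adjoint hR.linearIsometry.toContinuousLinearMap

theorem ampliate_apply {R : ι → E →ₗᵢ[ℂ] G} (hR : OrthogonalFamily ℂ (fun _ : ι => E) R)
    (A : E →L[ℂ] E) (x : lp (fun _ : ι => E) 2) :
    ampliate hR A (hR.linearIsometry x) = hR.linearIsometry (lpMap A x) := by
  have h : ContinuousLinearMap.adjoint hR.linearIsometry.toContinuousLinearMap
      (hR.linearIsometry x) = x := by
    refine ext_inner_left ℂ fun y => ?_
    rw [ContinuousLinearMap.adjoint_inner_right]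
    exact hR.linearIsometry.inner_map_map y x
  simp only [ampliate, ContinuousLinearMap.comp_apply, h]
  rfl

end Ampliation

section OpTensor
variable {X Y : Type} [MeasureSpace X] [MeasureSpace Y]
  [SFinite (volume : Measure X)] [SFinite (volume : Measure Y)]

theorem norm_onb (E : Type) [NormedAddCommGroup E] [InnerProductSpace ℂ E] [CompleteSpace E]
    (i : onbIndex E) : ‖onb E i‖ = 1 := (onb E).orthonormal.1 i

/-- The isometry `f ↦ f ⊗ eᵢ`. -/
def rightIso (i : onbIndex (L2 Y)) : L2 X →ₗᵢ[ℂ] L2 (X × Y) :=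
  { (tmulRight (X := X) (onb (L2 Y) i)).toLinearMap with
    norm_map' := fun f => by
      show ‖tmul f (onb (L2 Y) i)‖ = ‖f‖
      rw [norm_tmul, norm_onb, mul_one] }

/-- The isometry `g ↦ eᵢ ⊗ g`. -/
def leftIso (i : onbIndex (L2 X)) : L2 Y →ₗᵢ[ℂ] L2 (X × Y) :=
  { (tmulLeft (Y := Y) (onb (L2 X) i)).toLinearMap with
    norm_map' := fun f => by
      show ‖tmul (onb (L2 X) i) f‖ = ‖f‖
      rw [norm_tmul, norm_onb, one_mul] }

theorem orthogonalFamily_right :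
    OrthogonalFamily ℂ (fun _ : onbIndex (L2 Y) => L2 X) (rightIso (X := X) (Y := Y)) := by
  intro i j hij v w
  show inner ℂ (tmul v (onb (L2 Y) i)) (tmul w (onb (L2 Y) j)) = 0
  rw [inner_tmul, (onb (L2 Y)).orthonormal.2 hij, mul_zero]

theorem orthogonalFamily_left :
    OrthogonalFamily ℂ (fun _ : onbIndex (L2 X) => L2 Y) (leftIso (X := X) (Y := Y)) := by
  intro i j hij v w
  show inner ℂ (tmul (onb (L2 X) i) v) (tmul (onb (L2 X) j) w) = 0
  rw [inner_tmul, (onb (L2 X)).orthonormal.2 hij, zero_mul]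

/-- The tensor product operator `A ⊗ B`; see `opTensor_tmul`. -/
def opTensor (A : L2 X →L[ℂ] L2 X) (B : L2 Y →L[ℂ] L2 Y) : L2 (X × Y) →L[ℂ] L2 (X × Y) :=
  ampliate orthogonalFamily_right A ∘L ampliate orthogonalFamily_left B

theorem ampliate_right_tmul (A : L2 X →L[ℂ] L2 X) (f : L2 X) (g : L2 Y) :
    ampliate orthogonalFamily_right A (tmul f g) = tmul (A f) g := by
  have key : ∀ f : L2 X, ∃ x : lp (fun _ : onbIndex (L2 Y) => L2 X) 2,
      (∀ i, x i = inner ℂ (onb (L2 Y) i) g • f) ∧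
      (orthogonalFamily_right (X := X) (Y := Y)).linearIsometry x = tmul f g := by
    intro f
    have hx : Memℓp (fun i => (onb (L2 Y)).repr g i • f) 2 := by
      refine ((lp.memℓp ((onb (L2 Y)).repr g)).norm.const_mul ‖f‖).mono' fun i => ?_
      rw [norm_smul]; simp [mul_comm]
    refine ⟨⟨_, hx⟩, fun i => by simp [HilbertBasis.repr_apply_apply], ?_⟩
    have h1 := (orthogonalFamily_right (X := X) (Y := Y)).hasSum_linearIsometry ⟨_, hx⟩
    have h2 := ((onb (L2 Y)).hasSum_repr g).mapL (tmulLeft f)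
    refine h1.unique ?_
    convert h2 using 2 with i
    · show tmul (_ • f) _ = tmul f (_ • _)
      rw [tmul_smul_left, tmul_smul_right]
    · rfl
  obtain ⟨x, hx, hxe⟩ := key f
  obtain ⟨y, hy, hye⟩ := key (A f)
  rw [← hxe, ampliate_apply, ← hye]
  congr 1
  ext1
  funext i
  show A (x i) = y i
  rw [hx, hy, map_smul]

theorem ampliate_left_tmul (B : L2 Y →L[ℂ] L2 Y) (f : L2 X) (g : L2 Y) :
    ampliate orthogonalFamily_left B (tmul f g) = tmul f (B g) := by
  have key : ∀ g : L2 Y, ∃ x : lp (fun _ : onbIndex (L2 X) => L2 Y) 2,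
      (∀ i, x i = inner ℂ (onb (L2 X) i) f • g) ∧
      (orthogonalFamily_left (X := X) (Y := Y)).linearIsometry x = tmul f g := by
    intro g
    have hx : Memℓp (fun i => (onb (L2 X)).repr f i • g) 2 := by
      refine ((lp.memℓp ((onb (L2 X)).repr f)).norm.const_mul ‖g‖).mono' fun i => ?_
      rw [norm_smul]; simp [mul_comm]
    refine ⟨⟨_, hx⟩, fun i => by simp [HilbertBasis.repr_apply_apply], ?_⟩
    have h1 := (orthogonalFamily_left (X := X) (Y := Y)).hasSum_linearIsometry ⟨_, hx⟩
    have h2 := ((onb (L2 X)).hasSum_repr f).mapL (tmulRight g)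
    refine h1.unique ?_
    convert h2 using 2 with i
    · show tmul _ (_ • g) = tmul (_ • _) g
      rw [tmul_smul_left, tmul_smul_right]
    · rfl
  obtain ⟨x, hx, hxe⟩ := key g
  obtain ⟨y, hy, hye⟩ := key (B g)
  rw [← hxe, ampliate_apply, ← hye]
  congr 1
  ext1
  funext i
  show B (x i) = y i
  rw [hx, hy, map_smul]

theorem opTensor_tmul (A : L2 X →L[ℂ] L2 X) (B : L2 Y →L[ℂ] L2 Y) (f : L2 X) (g : L2 Y) :
    opTensor A B (tmul f g) = tmul (A f) (B g) := by
  rw [opTensor, ContinuousLinearMap.comp_apply, ampliate_left_tmul, ampliate_right_tmul]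

/-- The partial trace over the first tensor factor. -/
def partialTraceLeft (σ : L2 (X × Y) →L[ℂ] L2 (X × Y)) : L2 Y →L[ℂ] L2 Y :=
  ∑' i : onbIndex (L2 X), ContinuousLinearMap.adjoint (tmulLeft (onb (L2 X) i)) ∘L σ ∘L
    tmulLeft (onb (L2 X) i)
end OpTensor

section SingleMode
/-- The spacing `√π` of the square GKP lattice. -/
def c : ℝ := √Real.pi

theorem c_pos : 0 < c := Real.sqrt_pos.2 Real.pi_pos

/-- The translation `(T_a ψ)(x) = ψ (x - a)`. -/
def translation (a : ℝ) : L2 ℝ →L[ℂ] L2 ℝ :=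
  (Lp.compMeasurePreservingₗᵢ ℂ (fun x : ℝ => x - a)
    (measurePreserving_sub_right volume a)).toContinuousLinearMap

/-- The displacement operator `V(v₁, v₂) = exp(-i (v₁ p - v₂ q))`, that is
`(V(v₁, v₂) ψ)(x) = exp(i (v₂ x - v₁ v₂ / 2)) ψ(x - v₁)`. -/
def displacement (v₁ v₂ : ℝ) : L2 ℝ →L[ℂ] L2 ℝ :=
  mulOp (fun x : ℝ => Complex.exp (((v₂ * x - v₁ * v₂ / 2 : ℝ) : ℂ) * Complex.I))
    (by fun_prop) (fun x => (Complex.norm_exp_ofReal_mul_I _).le) ∘L translation v₁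

/-- The SUM gate `exp(-i q₁ p₂)`: `ψ ↦ ψ(x₁, x₂ - x₁)`. -/
def sumGate : L2 (ℝ × ℝ) →L[ℂ] L2 (ℝ × ℝ) :=
  (Lp.compMeasurePreservingₗᵢ ℂ (fun x : ℝ × ℝ => (x.1, -x.1 + x.2))
    (measurePreserving_prod_neg_add volume volume)).toContinuousLinearMap

/-- The integer `n` for which `n √π` is nearest to `x`. -/
def bin (x : ℝ) : ℤ := ⌊x / c + 1 / 2⌋

theorem measurable_bin : Measurable bin := by unfold bin; fun_prop

open Classical in
/-- The projection onto outcome `b` of the GKP `Z`-measurement: position is measured and rounded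
to the nearest multiple of `√π`; the outcome is the parity of that multiple. -/
def measZ (b : ZMod 2) : L2 ℝ →L[ℂ] L2 ℝ :=
  mulOp (fun x : ℝ => if (bin x : ZMod 2) = b then 1 else 0)
    (Measurable.ite (measurable_bin (MeasurableSet.of_discrete (s := {n : ℤ | (n : ZMod 2) = b})))
      measurable_const measurable_const)
    (fun x => by split_ifs <;> simp)


theorem memLp_dilation (f : L2 ℝ) :
    MemLp (fun x : ℝ => f ((2 * Real.pi)⁻¹ * x)) 2 volume := by
  have ha : (2 * Real.pi)⁻¹ ≠ 0 := by positivity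
  refine MemLp.comp_of_map (g := f) (f := fun x : ℝ => (2 * Real.pi)⁻¹ * x) ?_ (by fun_prop)
  rw [Real.map_volume_mul_left ha]
  exact (Lp.memLp f).smul_measure ENNReal.ofReal_ne_top

theorem eLpNorm_dilation (f : L2 ℝ) :
    eLpNorm (fun x : ℝ => f ((2 * Real.pi)⁻¹ * x)) 2 volume
      = ENNReal.ofReal (2 * Real.pi) ^ (1 / 2 : ℝ) * eLpNorm f 2 volume := by
  have ha : (2 * Real.pi)⁻¹ ≠ 0 := by positivity
  have hp : |((2 * Real.pi)⁻¹)⁻¹| = 2 * Real.pi := by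
    rw [inv_inv, abs_of_pos (by positivity)]
  have hm := Real.map_volume_mul_left ha
  have := eLpNorm_map_measure (p := 2) (μ := volume) (g := f)
    (f := fun x : ℝ => (2 * Real.pi)⁻¹ * x)
    (by rw [hm]; exact (Lp.aestronglyMeasurable f).smul_measure _) (by fun_prop)
  rw [hm, eLpNorm_smul_measure_of_ne_zero (by simp), hp] at this
  simpa [Function.comp_def] using this.symm

/-- The unitary dilation `(D ψ)(x) = (2π)^(-1/2) ψ(x / 2π)`. -/
def dilation : L2 ℝ →L[ℂ] L2 ℝ :=
  ((√(2 * Real.pi))⁻¹ : ℂ) • LinearMap.mkContinuous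
    { toFun := fun f => (memLp_dilation f).toLp _
      map_add' := fun f g => by
        rw [← MemLp.toLp_add]
        refine MemLp.toLp_congr _ _ ?_
        have hq : Measure.QuasiMeasurePreserving (fun x : ℝ => (2 * Real.pi)⁻¹ * x) :=
          ⟨by fun_prop, by
            rw [Real.map_volume_mul_left (by positivity)]
            exact Measure.smul_absolutelyContinuous⟩
        filter_upwards [hq.ae_eq_comp (Lp.coeFn_add f g)] with x hx
        exact hx
      map_smul' := fun a f => by
        rw [RingHom.id_apply, ← MemLp.toLp_const_smul]
        refine MemLp.toLp_congr _ _ ?_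
        have hq : Measure.QuasiMeasurePreserving (fun x : ℝ => (2 * Real.pi)⁻¹ * x) :=
          ⟨by fun_prop, by
            rw [Real.map_volume_mul_left (by positivity)]
            exact Measure.smul_absolutelyContinuous⟩
        filter_upwards [hq.ae_eq_comp (Lp.coeFn_smul a f)] with x hx
        exact hx }
    (ENNReal.ofReal (2 * Real.pi) ^ (1 / 2 : ℝ)).toReal (fun f => by
      show ‖(memLp_dilation f).toLp _‖ ≤ _
      rw [Lp.norm_toLp, eLpNorm_dilation, ENNReal.toReal_mul]
      rfl)

/-- The Fourier gate `F = exp(i π n / 2)`, `n` the number operator: the unitary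
`(F ψ)(x) = (2π)^(-1/2) ∫ exp(i x y) ψ(y) dy`. It is Mathlib's inverse Fourier transform,
whose kernel is `exp(2 π i x y)`, followed by a dilation. -/
def fourierGate : L2 ℝ →L[ℂ] L2 ℝ :=
  dilation ∘L (Lp.fourierTransformₗᵢ ℝ ℂ).symm.toContinuousLinearEquiv.toContinuousLinearMap

/-- The projection onto outcome `a` of the GKP `X`-measurement: the same binning of the momentum. -/
def measX (a : ZMod 2) : L2 ℝ →L[ℂ] L2 ℝ :=
  fourierGate ∘L measZ a ∘L ContinuousLinearMap.adjoint fourierGate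

/-- The wave function of `c^(-1/2) ∫ dz f(z) V(z) |ψ̄⟩`, where `|ψ̄⟩ = ∑ₙ γ(n mod 2) |c n⟩` (sum over
the integers, position eigenkets) is the ideal GKP codeword with amplitudes `γ` and `c = √π`. -/
def gkpWave (γ : ZMod 2 → ℂ) (f : ℝ × ℝ → ℂ) (x : ℝ) : ℂ :=
  (√c : ℂ)⁻¹ * ∑' n : ℤ, γ n *
    ∫ z₂ : ℝ, Complex.exp (((z₂ * (x + c * n) / 2 : ℝ) : ℂ) * Complex.I) * f (x - c * n, z₂)

/-- The square of syndromes: both displacements are at least `-c/2` and less than `c/2`. -/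
def patch : Set (ℝ × ℝ) := Set.Ico (-(c / 2)) (c / 2) ×ˢ Set.Ico (-(c / 2)) (c / 2)

theorem measurableSet_patch : MeasurableSet patch := measurableSet_Ico.prod measurableSet_Ico

theorem sub_mem_Ico_iff (x : ℝ) (n : ℤ) :
    x - c * n ∈ Set.Ico (-(c / 2)) (c / 2) ↔ n = bin x := by
  have hc := c_pos
  rw [eq_comm, bin, Int.floor_eq_iff, Set.mem_Ico, ← sub_le_iff_le_add, le_div_iff₀ hc,
    ← lt_sub_iff_add_lt, div_lt_iff₀ hc]
  constructor <;> rintro ⟨h1, h2⟩ <;> constructor <;> nlinarith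

theorem gkpWave_eq (γ : ZMod 2 → ℂ) (g : ℝ × ℝ → ℂ) (x : ℝ) :
    gkpWave γ (patch.indicator g) x = (√c : ℂ)⁻¹ * (γ (bin x) *
      ∫ z₂ : ℝ, Complex.exp (((z₂ * (x + c * bin x) / 2 : ℝ) : ℂ) * Complex.I) *
        patch.indicator g (x - c * bin x, z₂)) := by
  rw [gkpWave, tsum_eq_single (bin x)]
  intro n hn
  have h : x - c * n ∉ Set.Ico (-(c / 2)) (c / 2) := fun h => hn ((sub_mem_Ico_iff x n).1 h)
  have : ∀ z₂, patch.indicator g (x - c * n, z₂) = 0 := fun z₂ =>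
    Set.indicator_of_notMem (fun hz => h hz.1) _
  simp [this]

theorem stronglyMeasurable_gkpWave (γ : ZMod 2 → ℂ) {g : ℝ × ℝ → ℂ} (hg : StronglyMeasurable g) :
    StronglyMeasurable (gkpWave γ (patch.indicator g)) := by
  have hG : StronglyMeasurable (patch.indicator g) := hg.indicator measurableSet_patch
  have h : ∀ n : ℤ, StronglyMeasurable fun x : ℝ => ∫ z₂ : ℝ,
      Complex.exp (((z₂ * (x + c * n) / 2 : ℝ) : ℂ) * Complex.I) *
        patch.indicator g (x - c * n, z₂) := by
    intro n
    refine StronglyMeasurable.integral_prod_right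
      (f := fun x z₂ : ℝ => Complex.exp (((z₂ * (x + c * n) / 2 : ℝ) : ℂ) * Complex.I) *
        patch.indicator g (x - c * n, z₂)) ?_
    refine StronglyMeasurable.mul ?_ (hG.comp_measurable (g := fun p : ℝ × ℝ => (p.1 - c * n, p.2)) (by fun_prop))
    exact Measurable.stronglyMeasurable (by fun_prop)
  have h2 : Measurable (fun p : ℤ × ℝ => γ p.1 * ∫ z₂ : ℝ,
      Complex.exp (((z₂ * (p.2 + c * p.1) / 2 : ℝ) : ℂ) * Complex.I) *
        patch.indicator g (p.2 - c * p.1, z₂)) :=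
    measurable_from_prod_countable_right fun n => ((h n).const_mul (γ n)).measurable
  have h3 := (h2.comp (measurable_bin.prodMk measurable_id)).const_mul (√c : ℂ)⁻¹
  refine Measurable.stronglyMeasurable ?_
  convert h3 using 1
  funext x
  rw [gkpWave_eq]
  rfl

theorem tsum_slice (k : ℝ → ℂ) (hk : MemLp k 2 volume)
    (hs : ∀ z ∉ Set.Ico (-(c / 2)) (c / 2), k z = 0) (z₁ : ℝ) :
    ∑' n : ℤ, ‖∫ z₂ : ℝ, Complex.exp (((z₂ * (z₁ + 2 * c * n) / 2 : ℝ) : ℂ) * Complex.I) * k z₂‖ₑ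
      ^ 2 = ENNReal.ofReal (2 * c) * ∫⁻ z₂, ‖k z₂‖ₑ ^ 2 := by
  have hc := c_pos
  have hcc : c * c = Real.pi := Real.mul_self_sqrt Real.pi_pos.le
  have hab : -c < c := by linarith
  set h : ℝ → ℂ := fun z₂ => Complex.exp (((z₂ * z₁ / 2 : ℝ) : ℂ) * Complex.I) * k z₂ with hh
  have hnorm : ∀ z, ‖h z‖ = ‖k z‖ := fun z => by
    rw [hh]; simp only [norm_mul, Complex.norm_exp_ofReal_mul_I, one_mul]
  have hmem : MemLp h 2 volume := by
    refine hk.of_le ?_ (.of_forall fun z => (hnorm z).le)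
    refine AEStronglyMeasurable.mul ?_ hk.1
    exact (Measurable.aestronglyMeasurable (by fun_prop))
  have hsupp : ∀ z ∉ Set.Ioc (-c) c, k z = 0 := fun z hz => hs z fun hz' => hz
    ⟨by linarith [hz'.1], by linarith [hz'.2]⟩
  have hint : ∀ F : ℝ → ℂ, (∀ z ∉ Set.Ioc (-c) c, F z = 0) → ∫ z in (-c)..c, F z = ∫ z, F z := by
    intro F hF
    rw [intervalIntegral.integral_of_le hab.le]
    exact setIntegral_eq_integral_of_forall_compl_eq_zero hF
  have hP := hasSum_sq_fourierCoeffOn hab (hmem.restrict (Set.Ioc (-c) c))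
  have hcoef : ∀ n : ℤ, ∫ z₂ : ℝ, Complex.exp (((z₂ * (z₁ + 2 * c * n) / 2 : ℝ) : ℂ) * Complex.I)
      * k z₂ = (2 * c : ℝ) * fourierCoeffOn hab h (-n) := by
    intro n
    rw [fourierCoeffOn_eq_integral, ← hint _ (fun z hz => by rw [hsupp z hz, mul_zero])]
    rw [← intervalIntegral.integral_smul, ← intervalIntegral.integral_const_mul]
    refine intervalIntegral.integral_congr fun z _ => ?_
    simp only [hh, neg_neg, fourier_coe_apply, smul_eq_mul, Complex.real_smul]
    have e1 : Complex.exp (((z * (z₁ + 2 * c * n) / 2 : ℝ) : ℂ) * Complex.I)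
        = Complex.exp (2 * Real.pi * Complex.I * n * z / ((c - -c : ℝ) : ℂ)) *
          Complex.exp (((z * z₁ / 2 : ℝ) : ℂ) * Complex.I) := by
      rw [← Complex.exp_add]
      congr 1
      have : (c : ℂ) ≠ 0 := by exact_mod_cast hc.ne'
      rw [← hcc]
      push_cast
      field_simp
      ring
    rw [e1]
    have : (c : ℂ) ≠ 0 := by exact_mod_cast hc.ne'
    have h2 : ((2 * c : ℝ) : ℂ) * ((1 / (c - -c) : ℝ) : ℂ) = 1 := by
      push_cast; field_simp; ring
    linear_combination (-(Complex.exp (2 * Real.pi * Complex.I * n * z / ((c - -c : ℝ) : ℂ)) *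
          Complex.exp (((z * z₁ / 2 : ℝ) : ℂ) * Complex.I) * k z)) * h2
  have hval : (c - -c)⁻¹ • ∫ x in (-c)..c, ‖h x‖ ^ 2 = (2 * c)⁻¹ * ∫ x, ‖k x‖ ^ 2 := by
    rw [intervalIntegral.integral_of_le hab.le,
      setIntegral_eq_integral_of_forall_compl_eq_zero (fun z hz => by
        rw [hnorm, hsupp z hz]; simp)]
    simp only [hnorm, smul_eq_mul]
    congr 2
    ring
  rw [hval] at hP
  have hP' : HasSum (fun n : ℤ => ‖∫ z₂ : ℝ, Complex.exp (((z₂ * (z₁ + 2 * c * n) / 2 : ℝ) : ℂ)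
      * Complex.I) * k z₂‖ ^ 2) (2 * c * ∫ x, ‖k x‖ ^ 2) := by
    have := ((Equiv.neg ℤ).hasSum_iff.2 hP).mul_left ((2 * c) ^ 2)
    have e1 : (2 * c) ^ 2 * ((2 * c)⁻¹ * ∫ x, ‖k x‖ ^ 2) = 2 * c * ∫ x, ‖k x‖ ^ 2 := by
      field_simp
    have e2 : (fun n : ℤ => ‖∫ z₂ : ℝ, Complex.exp (((z₂ * (z₁ + 2 * c * n) / 2 : ℝ) : ℂ)
        * Complex.I) * k z₂‖ ^ 2) = fun n => (2 * c) ^ 2 * ‖fourierCoeffOn hab h (-n)‖ ^ 2 := by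
      funext n
      rw [hcoef, norm_mul, mul_pow, Complex.norm_real, Real.norm_eq_abs, sq_abs]
    rw [e1] at this
    rw [e2]
    exact this
  have hk2 : Integrable (fun x => ‖k x‖ ^ 2) := (memLp_two_iff_integrable_sq_norm hk.1).1 hk
  have hl : ENNReal.ofReal (∫ x, ‖k x‖ ^ 2) = ∫⁻ z₂, ‖k z₂‖ₑ ^ 2 := by
    rw [ofReal_integral_eq_lintegral_ofReal hk2 (.of_forall fun x => by positivity)]
    refine lintegral_congr fun x => ?_
    rw [ENNReal.ofReal_pow (norm_nonneg _), ofReal_norm]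
  rw [← hl, ← ENNReal.ofReal_mul (by positivity), ← hP'.tsum_eq,
    ENNReal.ofReal_tsum_of_nonneg (fun n => by positivity) hP'.summable]
  refine tsum_congr fun n => ?_
  rw [ENNReal.ofReal_pow (norm_nonneg _), ofReal_norm]

theorem lintegral_gkpWave_le {γ : ZMod 2 → ℂ} (hγ : ∀ μ, ‖γ μ‖ ≤ 1) {g : ℝ × ℝ → ℂ}
    (hg : StronglyMeasurable g) (hg2 : MemLp g 2 (volume.restrict patch)) :
    ∫⁻ x, ‖gkpWave γ (patch.indicator g) x‖ₑ ^ 2 ≤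
      2 * ∫⁻ z in patch, ‖g z‖ₑ ^ 2 := by
  have hc := c_pos
  set f := patch.indicator g with hf
  have hfm : StronglyMeasurable f := hg.indicator measurableSet_patch
  have hf2 : MemLp f 2 volume := (memLp_indicator_iff_restrict measurableSet_patch).2 hg2
  have hfint : ∫⁻ z in patch, ‖g z‖ₑ ^ 2 = ∫⁻ z, ‖f z‖ₑ ^ 2 := by
    rw [← lintegral_indicator measurableSet_patch]
    refine lintegral_congr fun z => ?_
    by_cases hz : z ∈ patch <;> simp [hf, hz]
  have hslice : ∀ᵐ z₁ : ℝ, MemLp (fun z₂ => f (z₁, z₂)) 2 volume := by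
    have h1 := (memLp_two_iff_integrable_sq_norm hf2.1).1 hf2
    filter_upwards [h1.prod_right_ae] with z₁ hz
    rw [memLp_two_iff_integrable_sq_norm]
    · exact hz
    · exact (hfm.comp_measurable (by fun_prop : Measurable fun z₂ : ℝ => (z₁, z₂))).aestronglyMeasurable
  set A : ℤ → ℝ → ℂ := fun n z₁ => ∫ z₂ : ℝ,
    Complex.exp (((z₂ * (z₁ + 2 * c * n) / 2 : ℝ) : ℂ) * Complex.I) * f (z₁, z₂) with hA
  have hAm : ∀ n, Measurable fun z₁ => ‖A n z₁‖ₑ ^ 2 := by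
    intro n
    refine Measurable.pow_const ?_ 2
    refine Measurable.enorm (StronglyMeasurable.measurable ?_)
    refine StronglyMeasurable.integral_prod_right
      (f := fun z₁ z₂ : ℝ => Complex.exp (((z₂ * (z₁ + 2 * c * n) / 2 : ℝ) : ℂ) * Complex.I) *
        f (z₁, z₂)) ?_
    exact StronglyMeasurable.mul (Measurable.stronglyMeasurable (by fun_prop)) hfm
  have hpt : ∀ x, ‖gkpWave γ f x‖ₑ ^ 2 ≤ ENNReal.ofReal c⁻¹ * ∑' n : ℤ, ‖A n (x - c * n)‖ₑ ^ 2 := by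
    intro x
    have h0 : ‖gkpWave γ f x‖ₑ ^ 2 ≤ ENNReal.ofReal c⁻¹ * ‖A (bin x) (x - c * bin x)‖ₑ ^ 2 := by
      have e : gkpWave γ f x = (√c : ℂ)⁻¹ * (γ (bin x) * A (bin x) (x - c * bin x)) := by
        rw [gkpWave_eq, hA]
        simp only
        congr 3
        funext z
        congr 4
        ring_nf
      rw [e]
      simp only [← ofReal_norm]
      rw [← ENNReal.ofReal_pow (norm_nonneg _), ← ENNReal.ofReal_pow (norm_nonneg _),
        ← ENNReal.ofReal_mul (by positivity)]
      refine ENNReal.ofReal_le_ofReal ?_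
      rw [norm_mul, norm_mul, mul_pow, mul_pow]
      have h1 : ‖((√c : ℂ)⁻¹)‖ ^ 2 = c⁻¹ := by
        rw [norm_inv, Complex.norm_real, Real.norm_eq_abs, abs_of_nonneg (Real.sqrt_nonneg _),
          inv_pow, Real.sq_sqrt hc.le]
      rw [h1]
      have h2 : ‖γ (bin x)‖ ^ 2 ≤ 1 := pow_le_one₀ (norm_nonneg _) (hγ _)
      have h3 : 0 ≤ ‖A (bin x) (x - c * bin x)‖ ^ 2 := by positivity
      have h4 : 0 ≤ c⁻¹ := by positivity
      exact mul_le_mul_of_nonneg_left (mul_le_of_le_one_left h3 h2) h4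
    exact h0.trans (mul_le_mul_right (ENNReal.le_tsum (f := fun n : ℤ => ‖A n (x - c * n)‖ₑ ^ 2) (bin x)) _)
  calc ∫⁻ x, ‖gkpWave γ f x‖ₑ ^ 2
      ≤ ∫⁻ x, ENNReal.ofReal c⁻¹ * ∑' n : ℤ, ‖A n (x - c * n)‖ₑ ^ 2 := lintegral_mono hpt
    _ = ENNReal.ofReal c⁻¹ * ∑' n : ℤ, ∫⁻ x, ‖A n (x - c * n)‖ₑ ^ 2 := by
        rw [lintegral_const_mul' _ _ ENNReal.ofReal_ne_top, lintegral_tsum]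
        intro n
        exact ((hAm n).comp (measurable_id.sub_const (c * n))).aemeasurable
    _ = ENNReal.ofReal c⁻¹ * ∑' n : ℤ, ∫⁻ x, ‖A n x‖ₑ ^ 2 := by
        congr 2
        funext n
        exact lintegral_sub_right_eq_self (fun x => ‖A n x‖ₑ ^ 2) (c * n)
    _ = ENNReal.ofReal c⁻¹ * ∫⁻ x, ∑' n : ℤ, ‖A n x‖ₑ ^ 2 := by
        rw [lintegral_tsum fun n => (hAm n).aemeasurable]
    _ = ENNReal.ofReal c⁻¹ * ∫⁻ x, ENNReal.ofReal (2 * c) * ∫⁻ z₂, ‖f (x, z₂)‖ₑ ^ 2 := by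
        congr 1
        refine lintegral_congr_ae ?_
        filter_upwards [hslice] with x hx
        refine tsum_slice _ hx (fun z hz => ?_) x
        exact Set.indicator_of_notMem (fun h => hz h.2) _
    _ = 2 * ∫⁻ z, ‖f z‖ₑ ^ 2 := by
        rw [lintegral_const_mul' _ _ ENNReal.ofReal_ne_top, ← mul_assoc,
          ← ENNReal.ofReal_mul (by positivity), Measure.volume_eq_prod,
          lintegral_prod _ (hfm.measurable.enorm.pow_const 2).aemeasurable]
        congr 1
        rw [show c⁻¹ * (2 * c) = 2 by field_simp]
        simp
    _ = 2 * ∫⁻ z in patch, ‖g z‖ₑ ^ 2 := by rw [hfint]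
theorem memLp_gkpWave {γ : ZMod 2 → ℂ} (hγ : ∀ μ, ‖γ μ‖ ≤ 1)
    (g : Lp ℂ 2 (volume.restrict patch)) :
    MemLp (gkpWave γ (patch.indicator g)) 2 volume := by
  refine ⟨(stronglyMeasurable_gkpWave γ (Lp.stronglyMeasurable g)).aestronglyMeasurable, ?_⟩
  rw [eLpNorm_lt_top_iff_lintegral_rpow_enorm_lt_top two_ne_zero ENNReal.ofNat_ne_top]
  have h1 := lintegral_gkpWave_le hγ (Lp.stronglyMeasurable g) (Lp.memLp g)
  have h2 := (eLpNorm_lt_top_iff_lintegral_rpow_enorm_lt_top two_ne_zero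
    ENNReal.ofNat_ne_top).1 (Lp.memLp g).2
  simp only [ENNReal.toReal_ofNat, ENNReal.rpow_ofNat] at h2 ⊢
  exact h1.trans_lt (ENNReal.mul_lt_top (by simp) h2)

theorem ae_shift {P : ℝ → Prop} (h : ∀ᵐ z : ℝ, P z) : ∀ᵐ x : ℝ, P (x - c * bin x) := by
  have h1 : ∀ᵐ x : ℝ, ∀ n : ℤ, P (x - c * n) := by
    rw [ae_all_iff]
    intro n
    exact (measurePreserving_sub_right volume (c * n)).quasiMeasurePreserving.ae h
  filter_upwards [h1] with x hx using hx (bin x)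

theorem ae_slice {p : ℝ × ℝ → Prop} (h : ∀ᵐ z ∂(volume.restrict patch), p z) :
    ∀ᵐ z₁ : ℝ, ∀ᵐ z₂ : ℝ, (z₁, z₂) ∈ patch → p (z₁, z₂) :=
  Measure.ae_ae_of_ae_prod ((ae_restrict_iff' measurableSet_patch).1 h)

theorem integrable_slice (g : Lp ℂ 2 (volume.restrict patch)) :
    ∀ᵐ z₁ : ℝ, Integrable fun z₂ : ℝ =>
      patch.indicator g (z₁, z₂) := by
  have hfin : IsFiniteMeasure (volume.restrict patch) := ⟨by
    rw [Measure.restrict_apply_univ, patch, Measure.volume_eq_prod, Measure.prod_prod]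
    simp [ENNReal.mul_lt_top]⟩
  have h1 : Integrable g (volume.restrict patch) := (Lp.memLp g).integrable one_le_two
  have h2 : Integrable (patch.indicator g) (volume : Measure (ℝ × ℝ)) :=
    (integrable_indicator_iff measurableSet_patch).2 h1
  exact h2.prod_right_ae

theorem integrable_phase_mul {k : ℝ → ℂ} (hk : Integrable k) (a : ℝ) :
    Integrable fun z₂ : ℝ => Complex.exp (((z₂ * a / 2 : ℝ) : ℂ) * Complex.I) * k z₂ :=
  hk.bdd_mul (c := 1) (Measurable.aestronglyMeasurable (by fun_prop))
    (.of_forall fun z => (Complex.norm_exp_ofReal_mul_I _).le)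

/-- The stabilizer-subsystem decomposition, one logical value at a time: the map
`|μ⟩ ⊗ f ↦ ∫ f(z) |μ; z⟩ dz` over the patch, `|μ; z⟩ = c^(-1/2) V(z) |μ̄⟩`. Its adjoint is the
map `φ ↦ (z ↦ ⟨μ; z | φ⟩)`. -/
def sssSynth (μ : ZMod 2) : Lp ℂ 2 (volume.restrict patch) →L[ℂ] L2 ℝ :=
  have hγ : ∀ ν : ZMod 2, ‖(Pi.single μ 1 : ZMod 2 → ℂ) ν‖ ≤ 1 := fun ν => by
    by_cases h : ν = μ
    · subst h; simp
    · simp [h]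
  LinearMap.mkContinuous
    { toFun := fun g => (memLp_gkpWave hγ g).toLp _
      map_add' := fun g g' => by
        rw [← MemLp.toLp_add]
        refine MemLp.toLp_congr _ _ ?_
        filter_upwards [ae_shift (ae_slice (Lp.coeFn_add g g')),
          ae_shift (integrable_slice g), ae_shift (integrable_slice g')] with x h1 h2 h3
        rw [Pi.add_apply, gkpWave_eq, gkpWave_eq, gkpWave_eq, ← mul_add, ← mul_add,
          ← integral_add (integrable_phase_mul h2 _) (integrable_phase_mul h3 _)]
        congr 2
        refine integral_congr_ae ?_
        filter_upwards [h1] with z hz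
        by_cases hp : (x - c * bin x, z) ∈ patch
        · simp only [Set.indicator_of_mem hp, hz hp, Pi.add_apply, mul_add]
        · simp only [Set.indicator_of_notMem hp, mul_zero, add_zero]
      map_smul' := fun a g => by
        rw [RingHom.id_apply, ← MemLp.toLp_const_smul]
        refine MemLp.toLp_congr _ _ ?_
        filter_upwards [ae_shift (ae_slice (Lp.coeFn_smul a g))] with x h1
        rw [Pi.smul_apply, gkpWave_eq, gkpWave_eq, smul_eq_mul, mul_left_comm a,
          mul_left_comm a, ← integral_const_mul (μ := volume) a]
        congr 2
        refine integral_congr_ae ?_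
        filter_upwards [h1] with z hz
        by_cases hp : (x - c * bin x, z) ∈ patch
        · simp only [Set.indicator_of_mem hp, hz hp, Pi.smul_apply, smul_eq_mul, mul_left_comm]
        · simp only [Set.indicator_of_notMem hp, mul_zero] }
    √2 (fun g => by
      have h1 := lintegral_gkpWave_le hγ (Lp.stronglyMeasurable g) (Lp.memLp g)
      show ‖(memLp_gkpWave hγ g).toLp _‖ ≤ _
      have e1 : eLpNorm (gkpWave (Pi.single μ 1) (patch.indicator g)) 2 volume ≤
          2 ^ (1 / 2 : ℝ) * eLpNorm g 2 (volume.restrict patch) := by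
        rw [eLpNorm_eq_lintegral_rpow_enorm_toReal two_ne_zero ENNReal.ofNat_ne_top,
          eLpNorm_eq_lintegral_rpow_enorm_toReal two_ne_zero ENNReal.ofNat_ne_top]
        simp only [ENNReal.toReal_ofNat, ENNReal.rpow_ofNat]
        exact (ENNReal.rpow_le_rpow h1 (by norm_num)).trans
          (ENNReal.mul_rpow_of_nonneg _ _ (by norm_num)).le
      rw [Lp.norm_toLp, Lp.norm_def, Real.sqrt_eq_rpow]
      have e2 : ((2 : ENNReal) ^ (1 / 2 : ℝ)).toReal = (2 : ℝ) ^ (1 / 2 : ℝ) := by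
        rw [← ENNReal.toReal_rpow]; simp
      rw [← e2, ← ENNReal.toReal_mul]
      exact ENNReal.toReal_mono
        (ENNReal.mul_ne_top (by simp) (Lp.memLp g).2.ne) e1)

theorem measurableSet_box (r : ℝ) : MeasurableSet {z : ℝ × ℝ | |z.1| < r ∧ |z.2| < r} :=
  ((isOpen_lt continuous_fst.abs continuous_const).inter
    (isOpen_lt continuous_snd.abs continuous_const)).measurableSet

open Classical in
/-- The `r`-filter `∑_μ ∫_{|z₁|, |z₂| < r} |μ; z⟩⟨μ; z| dz`. -/
def sssFilter (r : ℝ) : L2 ℝ →L[ℂ] L2 ℝ :=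
  ∑ μ : ZMod 2, sssSynth μ ∘L
    mulOp (fun z : ℝ × ℝ => if |z.1| < r ∧ |z.2| < r then 1 else 0)
      (Measurable.ite (measurableSet_box r) measurable_const measurable_const)
      (fun z => by split_ifs <;> simp) ∘L
    ContinuousLinearMap.adjoint (sssSynth μ)

/-- `ρ ↦ K ρ K†`. -/
def conj {E F : Type} [NormedAddCommGroup E] [InnerProductSpace ℂ E] [CompleteSpace E]
    [NormedAddCommGroup F] [InnerProductSpace ℂ F] [CompleteSpace F]
    (K : E →L[ℂ] F) (ρ : E →L[ℂ] E) : F →L[ℂ] F :=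
  K ∘L ρ ∘L ContinuousLinearMap.adjoint K

/-- The ideal GKP decoder: trace over the stabilizer subsystem, the `(μ, ν)` entry of the result
being `∫ ⟨μ; z | ρ | ν; z⟩ dz` over the patch. -/
def gkpDecoder (ρ : L2 ℝ →L[ℂ] L2 ℝ) : Matrix (ZMod 2) (ZMod 2) ℂ :=
  Matrix.of fun μ ν => opTrace (ContinuousLinearMap.adjoint (sssSynth μ) ∘L ρ ∘L sssSynth ν)

/-- A vector `∫ dz₁ dz₂ f(z₁, z₂) V(z₁, z₂) |ψ̄⟩` of norm one with `f` supported in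
`[-s, s) × [-s, s)`, `|ψ̄⟩` being the ideal GKP codeword with amplitudes `γ` (the constant
`c^(-1/2)` in `gkpWave` is absorbed into `f`). -/
def IsParamGKPVector (γ : ZMod 2 → ℂ) (s : ℝ) (φ : L2 ℝ) : Prop :=
  ‖φ‖ = 1 ∧ ∃ f : ℝ × ℝ → ℂ, Integrable f ∧
    Function.support f ⊆ Set.Ico (-s) s ×ˢ Set.Ico (-s) s ∧ φ =ᵐ[volume] gkpWave γ f

/-- An `s`-parameterized preparation of the codeword with amplitudes `γ`: a (countable) mixture of
normalized vectors as in `IsParamGKPVector`. -/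
structure Preparation (γ : ZMod 2 → ℂ) (s : ℝ) where
  prob : ℕ → ℝ
  vec : ℕ → L2 ℝ
  prob_nonneg : ∀ i, 0 ≤ prob i
  prob_sum : HasSum prob 1
  vec_param : ∀ i, IsParamGKPVector γ s (vec i)

/-- The prepared density operator. -/
def Preparation.state {γ : ZMod 2 → ℂ} {s : ℝ} (P : Preparation γ s) : L2 ℝ →L[ℂ] L2 ℝ :=
  ∑' i, (P.prob i : ℂ) • InnerProductSpace.rankOne ℂ (P.vec i) (P.vec i)

end SingleMode

section Noise
variable {E : Type} [NormedAddCommGroup E] [InnerProductSpace ℂ E] [CompleteSpace E]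

/-- `ρ ↦ ∑ⱼ Kⱼ ρ Kⱼ†`. -/
def kraus (K : ℕ → E →L[ℂ] E) (ρ : E →L[ℂ] E) : E →L[ℂ] E := ∑' j, conj (K j) ρ

/-- The generalized linear combinations of the operators in `S`: the closure of their linear span
in the weak operator topology. It contains the weak integrals `∫ f(z) V(z) dz` of families in `S`. -/
def closedSpan (S : Set (E →L[ℂ] E)) : Set (E →L[ℂ] E) :=
  {K | ContinuousLinearMapWOT.ofCLM K ∈
    closure (ContinuousLinearMapWOT.ofCLM '' (Submodule.span ℂ S : Set (E →L[ℂ] E)))}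

/-- A quantum channel, given by Kraus operators that are generalized linear combinations of
operators in `S`. -/
structure NoiseChannel (S : Set (E →L[ℂ] E)) where
  op : ℕ → E →L[ℂ] E
  mem : ∀ j, op j ∈ closedSpan S
  trace_preserving : ∀ ψ : E, HasSum (fun j => ‖op j ψ‖ ^ 2) (‖ψ‖ ^ 2)

/-- The displacements by at most `s` in each direction. For `s > 0` their closed span is that of the
displacements by vectors in the half-open square `[-s, s) × [-s, s)`; for `s = 0` only the identity
is left, so that `s = 0` describes noiseless operation. -/
def smallDisp (s : ℝ) : Set (L2 ℝ →L[ℂ] L2 ℝ) :=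
  {V | ∃ z₁ ∈ Set.Icc (-s) s, ∃ z₂ ∈ Set.Icc (-s) s, V = displacement z₁ z₂}

/-- The displacements of two modes by at most `s` in each direction. -/
def smallDisp₂ (s : ℝ) : Set (L2 (ℝ × ℝ) →L[ℂ] L2 (ℝ × ℝ)) :=
  {V | ∃ A ∈ smallDisp s, ∃ B ∈ smallDisp s, V = opTensor A B}

end Noise

section ErrorCorrection

/-- The identification of `(H₁ ⊗ H₂) ⊗ H₃` with `H₁ ⊗ (H₂ ⊗ H₃)`. -/
def assoc : L2 ((ℝ × ℝ) × ℝ) →L[ℂ] L2 (ℝ × (ℝ × ℝ)) :=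
  (Lp.compMeasurePreservingₗᵢ ℂ (MeasurableEquiv.prodAssoc (α := ℝ) (β := ℝ) (γ := ℝ)).symm
    (MeasurePreserving.symm _
      (volume_preserving_prodAssoc (α₁ := ℝ) (β₁ := ℝ) (γ₁ := ℝ)))).toContinuousLinearMap

/-- `A` acting on mode 1 of three. -/
def on1 (A : L2 ℝ →L[ℂ] L2 ℝ) : L2 ((ℝ × ℝ) × ℝ) →L[ℂ] L2 ((ℝ × ℝ) × ℝ) :=
  opTensor (opTensor A (ContinuousLinearMap.id ℂ (L2 ℝ))) (ContinuousLinearMap.id ℂ (L2 ℝ))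

/-- `A` acting on mode 2 of three. -/
def on2 (A : L2 ℝ →L[ℂ] L2 ℝ) : L2 ((ℝ × ℝ) × ℝ) →L[ℂ] L2 ((ℝ × ℝ) × ℝ) :=
  opTensor (opTensor (ContinuousLinearMap.id ℂ (L2 ℝ)) A) (ContinuousLinearMap.id ℂ (L2 ℝ))

/-- `A` acting on mode 3 of three. -/
def on3 (A : L2 ℝ →L[ℂ] L2 ℝ) : L2 ((ℝ × ℝ) × ℝ) →L[ℂ] L2 ((ℝ × ℝ) × ℝ) :=
  opTensor (ContinuousLinearMap.id ℂ (L2 (ℝ × ℝ))) A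

/-- `B` acting on modes 1 and 2 of three. -/
def on12 (B : L2 (ℝ × ℝ) →L[ℂ] L2 (ℝ × ℝ)) : L2 ((ℝ × ℝ) × ℝ) →L[ℂ] L2 ((ℝ × ℝ) × ℝ) :=
  opTensor B (ContinuousLinearMap.id ℂ (L2 ℝ))

/-- `B` acting on modes 2 and 3 of three. -/
def on23 (B : L2 (ℝ × ℝ) →L[ℂ] L2 (ℝ × ℝ)) : L2 ((ℝ × ℝ) × ℝ) →L[ℂ] L2 ((ℝ × ℝ) × ℝ) :=
  ContinuousLinearMap.adjoint assoc ∘L opTensor (ContinuousLinearMap.id ℂ (L2 ℝ)) B ∘L assoc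

/-- A Knill-type error-correction gadget, assembled from two noisy preparations of the logical zero
and one noise channel after (before, for measurements) each other location of the circuit. -/
structure ECGadget (s₀ sH sSum sX sZ sI : ℝ) where
  prep₂ : Preparation (Pi.single 0 1) s₀
  prep₃ : Preparation (Pi.single 0 1) s₀
  noiseH : NoiseChannel (smallDisp sH)
  noiseSum₂₃ : NoiseChannel (smallDisp₂ sSum)
  noiseSum₁₂ : NoiseChannel (smallDisp₂ sSum)
  noiseI : NoiseChannel (smallDisp sI)
  noiseI' : NoiseChannel (smallDisp sI)
  noiseX : NoiseChannel (smallDisp sX)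
  noiseZ : NoiseChannel (smallDisp sZ)

variable {s₀ sH sSum sX sZ sI : ℝ}

/-- The state of the three modes just before the ideal measurements, for input `ρ` on mode 1.
Mode 2 is a logical zero followed by a noisy Fourier gate, mode 3 a logical zero. A noisy SUM gate
acts from mode 2 to mode 3, mode 3 waits, a noisy SUM gate acts from mode 1 to mode 2 and mode 3
waits again; finally the noise of the `X`-measurement acts on mode 1 and that of the `Z`-measurement
on mode 2. -/
def ECGadget.preMeasurement (G : ECGadget s₀ sH sSum sX sZ sI) (ρ : L2 ℝ →L[ℂ] L2 ℝ) :
    L2 ((ℝ × ℝ) × ℝ) →L[ℂ] L2 ((ℝ × ℝ) × ℝ) :=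
  let τ := kraus G.noiseH.op (conj fourierGate G.prep₂.state)
  let σ₀ := opTensor (opTensor ρ τ) G.prep₃.state
  let σ₁ := kraus (fun j => on23 (G.noiseSum₂₃.op j)) (conj (on23 sumGate) σ₀)
  let σ₂ := kraus (fun j => on3 (G.noiseI.op j)) σ₁
  let σ₃ := kraus (fun j => on12 (G.noiseSum₁₂.op j)) (conj (on12 sumGate) σ₂)
  let σ₄ := kraus (fun j => on3 (G.noiseI'.op j)) σ₃
  let σ₅ := kraus (fun j => on1 (G.noiseX.op j)) σ₄
  kraus (fun j => on2 (G.noiseZ.op j)) σ₅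

/-- The state of mode 3, not normalized, when the `X`-measurement of mode 1 has outcome `a` and the
`Z`-measurement of mode 2 has outcome `b`; its trace is the probability of these outcomes. -/
def ECGadget.output (G : ECGadget s₀ sH sSum sX sZ sI) (a b : ZMod 2) (ρ : L2 ℝ →L[ℂ] L2 ℝ) :
    L2 ℝ →L[ℂ] L2 ℝ :=
  partialTraceLeft (conj (on1 (measX a) ∘L on2 (measZ b)) (G.preMeasurement ρ))

/-- The Pauli matrix `X`. -/
def pauliX : Matrix (ZMod 2) (ZMod 2) ℂ := Matrix.of fun μ ν => if μ = ν + 1 then 1 else 0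

/-- The Pauli matrix `Z`. -/
def pauliZ : Matrix (ZMod 2) (ZMod 2) ℂ := Matrix.diagonal fun μ => (-1) ^ μ.val

/-- The Pauli frame belonging to the measurement outcomes `a`, `b`. -/
def pauliFrame (a b : ZMod 2) : Matrix (ZMod 2) (ZMod 2) ℂ := pauliX ^ b.val * pauliZ ^ a.val

end ErrorCorrection

end
end GKP

/-! The argument runs in the Heisenberg picture with binned quadratures. `posOp b r` and `momOp b r`
project onto positions, respectively momenta, closer than r to a multiple of c of parity b. Because
c² = π, the set of such x is {cos(cr) < (-1)^b cos(cx)} for 0 ≤ r ≤ c, so the projection is a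
function of the phase e^{icx}. Hence every operator that intertwines two phases e^{icφ} and e^{icφ'}
also intertwines the bins of φ and φ' (Weierstrass approximation: `intertwine_indOp`,
`intertwine_binOp_add`). The behaviour of gates and noise follows from such phase relations. A
displacement by at most s enlarges the radius by s and keeps the parity. SUM acts by q₂ → q₁ + q₂
and p₁ → p₁ - p₂, so that radii and parities add. "V maps the range of P into that of Q" is a
linear, weakly closed condition on V, so it passes from displacements to the Kraus operators of the
noise (`comp_eq_of_mem_closedSpan`).

The bridge to the stabilizer subsystem is completeness, `sssSynth_comp_adjoint`. For r ≤ c/2 it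
identifies the r-filter with the product of the commuting position and momentum cut-offs
(`sssFilter_eq`), and it writes the (μ, ν) decoder entry as the trace against (1 + (-1)^ν Z)/2 ·
X^{μ+ν}, where Z and X are the signs of the position and momentum bins (`gkpDecoder_apply`).

States are handled as countable sums of pure states, and channels act on the vectors (`IsEnsemble`,
`expect_kraus`). A prepared logical zero has positions within s₀ of even multiples of c and momenta
within s₀ of multiples of c. The momentum statement needs an argument of its own, since the weight f
is only integrable (`adjoint_fourierGate_eq_zero`).

For (A), only mode 3 matters: its position radius grows to s₀ + (s₀ + sH) + sSum + 2 sI, its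
momentum radius stays smaller, and the remaining operations commute with mode 3
(`isTracked_output`).

For (B), all radii stay at most c/2, so parities propagate without error and the logical operators
pull back as in the ideal circuit: X₁ becomes X₁X₂X₃, Z₂ becomes Z₁Z₂, Z₃ becomes Z₂Z₃, and X₃
stays. On v ⊗ w ⊗ u with Xw = w and Zu = u, the expectations ⟨w, Zw⟩ and ⟨u, Xu⟩ vanish by
anticommutation, and what is left is one quarter of the Pauli-conjugated decoder entry
(`inner_prodOp_tmul`, `opTrace_outObs`). -/

namespace GKP
noncomputable section

/-! ### Multiplication operators on L². -/

section MulOp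
variable {X : Type} [MeasurableSpace X] {μ : Measure X}

theorem coeFn_mulOp (m : X → ℂ) (hm : Measurable m) (hb : ∀ x, ‖m x‖ ≤ 1) (f : Lp ℂ 2 μ) :
    mulOp m hm hb f =ᵐ[μ] fun x => m x * f x :=
  MemLp.coeFn_toLp (memLp_mul_of_le_one hm hb f)

theorem mulOp_comp {m m' : X → ℂ} (hm : Measurable m) (hb : ∀ x, ‖m x‖ ≤ 1)
    (hm' : Measurable m') (hb' : ∀ x, ‖m' x‖ ≤ 1) :
    mulOp m hm hb ∘L mulOp m' hm' hb' = (mulOp (fun x => m x * m' x) (hm.mul hm')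
      (fun x => by
        rw [norm_mul]; exact mul_le_one₀ (hb x) (norm_nonneg _) (hb' x)) :
      Lp ℂ 2 μ →L[ℂ] Lp ℂ 2 μ) := by
  ext1 f
  refine Lp.ext ?_
  rw [ContinuousLinearMap.comp_apply]
  filter_upwards [coeFn_mulOp m hm hb (mulOp m' hm' hb' f), coeFn_mulOp m' hm' hb' f,
    coeFn_mulOp (fun x => m x * m' x) (hm.mul hm') (fun x => by
        rw [norm_mul]; exact mul_le_one₀ (hb x) (norm_nonneg _) (hb' x)) f] with x h1 h2 h3
  rw [h1, h2, h3, mul_assoc]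

theorem mulOp_congr {m m' : X → ℂ} (hm : Measurable m) (hb : ∀ x, ‖m x‖ ≤ 1)
    (hm' : Measurable m') (hb' : ∀ x, ‖m' x‖ ≤ 1) (h : m =ᵐ[μ] m') :
    (mulOp m hm hb : Lp ℂ 2 μ →L[ℂ] Lp ℂ 2 μ) = mulOp m' hm' hb' := by
  ext1 f
  refine Lp.ext ?_
  filter_upwards [coeFn_mulOp m hm hb f, coeFn_mulOp m' hm' hb' f, h] with x h1 h2 h3
  rw [h1, h2, h3]

theorem adjoint_mulOp {m : X → ℂ} (hm : Measurable m) (hb : ∀ x, ‖m x‖ ≤ 1) :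
    ContinuousLinearMap.adjoint (mulOp m hm hb : Lp ℂ 2 μ →L[ℂ] Lp ℂ 2 μ) =
      mulOp (fun x => (starRingEnd ℂ) (m x)) (by fun_prop) (fun x => by simpa using hb x) := by
  symm
  rw [ContinuousLinearMap.eq_adjoint_iff]
  intro f g
  rw [L2.inner_def, L2.inner_def]
  refine integral_congr_ae ?_
  filter_upwards [coeFn_mulOp (fun x => (starRingEnd ℂ) (m x)) (by fun_prop)
    (fun x => by simpa using hb x) f, coeFn_mulOp m hm hb g] with x h1 h2
  simp only [h1, h2, RCLike.inner_apply, map_mul, RingHomCompTriple.comp_apply, RingHom.id_apply]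
  ring

/-- Dominated convergence for |(m n - m') f|², with majorant 4|f|² because both multipliers are
bounded by one. It serves to pass from continuous functions to indicators. -/
theorem tendsto_mulOp {m : ℕ → X → ℂ} {m' : X → ℂ} (hm : ∀ n, Measurable (m n))
    (hb : ∀ n x, ‖m n x‖ ≤ 1) (hm' : Measurable m') (hb' : ∀ x, ‖m' x‖ ≤ 1)
    (h : ∀ x, Filter.Tendsto (fun n => m n x) .atTop (nhds (m' x))) (f : Lp ℂ 2 μ) :
    Filter.Tendsto (fun n => mulOp (m n) (hm n) (hb n) f) .atTop (nhds (mulOp m' hm' hb' f)) := by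
  rw [tendsto_iff_norm_sub_tendsto_zero]
  have key : ∀ g : Lp ℂ 2 μ, ‖g‖ ^ 2 = ∫ x, ‖g x‖ ^ 2 ∂μ := fun g => by
    have := inner_self_eq_norm_sq_to_K (𝕜 := ℂ) g
    rw [L2.inner_def] at this
    have h2 : ∫ x, inner ℂ (g x) (g x) ∂μ = ((∫ x, ‖g x‖ ^ 2 ∂μ : ℝ) : ℂ) := by
      rw [← integral_complex_ofReal]
      refine integral_congr_ae (.of_forall fun x => ?_)
      simp only [inner_self_eq_norm_sq_to_K]
      push_cast
      rfl
    rw [h2] at this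
    exact (Complex.ofReal_injective (by rw [this]; push_cast; rfl)).symm
  have h2 : Filter.Tendsto (fun n => ‖mulOp (m n) (hm n) (hb n) f - mulOp m' hm' hb' f‖ ^ 2)
      .atTop (nhds 0) := by
    have e : ∀ n, ‖mulOp (m n) (hm n) (hb n) f - mulOp m' hm' hb' f‖ ^ 2 =
        ∫ x, ‖(m n x - m' x) * f x‖ ^ 2 ∂μ := by
      intro n
      rw [key]
      refine integral_congr_ae ?_
      filter_upwards [Lp.coeFn_sub (mulOp (m n) (hm n) (hb n) f) (mulOp m' hm' hb' f),
        coeFn_mulOp (m n) (hm n) (hb n) f, coeFn_mulOp m' hm' hb' f] with x h1 h2 h3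
      rw [h1, Pi.sub_apply, h2, h3, sub_mul]
    simp only [e]
    have hint := (memLp_two_iff_integrable_sq_norm (Lp.aestronglyMeasurable f)).1 (Lp.memLp f)
    rw [← integral_zero X ℝ (μ := μ)]
    refine tendsto_integral_of_dominated_convergence (fun x => 4 * ‖f x‖ ^ 2) ?_
      (hint.const_mul 4) ?_ ?_
    · intro n
      exact ((((hm n).sub hm').aestronglyMeasurable.mul
        (Lp.aestronglyMeasurable f)).norm.pow 2)
    · intro n
      refine .of_forall fun x => ?_
      rw [Real.norm_of_nonneg (by positivity), norm_mul, mul_pow]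
      have : ‖m n x - m' x‖ ≤ 2 := (norm_sub_le _ _).trans (by linarith [hb n x, hb' x])
      have h4 : ‖m n x - m' x‖ ^ 2 ≤ 4 := by nlinarith [norm_nonneg (m n x - m' x)]
      exact mul_le_mul_of_nonneg_right h4 (by positivity)
    · refine .of_forall fun x => ?_
      have h3 : Filter.Tendsto (fun n => ‖(m n x - m' x) * f x‖ ^ 2) .atTop
          (nhds (‖(m' x - m' x) * f x‖ ^ 2)) :=
        ((((h x).sub_const _).mul_const _).norm).pow 2
      simpa using h3
  have h3 := h2.sqrt
  simpa [Real.sqrt_sq (norm_nonneg _)] using h3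

/-- Multiplication by the phase `exp (i α)`. -/
def phaseOp (α : X → ℝ) (hα : Measurable α) : Lp ℂ 2 μ →L[ℂ] Lp ℂ 2 μ :=
  mulOp (fun x => Complex.exp ((α x : ℂ) * Complex.I)) (by fun_prop)
    (fun x => (Complex.norm_exp_ofReal_mul_I _).le)

open Classical in
/-- Multiplication by the indicator function of `s`. -/
def indOp (s : Set X) (hs : MeasurableSet s) : Lp ℂ 2 μ →L[ℂ] Lp ℂ 2 μ :=
  mulOp (fun x => if x ∈ s then 1 else 0) (Measurable.ite hs measurable_const measurable_const)
    (fun x => by split_ifs <;> simp)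

open Classical in
theorem coeFn_indOp (s : Set X) (hs : MeasurableSet s) (f : Lp ℂ 2 μ) :
    indOp s hs f =ᵐ[μ] fun x => if x ∈ s then f x else 0 := by
  refine (coeFn_mulOp _ _ _ f).trans (.of_forall fun x => ?_)
  simp only
  split_ifs <;> simp

theorem coeFn_phaseOp (α : X → ℝ) (hα : Measurable α) (f : Lp ℂ 2 μ) :
    phaseOp α hα f =ᵐ[μ] fun x => Complex.exp ((α x : ℂ) * Complex.I) * f x :=
  coeFn_mulOp _ _ _ f

theorem phaseOp_comp {α β : X → ℝ} (hα : Measurable α) (hβ : Measurable β) :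
    (phaseOp α hα ∘L phaseOp β hβ : Lp ℂ 2 μ →L[ℂ] Lp ℂ 2 μ) = phaseOp (α + β) (hα.add hβ) := by
  rw [phaseOp, phaseOp, mulOp_comp]
  refine mulOp_congr _ _ _ _ (.of_forall fun x => ?_)
  simp only [← Complex.exp_add, Pi.add_apply, Complex.ofReal_add, add_mul]

theorem phaseOp_zero (hα : Measurable (0 : X → ℝ)) :
    (phaseOp 0 hα : Lp ℂ 2 μ →L[ℂ] Lp ℂ 2 μ) = ContinuousLinearMap.id ℂ _ := by
  ext1 f
  refine Lp.ext ?_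
  filter_upwards [coeFn_phaseOp 0 hα f] with x hx
  simp [hx]

theorem phaseOp_congr {α β : X → ℝ} (hα : Measurable α) (hβ : Measurable β) (h : α = β) :
    (phaseOp α hα : Lp ℂ 2 μ →L[ℂ] Lp ℂ 2 μ) = phaseOp β hβ := by
  subst h; rfl

theorem indOp_comp {s t : Set X} (hs : MeasurableSet s) (ht : MeasurableSet t) :
    (indOp s hs ∘L indOp t ht : Lp ℂ 2 μ →L[ℂ] Lp ℂ 2 μ) = indOp (s ∩ t) (hs.inter ht) := by
  classical
  rw [indOp, indOp, mulOp_comp]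
  refine mulOp_congr _ _ _ _ (.of_forall fun x => ?_)
  by_cases h1 : x ∈ s <;> by_cases h2 : x ∈ t <;> simp [h1, h2]

theorem indOp_congr {s t : Set X} (hs : MeasurableSet s) (ht : MeasurableSet t)
    (h : ∀ᵐ x ∂μ, x ∈ s ↔ x ∈ t) :
    (indOp s hs : Lp ℂ 2 μ →L[ℂ] Lp ℂ 2 μ) = indOp t ht := by
  classical
  refine mulOp_congr _ _ _ _ ?_
  filter_upwards [h] with x hx
  simp [hx]

theorem indOp_empty : (indOp ∅ .empty : Lp ℂ 2 μ →L[ℂ] Lp ℂ 2 μ) = 0 := by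
  ext1 f
  refine Lp.ext ?_
  filter_upwards [coeFn_indOp ∅ .empty f, Lp.coeFn_zero ℂ 2 μ] with x h1 h2
  rw [h1, zero_apply, h2]
  simp

theorem indOp_eq_self_iff {s : Set X} (hs : MeasurableSet s) (f : Lp ℂ 2 μ) :
    indOp s hs f = f ↔ ∀ᵐ x ∂μ, x ∉ s → f x = 0 := by
  classical
  constructor
  · intro h
    filter_upwards [coeFn_indOp s hs f] with x hx hxs
    rw [h, if_neg hxs] at hx
    exact hx
  · intro h
    refine Lp.ext ?_
    filter_upwards [coeFn_indOp s hs f, h] with x hx h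
    rw [hx]
    split_ifs with hxs
    · rfl
    · exact (h hxs).symm

theorem adjoint_indOp {s : Set X} (hs : MeasurableSet s) :
    ContinuousLinearMap.adjoint (indOp s hs : Lp ℂ 2 μ →L[ℂ] Lp ℂ 2 μ) = indOp s hs := by
  classical
  rw [indOp, adjoint_mulOp]
  refine mulOp_congr _ _ _ _ (.of_forall fun x => ?_)
  simp only
  split_ifs <;> simp

end MulOp

/-! ### Functional calculus for intertwined phases. -/

section Intertwining
variable {X Y : Type} [MeasurableSpace X] [MeasurableSpace Y] {μ : Measure X} {ν : Measure Y}
  {U : Lp ℂ 2 μ →L[ℂ] Lp ℂ 2 ν} {α : X → ℝ} {β : Y → ℝ} {hα : Measurable α} {hβ : Measurable β}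

theorem phaseOp_inverse (hα : Measurable α) :
    (phaseOp α hα ∘L phaseOp (-α) hα.neg : Lp ℂ 2 μ →L[ℂ] Lp ℂ 2 μ) =
      ContinuousLinearMap.id ℂ _ := by
  rw [phaseOp_comp, ← phaseOp_zero measurable_zero]
  exact phaseOp_congr _ _ (by simp)

theorem phaseOp_inverse' (hα : Measurable α) :
    (phaseOp (-α) hα.neg ∘L phaseOp α hα : Lp ℂ 2 μ →L[ℂ] Lp ℂ 2 μ) =
      ContinuousLinearMap.id ℂ _ := by
  rw [phaseOp_comp, ← phaseOp_zero measurable_zero]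
  exact phaseOp_congr _ _ (by simp)

/-- Both phases are invertible, so the relation can be multiplied by the inverse phases from the
right and from the left; U itself need not be invertible. -/
theorem intertwine_neg (h : U ∘L phaseOp α hα = phaseOp β hβ ∘L U) :
    U ∘L phaseOp (-α) hα.neg = phaseOp (-β) hβ.neg ∘L U := by
  ext1 f
  have h1 := congr($h (phaseOp (-α) hα.neg f))
  have h2 : phaseOp α hα (phaseOp (-α) hα.neg f) = f := congr($(phaseOp_inverse hα) f)
  have h3 : ∀ g : Lp ℂ 2 ν, phaseOp (-β) hβ.neg (phaseOp β hβ g) = g :=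
    fun g => congr($(phaseOp_inverse' hβ) g)
  simp only [ContinuousLinearMap.comp_apply] at h1 ⊢
  rw [h2] at h1
  rw [h1, h3]

/-- Since cos α is the mean of e^{iα} and e^{-iα}, multiplication by cos α is intertwined with
multiplication by cos β, and powers follow by composition. The operators are given existentially
because p need not be bounded by one, as `mulOp` would require. -/
theorem exists_polynomial_op (h : U ∘L phaseOp α hα = phaseOp β hβ ∘L U) (p : Polynomial ℝ) :
    ∃ (A : Lp ℂ 2 μ →L[ℂ] Lp ℂ 2 μ) (B : Lp ℂ 2 ν →L[ℂ] Lp ℂ 2 ν), U ∘L A = B ∘L U ∧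
      (∀ f, A f =ᵐ[μ] fun x => ((p.eval (Real.cos (α x)) : ℝ) : ℂ) * f x) ∧
      (∀ g, B g =ᵐ[ν] fun y => ((p.eval (Real.cos (β y)) : ℝ) : ℂ) * g y) := by
  have hn := intertwine_neg h
  have hcos : ∀ {Z : Type} [MeasurableSpace Z] {κ : Measure Z} {γ : Z → ℝ} (hγ : Measurable γ)
      (f : Lp ℂ 2 κ), ((1 / 2 : ℂ) • (phaseOp γ hγ + phaseOp (-γ) hγ.neg) : Lp ℂ 2 κ →L[ℂ] Lp ℂ 2 κ) f =ᵐ[κ]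
        fun x => ((Real.cos (γ x) : ℝ) : ℂ) * f x := by
    intro Z _ κ γ hγ f
    have e : ((1 / 2 : ℂ) • (phaseOp γ hγ + phaseOp (-γ) hγ.neg) : Lp ℂ 2 κ →L[ℂ] Lp ℂ 2 κ) f =
      (1 / 2 : ℂ) • (phaseOp γ hγ f + phaseOp (-γ) hγ.neg f) := rfl
    rw [e]
    filter_upwards [Lp.coeFn_smul (1 / 2 : ℂ) (phaseOp γ hγ f + phaseOp (-γ) hγ.neg f),
      Lp.coeFn_add (phaseOp γ hγ f) (phaseOp (-γ) hγ.neg f), coeFn_phaseOp γ hγ f,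
      coeFn_phaseOp (-γ) hγ.neg f] with x h1 h2 h3 h4
    rw [h1, Pi.smul_apply, h2, Pi.add_apply, h3, h4, Complex.ofReal_cos, Complex.cos]
    simp only [Pi.neg_apply, Complex.ofReal_neg, smul_eq_mul]
    ring
  induction p using Polynomial.induction_on' with
  | add p q hp hq =>
    obtain ⟨A, B, h1, h2, h3⟩ := hp
    obtain ⟨A', B', h1', h2', h3'⟩ := hq
    refine ⟨A + A', B + B', ?_, fun f => ?_, fun f => ?_⟩
    · rw [ContinuousLinearMap.comp_add, ContinuousLinearMap.add_comp, h1, h1']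
    · filter_upwards [Lp.coeFn_add (A f) (A' f), h2 f, h2' f] with x e1 e2 e3
      rw [add_apply, e1, Pi.add_apply, e2, e3, Polynomial.eval_add]
      push_cast; ring
    · filter_upwards [Lp.coeFn_add (B f) (B' f), h3 f, h3' f] with x e1 e2 e3
      rw [add_apply, e1, Pi.add_apply, e2, e3, Polynomial.eval_add]
      push_cast; ring
  | monomial n a =>
    induction n with
    | zero =>
      refine ⟨(a : ℂ) • ContinuousLinearMap.id ℂ (Lp ℂ 2 μ),
        (a : ℂ) • ContinuousLinearMap.id ℂ (Lp ℂ 2 ν), ?_,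
        fun f => ?_, fun f => ?_⟩
      · ext1 f
        exact map_smul U (a : ℂ) f
      · filter_upwards [Lp.coeFn_smul (a : ℂ) f] with x e1
        refine e1.trans ?_
        simp
      · filter_upwards [Lp.coeFn_smul (a : ℂ) f] with x e1
        refine e1.trans ?_
        simp
    | succ n ih =>
      obtain ⟨A, B, h1, h2, h3⟩ := ih
      refine ⟨((1 / 2 : ℂ) • (phaseOp α hα + phaseOp (-α) hα.neg)) ∘L A,
        ((1 / 2 : ℂ) • (phaseOp β hβ + phaseOp (-β) hβ.neg)) ∘L B, ?_, fun f => ?_, fun f => ?_⟩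
      · rw [ContinuousLinearMap.comp_assoc, ← h1, ← ContinuousLinearMap.comp_assoc,
          ← ContinuousLinearMap.comp_assoc]
        congr 1
        rw [ContinuousLinearMap.comp_smul, ContinuousLinearMap.comp_add, h, hn,
          ContinuousLinearMap.smul_comp, ContinuousLinearMap.add_comp]
      · rw [ContinuousLinearMap.comp_apply]
        filter_upwards [hcos hα (A f), h2 f] with x e1 e2
        rw [e1, e2]
        simp only [Polynomial.eval_monomial]
        push_cast; ring
      · rw [ContinuousLinearMap.comp_apply]
        filter_upwards [hcos hβ (B f), h3 f] with x e1 e2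
        rw [e1, e2]
        simp only [Polynomial.eval_monomial]
        push_cast; ring

/-- Multiplication by `G (cos α)`. -/
def cosOp (G : ℝ → ℝ) (hG : Measurable G) (hb : ∀ t, |G t| ≤ 1) (α : X → ℝ) (hα : Measurable α) :
    Lp ℂ 2 μ →L[ℂ] Lp ℂ 2 μ :=
  mulOp (fun x => ((G (Real.cos (α x)) : ℝ) : ℂ)) (by fun_prop)
    (fun x => by rw [Complex.norm_real]; exact hb _)

theorem norm_sub_cosOp_le {G : ℝ → ℝ} (hG : Measurable G) (hb : ∀ t, |G t| ≤ 1)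
    (hα : Measurable α) {p : Polynomial ℝ} {ε : ℝ}
    (hp : ∀ t ∈ Set.Icc (-1 : ℝ) 1, |p.eval t - G t| < ε) {g : Lp ℂ 2 μ} {f : Lp ℂ 2 μ}
    (hg : g =ᵐ[μ] fun x => ((p.eval (Real.cos (α x)) : ℝ) : ℂ) * f x) :
    ‖g - cosOp G hG hb α hα f‖ ≤ ε * ‖f‖ := by
  refine Lp.norm_le_mul_norm_of_ae_le_mul ?_
  filter_upwards [hg, Lp.coeFn_sub g (cosOp G hG hb α hα f), coeFn_mulOp
    (fun x => ((G (Real.cos (α x)) : ℝ) : ℂ)) (by fun_prop)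
    (fun x => by rw [Complex.norm_real]; exact hb _) f] with x h1 h2 h3
  rw [h2, Pi.sub_apply, h1, cosOp, h3, ← sub_mul, norm_mul, ← Complex.ofReal_sub,
    Complex.norm_real]
  exact mul_le_mul_of_nonneg_right
    (hp _ ⟨Real.neg_one_le_cos _, Real.cos_le_one _⟩).le (norm_nonneg _)

/-- Weierstrass approximation of G on [-1, 1], where the cosine takes its values. -/
theorem intertwine_cosOp (h : U ∘L phaseOp α hα = phaseOp β hβ ∘L U) {G : ℝ → ℝ}
    (hG : Continuous G) (hb : ∀ t, |G t| ≤ 1) :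
    U ∘L cosOp G hG.measurable hb α hα = cosOp G hG.measurable hb β hβ ∘L U := by
  ext1 f
  rw [← sub_eq_zero, ← norm_le_zero_iff]
  refine le_of_forall_pos_le_add fun δ hδ => ?_
  -- The summand 1 makes N positive, so that δ / N is an admissible accuracy even when f = 0.
  set N := ‖U‖ * ‖f‖ + ‖U f‖ + 1 with hN
  have hNpos : 0 < N := by positivity
  obtain ⟨p, hp⟩ := exists_polynomial_near_of_continuousOn (-1) 1 G hG.continuousOn (δ / N)
    (by positivity)
  obtain ⟨A, B, h1, h2, h3⟩ := exists_polynomial_op h p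
  have e1 := norm_sub_cosOp_le hG.measurable hb hα hp (h2 f)
  have e2 := norm_sub_cosOp_le hG.measurable hb hβ hp (h3 (U f))
  have e3 : U (A f) = B (U f) := congr($h1 f)
  have e4 : (U ∘L cosOp G hG.measurable hb α hα) f - (cosOp G hG.measurable hb β hβ ∘L U) f =
      (B (U f) - cosOp G hG.measurable hb β hβ (U f)) -
        U (A f - cosOp G hG.measurable hb α hα f) := by
    rw [map_sub, e3]; simp
  rw [e4]
  calc _ ≤ δ / N * ‖U f‖ + ‖U‖ * (δ / N * ‖f‖) :=
        (norm_sub_le _ _).trans (add_le_add e2 ((U.le_opNorm _).trans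
          (mul_le_mul_of_nonneg_left e1 (norm_nonneg _))))
    _ = δ / N * (N - 1) := by rw [hN]; ring
    _ ≤ δ / N * N := by
        refine mul_le_mul_of_nonneg_left (by linarith) (by positivity)
    _ = 0 + δ := by field_simp; ring

theorem measurableSet_lt_cos (hα : Measurable α) (a : ℝ) :
    MeasurableSet {x | a < Real.cos (α x)} :=
  measurableSet_lt measurable_const (by fun_prop)

/-- The indicator of a < t is the pointwise limit of the continuous ramps max(0, min(1, n (t - a)));
they vanish at t = a, which is why the inequality is strict. -/
theorem intertwine_indOp (h : U ∘L phaseOp α hα = phaseOp β hβ ∘L U) (a : ℝ) :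
    U ∘L indOp {x | a < Real.cos (α x)} (measurableSet_lt_cos hα a) =
      indOp {y | a < Real.cos (β y)} (measurableSet_lt_cos hβ a) ∘L U := by
  classical
  set G : ℕ → ℝ → ℝ := fun n t => max 0 (min 1 (n * (t - a))) with hGdef
  have hG : ∀ n, Continuous (G n) := fun n => by fun_prop
  have hb : ∀ n t, |G n t| ≤ 1 := fun n t => by
    rw [abs_of_nonneg (le_max_left _ _)]
    exact max_le zero_le_one (min_le_left _ _)
  have hlim : ∀ t, Filter.Tendsto (fun n => ((G n t : ℝ) : ℂ)) .atTop
      (nhds (if a < t then 1 else 0)) := by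
    intro t
    split_ifs with hat
    · refine tendsto_const_nhds.congr' ?_
      obtain ⟨N, hN⟩ := exists_nat_gt (1 / (t - a))
      filter_upwards [Filter.eventually_ge_atTop N] with n hn
      have h0 : 0 < t - a := sub_pos.2 hat
      have h1 : 1 ≤ n * (t - a) := by
        rw [div_lt_iff₀ h0] at hN
        have : (N : ℝ) ≤ n := by exact_mod_cast hn
        nlinarith
      simp [hGdef, min_eq_left h1]
    · refine tendsto_const_nhds.congr fun n => ?_
      have h1 : (n : ℝ) * (t - a) ≤ 0 :=
        mul_nonpos_of_nonneg_of_nonpos (Nat.cast_nonneg n) (by linarith)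
      simp [hGdef, min_eq_right (h1.trans zero_le_one), h1]
  have L : ∀ {Z : Type} [MeasurableSpace Z] {κ : Measure Z} {γ : Z → ℝ} (hγ : Measurable γ)
      (f : Lp ℂ 2 κ), Filter.Tendsto (fun n => cosOp (G n) (hG n).measurable (hb n) γ hγ f) .atTop
        (nhds (indOp {x | a < Real.cos (γ x)} (measurableSet_lt_cos hγ a) f)) := by
    intro Z _ κ γ hγ f
    exact tendsto_mulOp _ _ _ _ (fun x => hlim (Real.cos (γ x))) f
  ext1 f
  refine tendsto_nhds_unique ((U.continuous.tendsto _).comp (L hα f)) ?_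
  refine (L hβ (U f)).congr fun n => ?_
  exact congr($(intertwine_cosOp h (hG n) (hb n)) f).symm

end Intertwining

/-! ### Bins around the multiples of c, and their intertwining. -/

section BinSet

/-- The points closer than `r` to a multiple `n c` of `c` with `n` of parity `b`. -/
def binSet (b : ZMod 2) (r : ℝ) : Set ℝ := {x | ∃ n : ℤ, (n : ZMod 2) = b ∧ |x - c * n| < r}

theorem measurableSet_binSet (b : ZMod 2) (r : ℝ) : MeasurableSet (binSet b r) := by
  have : IsOpen (binSet b r) := by
    have : binSet b r = ⋃ n : ℤ, ⋃ _ : (n : ZMod 2) = b, {x | |x - c * n| < r} := by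
      ext x; simp [binSet]
    rw [this]
    exact isOpen_iUnion fun n => isOpen_iUnion fun _ =>
      isOpen_lt (by fun_prop) continuous_const
  exact this.measurableSet

theorem binSet_mono (b : ZMod 2) {r r' : ℝ} (h : r ≤ r') : binSet b r ⊆ binSet b r' :=
  fun _ ⟨n, hn, hx⟩ => ⟨n, hn, hx.trans_le h⟩

theorem add_mem_binSet {b b' : ZMod 2} {r r' x y : ℝ} (hx : x ∈ binSet b r)
    (hy : y ∈ binSet b' r') : x + y ∈ binSet (b + b') (r + r') := by
  obtain ⟨n, hn, hx⟩ := hx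
  obtain ⟨m, hm, hy⟩ := hy
  refine ⟨n + m, by push_cast; rw [hn, hm], ?_⟩
  push_cast
  calc |x + y - c * (n + m)| = |(x - c * n) + (y - c * m)| := by ring_nf
    _ < r + r' := (abs_add_le _ _).trans_lt (add_lt_add hx hy)

theorem neg_mem_binSet {b : ZMod 2} {r x : ℝ} : -x ∈ binSet b r ↔ x ∈ binSet b r := by
  have key : ∀ y, y ∈ binSet b r → -y ∈ binSet b r := by
    rintro y ⟨n, hn, hx⟩
    refine ⟨-n, ?_, ?_⟩
    · push_cast; rw [hn]; exact ZMod.neg_eq_self_mod_two b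
    · push_cast
      rw [← abs_neg]
      convert hx using 2
      ring
  exact ⟨fun h => by simpa using key _ h, key x⟩

theorem add_mem_binSet_of_abs_le {b : ZMod 2} {r s x z : ℝ} (hx : x ∈ binSet b r)
    (hz : |z| ≤ s) : x + z ∈ binSet b (r + s) := by
  obtain ⟨n, hn, hx⟩ := hx
  refine ⟨n, hn, ?_⟩
  calc |x + z - c * n| = |(x - c * n) + z| := by ring_nf
    _ < r + s := (abs_add_le _ _).trans_lt (add_lt_add_of_lt_of_le hx hz)

theorem c_mul_c : c * c = Real.pi := Real.mul_self_sqrt Real.pi_pos.le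

/-- The sign `(-1) ^ b`. -/
def sgn (b : ZMod 2) : ℝ := (-1) ^ b.val

theorem sgn_zero : sgn 0 = 1 := by simp [sgn]

theorem sgn_one : sgn 1 = -1 := by simp [sgn, ZMod.val_one]

theorem cos_sub_intCast (x : ℝ) (n : ℤ) :
    Real.cos (c * (x - c * n)) = sgn n * Real.cos (c * x) := by
  have e : c * (x - c * n) = c * x - n * Real.pi := by rw [← c_mul_c]; ring
  rw [e, Real.cos_sub_int_mul_pi]
  congr 1
  rcases Int.even_or_odd n with h | h
  · rw [h.neg_one_zpow, (ZMod.intCast_zmod_eq_zero_iff_dvd n 2).2 h.two_dvd, sgn_zero]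
  · obtain ⟨k, rfl⟩ := h
    have : ((2 * k + 1 : ℤ) : ZMod 2) = 1 := by
      push_cast
      rw [show (2 : ZMod 2) = 0 from rfl]; ring
    rw [Odd.neg_one_zpow ⟨k, rfl⟩, this, sgn_one]

theorem sgn_mul_self (b : ZMod 2) : sgn b * sgn b = 1 := by
  fin_cases b
  · show sgn 0 * sgn 0 = 1
    rw [sgn_zero, one_mul]
  · show sgn 1 * sgn 1 = 1
    rw [sgn_one]; norm_num

/-- Cosine is strictly decreasing on [0, π], and c|x - c n| lies there once n is the nearest integer
of parity b. This turns membership in a bin into a condition on the phase e^{icx}, to which the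
functional calculus applies. -/
theorem mem_binSet_iff_cos {b : ZMod 2} {r : ℝ} (h0 : 0 ≤ r) (hr : r ≤ c) (x : ℝ) :
    x ∈ binSet b r ↔ Real.cos (c * r) < sgn b * Real.cos (c * x) := by
  have hc := c_pos
  have hcr : c * r ≤ Real.pi := by rw [← c_mul_c]; exact mul_le_mul_of_nonneg_left hr hc.le
  constructor
  · rintro ⟨n, rfl, hx⟩
    rw [← cos_sub_intCast, ← Real.cos_abs (c * (x - c * n)), abs_mul, abs_of_pos hc]
    exact Real.cos_lt_cos_of_nonneg_of_le_pi (by positivity) hcr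
      (mul_lt_mul_of_pos_left hx hc)
  · intro h
    obtain ⟨n, hn, hx⟩ : ∃ n : ℤ, (n : ZMod 2) = b ∧ |x - c * n| ≤ c := by
      obtain ⟨m, hm⟩ : ∃ m : ℤ, (m : ZMod 2) = b := ⟨b.val, by simp⟩
      -- Rounding in steps of 2c preserves the parity of m and leaves a distance of at most c.
      refine ⟨m + 2 * round ((x - c * m) / (2 * c)), ?_, ?_⟩
      · push_cast
        rw [show (2 : ZMod 2) = 0 from rfl, hm]; ring
      · have h1 := abs_sub_round ((x - c * m) / (2 * c))
        have h2 : x - c * ((m + 2 * round ((x - c * m) / (2 * c)) : ℤ) : ℝ) =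
            2 * c * ((x - c * m) / (2 * c) - round ((x - c * m) / (2 * c))) := by
          push_cast
          field_simp
          ring
        rw [h2, abs_mul, abs_of_pos (by positivity)]
        nlinarith
    refine ⟨n, hn, ?_⟩
    by_contra hcon
    push Not at hcon
    have := Real.cos_le_cos_of_nonneg_of_le_pi (x := c * r) (y := c * |x - c * n|)
      (by positivity) (by rw [← c_mul_c]; exact mul_le_mul_of_nonneg_left hx hc.le)
      (mul_le_mul_of_nonneg_left hcon hc.le)
    rw [← abs_of_pos hc, ← abs_mul, Real.cos_abs, abs_of_pos hc, cos_sub_intCast, hn] at this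
    linarith

/-- Multiples of c of different parity are at least c apart. -/
theorem binSet_disjoint {b b' : ZMod 2} (hb : b ≠ b') {r r' : ℝ} (hr : r + r' ≤ c) :
    binSet b r ∩ binSet b' r' = ∅ := by
  rw [Set.eq_empty_iff_forall_notMem]
  rintro x ⟨⟨n, hn, hx⟩, ⟨m, hm, hy⟩⟩
  have hne : n ≠ m := fun h => hb (by rw [← hn, ← hm, h])
  have h1 : (1 : ℝ) ≤ |(n : ℝ) - m| := by
    rw [← Int.cast_sub, ← Int.cast_abs]
    exact_mod_cast Int.one_le_abs (sub_ne_zero.2 hne)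
  have h2 : c * |(n : ℝ) - m| < r + r' := by
    rw [show c * |(n : ℝ) - m| = |c * ((n : ℝ) - m)| by rw [abs_mul, abs_of_pos c_pos]]
    calc |c * ((n : ℝ) - m)| = |(x - c * m) - (x - c * n)| := by ring_nf
      _ ≤ |x - c * m| + |x - c * n| := abs_sub _ _
      _ < r + r' := by linarith
  nlinarith [c_pos]

variable {X Y : Type} [MeasurableSpace X] [MeasurableSpace Y] {μ : Measure X} {ν : Measure Y}
  {U : Lp ℂ 2 μ →L[ℂ] Lp ℂ 2 ν} {φ : X → ℝ} {φ' : Y → ℝ}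

/-- Multiplication by the indicator function of `φ ∈ binSet b r`. -/
def binOp (φ : X → ℝ) (hφ : Measurable φ) (b : ZMod 2) (r : ℝ) : Lp ℂ 2 μ →L[ℂ] Lp ℂ 2 μ :=
  indOp (φ ⁻¹' binSet b r) (hφ (measurableSet_binSet b r))

/-- The offset c d adds π d to the phase, a sign that exchanges the parities when d = 1. The parity
b itself is a constant shift of both phases, hence a scalar factor, which commutes with U. -/
theorem intertwine_binOp_add (d : ZMod 2) (hφ : Measurable φ) (hφ' : Measurable φ')
    (h : U ∘L phaseOp (fun x => c * φ x) (by fun_prop) =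
      phaseOp (fun y => c * (φ' y + c * d.val)) (by fun_prop) ∘L U) (b : ZMod 2) {r : ℝ}
    (h0 : 0 ≤ r) (hr : r ≤ c) :
    U ∘L binOp φ hφ b r = binOp φ' hφ' (b + d) r ∘L U := by
  have e : ∀ {Z : Type} [MeasurableSpace Z] {κ : Measure Z} {γ : Z → ℝ} (hγ : Measurable γ)
      (e : ZMod 2), (binOp γ hγ (b + e) r : Lp ℂ 2 κ →L[ℂ] Lp ℂ 2 κ) =
        indOp {x | Real.cos (c * r) < Real.cos (c * (γ x + c * e.val) + c * (c * b.val))}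
          (measurableSet_lt_cos (α := fun x => c * (γ x + c * e.val) + c * (c * b.val)) (by fun_prop) _) := by
    intro Z _ κ γ hγ e
    refine indOp_congr _ _ (.of_forall fun x => ?_)
    rw [Set.mem_preimage, mem_binSet_iff_cos h0 hr, Set.mem_ofPred_eq]
    have := cos_sub_intCast (γ x) (-(b.val + e.val : ℕ))
    push_cast at this
    have h2 : (-((b.val : ZMod 2) + (e.val : ZMod 2))) = b + e := by
      rw [ZMod.natCast_zmod_val, ZMod.natCast_zmod_val, ZMod.neg_eq_self_mod_two]
    rw [show c * (γ x + c * e.val) + c * (c * b.val) =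
      c * (γ x - c * (-(b.val + e.val))) by ring, this, h2]
  have e0 := e (κ := μ) hφ 0
  rw [e hφ' d]
  simp only [add_zero, ZMod.val_zero, Nat.cast_zero, mul_zero] at e0
  rw [e0]
  refine intertwine_indOp (α := fun x => c * φ x + c * (c * b.val))
    (β := fun x => c * (φ' x + c * d.val) + c * (c * b.val)) (hα := by fun_prop)
    (hβ := by fun_prop) ?_ _
  have key : ∀ {Z : Type} [MeasurableSpace Z] {κ : Measure Z} {γ : Z → ℝ} (hγ : Measurable γ)
      (a : ℝ), (phaseOp (fun x => γ x + a) (by fun_prop) : Lp ℂ 2 κ →L[ℂ] Lp ℂ 2 κ) =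
        Complex.exp (a * Complex.I) • phaseOp γ hγ := by
    intro Z _ κ γ hγ a
    ext1 f
    refine Lp.ext ?_
    filter_upwards [coeFn_phaseOp (fun x => γ x + a) (by fun_prop) f, coeFn_phaseOp γ hγ f,
      Lp.coeFn_smul (Complex.exp (a * Complex.I)) (phaseOp γ hγ f)] with x h1 h2 h3
    rw [smul_apply, h1, h3, Pi.smul_apply, h2]
    push_cast
    rw [add_mul, Complex.exp_add, smul_eq_mul]
    ring
  rw [key (γ := fun x => c * φ x) (by fun_prop),
    key (γ := fun x => c * (φ' x + c * d.val)) (by fun_prop), ContinuousLinearMap.comp_smul, h,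
    ContinuousLinearMap.smul_comp]

/-- The same for the conjugate phases. This is the form met in momentum space, where translation by
c is multiplication by e^{-icp}. -/
theorem intertwine_binOp_add_of_neg (d : ZMod 2) (hφ : Measurable φ) (hφ' : Measurable φ')
    (h : U ∘L phaseOp (fun x => -(c * φ x)) (by fun_prop) =
      phaseOp (fun y => -(c * (φ' y + c * d.val))) (by fun_prop) ∘L U) (b : ZMod 2) {r : ℝ}
    (h0 : 0 ≤ r) (hr : r ≤ c) :
    U ∘L binOp φ hφ b r = binOp φ' hφ' (b + d) r ∘L U := by
  refine intertwine_binOp_add d hφ hφ' ?_ b h0 hr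
  have h' := intertwine_neg h
  rwa [phaseOp_congr _ (by fun_prop) (show -(fun x => -(c * φ x)) = fun x => c * φ x by
      funext x; simp),
    phaseOp_congr _ (by fun_prop) (show -(fun y => -(c * (φ' y + c * d.val))) =
      fun y => c * (φ' y + c * d.val) by funext y; simp)] at h'

theorem intertwine_binOp (hφ : Measurable φ) (hφ' : Measurable φ')
    (h : U ∘L phaseOp (fun x => c * φ x) (by fun_prop) =
      phaseOp (fun y => c * φ' y) (by fun_prop) ∘L U) (b : ZMod 2) {r : ℝ}
    (h0 : 0 ≤ r) (hr : r ≤ c) :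
    U ∘L binOp φ hφ b r = binOp φ' hφ' b r ∘L U := by
  have := intertwine_binOp_add 0 hφ hφ' (by simpa using h) b h0 hr
  simpa using this

theorem intertwine_binOp_of_neg (hφ : Measurable φ) (hφ' : Measurable φ')
    (h : U ∘L phaseOp (fun x => -(c * φ x)) (by fun_prop) =
      phaseOp (fun y => -(c * φ' y)) (by fun_prop) ∘L U) (b : ZMod 2) {r : ℝ}
    (h0 : 0 ≤ r) (hr : r ≤ c) :
    U ∘L binOp φ hφ b r = binOp φ' hφ' b r ∘L U := by
  have := intertwine_binOp_add_of_neg 0 hφ hφ' (by simpa using h) b h0 hr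
  simpa using this

end BinSet

/-! ### The Fourier gate exchanges translations and phases. -/

section Fourier
open FourierTransform SchwartzMap

theorem coeFn_translation (a : ℝ) (f : L2 ℝ) : translation a f =ᵐ[volume] fun x => f (x - a) :=
  Lp.coeFn_compMeasurePreserving f (measurePreserving_sub_right volume a)

theorem ae_comp_dilation {p : ℝ → Prop} (h : ∀ᵐ x, p x) : ∀ᵐ x : ℝ, p ((2 * Real.pi)⁻¹ * x) := by
  have hq : Measure.QuasiMeasurePreserving (fun x : ℝ => (2 * Real.pi)⁻¹ * x) :=
    ⟨by fun_prop, by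
      rw [Real.map_volume_mul_left (by positivity)]
      exact Measure.smul_absolutelyContinuous⟩
  exact hq.ae h

theorem coeFn_dilation (f : L2 ℝ) :
    dilation f =ᵐ[volume] fun x => (√(2 * Real.pi) : ℂ)⁻¹ * f ((2 * Real.pi)⁻¹ * x) := by
  refine (Lp.coeFn_smul _ ((memLp_dilation f).toLp _)).trans ?_
  filter_upwards [MemLp.coeFn_toLp (memLp_dilation f)] with x hx
  rw [Pi.smul_apply, hx, smul_eq_mul]

theorem norm_dilation (f : L2 ℝ) : ‖dilation f‖ = ‖f‖ := by
  have h : dilation f = ((√(2 * Real.pi))⁻¹ : ℂ) • (memLp_dilation f).toLp _ := rfl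
  have hp : (0 : ℝ) < 2 * Real.pi := by positivity
  rw [h, norm_smul, Lp.norm_toLp, eLpNorm_dilation, ENNReal.toReal_mul, ← Lp.norm_def,
    ← ENNReal.toReal_rpow, ENNReal.toReal_ofReal hp.le, ← Real.sqrt_eq_rpow, norm_inv,
    Complex.norm_real, Real.norm_of_nonneg (Real.sqrt_nonneg _), ← mul_assoc,
    inv_mul_cancel₀ (Real.sqrt_pos.2 hp).ne', one_mul]

theorem dilation_surjective : Function.Surjective dilation := by
  intro g
  have hp : (0 : ℝ) < 2 * Real.pi := by positivity
  have hg : MemLp (fun x : ℝ => g ((2 * Real.pi) * x)) 2 volume := by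
    refine MemLp.comp_of_map (g := g) (f := fun x : ℝ => (2 * Real.pi) * x) ?_ (by fun_prop)
    rw [Real.map_volume_mul_left hp.ne']
    exact (Lp.memLp g).smul_measure ENNReal.ofReal_ne_top
  refine ⟨(√(2 * Real.pi) : ℂ) • hg.toLp _, Lp.ext ?_⟩
  have h1 := ae_comp_dilation (Lp.coeFn_smul (√(2 * Real.pi) : ℂ) (hg.toLp _))
  have h2 := ae_comp_dilation (MemLp.coeFn_toLp hg)
  filter_upwards [coeFn_dilation ((√(2 * Real.pi) : ℂ) • hg.toLp _), h1, h2] with x e1 e2 e3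
  have h0 : (√(2 * Real.pi) : ℂ) ≠ 0 := by
    exact_mod_cast (Real.sqrt_pos.2 hp).ne'
  rw [e1, e2, Pi.smul_apply, e3, smul_eq_mul, ← mul_assoc, inv_mul_cancel₀ h0, one_mul]
  congr 1
  field_simp

/-- The inverse Fourier transform on `L²(ℝ)`. -/
abbrev invFourier : L2 ℝ →L[ℂ] L2 ℝ :=
  (Lp.fourierTransformₗᵢ ℝ ℂ).symm.toContinuousLinearEquiv.toContinuousLinearMap

theorem adjoint_comp_fourierGate :
    ContinuousLinearMap.adjoint fourierGate ∘L fourierGate = ContinuousLinearMap.id ℂ _ := by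
  have := (ContinuousLinearMap.norm_map_iff_adjoint_comp_self fourierGate).1 fun f => by
    show ‖dilation ((Lp.fourierTransformₗᵢ ℝ ℂ).symm f)‖ = ‖f‖
    rw [norm_dilation, LinearIsometryEquiv.norm_map]
  exact this

/-- An isometry that is onto is unitary: the dilation and the inverse Fourier transform are both
surjective. -/
theorem fourierGate_comp_adjoint :
    fourierGate ∘L ContinuousLinearMap.adjoint fourierGate = ContinuousLinearMap.id ℂ _ := by
  ext1 g
  obtain ⟨h, rfl⟩ := dilation_surjective g
  obtain ⟨f, rfl⟩ := (Lp.fourierTransformₗᵢ ℝ ℂ).symm.surjective h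
  exact congr(fourierGate ($adjoint_comp_fourierGate f))

theorem fourier_comp_sub (f : ℝ → ℂ) (a w : ℝ) :
    𝓕 (fun x => f (x - a)) w = Complex.exp (((-(2 * Real.pi * a * w) : ℝ) : ℂ) * Complex.I) *
      𝓕 f w := by
  rw [Real.fourier_real_eq_integral_exp_smul, Real.fourier_real_eq_integral_exp_smul,
    ← integral_const_mul, ← integral_add_right_eq_self _ a]
  refine integral_congr_ae (.of_forall fun x => ?_)
  simp only [smul_eq_mul, add_sub_cancel_right]
  rw [← mul_assoc, ← Complex.exp_add]
  congr 2
  push_cast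
  ring

theorem translation_toLp (f : 𝓢(ℝ, ℂ)) (a : ℝ) :
    translation a (f.toLp 2) = (f.compSubConstCLM ℂ a).toLp 2 := by
  refine Lp.ext ?_
  filter_upwards [coeFn_translation a (f.toLp 2), SchwartzMap.coeFn_toLp
    (f.compSubConstCLM ℂ a) 2, (measurePreserving_sub_right volume a).quasiMeasurePreserving.ae
    (SchwartzMap.coeFn_toLp f 2 volume)] with x h1 h2 h3
  rw [h1, h2, h3]
  rfl

/-- Schwartz functions are dense in L². On them the Fourier transform is an honest integral, so
shift rules can be checked pointwise. -/
theorem ext_schwartz {A B : L2 ℝ →L[ℂ] L2 ℝ} (h : ∀ f : 𝓢(ℝ, ℂ), A (f.toLp 2) = B (f.toLp 2)) :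
    A = B := by
  have := DenseRange.equalizer (SchwartzMap.denseRange_toLpCLM (E := ℝ) (F := ℂ) 
    (p := 2) (μ := volume) ENNReal.ofNat_ne_top) A.continuous B.continuous
    (funext fun f => h f)
  exact ContinuousLinearMap.coeFn_injective this

theorem invFourier_toLp (f : 𝓢(ℝ, ℂ)) : invFourier (f.toLp 2) = (𝓕⁻ f).toLp 2 :=
  SchwartzMap.toLp_fourierInv_eq f

theorem invFourier_comp_translation (a : ℝ) :
    invFourier ∘L translation a = phaseOp (fun w => 2 * Real.pi * a * w) (by fun_prop) ∘L
      invFourier := by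
  refine ext_schwartz fun f => ?_
  rw [ContinuousLinearMap.comp_apply, ContinuousLinearMap.comp_apply, translation_toLp,
    invFourier_toLp, invFourier_toLp]
  refine Lp.ext ?_
  filter_upwards [SchwartzMap.coeFn_toLp (𝓕⁻ (f.compSubConstCLM ℂ a)) 2,
    SchwartzMap.coeFn_toLp (𝓕⁻ f) 2, coeFn_phaseOp (fun w => 2 * Real.pi * a * w) (by fun_prop)
      ((𝓕⁻ f).toLp 2)] with w h1 h2 h3
  rw [h1, h3, h2, SchwartzMap.fourierInv_coe, SchwartzMap.fourierInv_coe,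
    Real.fourierInv_eq_fourier_neg, Real.fourierInv_eq_fourier_neg]
  refine (fourier_comp_sub f a (-w)).trans ?_
  congr 3
  ring_nf

/-- The forward transform turns translations into phases; cancelling it gives the rule for its
inverse. -/
theorem translation_comp_invFourier (a : ℝ) :
    translation a ∘L invFourier = invFourier ∘L
      phaseOp (fun w => -(2 * Real.pi * a * w)) (by fun_prop) := by
  have key : ((Lp.fourierTransformₗᵢ ℝ ℂ).toContinuousLinearEquiv : L2 ℝ →L[ℂ] L2 ℝ) ∘L
      translation a = phaseOp (fun w => -(2 * Real.pi * a * w)) (by fun_prop) ∘L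
      ((Lp.fourierTransformₗᵢ ℝ ℂ).toContinuousLinearEquiv : L2 ℝ →L[ℂ] L2 ℝ) := by
    have hF : ∀ f : 𝓢(ℝ, ℂ), ((Lp.fourierTransformₗᵢ ℝ ℂ).toContinuousLinearEquiv :
      L2 ℝ →L[ℂ] L2 ℝ) (f.toLp 2) = (𝓕 f).toLp 2 := SchwartzMap.toLp_fourier_eq
    refine ext_schwartz fun f => ?_
    rw [ContinuousLinearMap.comp_apply, ContinuousLinearMap.comp_apply, translation_toLp, hF, hF]
    refine Lp.ext ?_
    filter_upwards [SchwartzMap.coeFn_toLp (𝓕 (f.compSubConstCLM ℂ a)) 2,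
      SchwartzMap.coeFn_toLp (𝓕 f) 2, coeFn_phaseOp (fun w => -(2 * Real.pi * a * w))
        (by fun_prop) ((𝓕 f).toLp 2)] with w h1 h2 h3
    rw [h1, h3, h2, SchwartzMap.fourier_coe, SchwartzMap.fourier_coe]
    exact fourier_comp_sub f a w
  ext1 g
  apply (Lp.fourierTransformₗᵢ ℝ ℂ).injective
  have h1 := congr($key ((Lp.fourierTransformₗᵢ ℝ ℂ).symm g))
  refine h1.trans ?_
  show phaseOp _ (by fun_prop) ((Lp.fourierTransformₗᵢ ℝ ℂ) ((Lp.fourierTransformₗᵢ ℝ ℂ).symm g)) =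
    (Lp.fourierTransformₗᵢ ℝ ℂ) ((Lp.fourierTransformₗᵢ ℝ ℂ).symm _)
  rw [LinearIsometryEquiv.apply_symm_apply, LinearIsometryEquiv.apply_symm_apply]
  rfl

/-- `F T_a = exp(i a q) F`. -/
theorem fourierGate_comp_translation (a : ℝ) :
    fourierGate ∘L translation a = phaseOp (fun x => a * x) (by fun_prop) ∘L fourierGate := by
  ext1 f
  have h := congr($(invFourier_comp_translation a) f)
  simp only [ContinuousLinearMap.comp_apply] at h
  show dilation (invFourier (translation a f)) = phaseOp _ (by fun_prop) (dilation (invFourier f))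
  rw [h]
  set g := invFourier f
  refine Lp.ext ?_
  filter_upwards [coeFn_dilation (phaseOp (fun w => 2 * Real.pi * a * w) (by fun_prop) g),
    ae_comp_dilation (coeFn_phaseOp (fun w => 2 * Real.pi * a * w) (by fun_prop) g),
    coeFn_phaseOp (fun x => a * x) (by fun_prop) (dilation g), coeFn_dilation g] with x h1 h2 h3 h4
  rw [h1, h2, h3, h4, mul_left_comm]
  congr 4
  field_simp

/-- `T_a F = F exp(-i a q)`. -/
theorem translation_comp_fourierGate (a : ℝ) :
    translation a ∘L fourierGate = fourierGate ∘L phaseOp (fun x => -(a * x)) (by fun_prop) := by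
  ext1 f
  have hp : (2 * Real.pi) ≠ 0 := by positivity
  -- The dilation stretches by 2π, so a shift by a after it is a shift by a / 2π before it.
  have h := congr($(translation_comp_invFourier ((2 * Real.pi)⁻¹ * a)) f)
  simp only [ContinuousLinearMap.comp_apply] at h
  have e : (phaseOp (fun x => -(a * x)) (by fun_prop) : L2 ℝ →L[ℂ] L2 ℝ) =
      phaseOp (fun w => -(2 * Real.pi * ((2 * Real.pi)⁻¹ * a) * w)) (by fun_prop) :=
    phaseOp_congr _ _ (by funext x; field_simp)
  show translation a (dilation (invFourier f)) = dilation (invFourier (phaseOp _ (by fun_prop) f))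
  rw [e, ← h]
  set g := invFourier f
  refine Lp.ext ?_
  filter_upwards [coeFn_dilation (translation ((2 * Real.pi)⁻¹ * a) g),
    ae_comp_dilation (coeFn_translation ((2 * Real.pi)⁻¹ * a) g),
    coeFn_translation a (dilation g),
    (measurePreserving_sub_right volume a).quasiMeasurePreserving.ae (coeFn_dilation g)]
    with x h1 h2 h3 h4
  rw [h1, h2, h3, h4, mul_sub]

end Fourier

/-! ### Tensor products: totality of product vectors. -/

section Tensor
variable {X Y : Type} [MeasureSpace X] [MeasureSpace Y]
  [SigmaFinite (volume : Measure X)] [SigmaFinite (volume : Measure Y)]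

theorem coeFn_tmul (f : L2 X) (g : L2 Y) :
    tmul f g =ᵐ[volume] fun z : X × Y => f z.1 * g z.2 := MemLp.coeFn_toLp (memLp_tmul f g)

theorem tmul_indicator {s : Set X} {t : Set Y} (hs : MeasurableSet s) (ht : MeasurableSet t)
    (hs' : volume s ≠ ⊤) (ht' : volume t ≠ ⊤) (hst : volume (s ×ˢ t) ≠ ⊤) :
    tmul (indicatorConstLp 2 hs hs' (1 : ℂ)) (indicatorConstLp 2 ht ht' (1 : ℂ)) =
      indicatorConstLp 2 (hs.prod ht) hst (1 : ℂ) := by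
  refine Lp.ext ?_
  filter_upwards [coeFn_tmul (indicatorConstLp 2 hs hs' (1 : ℂ)) (indicatorConstLp 2 ht ht' (1 : ℂ)),
    Measure.quasiMeasurePreserving_fst.ae (indicatorConstLp_coeFn (p := 2) (hs := hs) (hμs := hs')
      (c := (1 : ℂ))),
    Measure.quasiMeasurePreserving_snd.ae (indicatorConstLp_coeFn (p := 2) (hs := ht) (hμs := ht')
      (c := (1 : ℂ))), indicatorConstLp_coeFn (p := 2) (hs := hs.prod ht) (hμs := hst)
      (c := (1 : ℂ))] with z h1 h2 h3 h4
  rw [h1, h2, h3, h4]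
  by_cases h5 : z.1 ∈ s <;> by_cases h6 : z.2 ∈ t <;> simp [h5, h6, Set.indicator]

/-- On a rectangle of finite measure the integrals of h over subrectangles are inner products with
products of indicators, hence zero. Rectangles form a π-system generating the σ-algebra, so h
vanishes almost everywhere there; σ-finiteness does the rest. -/
theorem eq_zero_of_inner_tmul (h : L2 (X × Y)) (H : ∀ f g, inner ℂ (tmul f g) h = 0) : h = 0 := by
  have key : ∀ n : ℕ, ∀ᵐ z ∂(volume : Measure (X × Y)),
      z ∈ spanningSets (volume : Measure X) n ×ˢ spanningSets (volume : Measure Y) n → h z = 0 := by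
    intro n
    set S := spanningSets (volume : Measure X) n
    set T := spanningSets (volume : Measure Y) n
    have hS : MeasurableSet S := measurableSet_spanningSets _ n
    have hT : MeasurableSet T := measurableSet_spanningSets _ n
    have hSf : volume S < ⊤ := measure_spanningSets_lt_top _ n
    have hTf : volume T < ⊤ := measure_spanningSets_lt_top _ n
    have hST : volume (S ×ˢ T) < ⊤ := by
      rw [Measure.volume_eq_prod, Measure.prod_prod]; exact ENNReal.mul_lt_top hSf hTf
    rw [← ae_restrict_iff' (hS.prod hT)]
    have hint : Integrable h (volume.restrict (S ×ˢ T)) :=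
      integrableOn_Lp_of_measure_ne_top h one_le_two hST.ne
    have hrect : ∀ s t, MeasurableSet s → MeasurableSet t →
        ∫ z in s ×ˢ t, h z ∂(volume.restrict (S ×ˢ T)) = 0 := by
      intro s t hs ht
      rw [Measure.restrict_restrict (hs.prod ht), Set.prod_inter_prod]
      have h1 : volume (s ∩ S) ≠ ⊤ := ((measure_mono Set.inter_subset_right).trans_lt hSf).ne
      have h2 : volume (t ∩ T) ≠ ⊤ := ((measure_mono Set.inter_subset_right).trans_lt hTf).ne
      have h3 : volume ((s ∩ S) ×ˢ (t ∩ T)) ≠ ⊤ := by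
        rw [Measure.volume_eq_prod, Measure.prod_prod]; exact ENNReal.mul_ne_top h1 h2
      rw [← L2.inner_indicatorConstLp_one (𝕜 := ℂ) ((hs.inter hS).prod (ht.inter hT)) h3,
        ← tmul_indicator (hs.inter hS) (ht.inter hT) h1 h2, H]
    have hz : (volume.restrict (S ×ˢ T)).withDensityᵥ h = 0 := by
      refine VectorMeasure.ext_of_generateFrom _ ?_ generateFrom_prod.symm isPiSystem_prod ?_
      · rintro _ ⟨s, hs, t, ht, rfl⟩
        rw [withDensityᵥ_apply hint (MeasurableSet.prod hs ht)]
        exact hrect s t hs ht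
      · rw [withDensityᵥ_apply hint .univ, ← Set.univ_prod_univ]
        exact hrect _ _ .univ .univ
    refine hint.ae_eq_zero_of_forall_setIntegral_eq_zero fun s hs _ => ?_
    rw [← withDensityᵥ_apply hint hs, hz]
    rfl
  refine Lp.ext ?_
  filter_upwards [ae_all_iff.2 key, Lp.coeFn_zero ℂ 2 (volume : Measure (X × Y))] with z h1 h2
  rw [h2]
  set N := max (spanningSetsIndex (volume : Measure X) z.1)
    (spanningSetsIndex (volume : Measure Y) z.2)
  refine h1 N ⟨?_, ?_⟩
  · exact monotone_spanningSets _ (le_max_left _ _) (mem_spanningSetsIndex _ z.1)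
  · exact monotone_spanningSets _ (le_max_right _ _) (mem_spanningSetsIndex _ z.2)

variable {E : Type} [NormedAddCommGroup E] [InnerProductSpace ℂ E] [CompleteSpace E]

/-- After passing to adjoints, equality on product vectors becomes orthogonality to all of them.
This reduces identities between operators on several modes to product vectors. -/
theorem ext_tmul {A B : L2 (X × Y) →L[ℂ] E} (h : ∀ f g, A (tmul f g) = B (tmul f g)) : A = B := by
  ext1 z
  refine ext_inner_left ℂ fun y => ?_
  rw [← ContinuousLinearMap.adjoint_inner_left, ← ContinuousLinearMap.adjoint_inner_left,
    ← sub_eq_zero, ← inner_sub_left]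
  have : ContinuousLinearMap.adjoint A y - ContinuousLinearMap.adjoint B y = 0 := by
    refine eq_zero_of_inner_tmul _ fun f g => ?_
    rw [inner_sub_right, ContinuousLinearMap.adjoint_inner_right,
      ContinuousLinearMap.adjoint_inner_right, h, sub_self]
  rw [this, inner_zero_left]

theorem opTensor_comp (A A' : L2 X →L[ℂ] L2 X) (B B' : L2 Y →L[ℂ] L2 Y) :
    opTensor A B ∘L opTensor A' B' = opTensor (A ∘L A') (B ∘L B') :=
  ext_tmul fun f g => by simp [opTensor_tmul]

theorem opTensor_id : opTensor (ContinuousLinearMap.id ℂ (L2 X)) (ContinuousLinearMap.id ℂ (L2 Y)) =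
    ContinuousLinearMap.id ℂ _ :=
  ext_tmul fun f g => by simp [opTensor_tmul]

theorem opTensor_add_left (A A' : L2 X →L[ℂ] L2 X) (B : L2 Y →L[ℂ] L2 Y) :
    opTensor (A + A') B = opTensor A B + opTensor A' B :=
  ext_tmul fun f g => by simp [opTensor_tmul, tmul_add_left]

theorem opTensor_add_right (A : L2 X →L[ℂ] L2 X) (B B' : L2 Y →L[ℂ] L2 Y) :
    opTensor A (B + B') = opTensor A B + opTensor A B' :=
  ext_tmul fun f g => by simp [opTensor_tmul, tmul_add_right]

theorem opTensor_smul_left (a : ℂ) (A : L2 X →L[ℂ] L2 X) (B : L2 Y →L[ℂ] L2 Y) :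
    opTensor (a • A) B = a • opTensor A B :=
  ext_tmul fun f g => by
    simp only [smul_apply, opTensor_tmul, tmul_smul_left]

theorem opTensor_smul_right (a : ℂ) (A : L2 X →L[ℂ] L2 X) (B : L2 Y →L[ℂ] L2 Y) :
    opTensor A (a • B) = a • opTensor A B :=
  ext_tmul fun f g => by
    simp only [smul_apply, opTensor_tmul, tmul_smul_right]

theorem adjoint_opTensor (A : L2 X →L[ℂ] L2 X) (B : L2 Y →L[ℂ] L2 Y) :
    ContinuousLinearMap.adjoint (opTensor A B) =
      opTensor (ContinuousLinearMap.adjoint A) (ContinuousLinearMap.adjoint B) := by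
  refine ext_tmul fun f g => ?_
  rw [← sub_eq_zero]
  refine eq_zero_of_inner_tmul _ fun f' g' => ?_
  rw [inner_sub_right, ContinuousLinearMap.adjoint_inner_right, opTensor_tmul, opTensor_tmul,
    inner_tmul, inner_tmul, ContinuousLinearMap.adjoint_inner_right,
    ContinuousLinearMap.adjoint_inner_right, sub_self]

theorem opTensor_phaseOp {α : X → ℝ} {β : Y → ℝ} (hα : Measurable α) (hβ : Measurable β) :
    opTensor (phaseOp α hα) (phaseOp β hβ) =
      phaseOp (fun z : X × Y => α z.1 + β z.2) (by fun_prop) := by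
  refine ext_tmul fun f g => ?_
  rw [opTensor_tmul]
  refine Lp.ext ?_
  filter_upwards [coeFn_tmul (phaseOp α hα f) (phaseOp β hβ g), coeFn_tmul f g,
    coeFn_phaseOp (fun z : X × Y => α z.1 + β z.2) (by fun_prop) (tmul f g),
    Measure.quasiMeasurePreserving_fst.ae (coeFn_phaseOp α hα f),
    Measure.quasiMeasurePreserving_snd.ae (coeFn_phaseOp β hβ g)] with z h1 h2 h3 h4 h5
  rw [h1, h3, h2, h4, h5]
  push_cast
  rw [add_mul, Complex.exp_add]
  ring

theorem opTensor_indOp_left {s : Set X} (hs : MeasurableSet s) :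
    opTensor (indOp s hs) (ContinuousLinearMap.id ℂ (L2 Y)) =
      indOp (Prod.fst ⁻¹' s) (measurable_fst hs) := by
  refine ext_tmul fun f g => ?_
  rw [opTensor_tmul]
  refine Lp.ext ?_
  filter_upwards [coeFn_tmul (indOp s hs f) g, coeFn_tmul f g,
    coeFn_indOp (Prod.fst ⁻¹' s) (measurable_fst hs) (tmul f g),
    Measure.quasiMeasurePreserving_fst.ae (coeFn_indOp s hs f)] with z h1 h2 h3 h4
  rw [ContinuousLinearMap.id_apply, h1, h3, h2, h4]
  by_cases hz : z.1 ∈ s <;> simp [hz]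

theorem opTensor_indOp_right {s : Set Y} (hs : MeasurableSet s) :
    opTensor (ContinuousLinearMap.id ℂ (L2 X)) (indOp s hs) =
      indOp (Prod.snd ⁻¹' s) (measurable_snd hs) := by
  refine ext_tmul fun f g => ?_
  rw [opTensor_tmul]
  refine Lp.ext ?_
  filter_upwards [coeFn_tmul f (indOp s hs g), coeFn_tmul f g,
    coeFn_indOp (Prod.snd ⁻¹' s) (measurable_snd hs) (tmul f g),
    Measure.quasiMeasurePreserving_snd.ae (coeFn_indOp s hs g)] with z h1 h2 h3 h4
  rw [ContinuousLinearMap.id_apply, h1, h3, h2, h4]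
  by_cases hz : z.2 ∈ s <;> simp [hz]

end Tensor

/-! ### Trace-preserving families of operators. -/

section Slices
variable {ι : Type} {E G : Type} [NormedAddCommGroup E] [InnerProductSpace ℂ E] [CompleteSpace E]
  [NormedAddCommGroup G] [InnerProductSpace ℂ G] [CompleteSpace G]

theorem surjective_of_ampliate_id {R : ι → E →ₗᵢ[ℂ] G} (hR : OrthogonalFamily ℂ (fun _ : ι => E) R)
    (h : ampliate hR (ContinuousLinearMap.id ℂ E) = ContinuousLinearMap.id ℂ G) :
    Function.Surjective hR.linearIsometry := fun z =>
  ⟨ContinuousLinearMap.adjoint hR.linearIsometry.toContinuousLinearMap z, congr($h z)⟩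

/-- A family of Kraus operators of a trace-preserving map. -/
def IsTracePreserving {κ : Type} (K : κ → E →L[ℂ] G) : Prop :=
  ∀ ψ : E, HasSum (fun j => ‖K j ψ‖ ^ 2) (‖ψ‖ ^ 2)

/-- Nonnegativity merges iterated sums into one sum over pairs, so that ensembles can be indexed by
products. -/
theorem hasSum_of_fiberwise {ι κ : Type} {f : ι → κ → ℝ} (hf : ∀ i j, 0 ≤ f i j) {g : ι → ℝ} {G : ℝ}
    (h1 : ∀ i, HasSum (f i) (g i)) (h2 : HasSum g G) :
    HasSum (fun p : ι × κ => f p.1 p.2) G := by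
  have hs : Summable fun p : ι × κ => f p.1 p.2 :=
    (summable_prod_of_nonneg fun p => hf p.1 p.2).2
      ⟨fun i => (h1 i).summable, by simpa only [(h1 _).tsum_eq] using h2.summable⟩
  have := hs.hasSum
  rwa [(this.prod_fiberwise h1).unique h2] at this

/-- The hypothesis on the identity says that the orthogonal copies span G. Squared norms then add up
over the copies, and the two nonnegative sums may be exchanged. -/
theorem isTracePreserving_ampliate {R : ι → E →ₗᵢ[ℂ] G}
    (hR : OrthogonalFamily ℂ (fun _ : ι => E) R)
    (h : ampliate hR (ContinuousLinearMap.id ℂ E) = ContinuousLinearMap.id ℂ G)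
    {κ : Type} {K : κ → E →L[ℂ] E} (hK : IsTracePreserving K) :
    IsTracePreserving fun j => ampliate hR (K j) := by
  intro ψ
  obtain ⟨x, rfl⟩ := surjective_of_ampliate_id hR h ψ
  have hn : ∀ y : lp (fun _ : ι => E) 2, HasSum (fun i => ‖y i‖ ^ 2) (‖y‖ ^ 2) := fun y => by
    have := lp.hasSum_norm (p := 2) (by norm_num) y
    simpa using this
  have hs := hasSum_of_fiberwise (f := fun i j => ‖K j (x i)‖ ^ 2) (fun i j => by positivity)
    (fun i => hK (x i)) (hn x)
  rw [← (Equiv.prodComm κ ι).hasSum_iff] at hs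
  have := hs.prod_fiberwise (fun j => hn (lpMap (K j) x))
  simp only [ampliate_apply, LinearIsometry.norm_map]
  exact this

end Slices

/-! ### Slicing a tensor product along an orthonormal basis. -/

section TensorSlices
variable {X Y : Type} [MeasureSpace X] [MeasureSpace Y]
  [SigmaFinite (volume : Measure X)] [SigmaFinite (volume : Measure Y)]

theorem ampliate_left_id : ampliate (orthogonalFamily_left (X := X) (Y := Y))
    (ContinuousLinearMap.id ℂ _) = ContinuousLinearMap.id ℂ _ :=
  ext_tmul fun f g => by simp [ampliate_left_tmul]

theorem ampliate_right_id : ampliate (orthogonalFamily_right (X := X) (Y := Y))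
    (ContinuousLinearMap.id ℂ _) = ContinuousLinearMap.id ℂ _ :=
  ext_tmul fun f g => by simp [ampliate_right_tmul]

theorem opTensor_id_left (B : L2 Y →L[ℂ] L2 Y) :
    opTensor (ContinuousLinearMap.id ℂ (L2 X)) B = ampliate orthogonalFamily_left B := by
  rw [opTensor, ampliate_right_id, ContinuousLinearMap.id_comp]

theorem opTensor_id_right (A : L2 X →L[ℂ] L2 X) :
    opTensor A (ContinuousLinearMap.id ℂ (L2 Y)) = ampliate orthogonalFamily_right A := by
  rw [opTensor, ampliate_left_id, ContinuousLinearMap.comp_id]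

theorem IsTracePreserving.opTensor_left {κ : Type} {K : κ → L2 X →L[ℂ] L2 X} (hK : IsTracePreserving K) :
    IsTracePreserving fun j => opTensor (K j) (ContinuousLinearMap.id ℂ (L2 Y)) := by
  simp only [opTensor_id_right]
  exact isTracePreserving_ampliate _ ampliate_right_id hK

theorem IsTracePreserving.opTensor_right {κ : Type} {K : κ → L2 Y →L[ℂ] L2 Y} (hK : IsTracePreserving K) :
    IsTracePreserving fun j => opTensor (ContinuousLinearMap.id ℂ (L2 X)) (K j) := by
  simp only [opTensor_id_left]
  exact isTracePreserving_ampliate _ ampliate_left_id hK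

/-- Parseval: the slices of Φ are its components in the orthogonal copies eᵢ ⊗ L²(Y). This puts the
partial trace into the form of a trace-preserving Kraus map. -/
theorem isTracePreserving_slice : IsTracePreserving fun i : onbIndex (L2 X) =>
    ContinuousLinearMap.adjoint (tmulLeft (Y := Y) (onb (L2 X) i)) := by
  classical
  intro Φ
  obtain ⟨x, rfl⟩ := surjective_of_ampliate_id _ (ampliate_left_id (X := X) (Y := Y)) Φ
  have hx : ∀ i, ContinuousLinearMap.adjoint (tmulLeft (Y := Y) (onb (L2 X) i))
      ((orthogonalFamily_left (X := X) (Y := Y)).linearIsometry x) = x i := by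
    intro i
    refine ext_inner_left ℂ fun y => ?_
    rw [ContinuousLinearMap.adjoint_inner_right]
    have : tmulLeft (onb (L2 X) i) y = (orthogonalFamily_left (X := X) (Y := Y)).linearIsometry
        (lp.single 2 i y) :=
      ((orthogonalFamily_left (X := X) (Y := Y)).linearIsometry_apply_single y).symm
    rw [this, LinearIsometry.inner_map_map, lp.inner_single_left]
  rw [LinearIsometry.norm_map]
  simp only [hx]
  simpa using lp.hasSum_norm (p := 2) (by norm_num) x

theorem slice_opTensor (f : L2 X) (B : L2 Y →L[ℂ] L2 Y) (Φ : L2 (X × Y)) :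
    ContinuousLinearMap.adjoint (tmulLeft f)
      (opTensor (ContinuousLinearMap.id ℂ (L2 X)) B Φ) =
    B (ContinuousLinearMap.adjoint (tmulLeft f) Φ) := by
  refine ext_inner_left ℂ fun y => ?_
  rw [ContinuousLinearMap.adjoint_inner_right, ← ContinuousLinearMap.adjoint_inner_left,
    ← ContinuousLinearMap.adjoint_inner_left B, ContinuousLinearMap.adjoint_inner_right,
    adjoint_opTensor]
  show inner ℂ (opTensor _ _ (tmul f y)) Φ = inner ℂ (tmul f _) Φ
  rw [opTensor_tmul]
  congr 2
  refine ext_inner_left ℂ fun z => ?_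
  rw [ContinuousLinearMap.adjoint_inner_right]
  rfl

end TensorSlices

/-! ### States as countable sums of pure states, and their traces. -/

section Ensemble
variable {ι κ : Type} {E F : Type} [NormedAddCommGroup E] [InnerProductSpace ℂ E] [CompleteSpace E]
  [NormedAddCommGroup F] [InnerProductSpace ℂ F] [CompleteSpace F]

/-- The trace-class operator `σ` is the sum of the (unnormalized) pure states `v i`. -/
def IsEnsemble (σ : E →L[ℂ] E) (v : ι → E) : Prop :=
  Summable (fun i => ‖v i‖ ^ 2) ∧ HasSum (fun i => InnerProductSpace.rankOne ℂ (v i) (v i)) σ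

theorem summable_rankOne {v : ι → E} (h : Summable fun i => ‖v i‖ ^ 2) :
    Summable fun i => InnerProductSpace.rankOne ℂ (v i) (v i) :=
  Summable.of_norm (by simpa [pow_two] using h)

/-- Square summability makes the rank-one operators absolutely summable in operator norm, so it
suffices to identify the sum on each vector. -/
theorem isEnsemble_of_apply {σ : E →L[ℂ] E} {v : ι → E} (h : Summable fun i => ‖v i‖ ^ 2)
    (h' : ∀ x, HasSum (fun i => inner ℂ (v i) x • v i) (σ x)) : IsEnsemble σ v := by
  refine ⟨h, ?_⟩
  have hs := (summable_rankOne h).hasSum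
  convert hs using 1
  ext1 x
  exact (h' x).unique (hs.mapL (ContinuousLinearMap.apply ℂ E x))

theorem IsEnsemble.hasSum_apply {σ : E →L[ℂ] E} {v : ι → E} (h : IsEnsemble σ v) (x : E) :
    HasSum (fun i => inner ℂ (v i) x • v i) (σ x) :=
  h.2.mapL (ContinuousLinearMap.apply ℂ E x)

theorem conj_rankOne (A : E →L[ℂ] F) (x : E) :
    conj A (InnerProductSpace.rankOne ℂ x x) = InnerProductSpace.rankOne ℂ (A x) (A x) := by
  ext1 y
  simp [conj, ContinuousLinearMap.adjoint_inner_right]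

theorem hasSum_conj {σ : E →L[ℂ] E} {τ : ι → E →L[ℂ] E} (h : HasSum τ σ) (A : E →L[ℂ] F) :
    HasSum (fun i => conj A (τ i)) (conj A σ) := by
  let C : (E →L[ℂ] E) →+ (F →L[ℂ] F) :=
    { toFun := conj A
      map_zero' := by ext1 x; simp [conj]
      map_add' := fun a b => by ext1 x; simp [conj] }
  have hC : Continuous C := by
    show Continuous fun ρ : E →L[ℂ] E => A ∘L ρ ∘L ContinuousLinearMap.adjoint A
    fun_prop
  exact h.map C hC

theorem IsEnsemble.conj {σ : E →L[ℂ] E} {v : ι → E} (h : IsEnsemble σ v) (A : E →L[ℂ] F) :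
    IsEnsemble (GKP.conj A σ) (fun i => A (v i)) := by
  refine ⟨?_, ?_⟩
  · refine Summable.of_nonneg_of_le (fun i => by positivity) (fun i => ?_) (h.1.mul_left (‖A‖ ^ 2))
    rw [← mul_pow]
    exact pow_le_pow_left₀ (norm_nonneg _) (A.le_opNorm _) 2
  · simpa only [conj_rankOne] using hasSum_conj h.2 A

/-- Each vector v i branches into the vectors K j (v i). Trace preservation keeps the doubled family
square summable, which permits summing over i first for each fixed j. -/
theorem IsEnsemble.tsum_conj {σ : E →L[ℂ] E} {v : ι → E} (h : IsEnsemble σ v)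
    {K : κ → E →L[ℂ] F} (hK : IsTracePreserving K) :
    IsEnsemble (∑' j, GKP.conj (K j) σ) (fun p : ι × κ => K p.2 (v p.1)) := by
  have hs : Summable fun p : ι × κ => ‖K p.2 (v p.1)‖ ^ 2 :=
    (hasSum_of_fiberwise (f := fun i j => ‖K j (v i)‖ ^ 2) (fun i j => by positivity)
      (fun i => hK (v i)) h.1.hasSum).summable
  refine ⟨hs, ?_⟩
  have h1 := (summable_rankOne hs).hasSum
  have h2 := (Equiv.prodComm κ ι).hasSum_iff.2 h1
  have h3 := h2.prod_fiberwise fun j => (h.conj (K j)).2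
  rw [h3.tsum_eq]
  exact h1

theorem IsEnsemble.kraus {σ : E →L[ℂ] E} {v : ι → E} (h : IsEnsemble σ v)
    {K : ℕ → E →L[ℂ] E} (hK : IsTracePreserving K) :
    IsEnsemble (kraus K σ) (fun p : ι × ℕ => K p.2 (v p.1)) :=
  h.tsum_conj hK

/-- Polarization of the norm identity. -/
theorem IsTracePreserving.hasSum_inner {K : κ → E →L[ℂ] F} (hK : IsTracePreserving K) (x y : E) :
    HasSum (fun j => inner ℂ (K j x) (K j y)) (inner ℂ x y) := by
  have h : ∀ z, HasSum (fun j => ((‖K j z‖ : ℝ) : ℂ) ^ 2) (((‖z‖ : ℝ) : ℂ) ^ 2) := fun z => by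
    have := (hK z).mapL Complex.ofRealCLM
    simpa using this
  simp only [inner_eq_sum_norm_sq_div_four]
  have e : ∀ j, K j x + K j y = K j (x + y) ∧ K j x - K j y = K j (x - y) ∧
      (K j x - (RCLike.I : ℂ) • K j y = K j (x - (RCLike.I : ℂ) • y)) ∧
      (K j x + (RCLike.I : ℂ) • K j y = K j (x + (RCLike.I : ℂ) • y)) := fun j => by
    simp only [map_add, map_sub, map_smul, and_self]
  simp only [fun j => (e j).1, fun j => (e j).2.1, fun j => (e j).2.2.1, fun j => (e j).2.2.2]
  exact ((((h _).sub (h _)).add (((h _).sub (h _)).mul_right _))).div_const _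

theorem summable_inner_of_sq {v w : ι → E} (hv : Summable fun i => ‖v i‖ ^ 2)
    (hw : Summable fun i => ‖w i‖ ^ 2) : Summable fun i => inner ℂ (v i) (w i) := by
  refine Summable.of_norm_bounded (hv.add hw) fun i => ?_
  have := norm_inner_le_norm (𝕜 := ℂ) (v i) (w i)
  nlinarith [sq_nonneg (‖v i‖ - ‖w i‖), sq_nonneg (‖v i‖ + ‖w i‖), norm_nonneg (v i)]

/-- The expectation value `∑ i, ⟨v i, R (v i)⟩`. -/
def expect (v : ι → E) (R : E →L[ℂ] E) : ℂ := ∑' i, inner ℂ (v i) (R (v i))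

/-- The Heisenberg picture restricted to the vectors at hand: R has to be pulled back along the
Kraus operators only on the v i, and ∑ⱼ ⟨Kⱼ x, Kⱼ y⟩ = ⟨x, y⟩ then removes the channel. -/
theorem expect_kraus {v : ι → E} (hv : Summable fun i => ‖v i‖ ^ 2) {K : κ → E →L[ℂ] F}
    (hK : IsTracePreserving K) {R : F →L[ℂ] F} {R' : E →L[ℂ] E}
    (h : ∀ i j, R (K j (v i)) = K j (R' (v i))) :
    expect (fun p : ι × κ => K p.2 (v p.1)) R = expect v R' := by
  have hs : ∀ w : ι → E, (Summable fun i => ‖w i‖ ^ 2) →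
      Summable fun p : ι × κ => ‖K p.2 (w p.1)‖ ^ 2 := fun w hw =>
    (hasSum_of_fiberwise (f := fun i j => ‖K j (w i)‖ ^ 2) (fun i j => by positivity)
      (fun i => hK (w i)) hw.hasSum).summable
  have hv' : Summable fun i => ‖R' (v i)‖ ^ 2 := by
    refine Summable.of_nonneg_of_le (fun i => by positivity) (fun i => ?_) (hv.mul_left (‖R'‖ ^ 2))
    rw [← mul_pow]
    exact pow_le_pow_left₀ (norm_nonneg _) (R'.le_opNorm _) 2
  simp only [expect, h]
  have h1 := (summable_inner_of_sq (hs v hv) (hs _ hv')).hasSum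
  exact (h1.prod_fiberwise fun i => hK.hasSum_inner (v i) (R' (v i))).tsum_eq.symm

theorem expect_isometry {v : ι → E} {U : E →L[ℂ] F} (hU : ∀ x, ‖U x‖ = ‖x‖) {R : F →L[ℂ] F}
    {R' : E →L[ℂ] E} (h : ∀ i, R (U (v i)) = U (R' (v i))) :
    expect (fun i => U (v i)) R = expect v R' := by
  have hU' := (ContinuousLinearMap.inner_map_map_iff_adjoint_comp_self U).2
    ((ContinuousLinearMap.norm_map_iff_adjoint_comp_self U).1 hU)
  simp only [expect, h, hU']

theorem hasSum_sq_onb (x : E) : HasSum (fun i => ‖inner ℂ (onb E i) x‖ ^ 2) (‖x‖ ^ 2) := by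
  have := lp.hasSum_norm (p := 2) (by norm_num) ((onb E).repr x)
  simpa [HilbertBasis.repr_apply_apply] using this

/-- Parseval in the basis of F for each v i, followed by an exchange of the two sums; absolute
convergence comes from |ab| ≤ a² + b². Allowing A and B to pass through another space covers the
decoder, whose trace is over syndromes. -/
theorem IsEnsemble.opTrace_eq {σ : E →L[ℂ] E} {v : ι → E} (h : IsEnsemble σ v)
    (A : E →L[ℂ] F) (B : F →L[ℂ] E) : opTrace (A ∘L σ ∘L B) = expect v (B ∘L A) := by
  have hsum : ∀ C : E →L[ℂ] F, Summable fun p : ι × onbIndex F =>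
      ‖inner ℂ (onb F p.2) (C (v p.1))‖ ^ 2 := fun C =>
    (hasSum_of_fiberwise (f := fun i j => ‖inner ℂ (onb F j) (C (v i))‖ ^ 2)
      (fun i j => by positivity) (fun i => hasSum_sq_onb _) (h.conj C).1.hasSum).summable
  have hs : Summable fun p : ι × onbIndex F =>
      inner ℂ (ContinuousLinearMap.adjoint B (v p.1)) (onb F p.2) *
        inner ℂ (onb F p.2) (A (v p.1)) := by
    refine Summable.of_norm_bounded ((hsum A).add (hsum (ContinuousLinearMap.adjoint B)))
      fun p => ?_
    rw [norm_mul, norm_inner_symm]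
    set a := ‖inner ℂ (onb F p.2) (ContinuousLinearMap.adjoint B (v p.1))‖
    set b := ‖inner ℂ (onb F p.2) (A (v p.1))‖
    nlinarith [sq_nonneg (a - b), sq_nonneg a, sq_nonneg b]
  have h1 := hs.hasSum.prod_fiberwise fun i =>
    (onb F).hasSum_inner_mul_inner (ContinuousLinearMap.adjoint B (v i)) (A (v i))
  have h2 := ((Equiv.prodComm _ _).hasSum_iff.2 hs.hasSum).prod_fiberwise
    (g := fun j => inner ℂ (onb F j) (A (σ (B (onb F j))))) fun j => by
      have := ((h.hasSum_apply (B (onb F j))).mapL A).mapL (innerSL ℂ (onb F j))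
      simp only [innerSL_apply_apply, map_smul, smul_eq_mul] at this
      simpa [ContinuousLinearMap.adjoint_inner_left] using this
  rw [expect, opTrace]
  have e1 := h2.tsum_eq.trans h1.tsum_eq.symm
  refine e1.trans (tsum_congr fun i => ?_)
  rw [ContinuousLinearMap.adjoint_inner_left]
  rfl

/-- With S the positive square root of ρ, take the vectors S eᵢ: the sum of their squared norms ⟨eᵢ,
ρ eᵢ⟩ converges, and expanding S x in the basis recovers ρ x. -/
theorem IsDensityOperator.exists_isEnsemble {ρ : E →L[ℂ] E} (h : IsDensityOperator ρ) :
    ∃ v : onbIndex E → E, IsEnsemble ρ v := by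
  have hpos : 0 ≤ ρ := (ContinuousLinearMap.nonneg_iff_isPositive ρ).2 h.1
  set S := CFC.sqrt ρ with hS
  have hSS : S * S = ρ := CFC.sqrt_mul_sqrt_self ρ hpos
  have hSadj : ContinuousLinearMap.adjoint S = S :=
    ((ContinuousLinearMap.nonneg_iff_isPositive S).1 (CFC.sqrt_nonneg ρ)).isSelfAdjoint
  refine ⟨fun i => S (onb E i), isEnsemble_of_apply ?_ fun x => ?_⟩
  · have := (h.2.mapL Complex.reCLM).summable
    refine this.congr fun i => ?_
    have e : ρ (onb E i) = S (S (onb E i)) := by rw [← hSS]; rfl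
    rw [e, ← ContinuousLinearMap.adjoint_inner_left, hSadj, inner_self_eq_norm_sq_to_K]
    simp [← Complex.ofReal_pow]
  · have h1 := ((onb E).hasSum_repr (S x)).mapL S
    rw [show ρ x = S (S x) by rw [← hSS]; rfl]
    convert h1 using 2 with i
    rw [map_smul, HilbertBasis.repr_apply_apply, ← ContinuousLinearMap.adjoint_inner_left, hSadj]

theorem Preparation.isEnsemble {γ : ZMod 2 → ℂ} {s : ℝ} (P : Preparation γ s) :
    IsEnsemble P.state fun i => ((√(P.prob i) : ℝ) : ℂ) • P.vec i := by
  have h1 : ∀ i, ‖((√(P.prob i) : ℝ) : ℂ) • P.vec i‖ ^ 2 = P.prob i := fun i => by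
    rw [norm_smul, (P.vec_param i).1, mul_one, Complex.norm_real, Real.norm_eq_abs, sq_abs,
      Real.sq_sqrt (P.prob_nonneg i)]
  have h0 : Summable fun i => ‖((√(P.prob i) : ℝ) : ℂ) • P.vec i‖ ^ 2 := by
    simpa only [h1] using P.prob_sum.summable
  refine ⟨h0, ?_⟩
  have h2 := (summable_rankOne h0).hasSum
  have e : ∀ i, InnerProductSpace.rankOne ℂ (((√(P.prob i) : ℝ) : ℂ) • P.vec i)
      (((√(P.prob i) : ℝ) : ℂ) • P.vec i) =
      (P.prob i : ℂ) • InnerProductSpace.rankOne ℂ (P.vec i) (P.vec i) := fun i => by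
    ext1 x
    simp only [InnerProductSpace.rankOne_apply, inner_smul_left, smul_apply, smul_smul,
      Complex.conj_ofReal]
    congr 1
    have : ((√(P.prob i) : ℝ) : ℂ) * ((√(P.prob i) : ℝ) : ℂ) = P.prob i := by
      rw [← Complex.ofReal_mul, Real.mul_self_sqrt (P.prob_nonneg i)]
    linear_combination (inner ℂ (P.vec i) x) * this
  simp only [e] at h2 ⊢
  exact h2

end Ensemble

/-! ### Ensembles of product states and of partial traces. -/

section TensorEnsemble
variable {ι κ : Type} {X Y : Type} [MeasureSpace X] [MeasureSpace Y]
  [SigmaFinite (volume : Measure X)] [SigmaFinite (volume : Measure Y)]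

theorem IsEnsemble.opTensor {σ : L2 X →L[ℂ] L2 X} {τ : L2 Y →L[ℂ] L2 Y} {v : ι → L2 X}
    {w : κ → L2 Y} (hv : IsEnsemble σ v) (hw : IsEnsemble τ w) :
    IsEnsemble (opTensor σ τ) (fun p : ι × κ => tmul (v p.1) (w p.2)) := by
  have hs : Summable fun p : ι × κ => ‖tmul (v p.1) (w p.2)‖ ^ 2 := by
    simp only [norm_tmul, mul_pow]
    exact (hasSum_of_fiberwise (f := fun i j => ‖v i‖ ^ 2 * ‖w j‖ ^ 2)
      (fun i j => by positivity) (fun i => hw.1.hasSum.mul_left _)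
      (hv.1.hasSum.mul_right _)).summable
  refine ⟨hs, ?_⟩
  have h1 := (summable_rankOne hs).hasSum
  convert h1 using 1
  refine ext_tmul fun f g => ?_
  rw [opTensor_tmul]
  have h2 := h1.mapL (ContinuousLinearMap.apply ℂ _ (tmul f g))
  have h3 := h2.prod_fiberwise (g := fun i => tmul (inner ℂ (v i) f • v i) (τ g)) fun i => by
    have := (hw.hasSum_apply g).mapL (tmulLeft (inner ℂ (v i) f • v i))
    convert this using 2 with j
    · show inner ℂ (tmul (v i) (w j)) (tmul f g) • tmul (v i) (w j) =
        tmul (inner ℂ (v i) f • v i) (inner ℂ (w j) g • w j)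
      rw [tmul_smul_left, tmul_smul_right, smul_smul, inner_tmul]
    · rfl
  exact ((hv.hasSum_apply f).mapL (tmulRight (τ g))).unique h3

theorem IsEnsemble.partialTraceLeft {σ : L2 (X × Y) →L[ℂ] L2 (X × Y)} {v : ι → L2 (X × Y)}
    (hv : IsEnsemble σ v) : IsEnsemble (partialTraceLeft σ)
      (fun p : ι × onbIndex (L2 X) =>
        ContinuousLinearMap.adjoint (tmulLeft (onb (L2 X) p.2)) (v p.1)) := by
  have h := hv.tsum_conj (isTracePreserving_slice (X := X) (Y := Y))
  simp only [GKP.conj, ContinuousLinearMap.adjoint_adjoint] at h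
  exact h

end TensorEnsemble

/-! ### Binned quadratures in the stabilizer subsystem decomposition. -/

section StabilizerSubsystem

theorem coeFn_sssSynth (μ : ZMod 2) (g : Lp ℂ 2 (volume.restrict patch)) :
    sssSynth μ g =ᵐ[volume] gkpWave (Pi.single μ 1) (patch.indicator g) := by
  have hγ : ∀ ν : ZMod 2, ‖(Pi.single μ 1 : ZMod 2 → ℂ) ν‖ ≤ 1 := fun ν => by
    by_cases h : ν = μ
    · subst h; simp
    · simp [h]
  exact MemLp.coeFn_toLp (memLp_gkpWave hγ g)

theorem gkpWave_single_of_ne {μ : ZMod 2} {x : ℝ} (h : (bin x : ZMod 2) ≠ μ) (g : ℝ × ℝ → ℂ) :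
    gkpWave (Pi.single μ 1) (patch.indicator g) x = 0 := by
  rw [gkpWave_eq, Pi.single_eq_of_ne h, zero_mul, mul_zero]

theorem gkpWave_single_of_eq {μ : ZMod 2} {x : ℝ} (h : (bin x : ZMod 2) = μ) (g : ℝ × ℝ → ℂ) :
    gkpWave (Pi.single μ 1) (patch.indicator g) x = (√c : ℂ)⁻¹ *
      ∫ z₂ : ℝ, Complex.exp (((z₂ * (x + c * bin x) / 2 : ℝ) : ℂ) * Complex.I) *
        patch.indicator g (x - c * bin x, z₂) := by
  rw [gkpWave_eq, h, Pi.single_eq_same, one_mul]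

theorem sub_bin_mem (x : ℝ) : x - c * bin x ∈ Set.Ico (-(c / 2)) (c / 2) :=
  (sub_mem_Ico_iff x (bin x)).2 rfl

theorem bin_sub_mul (x : ℝ) (n : ℤ) : bin (x - c * n) = bin x - n := by
  symm
  rw [← sub_mem_Ico_iff]
  have := sub_bin_mem x
  push_cast
  convert this using 1
  ring

/-- The half-period translation acts on the logical factor as `X` and on the syndrome as a phase. -/
theorem translation_comp_sssSynth (μ : ZMod 2) :
    translation c ∘L sssSynth μ =
      sssSynth (μ + 1) ∘L phaseOp (fun z : ℝ × ℝ => -(c * z.2)) (by fun_prop) := by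
  ext1 g
  refine Lp.ext ?_
  rw [ContinuousLinearMap.comp_apply, ContinuousLinearMap.comp_apply]
  have hq := (measurePreserving_sub_right volume c).quasiMeasurePreserving.ae (coeFn_sssSynth μ g)
  filter_upwards [coeFn_translation c (sssSynth μ g), hq,
    coeFn_sssSynth (μ + 1) (phaseOp (fun z : ℝ × ℝ => -(c * z.2)) (by fun_prop) g),
    ae_shift (ae_slice (coeFn_phaseOp (fun z : ℝ × ℝ => -(c * z.2)) (by fun_prop) g))]
    with x h1 h2 h3 h4
  rw [h1, h2, h3]
  have hbin : bin (x - c) = bin x - 1 := by simpa using bin_sub_mul x 1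
  by_cases hb : (bin x : ZMod 2) = μ + 1
  · have hb' : (bin (x - c) : ZMod 2) = μ := by rw [hbin]; push_cast; rw [hb]; ring
    rw [gkpWave_single_of_eq hb, gkpWave_single_of_eq hb', hbin]
    congr 1
    refine integral_congr_ae ?_
    filter_upwards [h4] with z hz
    have e : x - c - c * ((bin x - 1 : ℤ) : ℝ) = x - c * bin x := by push_cast; ring
    rw [e]
    by_cases hp : (x - c * bin x, z) ∈ patch
    · rw [Set.indicator_of_mem hp, Set.indicator_of_mem hp, hz hp, ← mul_assoc, ← Complex.exp_add]
      congr 2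
      push_cast
      ring
    · rw [Set.indicator_of_notMem hp, Set.indicator_of_notMem hp, mul_zero, mul_zero]
  · have hb' : (bin (x - c) : ZMod 2) ≠ μ := fun h => hb (by
      rw [hbin] at h; push_cast at h; rw [← h]; ring)
    rw [gkpWave_single_of_ne hb, gkpWave_single_of_ne hb']

/-- The projection onto positions within `r` of a multiple of `c` of parity `b`. -/
def posOp (b : ZMod 2) (r : ℝ) : L2 ℝ →L[ℂ] L2 ℝ := binOp id measurable_id b r

/-- The projection onto momenta within `r` of a multiple of `c` of parity `b`. -/
def momOp (b : ZMod 2) (r : ℝ) : L2 ℝ →L[ℂ] L2 ℝ :=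
  fourierGate ∘L posOp b r ∘L ContinuousLinearMap.adjoint fourierGate

/-- Half the spacing is the threshold below which a multiple of c within distance r must be the
nearest one. -/
theorem mem_binSet_iff {b : ZMod 2} {r x : ℝ} (hr : r ≤ c / 2) :
    x ∈ binSet b r ↔ (bin x : ZMod 2) = b ∧ |x - c * bin x| < r := by
  constructor
  · rintro ⟨n, hn, hx⟩
    have : n = bin x := by
      rw [← sub_mem_Ico_iff]
      have := abs_lt.1 hx
      exact ⟨by linarith [this.1], by linarith [this.2]⟩
    subst this
    exact ⟨hn, hx⟩
  · rintro ⟨h1, h2⟩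
    exact ⟨bin x, h1, h2⟩

theorem bin_of_mem_Ico {x : ℝ} (h : x ∈ Set.Ico (-(c / 2)) (c / 2)) : bin x = 0 := by
  symm; rw [← sub_mem_Ico_iff]; simpa using h

/-- The half-open cells differ from open intervals only by the point -c/2, and the countably many
translates of it form a null set. -/
theorem ae_abs_sub_bin_lt : ∀ᵐ x : ℝ, |x - c * bin x| < c / 2 := by
  have : ∀ᵐ x : ℝ, x ≠ -(c / 2) := by
    rw [ae_iff]; simp
  filter_upwards [ae_shift this] with x hx
  have h := sub_bin_mem x
  rw [abs_lt]
  exact ⟨lt_of_le_of_ne h.1 (Ne.symm hx), h.2⟩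

theorem measZ_eq (b : ZMod 2) : measZ b = posOp b (c / 2) := by
  classical
  rw [measZ, posOp, binOp, indOp]
  refine mulOp_congr _ _ _ _ ?_
  filter_upwards [ae_abs_sub_bin_lt] with x hx
  simp [mem_binSet_iff le_rfl, hx]

theorem measX_eq (b : ZMod 2) : measX b = momOp b (c / 2) := by
  rw [measX, measZ_eq, momOp]

theorem coeFn_posOp (b : ZMod 2) (r : ℝ) (f : L2 ℝ) :
    ∀ᵐ x, (x ∈ binSet b r → posOp b r f x = f x) ∧ (x ∉ binSet b r → posOp b r f x = 0) := by
  filter_upwards [coeFn_indOp (id ⁻¹' binSet b r) (measurable_id (measurableSet_binSet b r)) f]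
    with x hx
  exact ⟨fun h => hx.trans (if_pos h), fun h => hx.trans (if_neg h)⟩

/-- The syndromes whose first component is less than `r` in absolute value. -/
def fstBox (r : ℝ) : Lp ℂ 2 (volume.restrict patch) →L[ℂ] Lp ℂ 2 (volume.restrict patch) :=
  indOp {z : ℝ × ℝ | |z.1| < r} (measurableSet_lt (by fun_prop) measurable_const)

/-- The syndromes whose second component is less than `r` in absolute value. -/
def sndBox (r : ℝ) : Lp ℂ 2 (volume.restrict patch) →L[ℂ] Lp ℂ 2 (volume.restrict patch) :=
  indOp {z : ℝ × ℝ | |z.2| < r} (measurableSet_lt (by fun_prop) measurable_const)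

/-- At x the synthesized wave function involves only the slice z₁ = x - c · bin x, and it vanishes
unless the cell has parity μ. Cutting off positions is therefore cutting off z₁. -/
theorem posOp_comp_sssSynth {b μ : ZMod 2} {r : ℝ} (hr : r ≤ c / 2) :
    posOp b r ∘L sssSynth μ = if b = μ then sssSynth μ ∘L fstBox r else 0 := by
  ext1 g
  refine Lp.ext ?_
  rw [ContinuousLinearMap.comp_apply]
  split_ifs with hbμ
  · subst hbμ
    rw [ContinuousLinearMap.comp_apply]
    filter_upwards [coeFn_posOp b r (sssSynth b g), coeFn_sssSynth b g,
      coeFn_sssSynth b (fstBox r g), ae_shift (ae_slice (coeFn_indOp {z : ℝ × ℝ | |z.1| < r}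
        (measurableSet_lt (by fun_prop) measurable_const) g))] with x h1 h2 h3 h4
    rw [h3]
    by_cases hb : (bin x : ZMod 2) = b
    · by_cases hx : |x - c * bin x| < r
      · rw [h1.1 ((mem_binSet_iff hr).2 ⟨hb, hx⟩), h2, gkpWave_single_of_eq hb,
          gkpWave_single_of_eq hb]
        congr 1
        refine integral_congr_ae ?_
        filter_upwards [h4] with z hz
        by_cases hp : (x - c * bin x, z) ∈ patch
        · rw [Set.indicator_of_mem hp, Set.indicator_of_mem hp, fstBox, hz hp, if_pos hx]
        · rw [Set.indicator_of_notMem hp, Set.indicator_of_notMem hp]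
      · rw [h1.2 fun h => hx ((mem_binSet_iff hr).1 h).2, gkpWave_single_of_eq hb,
          integral_eq_zero_of_ae, mul_zero]
        filter_upwards [h4] with z hz
        by_cases hp : (x - c * bin x, z) ∈ patch
        · rw [Set.indicator_of_mem hp, fstBox, hz hp, if_neg hx, mul_zero]; rfl
        · rw [Set.indicator_of_notMem hp, mul_zero]; rfl
    · rw [h1.2 fun h => hb ((mem_binSet_iff hr).1 h).1, gkpWave_single_of_ne hb]
  · filter_upwards [coeFn_posOp b r (sssSynth μ g), coeFn_sssSynth μ g,
      Lp.coeFn_zero ℂ 2 (volume : Measure ℝ)] with x h1 h2 h3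
    rw [zero_apply, h3]
    by_cases hx : x ∈ binSet b r
    · rw [h1.1 hx, h2, gkpWave_single_of_ne fun h => hbμ ?_]
      · rfl
      · rw [← h, ((mem_binSet_iff hr).1 hx).1]
    · rw [h1.2 hx]; rfl

theorem adjoint_fourierGate_translation (a : ℝ) :
    ContinuousLinearMap.adjoint fourierGate ∘L translation a =
      phaseOp (fun x => -(a * x)) (by fun_prop) ∘L ContinuousLinearMap.adjoint fourierGate := by
  calc _ = ContinuousLinearMap.adjoint fourierGate ∘L (translation a ∘L fourierGate) ∘L
        ContinuousLinearMap.adjoint fourierGate := by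
        rw [ContinuousLinearMap.comp_assoc, fourierGate_comp_adjoint, ContinuousLinearMap.comp_id]
    _ = (ContinuousLinearMap.adjoint fourierGate ∘L fourierGate) ∘L
        phaseOp (fun x => -(a * x)) (by fun_prop) ∘L ContinuousLinearMap.adjoint fourierGate := by
        rw [translation_comp_fourierGate]; rfl
    _ = _ := by rw [adjoint_comp_fourierGate, ContinuousLinearMap.id_comp]

theorem momOp_comp_of_intertwine {E : Type} [NormedAddCommGroup E] [NormedSpace ℂ E]
    {U : E →L[ℂ] L2 ℝ} {B : E →L[ℂ] E} {b : ZMod 2} {r : ℝ}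
    (h : (ContinuousLinearMap.adjoint fourierGate ∘L U) ∘L B =
      posOp b r ∘L (ContinuousLinearMap.adjoint fourierGate ∘L U)) :
    momOp b r ∘L U = U ∘L B := by
  rw [momOp, ContinuousLinearMap.comp_assoc, ContinuousLinearMap.comp_assoc, ← h,
    ContinuousLinearMap.comp_assoc, ← ContinuousLinearMap.comp_assoc, fourierGate_comp_adjoint,
    ContinuousLinearMap.id_comp]

theorem binOp_snd_zero {r : ℝ} (hr : r ≤ c / 2) :
    (binOp (fun z : ℝ × ℝ => z.2) measurable_snd 0 r :
      Lp ℂ 2 (volume.restrict patch) →L[ℂ] Lp ℂ 2 (volume.restrict patch)) = sndBox r := by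
  refine indOp_congr _ _ ?_
  filter_upwards [ae_restrict_mem measurableSet_patch] with z hz
  rw [Set.mem_preimage, mem_binSet_iff hr, bin_of_mem_Ico hz.2]
  simp

theorem binOp_snd_one {r : ℝ} (hr : r ≤ c / 2) :
    (binOp (fun z : ℝ × ℝ => z.2) measurable_snd 1 r :
      Lp ℂ 2 (volume.restrict patch) →L[ℂ] Lp ℂ 2 (volume.restrict patch)) = 0 := by
  rw [← indOp_empty]
  refine indOp_congr _ _ ?_
  filter_upwards [ae_restrict_mem measurableSet_patch] with z hz
  rw [Set.mem_preimage, mem_binSet_iff hr, bin_of_mem_Ico hz.2]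
  simp

/-- Translation by c exchanges the two logical values, so on the logical plus it is just the phase
e^{-ic z₂}; in momentum space it is e^{-icp}. Momentum bins thus become bins of z₂, and since z₂
lies in [-c/2, c/2) only the even bin around 0 is met. -/
theorem momOp_comp_add {r : ℝ} (h0 : 0 ≤ r) (hr : r ≤ c / 2) (b : ZMod 2) :
    momOp b r ∘L (sssSynth 0 + sssSynth 1) =
      if b = 0 then (sssSynth 0 + sssSynth 1) ∘L sndBox r else 0 := by
  have hc := c_pos
  have hU : (ContinuousLinearMap.adjoint fourierGate ∘L (sssSynth 0 + sssSynth 1)) ∘L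
      phaseOp (fun z : ℝ × ℝ => -(c * z.2)) (by fun_prop) =
      phaseOp (fun x => -(c * x)) (by fun_prop) ∘L
        (ContinuousLinearMap.adjoint fourierGate ∘L (sssSynth 0 + sssSynth 1)) := by
    rw [← ContinuousLinearMap.comp_assoc, ← adjoint_fourierGate_translation,
      ContinuousLinearMap.comp_assoc, ContinuousLinearMap.comp_assoc,
      ContinuousLinearMap.comp_add, translation_comp_sssSynth, translation_comp_sssSynth,
      ContinuousLinearMap.add_comp]
    rw [show (1 + 1 : ZMod 2) = 0 from rfl, zero_add, add_comm]
  have h := intertwine_binOp_of_neg (φ := fun z : ℝ × ℝ => z.2) (φ' := id) measurable_snd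
    measurable_id hU b h0 (by linarith)
  have h2 := momOp_comp_of_intertwine h
  rw [h2]
  fin_cases b
  · exact congr((sssSynth 0 + sssSynth 1) ∘L $(binOp_snd_zero hr))
  · exact congr((sssSynth 0 + sssSynth 1) ∘L $(binOp_snd_one hr)).trans
      ((ContinuousLinearMap.comp_zero _).trans (if_neg (one_ne_zero (α := ZMod 2))).symm)

/-- On the logical minus the exchange costs the sign -1 = e^{-iπ}, which offsets the momentum by c:
only odd bins occur. -/
theorem momOp_comp_sub {r : ℝ} (h0 : 0 ≤ r) (hr : r ≤ c / 2) (b : ZMod 2) :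
    momOp b r ∘L (sssSynth 0 - sssSynth 1) =
      if b = 1 then (sssSynth 0 - sssSynth 1) ∘L sndBox r else 0 := by
  have hc := c_pos
  have hU : (ContinuousLinearMap.adjoint fourierGate ∘L (sssSynth 0 - sssSynth 1)) ∘L
      phaseOp (fun z : ℝ × ℝ => -(c * z.2)) (by fun_prop) =
      phaseOp (fun x => -(c * (x + c * ((1 : ZMod 2).val : ℝ)))) (by fun_prop) ∘L
        (ContinuousLinearMap.adjoint fourierGate ∘L (sssSynth 0 - sssSynth 1)) := by
    have e : (phaseOp (fun x => -(c * (x + c * ((1 : ZMod 2).val : ℝ)))) (by fun_prop) :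
        L2 ℝ →L[ℂ] L2 ℝ) = -phaseOp (fun x => -(c * x)) (by fun_prop) := by
      ext1 f
      refine Lp.ext ?_
      rw [neg_apply]
      filter_upwards [coeFn_phaseOp (fun x => -(c * (x + c * ((1 : ZMod 2).val : ℝ))))
        (by fun_prop) f, coeFn_phaseOp (fun x => -(c * x)) (by fun_prop) f,
        Lp.coeFn_neg (phaseOp (fun x => -(c * x)) (by fun_prop) f)] with x h1 h2 h3
      rw [h1, h3, Pi.neg_apply, h2]
      have hv : ((1 : ZMod 2).val : ℝ) = 1 := by simp [ZMod.val_one]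
      rw [hv, show -(c * (x + c * 1)) = -(c * x) - Real.pi by rw [← c_mul_c]; ring]
      push_cast
      rw [sub_mul, Complex.exp_sub, Complex.exp_pi_mul_I]
      ring
    rw [e, ContinuousLinearMap.neg_comp, ← ContinuousLinearMap.comp_assoc,
      ← adjoint_fourierGate_translation,
      ContinuousLinearMap.comp_assoc, ContinuousLinearMap.comp_assoc,
      ContinuousLinearMap.comp_sub, translation_comp_sssSynth, translation_comp_sssSynth,
      ContinuousLinearMap.sub_comp]
    rw [show (1 + 1 : ZMod 2) = 0 from rfl, zero_add, ← ContinuousLinearMap.comp_neg, neg_sub]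
  -- The bin of z₂ is taken with parity b + 1, so that after the offset the momentum bin has parity
  -- b.
  have h := intertwine_binOp_add_of_neg 1 (φ := fun z : ℝ × ℝ => z.2) (φ' := id) measurable_snd
    measurable_id hU (b + 1) h0 (by linarith)
  rw [add_assoc, show (1 + 1 : ZMod 2) = 0 from rfl, add_zero] at h
  have h2 := momOp_comp_of_intertwine h
  rw [h2]
  fin_cases b
  · exact congr((sssSynth 0 - sssSynth 1) ∘L $(binOp_snd_one hr)).trans
      ((ContinuousLinearMap.comp_zero _).trans (if_neg (zero_ne_one (α := ZMod 2))).symm)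
  · exact congr((sssSynth 0 - sssSynth 1) ∘L $(binOp_snd_zero hr))

theorem sndBox_half : sndBox (c / 2) = ContinuousLinearMap.id ℂ _ := by
  ext1 g
  rw [ContinuousLinearMap.id_apply, sndBox, indOp_eq_self_iff]
  rw [ae_restrict_iff' measurableSet_patch]
  have : ∀ᵐ z : ℝ × ℝ, z.2 ≠ -(c / 2) := by
    refine Measure.quasiMeasurePreserving_snd.ae (p := fun y : ℝ => y ≠ -(c / 2)) ?_
    rw [ae_iff]; simp
  filter_upwards [this] with z hz hp h
  exact absurd (abs_lt.2 ⟨lt_of_le_of_ne hp.2.1 (Ne.symm hz), hp.2.2⟩) h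

theorem sssSynth_eq (μ : ZMod 2) : sssSynth μ = (1 / 2 : ℂ) • (sssSynth 0 + sssSynth 1) +
    (sgn μ / 2 : ℂ) • (sssSynth 0 - sssSynth 1) := by
  fin_cases μ
  · show sssSynth 0 = _ + ((sgn 0 : ℂ) / 2) • _
    rw [sgn_zero]; push_cast; module
  · show sssSynth 1 = _ + ((sgn 1 : ℂ) / 2) • _
    rw [sgn_one]; push_cast; module

/-- The projection onto positions within `r` of a multiple of `c`. -/
def posFilter (r : ℝ) : L2 ℝ →L[ℂ] L2 ℝ := posOp 0 r + posOp 1 r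

/-- The projection onto momenta within `r` of a multiple of `c`. -/
def momFilter (r : ℝ) : L2 ℝ →L[ℂ] L2 ℝ := momOp 0 r + momOp 1 r

/-- The logical `Z` operator. -/
def logicalZ : L2 ℝ →L[ℂ] L2 ℝ := measZ 0 - measZ 1

/-- The logical `X` operator. -/
def logicalX : L2 ℝ →L[ℂ] L2 ℝ := measX 0 - measX 1

/-- Momentum operators act diagonally on logical plus and minus. The factor a on minus is 1 for the
momentum filter and -1 for the logical X. -/
theorem comp_sssSynth_of_comp {A : L2 ℝ →L[ℂ] L2 ℝ}
    {B : Lp ℂ 2 (volume.restrict patch) →L[ℂ] Lp ℂ 2 (volume.restrict patch)} {a : ℂ}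
    (h1 : A ∘L (sssSynth 0 + sssSynth 1) = (sssSynth 0 + sssSynth 1) ∘L B)
    (h2 : A ∘L (sssSynth 0 - sssSynth 1) = a • (sssSynth 0 - sssSynth 1) ∘L B) (μ : ZMod 2) :
    A ∘L sssSynth μ = ((1 / 2 : ℂ) • (sssSynth 0 + sssSynth 1) +
      (a * sgn μ / 2 : ℂ) • (sssSynth 0 - sssSynth 1)) ∘L B := by
  rw [sssSynth_eq μ, ContinuousLinearMap.comp_add, ContinuousLinearMap.comp_smul,
    ContinuousLinearMap.comp_smul, h1, h2]
  simp only [ContinuousLinearMap.add_comp, ContinuousLinearMap.smul_comp,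
    ContinuousLinearMap.sub_comp]
  module

theorem momFilter_comp_sssSynth {r : ℝ} (h0 : 0 ≤ r) (hr : r ≤ c / 2) (μ : ZMod 2) :
    momFilter r ∘L sssSynth μ = sssSynth μ ∘L sndBox r := by
  have h := comp_sssSynth_of_comp (A := momFilter r) (B := sndBox r) (a := 1)
    (by rw [momFilter, ContinuousLinearMap.add_comp, momOp_comp_add h0 hr, momOp_comp_add h0 hr,
      if_pos rfl, if_neg one_ne_zero, add_zero])
    (by rw [momFilter, ContinuousLinearMap.add_comp, momOp_comp_sub h0 hr, momOp_comp_sub h0 hr,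
      if_pos rfl, if_neg zero_ne_one, zero_add, one_smul]) μ
  rw [h, one_mul, ← sssSynth_eq]

theorem logicalX_comp_sssSynth (μ : ZMod 2) : logicalX ∘L sssSynth μ = sssSynth (μ + 1) := by
  have h0 : 0 ≤ c / 2 := by have := c_pos; positivity
  have h := comp_sssSynth_of_comp (A := logicalX) (B := sndBox (c / 2)) (a := -1)
    (by rw [logicalX, measX_eq, measX_eq, ContinuousLinearMap.sub_comp, momOp_comp_add h0 le_rfl,
      momOp_comp_add h0 le_rfl, if_pos rfl, if_neg one_ne_zero, sub_zero])
    (by rw [logicalX, measX_eq, measX_eq, ContinuousLinearMap.sub_comp, momOp_comp_sub h0 le_rfl,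
      momOp_comp_sub h0 le_rfl, if_pos rfl, if_neg zero_ne_one, zero_sub, neg_smul, one_smul]) μ
  rw [h, sndBox_half, ContinuousLinearMap.comp_id, sssSynth_eq (μ + 1)]
  congr 3
  fin_cases μ
  · show (-1 * sgn 0 : ℂ) = sgn 1
    rw [sgn_zero, sgn_one]; norm_num
  · show (-1 * sgn 1 : ℂ) = sgn 0
    rw [sgn_zero, sgn_one]; norm_num

end StabilizerSubsystem

/-! ### Completeness of the decomposition, and the filter in terms of quadratures. -/

section Completeness

/-- The syndrome amplitudes of a wave function supported in the `n`-th bin. -/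
def binAmplitude (n : ℤ) (ψ : L2 ℝ) (z : ℝ × ℝ) : ℂ :=
  (√c : ℂ)⁻¹ * (Complex.exp (((-(z.2 * (z.1 + 2 * c * n) / 2) : ℝ) : ℂ) * Complex.I) *
    ψ (z.1 + c * n))

theorem memLp_binAmplitude (n : ℤ) (ψ : L2 ℝ) :
    MemLp (binAmplitude n ψ) 2 (volume.restrict patch) := by
  have h1 : MemLp (fun x : ℝ => ψ (x + c * n)) 2 volume :=
    (Lp.memLp ψ).comp_measurePreserving (measurePreserving_add_right volume (c * n))
  have h2 : MemLp (fun z : ℝ × ℝ => ψ (z.1 + c * n)) 2 (volume.restrict patch) := by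
    have := (h1.restrict (Set.Ico (-(c / 2)) (c / 2))).comp_fst
      (volume.restrict (Set.Ico (-(c / 2)) (c / 2)))
    rw [Measure.prod_restrict] at this
    exact this
  refine MemLp.const_mul (h2.of_le ?_ (.of_forall fun z => ?_)) _
  · exact (Measurable.aestronglyMeasurable (by fun_prop)).mul h2.1
  · rw [norm_mul, Complex.norm_exp_ofReal_mul_I, one_mul]

/-- The projection onto the `n`-th bin. -/
def singleBin (n : ℤ) : L2 ℝ →L[ℂ] L2 ℝ :=
  indOp (bin ⁻¹' {n}) (measurable_bin (MeasurableSet.of_discrete (s := {n})))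

theorem coeFn_singleBin (n : ℤ) (ψ : L2 ℝ) :
    singleBin n ψ =ᵐ[volume] fun x => if bin x = n then ψ x else 0 := by
  classical
  filter_upwards [coeFn_indOp (bin ⁻¹' {n}) (measurable_bin (MeasurableSet.of_discrete
    (s := {n}))) ψ] with x hx
  refine hx.trans ?_
  by_cases h : bin x = n <;> simp [h]

theorem adjoint_singleBin (n : ℤ) : ContinuousLinearMap.adjoint (singleBin n) = singleBin n :=
  adjoint_indOp (measurable_bin (MeasurableSet.of_discrete (s := {n})))

/-- In the inner product with a synthesized vector only the n-th bin contributes; the substitution x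
= z₁ + c n and Fubini turn it into an integral over the patch, from which the amplitude is read off.
-/
theorem adjoint_sssSynth_singleBin (n : ℤ) (ψ : L2 ℝ) :
    ContinuousLinearMap.adjoint (sssSynth n) (singleBin n ψ) =
      (memLp_binAmplitude n ψ).toLp _ := by
  refine ext_inner_right ℂ fun g => ?_
  rw [ContinuousLinearMap.adjoint_inner_left, L2.inner_def, L2.inner_def]
  set J := (memLp_binAmplitude n ψ).toLp (binAmplitude n ψ) with hJ
  set k : ℝ × ℝ → ℂ := patch.indicator fun z => inner ℂ (binAmplitude n ψ z) (g z) with hk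
  have hkint : Integrable k := by
    refine (integrable_indicator_iff measurableSet_patch).2 ?_
    refine (integrable_congr ?_).1 (L2.integrable_inner (𝕜 := ℂ) J g)
    filter_upwards [MemLp.coeFn_toLp (memLp_binAmplitude n ψ)] with z hz
    rw [hJ, hz]
  have hR : ∫ z in patch, inner ℂ (J z) (g z) = ∫ z, k z := by
    rw [hk, integral_indicator measurableSet_patch]
    refine integral_congr_ae ?_
    filter_upwards [MemLp.coeFn_toLp (memLp_binAmplitude n ψ)] with z hz
    rw [hJ, hz]
  have hF : ∫ z, k z = ∫ x, ∫ y, k (x, y) := integral_prod k hkint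
  rw [hR, hF, ← integral_sub_right_eq_self (fun x => ∫ y, k (x, y)) (c * n)]
  refine integral_congr_ae ?_
  filter_upwards [coeFn_singleBin n ψ, coeFn_sssSynth n g] with x h1 h2
  rw [h1, h2]
  by_cases hx : bin x = n
  · rw [if_pos hx, gkpWave_single_of_eq (by rw [hx]), hx, RCLike.inner_apply, mul_right_comm,
      ← integral_const_mul]
    refine integral_congr_ae (.of_forall fun z => ?_)
    simp only [hk]
    by_cases hp : (x - c * n, z) ∈ patch
    · rw [Set.indicator_of_mem hp, Set.indicator_of_mem hp, binAmplitude, RCLike.inner_apply]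
      simp only [map_mul, map_inv₀, Complex.conj_ofReal, ← Complex.exp_conj, Complex.conj_I,
        sub_add_cancel]
      rw [show ((-(z * (x - c * n + 2 * c * n) / 2) : ℝ) : ℂ) * -Complex.I =
        ((z * (x + c * n) / 2 : ℝ) : ℂ) * Complex.I by push_cast; ring]
      ring
    · rw [Set.indicator_of_notMem hp, Set.indicator_of_notMem hp, mul_zero, mul_zero]
  · rw [if_neg hx, inner_zero_left, integral_eq_zero_of_ae]
    refine .of_forall fun z => ?_
    have : (x - c * n, z) ∉ patch := fun h => hx ((sub_mem_Ico_iff x n).1 h.1).symm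
    exact Set.indicator_of_notMem this _

/-- Since c² = π, the integrand completes k full periods over an interval of length c. -/
theorem integral_phase (k : ℤ) : ∫ z in Set.Ico (-(c / 2)) (c / 2),
    Complex.exp (((z * (c * (2 * k)) : ℝ) : ℂ) * Complex.I) = if k = 0 then (c : ℂ) else 0 := by
  have hc := c_pos
  rw [integral_Ico_eq_integral_Ioc, ← intervalIntegral.integral_of_le (by linarith)]
  split_ifs with h
  · subst h
    simp
  · have hk : ((c * (2 * k) : ℝ) : ℂ) * Complex.I ≠ 0 := by
      have : (c * (2 * k) : ℝ) ≠ 0 := by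
        have : (k : ℝ) ≠ 0 := by exact_mod_cast h
        positivity
      exact mul_ne_zero (by exact_mod_cast this) Complex.I_ne_zero
    have e : ∀ z : ℝ, Complex.exp (((z * (c * (2 * k)) : ℝ) : ℂ) * Complex.I) =
        Complex.exp (((c * (2 * k) : ℝ) : ℂ) * Complex.I * z) := fun z => by
      congr 1; push_cast; ring
    simp only [e]
    rw [integral_exp_mul_complex hk, sub_eq_zero.2, zero_div]
    rw [Complex.exp_eq_exp_iff_exists_int]
    refine ⟨k, ?_⟩
    have hcc : (c : ℂ) * c = Real.pi := by exact_mod_cast c_mul_c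
    push_cast
    linear_combination (2 * k * Complex.I) * hcc

/-- In a cell of the same parity at distance 2k from the n-th, the integral over z₂ is that of a
character and vanishes unless k = 0. In the n-th cell the factors c^{-1/2} · c^{-1/2} · c cancel. -/
theorem sssSynth_adjoint_singleBin (n : ℤ) :
    sssSynth n ∘L ContinuousLinearMap.adjoint (sssSynth n) ∘L singleBin n = singleBin n := by
  have hc := c_pos
  ext1 ψ
  rw [ContinuousLinearMap.comp_apply, ContinuousLinearMap.comp_apply, adjoint_sssSynth_singleBin]
  refine Lp.ext ?_
  filter_upwards [coeFn_singleBin n ψ, coeFn_sssSynth n ((memLp_binAmplitude n ψ).toLp _),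
    ae_shift (ae_slice (MemLp.coeFn_toLp (memLp_binAmplitude n ψ)))] with x h1 h2 h3
  rw [h1, h2]
  by_cases hb : (bin x : ZMod 2) = n
  · rw [gkpWave_single_of_eq hb]
    obtain ⟨k, hk⟩ : ∃ k : ℤ, bin x - n = 2 * k := by
      have : ((bin x - n : ℤ) : ZMod 2) = 0 := by push_cast; rw [hb, sub_self]
      exact (ZMod.intCast_zmod_eq_zero_iff_dvd _ 2).1 this
    have hkR : (bin x : ℝ) - n = 2 * k := by exact_mod_cast hk
    have e : ∀ᵐ z : ℝ, Complex.exp (((z * (x + c * bin x) / 2 : ℝ) : ℂ) * Complex.I) *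
        patch.indicator ((memLp_binAmplitude n ψ).toLp _) (x - c * bin x, z) =
        (Set.Ico (-(c / 2)) (c / 2)).indicator (fun z : ℝ => ((√c : ℂ)⁻¹ * ψ (x - c * bin x + c * n)) *
          Complex.exp (((z * (c * (2 * k)) : ℝ) : ℂ) * Complex.I)) z := by
      filter_upwards [h3] with z hz
      by_cases hp : z ∈ Set.Ico (-(c / 2)) (c / 2)
      · have hp' : (x - c * bin x, z) ∈ patch := ⟨sub_bin_mem x, hp⟩
        rw [Set.indicator_of_mem hp, Set.indicator_of_mem hp', hz hp', binAmplitude,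
          show z * (c * (2 * (k : ℝ))) = z * (x + c * bin x) / 2 +
            -(z * (x - c * bin x + 2 * c * n) / 2) by rw [← hkR]; ring]
        rw [Complex.ofReal_add, add_mul, Complex.exp_add]
        ring
      · have hp' : (x - c * bin x, z) ∉ patch := fun h => hp h.2
        rw [Set.indicator_of_notMem hp, Set.indicator_of_notMem hp', mul_zero]
    rw [integral_congr_ae e, integral_indicator measurableSet_Ico, integral_const_mul,
      integral_phase]
    have hs : (√c : ℂ)⁻¹ * (√c : ℂ)⁻¹ * c = 1 := by
      have h0 : (√c : ℂ) ≠ 0 := by exact_mod_cast (Real.sqrt_pos.2 hc).ne'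
      have h5 : (√c : ℂ) * √c = c := by exact_mod_cast Real.mul_self_sqrt hc.le
      rw [← h5]; field_simp
    by_cases hx : bin x = n
    · have hk0 : k = 0 := by rw [hx] at hk; omega
      rw [if_pos hk0, if_pos hx, hx, sub_add_cancel]
      linear_combination (ψ x) * hs
    · have hk0 : k ≠ 0 := by rintro rfl; exact hx (by omega)
      rw [if_neg hk0, if_neg hx, mul_zero, mul_zero]
  · rw [gkpWave_single_of_ne hb, if_neg]
    exact fun h => hb (by rw [show bin x = n from h])

theorem measZ_comp_singleBin (b : ZMod 2) (n : ℤ) :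
    measZ b ∘L singleBin n = if (n : ZMod 2) = b then singleBin n else 0 := by
  classical
  ext1 ψ
  refine Lp.ext ?_
  filter_upwards [coeFn_mulOp (fun x : ℝ => if (bin x : ZMod 2) = b then 1 else 0)
    (Measurable.ite (measurable_bin (MeasurableSet.of_discrete (s := {n : ℤ | (n : ZMod 2) = b})))
      measurable_const measurable_const)
    (fun x => by split_ifs <;> simp) (singleBin n ψ), coeFn_singleBin n ψ,
    Lp.coeFn_zero ℂ 2 (volume : Measure ℝ)] with x h1 h2 h3
  refine h1.trans ?_
  split_ifs with h4 h5 h5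
  · rw [one_mul]
  · rw [zero_apply, h3, h2, if_neg, mul_zero]; · rfl
    rintro rfl; exact h5 h4
  · rw [zero_mul, h2, if_neg]
    rintro rfl; exact h4 h5
  · rw [zero_mul, zero_apply, h3]; rfl

theorem measZ_comp_sssSynth (b μ : ZMod 2) :
    measZ b ∘L sssSynth μ = if b = μ then sssSynth μ else 0 := by
  have hc := c_pos
  rw [measZ_eq, posOp_comp_sssSynth le_rfl]
  congr 1
  have : fstBox (c / 2) = ContinuousLinearMap.id ℂ _ := by
    ext1 g
    rw [ContinuousLinearMap.id_apply, fstBox, indOp_eq_self_iff]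
    rw [ae_restrict_iff' measurableSet_patch]
    have : ∀ᵐ z : ℝ × ℝ, z.1 ≠ -(c / 2) := by
      refine Measure.quasiMeasurePreserving_fst.ae (p := fun y : ℝ => y ≠ -(c / 2)) ?_
      rw [ae_iff]; simp
    filter_upwards [this] with z hz hp h
    exact absurd (abs_lt.2 ⟨lt_of_le_of_ne hp.1.1 (Ne.symm hz), hp.1.2⟩) h
  rw [this, ContinuousLinearMap.comp_id]

theorem adjoint_posOp (b : ZMod 2) (r : ℝ) :
    ContinuousLinearMap.adjoint (posOp b r) = posOp b r :=
  adjoint_indOp (measurable_id (measurableSet_binSet b r))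

/-- Passing to the adjoint turns the hypothesis into the vanishing of a function on every bin, so
convergence of the sum of the bin projections is not needed. -/
theorem eq_zero_of_comp_singleBin {A : L2 ℝ →L[ℂ] L2 ℝ} (h : ∀ n, A ∘L singleBin n = 0) : A = 0 := by
  have h1 : ∀ n ψ, singleBin n (ContinuousLinearMap.adjoint A ψ) = 0 := fun n ψ => by
    have := congr(ContinuousLinearMap.adjoint $(h n) ψ)
    rw [ContinuousLinearMap.adjoint_comp, adjoint_singleBin] at this
    simpa using this
  have h2 : ContinuousLinearMap.adjoint A = 0 := by
    ext1 ψ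
    refine Lp.ext ?_
    have h3 : ∀ᵐ x : ℝ, ∀ n : ℤ, bin x = n → (ContinuousLinearMap.adjoint A ψ) x = 0 := by
      rw [ae_all_iff]
      intro n
      filter_upwards [coeFn_singleBin n (ContinuousLinearMap.adjoint A ψ),
        Lp.coeFn_zero ℂ 2 (volume : Measure ℝ)] with x e1 e2 hx
      have e3 := h1 n ψ
      rw [e3, e2, if_pos hx] at e1
      exact e1.symm
    filter_upwards [h3, Lp.coeFn_zero ℂ 2 (volume : Measure ℝ)] with x e1 e2
    rw [zero_apply, e2, e1 _ rfl]; rfl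
  rw [← ContinuousLinearMap.adjoint_adjoint A, h2, map_zero]

/-- The stabilizer subsystem decomposition is complete. -/
theorem sssSynth_comp_adjoint (μ : ZMod 2) :
    sssSynth μ ∘L ContinuousLinearMap.adjoint (sssSynth μ) = measZ μ := by
  have hadj : ∀ b, ContinuousLinearMap.adjoint (measZ b) = measZ b := fun b => by
    rw [measZ_eq, adjoint_posOp]
  have h0 : ∀ b, ContinuousLinearMap.adjoint (sssSynth μ) ∘L measZ b =
      if b = μ then ContinuousLinearMap.adjoint (sssSynth μ) else 0 := fun b => by
    have := congr(ContinuousLinearMap.adjoint $(measZ_comp_sssSynth b μ))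
    rw [ContinuousLinearMap.adjoint_comp, hadj] at this
    rw [this]
    split_ifs <;> simp
  rw [← sub_eq_zero]
  refine eq_zero_of_comp_singleBin fun n => ?_
  rw [ContinuousLinearMap.sub_comp, measZ_comp_singleBin, ContinuousLinearMap.comp_assoc]
  split_ifs with h
  · subst h
    rw [sssSynth_adjoint_singleBin, sub_self]
  -- A bin of the wrong parity lies in the range of the wrong `measZ`, which the adjoint of the
  -- synthesis map annihilates.
  · have h1 : singleBin n = measZ n ∘L singleBin n := by rw [measZ_comp_singleBin, if_pos rfl]
    rw [h1, ← ContinuousLinearMap.comp_assoc (ContinuousLinearMap.adjoint (sssSynth μ)), h0,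
      if_neg h]
    simp

theorem measZ_add : measZ 0 + measZ 1 = ContinuousLinearMap.id ℂ _ := by
  rw [← sub_eq_zero]
  refine eq_zero_of_comp_singleBin fun n => ?_
  rw [ContinuousLinearMap.sub_comp, ContinuousLinearMap.add_comp, measZ_comp_singleBin,
    measZ_comp_singleBin, ContinuousLinearMap.id_comp]
  rcases (by decide : ∀ b : ZMod 2, b = 0 ∨ b = 1) n with h | h <;> simp [h]

theorem posFilter_comp_sssSynth {r : ℝ} (hr : r ≤ c / 2) (μ : ZMod 2) :
    posFilter r ∘L sssSynth μ = sssSynth μ ∘L fstBox r := by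
  rw [posFilter, ContinuousLinearMap.add_comp, posOp_comp_sssSynth hr, posOp_comp_sssSynth hr]
  rcases (by decide : ∀ b : ZMod 2, b = 0 ∨ b = 1) μ with h | h <;> simp [h]

/-- On each logical value the position filter cuts off z₁ and the momentum filter cuts off z₂;
completeness then removes the synthesis maps. From here on, the syndrome filter is a condition on
the two quadratures. -/
theorem sssFilter_eq {r : ℝ} (h0 : 0 ≤ r) (hr : r ≤ c / 2) :
    sssFilter r = posFilter r ∘L momFilter r := by
  have hbox : (mulOp (fun z : ℝ × ℝ => if |z.1| < r ∧ |z.2| < r then 1 else 0)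
      (Measurable.ite (measurableSet_box r) measurable_const measurable_const)
      (fun z => by split_ifs <;> simp) : Lp ℂ 2 (volume.restrict patch) →L[ℂ] _) =
      fstBox r ∘L sndBox r := by
    classical
    rw [fstBox, sndBox, indOp_comp, indOp]
    refine mulOp_congr _ _ _ _ (.of_forall fun z => ?_)
    simp
  have h : ∀ μ, sssSynth μ ∘L mulOp (fun z : ℝ × ℝ => if |z.1| < r ∧ |z.2| < r then 1 else 0)
      (Measurable.ite (measurableSet_box r) measurable_const measurable_const)
      (fun z => by split_ifs <;> simp) ∘L ContinuousLinearMap.adjoint (sssSynth μ) =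
      posFilter r ∘L momFilter r ∘L measZ μ := by
    intro μ
    rw [← sssSynth_comp_adjoint μ, hbox]
    simp only [← ContinuousLinearMap.comp_assoc]
    rw [← posFilter_comp_sssSynth hr, ContinuousLinearMap.comp_assoc (posFilter r),
      ← momFilter_comp_sssSynth h0 hr, ← ContinuousLinearMap.comp_assoc (posFilter r)]
  rw [sssFilter]
  calc _ = ∑ μ : ZMod 2, posFilter r ∘L momFilter r ∘L measZ μ := Finset.sum_congr rfl fun μ _ => by
        rw [← h]
    _ = posFilter r ∘L momFilter r ∘L (measZ 0 + measZ 1) := by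
        rw [ContinuousLinearMap.comp_add, ContinuousLinearMap.comp_add]
        exact Fin.sum_univ_two _
    _ = _ := by rw [measZ_add, ContinuousLinearMap.comp_id]

theorem adjoint_momOp (b : ZMod 2) (r : ℝ) :
    ContinuousLinearMap.adjoint (momOp b r) = momOp b r := by
  rw [momOp, ContinuousLinearMap.adjoint_comp, ContinuousLinearMap.adjoint_comp, adjoint_posOp,
    ContinuousLinearMap.adjoint_adjoint, ContinuousLinearMap.comp_assoc]

/-- The off-diagonal decoder entries: the logical X shifts the logical value, which reduces them to
completeness. -/
theorem sssSynth_comp_adjoint_add_one (ν : ZMod 2) :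
    sssSynth ν ∘L ContinuousLinearMap.adjoint (sssSynth (ν + 1)) = measZ ν ∘L logicalX := by
  have hX : ContinuousLinearMap.adjoint logicalX = logicalX := by
    rw [logicalX, map_sub, measX_eq, measX_eq, adjoint_momOp, adjoint_momOp]
  rw [← logicalX_comp_sssSynth, ContinuousLinearMap.adjoint_comp, hX,
    ← ContinuousLinearMap.comp_assoc, sssSynth_comp_adjoint]

end Completeness

/-! ### Conditions inherited by generalized linear combinations. -/

section ClosedSpan
variable {E : Type} [NormedAddCommGroup E] [InnerProductSpace ℂ E] [CompleteSpace E]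

/-- The condition is linear in V, and each matrix element ⟨y, A V B x⟩ is continuous in the weak
operator topology, so it survives both the span and the closure. -/
theorem comp_eq_zero_of_mem_closedSpan {S : Set (E →L[ℂ] E)} {A B : E →L[ℂ] E}
    (h : ∀ V ∈ S, A ∘L V ∘L B = 0) {K : E →L[ℂ] E} (hK : K ∈ closedSpan S) : A ∘L K ∘L B = 0 := by
  ext1 x
  refine ext_inner_left ℂ fun y => ?_
  rw [zero_apply, inner_zero_right, ContinuousLinearMap.comp_apply,
    ContinuousLinearMap.comp_apply, ← ContinuousLinearMap.adjoint_inner_left]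
  set y' := ContinuousLinearMap.adjoint A y
  set f : (E →WOT[ℂ] E) → ℂ := fun V => inner ℂ y' (V (B x)) with hf
  have hcont : Continuous f :=
    (ContinuousLinearMapWOT.continuous_iff.1 continuous_id) (B x) y'
  have hsub : closure (ContinuousLinearMapWOT.ofCLM ''
      (Submodule.span ℂ S : Set (E →L[ℂ] E))) ⊆ f ⁻¹' {0} := by
    refine closure_minimal ?_ (isClosed_singleton.preimage hcont)
    rintro _ ⟨V, hV, rfl⟩
    show inner ℂ y' (V (B x)) = 0
    have : A ∘L V ∘L B = 0 := by
      induction hV using Submodule.span_induction with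
      | mem V hV => exact h V hV
      | zero => simp
      | add V W _ _ hV hW =>
        rw [ContinuousLinearMap.add_comp, ContinuousLinearMap.comp_add, hV, hW, add_zero]
      | smul a V _ hV =>
        rw [ContinuousLinearMap.smul_comp, ContinuousLinearMap.comp_smul, hV, smul_zero]
    rw [ContinuousLinearMap.adjoint_inner_left]
    have h2 := congr($this x)
    simp only [ContinuousLinearMap.comp_apply, zero_apply] at h2
    rw [h2, inner_zero_right]
  exact hsub hK

theorem comp_eq_of_mem_closedSpan {S : Set (E →L[ℂ] E)} {P Q : E →L[ℂ] E}
    (h : ∀ V ∈ S, Q ∘L V ∘L P = V ∘L P) {K : E →L[ℂ] E} (hK : K ∈ closedSpan S) :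
    Q ∘L K ∘L P = K ∘L P := by
  have := comp_eq_zero_of_mem_closedSpan (A := Q - ContinuousLinearMap.id ℂ E) (B := P)
    (fun V hV => by rw [ContinuousLinearMap.sub_comp, h V hV]; simp) hK
  rwa [ContinuousLinearMap.sub_comp, ContinuousLinearMap.id_comp, sub_eq_zero] at this

end ClosedSpan

/-! ### Displacements and logical operators acting on bins. -/

section SingleModeNoise

theorem coeFn_displacement (v₁ v₂ : ℝ) (f : L2 ℝ) : displacement v₁ v₂ f =ᵐ[volume]
    fun x => Complex.exp (((v₂ * x - v₁ * v₂ / 2 : ℝ) : ℂ) * Complex.I) * f (x - v₁) := by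
  filter_upwards [coeFn_mulOp (fun x : ℝ =>
    Complex.exp (((v₂ * x - v₁ * v₂ / 2 : ℝ) : ℂ) * Complex.I)) (by fun_prop)
    (fun x => (Complex.norm_exp_ofReal_mul_I _).le) (translation v₁ f),
    coeFn_translation v₁ f] with x h1 h2
  rw [← h2]
  exact h1

theorem displacement_comp_phaseOp (v₁ v₂ : ℝ) :
    displacement v₁ v₂ ∘L phaseOp (fun x => c * id x) (by fun_prop) =
      phaseOp (fun x => c * (x - v₁)) (by fun_prop) ∘L displacement v₁ v₂ := by
  ext1 f
  refine Lp.ext ?_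
  rw [ContinuousLinearMap.comp_apply, ContinuousLinearMap.comp_apply]
  filter_upwards [coeFn_displacement v₁ v₂ (phaseOp (fun x => c * id x) (by fun_prop) f),
    coeFn_displacement v₁ v₂ f, (measurePreserving_sub_right volume v₁).quasiMeasurePreserving.ae
      (coeFn_phaseOp (fun x => c * id x) (by fun_prop) f),
    coeFn_phaseOp (fun x => c * (x - v₁)) (by fun_prop) (displacement v₁ v₂ f)] with x h1 h2 h3 h4
  rw [h1, h3, h4, h2, mul_left_comm]
  rfl

/-- The Weyl relation. The scalar e^{ic v₂} is the momentum shift by v₂ as seen by the translation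
by c. -/
theorem displacement_comp_translation (v₁ v₂ : ℝ) :
    displacement v₁ v₂ ∘L translation c =
      Complex.exp (((c * v₂ : ℝ) : ℂ) * Complex.I) • (translation c ∘L displacement v₁ v₂) := by
  ext1 f
  refine Lp.ext ?_
  rw [smul_apply, ContinuousLinearMap.comp_apply, ContinuousLinearMap.comp_apply]
  filter_upwards [coeFn_displacement v₁ v₂ (translation c f),
    (measurePreserving_sub_right volume c).quasiMeasurePreserving.ae (coeFn_displacement v₁ v₂ f),
    (measurePreserving_sub_right volume v₁).quasiMeasurePreserving.ae (coeFn_translation c f),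
    coeFn_translation c (displacement v₁ v₂ f), Lp.coeFn_smul
    (Complex.exp (((c * v₂ : ℝ) : ℂ) * Complex.I)) (translation c (displacement v₁ v₂ f))]
    with x h1 h2 h3 h4 h5
  rw [h1, h3, h5, Pi.smul_apply, h4, h2, smul_eq_mul, ← mul_assoc, ← Complex.exp_add,
    sub_right_comm]
  congr 2
  push_cast
  ring

theorem adjoint_fourierGate_comp_phaseOp (a : ℝ) :
    ContinuousLinearMap.adjoint fourierGate ∘L phaseOp (fun x => a * x) (by fun_prop) =
      translation a ∘L ContinuousLinearMap.adjoint fourierGate := by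
  calc _ = ContinuousLinearMap.adjoint fourierGate ∘L
        (phaseOp (fun x => a * x) (by fun_prop) ∘L fourierGate) ∘L
        ContinuousLinearMap.adjoint fourierGate := by
        rw [ContinuousLinearMap.comp_assoc, fourierGate_comp_adjoint, ContinuousLinearMap.comp_id]
    _ = (ContinuousLinearMap.adjoint fourierGate ∘L fourierGate) ∘L
        translation a ∘L ContinuousLinearMap.adjoint fourierGate := by
        rw [← fourierGate_comp_translation]; rfl
    _ = _ := by rw [adjoint_comp_fourierGate, ContinuousLinearMap.id_comp]

theorem phaseOp_add_const {X : Type} [MeasurableSpace X] {μ : Measure X} {α : X → ℝ}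
    (hα : Measurable α) (a : ℝ) :
    (phaseOp (fun x => α x + a) (by fun_prop) : Lp ℂ 2 μ →L[ℂ] Lp ℂ 2 μ) =
      Complex.exp (a * Complex.I) • phaseOp α hα := by
  ext1 f
  refine Lp.ext ?_
  filter_upwards [coeFn_phaseOp (fun x => α x + a) (by fun_prop) f, coeFn_phaseOp α hα f,
    Lp.coeFn_smul (Complex.exp (a * Complex.I)) (phaseOp α hα f)] with x h1 h2 h3
  rw [smul_apply, h1, h3, Pi.smul_apply, h2]
  push_cast
  rw [add_mul, Complex.exp_add, smul_eq_mul]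
  ring

/-- The momentum-space version of `A`. -/
def toMom (A : L2 ℝ →L[ℂ] L2 ℝ) : L2 ℝ →L[ℂ] L2 ℝ :=
  ContinuousLinearMap.adjoint fourierGate ∘L A ∘L fourierGate

theorem fourierGate_adjoint_apply (f : L2 ℝ) :
    fourierGate (ContinuousLinearMap.adjoint fourierGate f) = f :=
  congr($fourierGate_comp_adjoint f)

theorem adjoint_fourierGate_apply (f : L2 ℝ) :
    ContinuousLinearMap.adjoint fourierGate (fourierGate f) = f :=
  congr($adjoint_comp_fourierGate f)

theorem toMom_comp_phaseOp (A : L2 ℝ →L[ℂ] L2 ℝ) :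
    toMom A ∘L phaseOp (fun x => -(c * id x)) (by fun_prop) = ContinuousLinearMap.adjoint fourierGate ∘L
      (A ∘L translation c) ∘L fourierGate := by
  have := translation_comp_fourierGate c
  rw [ContinuousLinearMap.comp_assoc A, this]
  rfl

theorem phaseOp_comp_toMom (A : L2 ℝ →L[ℂ] L2 ℝ) :
    phaseOp (fun x => -(c * id x)) (by fun_prop) ∘L toMom A = ContinuousLinearMap.adjoint fourierGate ∘L
      (translation c ∘L A) ∘L fourierGate := by
  have := adjoint_fourierGate_translation c
  calc _ = (phaseOp (fun x => -(c * x)) (by fun_prop) ∘L ContinuousLinearMap.adjoint fourierGate) ∘L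
        A ∘L fourierGate := rfl
    _ = _ := by rw [← this]; rfl

theorem posOp_mono (b : ZMod 2) {r r' : ℝ} (h : r ≤ r') : posOp b r' ∘L posOp b r = posOp b r := by
  rw [posOp, posOp, binOp, binOp, indOp_comp]
  refine indOp_congr _ _ (.of_forall fun x => ?_)
  exact ⟨fun hx => hx.2, fun hx => ⟨binSet_mono b h hx, hx⟩⟩

theorem posOp_disjoint {b b' : ZMod 2} (hb : b ≠ b') {r r' : ℝ} (h : r + r' ≤ c) :
    posOp b r ∘L posOp b' r' = 0 := by
  rw [posOp, posOp, binOp, binOp, indOp_comp, ← indOp_empty]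
  refine indOp_congr _ _ (.of_forall fun x => ?_)
  have : x ∉ binSet b r ∩ binSet b' r' := by rw [binSet_disjoint hb h]; exact id
  exact ⟨fun hx => this hx, fun hx => hx.elim⟩

theorem momOp_comp_momOp (b b' : ZMod 2) (r r' : ℝ) : momOp b r ∘L momOp b' r' =
    fourierGate ∘L (posOp b r ∘L posOp b' r') ∘L ContinuousLinearMap.adjoint fourierGate := by
  ext1 f
  simp [momOp, adjoint_fourierGate_apply]

theorem momOp_mono (b : ZMod 2) {r r' : ℝ} (h : r ≤ r') : momOp b r' ∘L momOp b r = momOp b r := by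
  rw [momOp_comp_momOp, posOp_mono b h, momOp]

theorem momOp_disjoint {b b' : ZMod 2} (hb : b ≠ b') {r r' : ℝ} (h : r + r' ≤ c) :
    momOp b r ∘L momOp b' r' = 0 := by
  rw [momOp_comp_momOp, posOp_disjoint hb h]; simp

theorem posOp_comp_binOp_sub (b : ZMod 2) {r s v : ℝ} (hv : |v| ≤ s) :
    posOp b (r + s) ∘L binOp (fun x => x - v) (by fun_prop) b r =
      binOp (fun x => x - v) (by fun_prop) b r := by
  rw [posOp, binOp, binOp, indOp_comp]
  refine indOp_congr _ _ (.of_forall fun x => ?_)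
  refine ⟨fun hx => hx.2, fun hx => ⟨?_, hx⟩⟩
  have := add_mem_binSet_of_abs_le (show x - v ∈ binSet b r from hx) hv
  rwa [sub_add_cancel] at this

/-- A displacement intertwines q with q - v₁, so a bin is moved by v₁; if |v₁| ≤ s it stays inside
the bin of the same parity and radius r + s. -/
theorem posOp_comp_displacement (b : ZMod 2) {r s v₁ v₂ : ℝ} (h0 : 0 ≤ r) (hr : r ≤ c)
    (hv : |v₁| ≤ s) : posOp b (r + s) ∘L displacement v₁ v₂ ∘L posOp b r =
      displacement v₁ v₂ ∘L posOp b r := by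
  have h := intertwine_binOp (φ := id) (φ' := fun x => x - v₁) measurable_id (by fun_prop)
    (displacement_comp_phaseOp v₁ v₂) b h0 hr
  rw [posOp, posOp, h, ← ContinuousLinearMap.comp_assoc]
  exact congr($(posOp_comp_binOp_sub b hv) ∘L displacement v₁ v₂)

theorem momOp_comp_of_toMom {A : L2 ℝ →L[ℂ] L2 ℝ} {b b' : ZMod 2} {r r' : ℝ}
    (h : posOp b' r' ∘L toMom A ∘L posOp b r = toMom A ∘L posOp b r) :
    momOp b' r' ∘L A ∘L momOp b r = A ∘L momOp b r := by
  ext1 f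
  have h2 := congr(fourierGate ($h (ContinuousLinearMap.adjoint fourierGate f)))
  simpa [toMom, momOp, fourierGate_adjoint_apply] using h2

/-- By the Weyl relation the displacement intertwines e^{-icp} with e^{-ic(p - v₂)}; the rest is as
for positions. -/
theorem momOp_comp_displacement (b : ZMod 2) {r s v₁ v₂ : ℝ} (h0 : 0 ≤ r) (hr : r ≤ c)
    (hv : |v₂| ≤ s) : momOp b (r + s) ∘L displacement v₁ v₂ ∘L momOp b r =
      displacement v₁ v₂ ∘L momOp b r := by
  refine momOp_comp_of_toMom ?_
  have hU : toMom (displacement v₁ v₂) ∘L phaseOp (fun x => -(c * id x)) (by fun_prop) =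
      phaseOp (fun x => -(c * (x - v₂))) (by fun_prop) ∘L toMom (displacement v₁ v₂) := by
    have e : (phaseOp (fun x => -(c * (x - v₂))) (by fun_prop) : L2 ℝ →L[ℂ] L2 ℝ) =
        Complex.exp (((c * v₂ : ℝ) : ℂ) * Complex.I) •
          phaseOp (fun x => -(c * id x)) (by fun_prop) := by
      rw [← phaseOp_add_const]
      exact phaseOp_congr _ _ (by funext x; simp only [id]; ring)
    rw [e, ContinuousLinearMap.smul_comp, phaseOp_comp_toMom, toMom_comp_phaseOp,
      displacement_comp_translation]
    simp only [ContinuousLinearMap.smul_comp, ContinuousLinearMap.comp_smul]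
  have h := intertwine_binOp_of_neg (φ := id) (φ' := fun x => x - v₂) measurable_id (by fun_prop)
    hU b h0 hr
  rw [posOp, posOp, h, ← ContinuousLinearMap.comp_assoc]
  exact congr($(posOp_comp_binOp_sub b hv) ∘L toMom (displacement v₁ v₂))

theorem abs_le_of_mem_smallDisp {s : ℝ} {V : L2 ℝ →L[ℂ] L2 ℝ} (h : V ∈ smallDisp s) :
    ∃ z₁ z₂, |z₁| ≤ s ∧ |z₂| ≤ s ∧ V = displacement z₁ z₂ := by
  obtain ⟨z₁, h1, z₂, h2, rfl⟩ := h
  exact ⟨z₁, z₂, abs_le.2 h1, abs_le.2 h2, rfl⟩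

theorem measZ_comp_translation (b : ZMod 2) :
    measZ b ∘L translation c = translation c ∘L measZ (b + 1) := by
  classical
  have hm : ∀ (d : ZMod 2) (f : L2 ℝ), measZ d f =ᵐ[volume]
      fun x => (if (bin x : ZMod 2) = d then 1 else 0) * f x := fun d f => coeFn_mulOp _ _ _ f
  ext1 f
  refine Lp.ext ?_
  rw [ContinuousLinearMap.comp_apply, ContinuousLinearMap.comp_apply]
  filter_upwards [hm b (translation c f), coeFn_translation c f,
    coeFn_translation c (measZ (b + 1) f),
    (measurePreserving_sub_right volume c).quasiMeasurePreserving.ae (hm (b + 1) f)]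
    with x h1 h2 h3 h4
  have hbin : bin (x - c) = bin x - 1 := by simpa using bin_sub_mul x 1
  rw [h1, h2, h3, h4, hbin]
  have : ((bin x - 1 : ℤ) : ZMod 2) = b + 1 ↔ (bin x : ZMod 2) = b := by
    push_cast
    exact (by decide : ∀ t b : ZMod 2, t - 1 = b + 1 ↔ t = b) _ _
  simp only [this]

theorem logicalZ_comp_translation :
    logicalZ ∘L translation c = -(translation c ∘L logicalZ) := by
  rw [logicalZ, ContinuousLinearMap.sub_comp, measZ_comp_translation, measZ_comp_translation,
    ContinuousLinearMap.comp_sub, zero_add, show (1 + 1 : ZMod 2) = 0 from rfl, neg_sub]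

theorem logicalX_eq : logicalX = fourierGate ∘L logicalZ ∘L ContinuousLinearMap.adjoint fourierGate := by
  rw [logicalX, measX, measX, logicalZ, ContinuousLinearMap.sub_comp, ContinuousLinearMap.comp_sub]

theorem phaseOp_shift : (phaseOp (fun x : ℝ => -(c * (id x + c * ((1 : ZMod 2).val : ℝ)))) (by fun_prop) :
    L2 ℝ →L[ℂ] L2 ℝ) = -phaseOp (fun x => -(c * id x)) (by fun_prop) := by
  have h := phaseOp_add_const (μ := (volume : Measure ℝ)) (α := fun x : ℝ => -(c * id x))
    (by fun_prop) (-Real.pi)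
  rw [Complex.ofReal_neg, neg_mul, Complex.exp_neg, Complex.exp_pi_mul_I, inv_neg, inv_one,
    neg_smul, one_smul] at h
  rw [← h]
  refine phaseOp_congr _ _ ?_
  funext x
  have hv : ((1 : ZMod 2).val : ℝ) = 1 := by simp [ZMod.val_one]
  rw [hv, ← c_mul_c]
  ring

/-- The logical Z is a square wave in position that changes sign under translation by c. It
therefore exchanges the parities of the momentum bins, and does so without enlarging the radius. -/
theorem logicalZ_comp_momOp (b : ZMod 2) {r : ℝ} (h0 : 0 ≤ r) (hr : r ≤ c) :
    logicalZ ∘L momOp b r = momOp (b + 1) r ∘L logicalZ := by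
  have hU : toMom logicalZ ∘L phaseOp (fun x => -(c * id x)) (by fun_prop) =
      phaseOp (fun x : ℝ => -(c * (id x + c * ((1 : ZMod 2).val : ℝ)))) (by fun_prop) ∘L
        toMom logicalZ := by
    rw [phaseOp_shift, ContinuousLinearMap.neg_comp, phaseOp_comp_toMom, toMom_comp_phaseOp,
      logicalZ_comp_translation]
    simp only [ContinuousLinearMap.neg_comp, ContinuousLinearMap.comp_neg]
  have h := intertwine_binOp_add_of_neg 1 (φ := id) (φ' := id) measurable_id measurable_id
    hU b h0 hr
  ext1 f
  have h2 := congr(fourierGate ($h (ContinuousLinearMap.adjoint fourierGate f)))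
  simp only [toMom, ContinuousLinearMap.comp_apply, fourierGate_adjoint_apply] at h2
  exact h2

/-- The mirror image: the logical X anticommutes with the phase e^{icq}. -/
theorem logicalX_comp_posOp (b : ZMod 2) {r : ℝ} (h0 : 0 ≤ r) (hr : r ≤ c) :
    logicalX ∘L posOp b r = posOp (b + 1) r ∘L logicalX := by
  have hU : logicalX ∘L phaseOp (fun x => -(c * id x)) (by fun_prop) =
      phaseOp (fun x : ℝ => -(c * (id x + c * ((1 : ZMod 2).val : ℝ)))) (by fun_prop) ∘L
        logicalX := by
    rw [phaseOp_shift]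
    have h1 : logicalX ∘L phaseOp (fun x => c * x) (by fun_prop) =
        -(phaseOp (fun x => c * x) (by fun_prop) ∘L logicalX) := by
      rw [logicalX_eq, ContinuousLinearMap.comp_assoc, ContinuousLinearMap.comp_assoc,
        adjoint_fourierGate_comp_phaseOp, ← ContinuousLinearMap.comp_assoc logicalZ,
        logicalZ_comp_translation, ← ContinuousLinearMap.comp_assoc (phaseOp _ _),
        ← fourierGate_comp_translation, ContinuousLinearMap.neg_comp, ContinuousLinearMap.comp_neg]
      rfl
    ext1 f
    -- The anticommutation with e^{icq} is multiplied by the inverse phase on both sides, which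
    -- yields the one with e^{-icq}.
    have h2 := congr(phaseOp (-fun x => c * x) (by fun_prop)
      ($h1 (phaseOp (-fun x => c * x) (by fun_prop) f)))
    have e1 : ∀ g : L2 ℝ, phaseOp (-fun x => c * x) (by fun_prop)
        (phaseOp (fun x => c * x) (by fun_prop) g) = g :=
      fun g => congr($(phaseOp_inverse' (by fun_prop)) g)
    have e2 : ∀ g : L2 ℝ, phaseOp (fun x => c * x) (by fun_prop)
        (phaseOp (-fun x => c * x) (by fun_prop) g) = g :=
      fun g => congr($(phaseOp_inverse (by fun_prop)) g)
    simp only [ContinuousLinearMap.comp_apply, neg_apply, map_neg, e1, e2] at h2 ⊢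
    rw [eq_neg_iff_add_eq_zero, ← eq_neg_iff_add_eq_zero.1 h2.symm.symm, add_comm]
    rfl
  exact intertwine_binOp_add_of_neg 1 (φ := id) (φ' := id) measurable_id measurable_id
    hU b h0 hr

end SingleModeNoise

/-! ### Abstract binned observables: how radii and parities propagate. -/

section Binned
variable {E F : Type} [NormedAddCommGroup E] [InnerProductSpace ℂ E]
  [NormedAddCommGroup F] [InnerProductSpace ℂ F]

/-- The projections `P b r` onto the values within `r` of the multiples of `c` of parity `b`
of an observable. -/
structure IsBinned (P : ZMod 2 → ℝ → E →L[ℂ] E) : Prop where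
  mono : ∀ (b : ZMod 2) {r r' : ℝ}, r ≤ r' → P b r' ∘L P b r = P b r
  disjoint : ∀ {b b' : ZMod 2}, b ≠ b' → ∀ {r r' : ℝ}, r + r' ≤ c → P b r ∘L P b' r' = 0

/-- The sign `(-1) ^ b` of the parity of the bin. -/
def signOp (P : ZMod 2 → ℝ → E →L[ℂ] E) : E →L[ℂ] E := P 0 (c / 2) - P 1 (c / 2)

/-- The projection onto the values within `r` of a multiple of `c`. -/
def filterOp (P : ZMod 2 → ℝ → E →L[ℂ] E) (r : ℝ) : E →L[ℂ] E := P 0 r + P 1 r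

/-- The vectors supported within `r` of the multiples of `c`. -/
def supported (P : ZMod 2 → ℝ → E →L[ℂ] E) (r : ℝ) : Submodule ℂ E where
  carrier := {v | filterOp P r v = v}
  add_mem' {v w} hv hw := by
    rw [Set.mem_ofPred_eq] at hv hw ⊢
    rw [map_add, hv, hw]
  zero_mem' := by simp
  smul_mem' a v hv := by
    rw [Set.mem_ofPred_eq] at hv ⊢
    rw [map_smul, hv]

theorem mem_supported {P : ZMod 2 → ℝ → E →L[ℂ] E} {r : ℝ} {v : E} :
    v ∈ supported P r ↔ P 0 r v + P 1 r v = v := Iff.rfl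

theorem mem_supported_of_commute {P : ZMod 2 → ℝ → E →L[ℂ] E} {r : ℝ} {A : E →L[ℂ] E}
    (h : A ∘L filterOp P r = filterOp P r ∘L A) {v : E} (hv : v ∈ supported P r) :
    A v ∈ supported P r := by
  have h1 := congr($h v)
  simp only [ContinuousLinearMap.comp_apply] at h1
  show filterOp P r (A v) = A v
  rw [← h1, show filterOp P r v = v from hv]

variable {P : ZMod 2 → ℝ → E →L[ℂ] E} {Q : ZMod 2 → ℝ → F →L[ℂ] F}

namespace IsBinned

theorem apply_of_ne (hP : IsBinned P) {b b' : ZMod 2} (hb : b ≠ b') {r r' : ℝ} (hr : r + r' ≤ c)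
    {v : E} (hv : P b' r' v = v) : P b r v = 0 := by
  rw [← hv]; exact congr($(hP.disjoint hb hr) v)

theorem apply_mono (hP : IsBinned P) {b : ZMod 2} {r r' : ℝ} (h : r ≤ r') {v : E}
    (hv : P b r v = v) : P b r' v = v := by
  nth_rewrite 1 [← hv]
  exact congr($(hP.mono b h) v) |>.trans hv

theorem apply_apply (hP : IsBinned P) (b : ZMod 2) (r : ℝ) (v : E) : P b r (P b r v) = P b r v :=
  congr($(hP.mono b le_rfl) v)

theorem mem_supported_of_apply (hP : IsBinned P) {b : ZMod 2} {r : ℝ} (hr : r ≤ c / 2) {v : E}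
    (hv : P b r v = v) : v ∈ supported P r := by
  rw [mem_supported]
  rcases (by decide : ∀ b : ZMod 2, b = 0 ∨ b = 1) b with rfl | rfl
  · rw [hv, hP.apply_of_ne one_ne_zero (by linarith) hv, add_zero]
  · rw [hv, hP.apply_of_ne zero_ne_one (by linarith) hv, zero_add]

theorem signOp_of_apply (hP : IsBinned P) {b : ZMod 2} {r : ℝ} (hr : r ≤ c / 2) {v : E}
    (hv : P b r v = v) : signOp P v = (sgn b : ℂ) • v := by
  have h := hP.apply_mono hr hv
  rw [signOp, sub_apply]
  rcases (by decide : ∀ b : ZMod 2, b = 0 ∨ b = 1) b with rfl | rfl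
  · rw [h, hP.apply_of_ne one_ne_zero (by linarith) h, sgn_zero]; simp
  · rw [h, hP.apply_of_ne zero_ne_one (by linarith) h, sgn_one]; simp

theorem supported_mono (hP : IsBinned P) {r r' : ℝ} (h : r ≤ r') (hr : r' ≤ c / 2) :
    supported P r ≤ supported P r' := by
  intro v hv
  rw [← mem_supported.1 hv]
  exact add_mem
    (hP.mem_supported_of_apply hr (hP.apply_mono h (hP.apply_apply 0 r v)))
    (hP.mem_supported_of_apply hr (hP.apply_mono h (hP.apply_apply 1 r v)))

end IsBinned

/-- `W` maps values within `r` of a multiple of `c` to values within `r'` of the same multiple. -/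
def Carries (W : E →L[ℂ] F) (P : ZMod 2 → ℝ → E →L[ℂ] E) (Q : ZMod 2 → ℝ → F →L[ℂ] F)
    (r r' : ℝ) : Prop :=
  ∀ b, Q b r' ∘L W ∘L P b r = W ∘L P b r

/-- The two parity components of v keep their parity under W. As the radii are at most c/2, the sign
operator is the scalar (-1)^b on each component, before and after. -/
theorem Carries.map_supported {W : E →L[ℂ] F} {r r' : ℝ} (h : Carries W P Q r r')
    (hP : IsBinned P) (hQ : IsBinned Q) (hr : r ≤ c / 2) (hr' : r' ≤ c / 2) {v : E}
    (hv : v ∈ supported P r) :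
    W v ∈ supported Q r' ∧ signOp Q (W v) = W (signOp P v) := by
  have h1 : ∀ b, Q b r' (W (P b r v)) = W (P b r v) := fun b => congr($(h b) v)
  rw [← mem_supported.1 hv]
  simp only [map_add]
  refine ⟨add_mem (hQ.mem_supported_of_apply hr' (h1 0)) (hQ.mem_supported_of_apply hr' (h1 1)), ?_⟩
  rw [hQ.signOp_of_apply hr' (h1 0), hQ.signOp_of_apply hr' (h1 1),
    hP.signOp_of_apply hr (hP.apply_apply 0 r v), hP.signOp_of_apply hr (hP.apply_apply 1 r v),
    map_smul, map_smul]

/-- `W` maps values within `r₁` and `r₂` of two multiples of `c` to values within `r'` of a multiple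
whose parity is the sum of the parities. -/
def CarriesSum (W : E →L[ℂ] F) (P₁ P₂ : ZMod 2 → ℝ → E →L[ℂ] E) (Q : ZMod 2 → ℝ → F →L[ℂ] F)
    (r₁ r₂ r' : ℝ) : Prop :=
  ∀ b₁ b₂, Q (b₁ + b₂) r' ∘L W ∘L P₁ b₁ r₁ ∘L P₂ b₂ r₂ = W ∘L P₁ b₁ r₁ ∘L P₂ b₂ r₂

theorem sgn_add (a b : ZMod 2) : sgn (a + b) = sgn a * sgn b := by
  rcases (by decide : ∀ b : ZMod 2, b = 0 ∨ b = 1) a with rfl | rfl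
  · rw [zero_add, sgn_zero, one_mul]
  · rcases (by decide : ∀ b : ZMod 2, b = 0 ∨ b = 1) b with rfl | rfl
    · rw [add_zero, sgn_zero, mul_one]
    · rw [show (1 + 1 : ZMod 2) = 0 from rfl, sgn_zero, sgn_one]; norm_num

/-- Since the projections commute, v splits into four pieces with definite pairs of parities; on
each piece the output sign is the product of the two input signs. -/
theorem CarriesSum.map_supported {P₁ P₂ : ZMod 2 → ℝ → E →L[ℂ] E} {W : E →L[ℂ] F} {r₁ r₂ r' : ℝ}
    (h : CarriesSum W P₁ P₂ Q r₁ r₂ r')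
    (h₁ : IsBinned P₁) (h₂ : IsBinned P₂) (hQ : IsBinned Q) (hr₁ : r₁ ≤ c / 2) (hr₂ : r₂ ≤ c / 2)
    (hr' : r' ≤ c / 2) (hcomm : ∀ b₁ b₂, P₁ b₁ r₁ ∘L P₂ b₂ r₂ = P₂ b₂ r₂ ∘L P₁ b₁ r₁) {v : E}
    (hv₁ : v ∈ supported P₁ r₁) (hv₂ : v ∈ supported P₂ r₂) :
    W v ∈ supported Q r' ∧ signOp Q (W v) = W (signOp P₁ (signOp P₂ v)) := by
  have e : ∀ b₁ b₂, Q (b₁ + b₂) r' (W (P₁ b₁ r₁ (P₂ b₂ r₂ v))) = W (P₁ b₁ r₁ (P₂ b₂ r₂ v)) :=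
    fun b₁ b₂ => congr($(h b₁ b₂) v)
  have e₁ : ∀ b₁ b₂, signOp P₁ (P₁ b₁ r₁ (P₂ b₂ r₂ v)) = (sgn b₁ : ℂ) • P₁ b₁ r₁ (P₂ b₂ r₂ v) :=
    fun b₁ b₂ => h₁.signOp_of_apply hr₁ (h₁.apply_apply _ _ _)
  have hd : ∀ b₂, P₁ 0 r₁ (P₂ b₂ r₂ v) + P₁ 1 r₁ (P₂ b₂ r₂ v) = P₂ b₂ r₂ v := fun b₂ => by
    have c0 : P₁ 0 r₁ (P₂ b₂ r₂ v) = P₂ b₂ r₂ (P₁ 0 r₁ v) := congr($(hcomm 0 b₂) v)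
    have c1 : P₁ 1 r₁ (P₂ b₂ r₂ v) = P₂ b₂ r₂ (P₁ 1 r₁ v) := congr($(hcomm 1 b₂) v)
    rw [c0, c1, ← map_add, mem_supported.1 hv₁]
  have hv : v = (P₁ 0 r₁ (P₂ 0 r₂ v) + P₁ 1 r₁ (P₂ 0 r₂ v)) +
      (P₁ 0 r₁ (P₂ 1 r₂ v) + P₁ 1 r₁ (P₂ 1 r₂ v)) := by
    rw [hd, hd, mem_supported.1 hv₂]
  have hs : signOp P₁ (signOp P₂ v) =
      (P₁ 0 r₁ (P₂ 0 r₂ v) - P₁ 1 r₁ (P₂ 0 r₂ v)) -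
      (P₁ 0 r₁ (P₂ 1 r₂ v) - P₁ 1 r₁ (P₂ 1 r₂ v)) := by
    have e2 : signOp P₂ v = P₂ 0 r₂ v - P₂ 1 r₂ v := by
      nth_rewrite 1 [← mem_supported.1 hv₂]
      rw [map_add, h₂.signOp_of_apply hr₂ (h₂.apply_apply 0 _ _),
        h₂.signOp_of_apply hr₂ (h₂.apply_apply 1 _ _), sgn_zero, sgn_one]
      push_cast
      module
    have e3 : ∀ b₂, signOp P₁ (P₂ b₂ r₂ v) = P₁ 0 r₁ (P₂ b₂ r₂ v) - P₁ 1 r₁ (P₂ b₂ r₂ v) := by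
      intro b₂
      have : signOp P₁ (P₁ 0 r₁ (P₂ b₂ r₂ v) + P₁ 1 r₁ (P₂ b₂ r₂ v)) =
          P₁ 0 r₁ (P₂ b₂ r₂ v) - P₁ 1 r₁ (P₂ b₂ r₂ v) := by
        rw [map_add, e₁, e₁, sgn_zero, sgn_one]
        push_cast
        module
      rwa [hd] at this
    rw [e2, map_sub, e3, e3]
  constructor
  · rw [show W v = W _ from congrArg W hv]
    simp only [map_add]
    refine add_mem (add_mem ?_ ?_) (add_mem ?_ ?_) <;>
      exact hQ.mem_supported_of_apply hr' (e _ _)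
  · rw [hs, show W v = W _ from congrArg W hv]
    simp only [map_add, map_sub]
    rw [hQ.signOp_of_apply hr' (e 0 0), hQ.signOp_of_apply hr' (e 0 1),
      hQ.signOp_of_apply hr' (e 1 0), hQ.signOp_of_apply hr' (e 1 1)]
    simp only [sgn_add, sgn_zero, sgn_one]
    push_cast
    module

end Binned

/-! ### The SUM gate on positions and momenta. -/

section SumGate

theorem coeFn_sumGate (f : L2 (ℝ × ℝ)) :
    sumGate f =ᵐ[volume] fun z => f (z.1, -z.1 + z.2) :=
  Lp.coeFn_compMeasurePreserving f (measurePreserving_prod_neg_add volume volume)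

theorem sumGate_comp_phaseOp {φ φ' : ℝ × ℝ → ℝ} (hφ : Measurable φ) (hφ' : Measurable φ')
    (h : ∀ z, φ (z.1, -z.1 + z.2) = φ' z) :
    sumGate ∘L phaseOp φ hφ = phaseOp φ' hφ' ∘L sumGate := by
  ext1 f
  refine Lp.ext ?_
  rw [ContinuousLinearMap.comp_apply, ContinuousLinearMap.comp_apply]
  filter_upwards [coeFn_sumGate (phaseOp φ hφ f),
    (measurePreserving_prod_neg_add volume volume).quasiMeasurePreserving.ae (coeFn_phaseOp φ hφ f),
    coeFn_phaseOp φ' hφ' (sumGate f), coeFn_sumGate f] with z h1 h2 h3 h4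
  rw [h1, h3, h4, h2, h]

theorem opTensor_translation (a d : ℝ) (f : L2 (ℝ × ℝ)) :
    opTensor (translation a) (translation d) f =ᵐ[volume] fun z => f (z.1 - a, z.2 - d) := by
  have mp : MeasurePreserving (fun z : ℝ × ℝ => (z.1 - a, z.2 - d)) volume volume :=
    (measurePreserving_sub_right volume a).prod (measurePreserving_sub_right volume d)
  have h : opTensor (translation a) (translation d) =
      (Lp.compMeasurePreservingₗᵢ ℂ _ mp).toContinuousLinearMap := by
    refine ext_tmul fun f g => Lp.ext ?_
    rw [opTensor_tmul]
    have h0 : (Lp.compMeasurePreservingₗᵢ ℂ _ mp).toContinuousLinearMap (tmul f g) =ᵐ[volume]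
        fun z => tmul f g (z.1 - a, z.2 - d) := Lp.coeFn_compMeasurePreserving _ mp
    filter_upwards [h0, coeFn_tmul (translation a f) (translation d g),
      mp.quasiMeasurePreserving.ae (coeFn_tmul f g),
      Measure.quasiMeasurePreserving_fst.ae (coeFn_translation a f),
      Measure.quasiMeasurePreserving_snd.ae (coeFn_translation d g)] with z h1 h2 h3 h4 h5
    rw [h1, h2, h3, h4, h5]
  rw [h]
  exact Lp.coeFn_compMeasurePreserving f mp

theorem sumGate_comp_translation (a d : ℝ) :
    sumGate ∘L opTensor (translation a) (translation d) =
      opTensor (translation a) (translation (a + d)) ∘L sumGate := by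
  ext1 f
  refine Lp.ext ?_
  rw [ContinuousLinearMap.comp_apply, ContinuousLinearMap.comp_apply]
  have mp : MeasurePreserving (fun z : ℝ × ℝ => (z.1 - a, z.2 - (a + d))) volume volume :=
    (measurePreserving_sub_right volume a).prod (measurePreserving_sub_right volume (a + d))
  filter_upwards [coeFn_sumGate (opTensor (translation a) (translation d) f),
    (measurePreserving_prod_neg_add volume volume).quasiMeasurePreserving.ae
      (opTensor_translation a d f), opTensor_translation a (a + d) (sumGate f),
    mp.quasiMeasurePreserving.ae (coeFn_sumGate f)] with z h1 h2 h3 h4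
  rw [h1, h2, h3, h4]
  congr 2
  ring

theorem opTensor_posOp_left (b : ZMod 2) (r : ℝ) :
    opTensor (posOp b r) (ContinuousLinearMap.id ℂ (L2 ℝ)) =
      binOp (Prod.fst : ℝ × ℝ → ℝ) measurable_fst b r :=
  opTensor_indOp_left (measurable_id (measurableSet_binSet b r))

theorem opTensor_posOp_right (b : ZMod 2) (r : ℝ) :
    opTensor (ContinuousLinearMap.id ℂ (L2 ℝ)) (posOp b r) =
      binOp (Prod.snd : ℝ × ℝ → ℝ) measurable_snd b r :=
  opTensor_indOp_right (measurable_id (measurableSet_binSet b r))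

/-- The projections of a binned observable of the first of two modes. -/
def left₂ (P : ZMod 2 → ℝ → L2 ℝ →L[ℂ] L2 ℝ) (b : ZMod 2) (r : ℝ) :
    L2 (ℝ × ℝ) →L[ℂ] L2 (ℝ × ℝ) := opTensor (P b r) (ContinuousLinearMap.id ℂ (L2 ℝ))

/-- The projections of a binned observable of the second of two modes. -/
def right₂ (P : ZMod 2 → ℝ → L2 ℝ →L[ℂ] L2 ℝ) (b : ZMod 2) (r : ℝ) :
    L2 (ℝ × ℝ) →L[ℂ] L2 (ℝ × ℝ) := opTensor (ContinuousLinearMap.id ℂ (L2 ℝ)) (P b r)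

theorem sumGate_comp_left_posOp (b : ZMod 2) {r : ℝ} (h0 : 0 ≤ r) (hr : r ≤ c) :
    sumGate ∘L left₂ posOp b r = left₂ posOp b r ∘L sumGate := by
  rw [left₂, opTensor_posOp_left]
  exact intertwine_binOp measurable_fst measurable_fst
    (sumGate_comp_phaseOp _ _ fun z => rfl) b h0 hr

theorem binOp_add_comp {X : Type} [MeasurableSpace X] {μ : Measure X} {φ φ' : X → ℝ}
    (hφ : Measurable φ) (hφ' : Measurable φ') (b b' : ZMod 2) (r r' : ℝ) :
    (binOp (fun x => φ x + φ' x) (hφ.add hφ') (b + b') (r + r') : Lp ℂ 2 μ →L[ℂ] Lp ℂ 2 μ) ∘L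
      binOp φ hφ b r ∘L binOp φ' hφ' b' r' = binOp φ hφ b r ∘L binOp φ' hφ' b' r' := by
  simp only [binOp, indOp_comp]
  refine indOp_congr _ _ (.of_forall fun x => ⟨fun h => h.2, fun h => ⟨?_, h⟩⟩)
  exact add_mem_binSet h.1 h.2

theorem binOp_sub_comp {X : Type} [MeasurableSpace X] {μ : Measure X} {φ φ' : X → ℝ}
    (hφ : Measurable φ) (hφ' : Measurable φ') (b b' : ZMod 2) (r r' : ℝ) :
    (binOp (fun x => φ x - φ' x) (hφ.sub hφ') (b + b') (r + r') : Lp ℂ 2 μ →L[ℂ] Lp ℂ 2 μ) ∘L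
      binOp φ hφ b r ∘L binOp φ' hφ' b' r' = binOp φ hφ b r ∘L binOp φ' hφ' b' r' := by
  simp only [binOp, indOp_comp]
  refine indOp_congr _ _ (.of_forall fun x => ⟨fun h => h.2, fun h => ⟨?_, h⟩⟩)
  have := add_mem_binSet h.1 (neg_mem_binSet.2 h.2)
  rwa [← sub_eq_add_neg] at this

/-- The second position after the gate corresponds to the sum of the positions before it, so radii
and parities add. -/
theorem sumGate_carriesSum_posOp {r r' : ℝ} (h0 : 0 ≤ r + r') (hr : r + r' ≤ c) :
    CarriesSum sumGate (left₂ posOp) (right₂ posOp) (right₂ posOp) r r' (r + r') := by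
  intro b b'
  simp only [left₂, right₂, opTensor_posOp_left, opTensor_posOp_right]
  have h := intertwine_binOp (φ := fun z : ℝ × ℝ => z.1 + z.2) (by fun_prop) measurable_snd
    (sumGate_comp_phaseOp (by fun_prop) (by fun_prop) fun z => by
      simp only [add_neg_cancel_left]) (b + b') h0 hr
  rw [← ContinuousLinearMap.comp_assoc, ← h, ContinuousLinearMap.comp_assoc, binOp_add_comp]

/-- The SUM gate in momentum representation. -/
def sumGateMom : L2 (ℝ × ℝ) →L[ℂ] L2 (ℝ × ℝ) :=
  opTensor (ContinuousLinearMap.adjoint fourierGate) (ContinuousLinearMap.adjoint fourierGate) ∘L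
    sumGate ∘L opTensor fourierGate fourierGate

theorem opTensor_fourierGate_adjoint_apply (f : L2 (ℝ × ℝ)) :
    opTensor fourierGate fourierGate (opTensor (ContinuousLinearMap.adjoint fourierGate)
      (ContinuousLinearMap.adjoint fourierGate) f) = f := by
  have : opTensor fourierGate fourierGate ∘L opTensor (ContinuousLinearMap.adjoint fourierGate)
      (ContinuousLinearMap.adjoint fourierGate) = ContinuousLinearMap.id ℂ (L2 (ℝ × ℝ)) := by
    rw [opTensor_comp, fourierGate_comp_adjoint, opTensor_id]
  exact congr($this f)

theorem opTensor_adjoint_fourierGate_apply (f : L2 (ℝ × ℝ)) :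
    opTensor (ContinuousLinearMap.adjoint fourierGate) (ContinuousLinearMap.adjoint fourierGate)
      (opTensor fourierGate fourierGate f) = f := by
  have : opTensor (ContinuousLinearMap.adjoint fourierGate)
      (ContinuousLinearMap.adjoint fourierGate) ∘L opTensor fourierGate fourierGate =
        ContinuousLinearMap.id ℂ (L2 (ℝ × ℝ)) := by
    rw [opTensor_comp, adjoint_comp_fourierGate, opTensor_id]
  exact congr($this f)

theorem opTensor_fourierGate_comp_phaseOp (a d : ℝ) :
    opTensor fourierGate fourierGate ∘L phaseOp (fun z : ℝ × ℝ => -(a * z.1) + -(d * z.2))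
      (by fun_prop) = opTensor (translation a) (translation d) ∘L opTensor fourierGate fourierGate := by
  rw [← opTensor_phaseOp (α := fun x => -(a * x)) (β := fun x => -(d * x)) (by fun_prop)
    (by fun_prop), opTensor_comp, opTensor_comp, translation_comp_fourierGate,
    translation_comp_fourierGate]

/-- Translations by (a, d) pass through the gate as translations by (a, a + d), and in momentum
space these are phases. Taking a = 0 shows that p₂ is preserved, and d = -a that the new p₁ is p₁ -
p₂. -/
theorem sumGateMom_comp_phaseOp (a d : ℝ) :
    sumGateMom ∘L phaseOp (fun z : ℝ × ℝ => -(a * z.1) + -(d * z.2)) (by fun_prop) =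
      phaseOp (fun z : ℝ × ℝ => -(a * z.1) + -((a + d) * z.2)) (by fun_prop) ∘L sumGateMom := by
  have h1 := opTensor_fourierGate_comp_phaseOp a d
  have h2 := opTensor_fourierGate_comp_phaseOp a (a + d)
  have h3 := sumGate_comp_translation a d
  ext1 f
  have e1 := fun f => congr($h1 f)
  have e2 := fun f => congr($h2 f)
  have e3 := fun f => congr($h3 f)
  simp only [ContinuousLinearMap.comp_apply] at e1 e2 e3
  simp only [sumGateMom, ContinuousLinearMap.comp_apply]
  rw [e1, e3, ← opTensor_adjoint_fourierGate_apply (phaseOp _ _ _), e2,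
    opTensor_fourierGate_adjoint_apply]

theorem left_momOp (b : ZMod 2) (r : ℝ) : left₂ momOp b r = opTensor fourierGate fourierGate ∘L
    left₂ posOp b r ∘L
    opTensor (ContinuousLinearMap.adjoint fourierGate) (ContinuousLinearMap.adjoint fourierGate) := by
  simp only [left₂, opTensor_comp, momOp, ContinuousLinearMap.id_comp, fourierGate_comp_adjoint]

theorem right_momOp (b : ZMod 2) (r : ℝ) : right₂ momOp b r = opTensor fourierGate fourierGate ∘L
    right₂ posOp b r ∘L
    opTensor (ContinuousLinearMap.adjoint fourierGate) (ContinuousLinearMap.adjoint fourierGate) := by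
  simp only [right₂, opTensor_comp, momOp, ContinuousLinearMap.id_comp, fourierGate_comp_adjoint]

section Conjugation
variable {E : Type} [NormedAddCommGroup E] [NormedSpace ℂ E] {J J' U A A' B : E →L[ℂ] E}

theorem comp_conj_of_conj (hJ : ∀ f, J (J' f) = f) (h : (J' ∘L U ∘L J) ∘L A = B ∘L J' ∘L U ∘L J) :
    U ∘L J ∘L A ∘L J' = (J ∘L B ∘L J') ∘L U := by
  ext1 f
  have e := congr(J ($h (J' f)))
  simp only [ContinuousLinearMap.comp_apply] at e ⊢
  rwa [hJ, hJ] at e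

theorem conj_comp_of_conj (hJ : ∀ f, J (J' f) = f) (hJ' : ∀ f, J' (J f) = f)
    (h : B ∘L (J' ∘L U ∘L J) ∘L A ∘L A' = (J' ∘L U ∘L J) ∘L A ∘L A') :
    (J ∘L B ∘L J') ∘L U ∘L (J ∘L A ∘L J') ∘L J ∘L A' ∘L J' =
      U ∘L (J ∘L A ∘L J') ∘L J ∘L A' ∘L J' := by
  ext1 f
  have e := congr(J ($h (J' f)))
  simp only [ContinuousLinearMap.comp_apply] at e ⊢
  rw [hJ] at e
  rwa [hJ']

end Conjugation

theorem sumGate_comp_right_momOp (b : ZMod 2) {r : ℝ} (h0 : 0 ≤ r) (hr : r ≤ c) :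
    sumGate ∘L right₂ momOp b r = right₂ momOp b r ∘L sumGate := by
  have h : sumGateMom ∘L right₂ posOp b r = right₂ posOp b r ∘L sumGateMom := by
    rw [right₂, opTensor_posOp_right]
    refine intertwine_binOp_of_neg measurable_snd measurable_snd ?_ b h0 hr
    simpa using sumGateMom_comp_phaseOp 0 c
  rw [right_momOp]
  exact comp_conj_of_conj opTensor_fourierGate_adjoint_apply h

/-- The new first momentum is a difference, but bins are symmetric and signs do not matter modulo 2,
so parities and radii add as for a sum. -/
theorem sumGate_carriesSum_momOp {r r' : ℝ} (h0 : 0 ≤ r + r') (hr : r + r' ≤ c) :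
    CarriesSum sumGate (left₂ momOp) (right₂ momOp) (left₂ momOp) r r' (r + r') := by
  intro b b'
  have h := intertwine_binOp_of_neg (U := sumGateMom) (φ := fun z : ℝ × ℝ => z.1 - z.2) (by fun_prop) measurable_fst
    (by
      have := sumGateMom_comp_phaseOp c (-c)
      rw [phaseOp_congr _ (by fun_prop) (show (fun z : ℝ × ℝ => -(c * z.1) + -(-c * z.2)) =
        fun z => -(c * (z.1 - z.2)) by funext z; ring),
        phaseOp_congr _ (by fun_prop) (show (fun z : ℝ × ℝ => -(c * z.1) + -((c + -c) * z.2)) =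
        fun z => -(c * z.1) by funext z; ring)] at this
      exact this) (b + b') h0 hr
  have h2 : left₂ posOp (b + b') (r + r') ∘L sumGateMom ∘L left₂ posOp b r ∘L right₂ posOp b' r' =
      sumGateMom ∘L left₂ posOp b r ∘L right₂ posOp b' r' := by
    simp only [left₂, right₂, opTensor_posOp_left, opTensor_posOp_right]
    rw [← ContinuousLinearMap.comp_assoc, ← h, ContinuousLinearMap.comp_assoc, binOp_sub_comp]
  rw [left_momOp, left_momOp, right_momOp]
  exact conj_comp_of_conj opTensor_fourierGate_adjoint_apply
    opTensor_adjoint_fourierGate_apply h2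

end SumGate

/-! ### Transport of binned observables along algebra homomorphisms. -/

section Representation
variable {E F G : Type} [NormedAddCommGroup E] [InnerProductSpace ℂ E]
  [NormedAddCommGroup F] [InnerProductSpace ℂ F] [NormedAddCommGroup G] [InnerProductSpace ℂ G]

/-- Unital algebra homomorphisms between algebras of operators. -/
structure IsRep (π : (E →L[ℂ] E) → (F →L[ℂ] F)) : Prop where
  map_comp : ∀ A B, π (A ∘L B) = π A ∘L π B
  map_add : ∀ A B, π (A + B) = π A + π B
  map_smul : ∀ (a : ℂ) A, π (a • A) = a • π A
  map_id : π (ContinuousLinearMap.id ℂ E) = ContinuousLinearMap.id ℂ F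

namespace IsRep
variable {π : (E →L[ℂ] E) → (F →L[ℂ] F)} {π' : (F →L[ℂ] F) → (G →L[ℂ] G)}

theorem comp (h' : IsRep π') (h : IsRep π) : IsRep fun A => π' (π A) where
  map_comp A B := by rw [h.map_comp, h'.map_comp]
  map_add A B := by rw [h.map_add, h'.map_add]
  map_smul a A := by rw [h.map_smul, h'.map_smul]
  map_id := by rw [h.map_id, h'.map_id]

theorem map_zero (h : IsRep π) : π 0 = 0 := by
  simpa using h.map_smul 0 0

theorem map_sub (h : IsRep π) (A B : E →L[ℂ] E) : π (A - B) = π A - π B := by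
  have := h.map_smul (-1) B
  rw [neg_one_smul, neg_one_smul] at this
  rw [sub_eq_add_neg, h.map_add, this, ← sub_eq_add_neg]

theorem isBinned (h : IsRep π) {P : ZMod 2 → ℝ → E →L[ℂ] E} (hP : IsBinned P) :
    IsBinned fun b r => π (P b r) where
  mono b r r' hr := by rw [← h.map_comp, hP.mono b hr]
  disjoint hb r r' hr := by rw [← h.map_comp, hP.disjoint hb hr, h.map_zero]

theorem signOp_eq (h : IsRep π) (P : ZMod 2 → ℝ → E →L[ℂ] E) :
    signOp (fun b r => π (P b r)) = π (signOp P) := (h.map_sub _ _).symm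

theorem filterOp_eq (h : IsRep π) (P : ZMod 2 → ℝ → E →L[ℂ] E) (r : ℝ) :
    filterOp (fun b r => π (P b r)) r = π (filterOp P r) := (h.map_add _ _).symm

theorem carries (h : IsRep π) {P Q : ZMod 2 → ℝ → E →L[ℂ] E} {W : E →L[ℂ] E} {r r' : ℝ}
    (hW : Carries W P Q r r') :
    Carries (π W) (fun b r => π (P b r)) (fun b r => π (Q b r)) r r' := fun b => by
  rw [← h.map_comp, ← h.map_comp, hW b]

theorem carriesSum (h : IsRep π) {P₁ P₂ Q : ZMod 2 → ℝ → E →L[ℂ] E} {W : E →L[ℂ] E} {r₁ r₂ r' : ℝ}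
    (hW : CarriesSum W P₁ P₂ Q r₁ r₂ r') :
    CarriesSum (π W) (fun b r => π (P₁ b r)) (fun b r => π (P₂ b r)) (fun b r => π (Q b r))
      r₁ r₂ r' := fun b b' => by
  rw [← h.map_comp, ← h.map_comp, ← h.map_comp, hW b b']

end IsRep

theorem carries_of_commute {P : ZMod 2 → ℝ → E →L[ℂ] E} (hP : IsBinned P) {W : E →L[ℂ] E} {r : ℝ}
    (h : ∀ b, W ∘L P b r = P b r ∘L W) : Carries W P P r r := fun b => by
  rw [h b, ← ContinuousLinearMap.comp_assoc, hP.mono b le_rfl]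

theorem Carries.mono {P : ZMod 2 → ℝ → E →L[ℂ] E} (hP : IsBinned P) {W : E →L[ℂ] E} {r r' r'' : ℝ}
    (h : Carries W P P r r') (hr : r' ≤ r'') : Carries W P P r r'' := fun b => by
  rw [← h b, ← ContinuousLinearMap.comp_assoc, hP.mono b hr]

theorem CarriesSum.mono {P₁ P₂ Q : ZMod 2 → ℝ → E →L[ℂ] E} (hQ : IsBinned Q) {W : E →L[ℂ] E}
    {r₁ r₂ r' r'' : ℝ} (h : CarriesSum W P₁ P₂ Q r₁ r₂ r') (hr : r' ≤ r'') :
    CarriesSum W P₁ P₂ Q r₁ r₂ r'' := fun b b' => by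
  rw [← h b b', ← ContinuousLinearMap.comp_assoc, hQ.mono _ hr]

end Representation

/-! ### Noise Kraus operators acting on bins. -/

section Displacements

theorem isBinned_posOp : IsBinned posOp := ⟨posOp_mono, posOp_disjoint⟩

theorem isBinned_momOp : IsBinned momOp := ⟨momOp_mono, momOp_disjoint⟩

theorem signOp_posOp : signOp posOp = logicalZ := by
  rw [signOp, logicalZ, measZ_eq, measZ_eq]

theorem signOp_momOp : signOp momOp = logicalX := by
  rw [signOp, logicalX, measX_eq, measX_eq]

theorem isRep_left : IsRep fun A : L2 ℝ →L[ℂ] L2 ℝ =>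
    opTensor A (ContinuousLinearMap.id ℂ (L2 ℝ)) where
  map_comp A B := by rw [opTensor_comp, ContinuousLinearMap.id_comp]
  map_add A B := opTensor_add_left A B _
  map_smul a A := opTensor_smul_left a A _
  map_id := opTensor_id

theorem isRep_right : IsRep fun A : L2 ℝ →L[ℂ] L2 ℝ =>
    opTensor (ContinuousLinearMap.id ℂ (L2 ℝ)) A where
  map_comp A B := by rw [opTensor_comp, ContinuousLinearMap.id_comp]
  map_add A B := opTensor_add_right _ A B
  map_smul a A := opTensor_smul_right a _ A
  map_id := opTensor_id

variable {s r : ℝ}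

/-- For a single displacement the bin grows by its shift; the condition passes to the weakly closed
span. -/
theorem carries_posOp {K : L2 ℝ →L[ℂ] L2 ℝ} (hK : K ∈ closedSpan (smallDisp s)) (h0 : 0 ≤ r)
    (hr : r ≤ c) : Carries K posOp posOp r (r + s) := fun b => by
  refine comp_eq_of_mem_closedSpan (fun V hV => ?_) hK
  obtain ⟨z₁, z₂, h1, h2, rfl⟩ := abs_le_of_mem_smallDisp hV
  exact posOp_comp_displacement b h0 hr h1

theorem carries_momOp {K : L2 ℝ →L[ℂ] L2 ℝ} (hK : K ∈ closedSpan (smallDisp s)) (h0 : 0 ≤ r)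
    (hr : r ≤ c) : Carries K momOp momOp r (r + s) := fun b => by
  refine comp_eq_of_mem_closedSpan (fun V hV => ?_) hK
  obtain ⟨z₁, z₂, h1, h2, rfl⟩ := abs_le_of_mem_smallDisp hV
  exact momOp_comp_displacement b h0 hr h2

theorem carries_left {P : ZMod 2 → ℝ → L2 ℝ →L[ℂ] L2 ℝ} {r' : ℝ}
    (h : ∀ A ∈ smallDisp s, Carries A P P r r') {K : L2 (ℝ × ℝ) →L[ℂ] L2 (ℝ × ℝ)}
    (hK : K ∈ closedSpan (smallDisp₂ s)) : Carries K (left₂ P) (left₂ P) r r' := fun b => by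
  refine comp_eq_of_mem_closedSpan (fun V hV => ?_) hK
  obtain ⟨A, hA, B, hB, rfl⟩ := hV
  rw [left₂, left₂, opTensor_comp, opTensor_comp, h A hA b]
  simp

theorem carries_right {P : ZMod 2 → ℝ → L2 ℝ →L[ℂ] L2 ℝ} {r' : ℝ}
    (h : ∀ A ∈ smallDisp s, Carries A P P r r') {K : L2 (ℝ × ℝ) →L[ℂ] L2 (ℝ × ℝ)}
    (hK : K ∈ closedSpan (smallDisp₂ s)) : Carries K (right₂ P) (right₂ P) r r' := fun b => by
  refine comp_eq_of_mem_closedSpan (fun V hV => ?_) hK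
  obtain ⟨A, hA, B, hB, rfl⟩ := hV
  rw [right₂, right₂, opTensor_comp, opTensor_comp, h B hB b]
  simp

theorem mem_closedSpan_of_mem {E : Type} [NormedAddCommGroup E] [InnerProductSpace ℂ E]
    [CompleteSpace E] {S : Set (E →L[ℂ] E)} {A : E →L[ℂ] E} (h : A ∈ S) : A ∈ closedSpan S :=
  subset_closure ⟨A, Submodule.subset_span h, rfl⟩

end Displacements

/-! ### Operators on three modes. -/

section ThreeModes

theorem ext_tmul₃ {E : Type} [NormedAddCommGroup E] [InnerProductSpace ℂ E] [CompleteSpace E]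
    {A B : L2 ((ℝ × ℝ) × ℝ) →L[ℂ] E}
    (h : ∀ f g k, A (tmul (tmul f g) k) = B (tmul (tmul f g) k)) : A = B := by
  refine ext_tmul fun Φ k => ?_
  have : A ∘L tmulRight k = B ∘L tmulRight k := ext_tmul fun f g => h f g k
  exact congr($this Φ)

theorem ext_tmul₃' {E : Type} [NormedAddCommGroup E] [InnerProductSpace ℂ E] [CompleteSpace E]
    {A B : L2 (ℝ × (ℝ × ℝ)) →L[ℂ] E}
    (h : ∀ f g k, A (tmul f (tmul g k)) = B (tmul f (tmul g k))) : A = B := by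
  refine ext_tmul fun f Φ => ?_
  have : A ∘L tmulLeft f = B ∘L tmulLeft f := ext_tmul fun g k => h f g k
  exact congr($this Φ)

theorem assoc_tmul (f g k : L2 ℝ) : assoc (tmul (tmul f g) k) = tmul f (tmul g k) := by
  refine Lp.ext ?_
  have mp : MeasurePreserving (MeasurableEquiv.prodAssoc (α := ℝ) (β := ℝ) (γ := ℝ)).symm
      volume volume := MeasurePreserving.symm _
      (volume_preserving_prodAssoc (α₁ := ℝ) (β₁ := ℝ) (γ₁ := ℝ))
  have h0 : assoc (tmul (tmul f g) k) =ᵐ[volume] fun z => tmul (tmul f g) k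
      (MeasurableEquiv.prodAssoc (α := ℝ) (β := ℝ) (γ := ℝ).symm z) :=
    Lp.coeFn_compMeasurePreserving _ mp
  filter_upwards [h0, mp.quasiMeasurePreserving.ae (coeFn_tmul (tmul f g) k),
    mp.quasiMeasurePreserving.ae (Measure.quasiMeasurePreserving_fst.ae (coeFn_tmul f g)),
    coeFn_tmul f (tmul g k), Measure.quasiMeasurePreserving_snd.ae (coeFn_tmul g k)]
    with z h1 h2 h3 h4 h5
  rw [h1, h2, h3, h4, h5]
  exact mul_assoc _ _ _

theorem adjoint_assoc_comp : ContinuousLinearMap.adjoint assoc ∘L assoc =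
    ContinuousLinearMap.id ℂ (L2 ((ℝ × ℝ) × ℝ)) :=
  (ContinuousLinearMap.norm_map_iff_adjoint_comp_self assoc).1 fun x => LinearIsometry.norm_map _ x

theorem adjoint_assoc_tmul (f g k : L2 ℝ) :
    ContinuousLinearMap.adjoint assoc (tmul f (tmul g k)) = tmul (tmul f g) k := by
  rw [← assoc_tmul]
  exact congr($adjoint_assoc_comp (tmul (tmul f g) k))

theorem assoc_comp_adjoint : assoc ∘L ContinuousLinearMap.adjoint assoc =
    ContinuousLinearMap.id ℂ (L2 (ℝ × (ℝ × ℝ))) :=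
  ext_tmul₃' fun f g k => by
    rw [ContinuousLinearMap.comp_apply, adjoint_assoc_tmul, assoc_tmul]; rfl

theorem assoc_adjoint_apply (Φ : L2 (ℝ × (ℝ × ℝ))) :
    assoc (ContinuousLinearMap.adjoint assoc Φ) = Φ := congr($assoc_comp_adjoint Φ)

theorem isRep_on12 : IsRep on12 where
  map_comp A B := by rw [on12, on12, on12, opTensor_comp, ContinuousLinearMap.id_comp]
  map_add A B := opTensor_add_left A B _
  map_smul a A := opTensor_smul_left a A _
  map_id := opTensor_id

theorem isRep_on1 : IsRep on1 := isRep_on12.comp isRep_left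

theorem isRep_on2 : IsRep on2 := isRep_on12.comp isRep_right

theorem isRep_on3 : IsRep on3 where
  map_comp A B := by rw [on3, on3, on3, opTensor_comp, ContinuousLinearMap.id_comp]
  map_add A B := opTensor_add_right _ A B
  map_smul a A := opTensor_smul_right a _ A
  map_id := opTensor_id

theorem isRep_on23 : IsRep on23 where
  map_comp A B := by
    ext1 f
    simp only [on23, ContinuousLinearMap.comp_apply, assoc_adjoint_apply]
    rw [← ContinuousLinearMap.comp_apply (opTensor _ A), opTensor_comp, ContinuousLinearMap.id_comp]
  map_add A B := by
    rw [on23, opTensor_add_right, ContinuousLinearMap.add_comp, ContinuousLinearMap.comp_add]; rfl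
  map_smul a A := by
    rw [on23, opTensor_smul_right, ContinuousLinearMap.smul_comp, ContinuousLinearMap.comp_smul]; rfl
  map_id := by rw [on23, opTensor_id, ContinuousLinearMap.id_comp, adjoint_assoc_comp]

theorem on1_tmul (A : L2 ℝ →L[ℂ] L2 ℝ) (f g k : L2 ℝ) :
    on1 A (tmul (tmul f g) k) = tmul (tmul (A f) g) k := by
  rw [on1, opTensor_tmul, opTensor_tmul]; rfl

theorem on2_tmul (A : L2 ℝ →L[ℂ] L2 ℝ) (f g k : L2 ℝ) :
    on2 A (tmul (tmul f g) k) = tmul (tmul f (A g)) k := by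
  rw [on2, opTensor_tmul, opTensor_tmul]; rfl

theorem on3_tmul (A : L2 ℝ →L[ℂ] L2 ℝ) (f g k : L2 ℝ) :
    on3 A (tmul (tmul f g) k) = tmul (tmul f g) (A k) := by
  rw [on3, opTensor_tmul]; rfl

theorem on23_left (A : L2 ℝ →L[ℂ] L2 ℝ) :
    on23 (opTensor A (ContinuousLinearMap.id ℂ (L2 ℝ))) = on2 A :=
  ext_tmul₃ fun f g k => by
    rw [on2_tmul, on23, ContinuousLinearMap.comp_apply, ContinuousLinearMap.comp_apply, assoc_tmul,
      opTensor_tmul, opTensor_tmul]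
    exact adjoint_assoc_tmul _ _ _

theorem on23_right (A : L2 ℝ →L[ℂ] L2 ℝ) :
    on23 (opTensor (ContinuousLinearMap.id ℂ (L2 ℝ)) A) = on3 A :=
  ext_tmul₃ fun f g k => by
    rw [on3_tmul, on23, ContinuousLinearMap.comp_apply, ContinuousLinearMap.comp_apply, assoc_tmul,
      opTensor_tmul, opTensor_tmul]
    exact adjoint_assoc_tmul _ _ _

theorem on1_eq (A : L2 ℝ →L[ℂ] L2 ℝ) : on1 A = ContinuousLinearMap.adjoint assoc ∘L
    opTensor A (ContinuousLinearMap.id ℂ (L2 (ℝ × ℝ))) ∘L assoc :=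
  ext_tmul₃ fun f g k => by
    rw [on1_tmul, ContinuousLinearMap.comp_apply, ContinuousLinearMap.comp_apply, assoc_tmul,
      opTensor_tmul]
    exact (adjoint_assoc_tmul _ _ _).symm

theorem on23_comp_on1 (B : L2 (ℝ × ℝ) →L[ℂ] L2 (ℝ × ℝ)) (A : L2 ℝ →L[ℂ] L2 ℝ) :
    on23 B ∘L on1 A = on1 A ∘L on23 B := by
  rw [on1_eq]
  ext1 f
  simp only [on23, ContinuousLinearMap.comp_apply, assoc_adjoint_apply]
  rw [← ContinuousLinearMap.comp_apply (opTensor _ B), opTensor_comp,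
    ← ContinuousLinearMap.comp_apply (opTensor A _), opTensor_comp]
  simp

theorem on12_comp_on3 (B : L2 (ℝ × ℝ) →L[ℂ] L2 (ℝ × ℝ)) (A : L2 ℝ →L[ℂ] L2 ℝ) :
    on12 B ∘L on3 A = on3 A ∘L on12 B := by
  rw [on12, on3, opTensor_comp, opTensor_comp]
  simp

/-- `A` acting on the given one of three modes. -/
def onMode : Fin 3 → (L2 ℝ →L[ℂ] L2 ℝ) → (L2 ((ℝ × ℝ) × ℝ) →L[ℂ] L2 ((ℝ × ℝ) × ℝ)) :=
  ![on1, on2, on3]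

theorem isRep_onMode (i : Fin 3) : IsRep (onMode i) := by
  fin_cases i
  · exact isRep_on1
  · exact isRep_on2
  · exact isRep_on3

theorem onMode_comp_onMode {i j : Fin 3} (hij : i ≠ j) (A B : L2 ℝ →L[ℂ] L2 ℝ) :
    onMode i A ∘L onMode j B = onMode j B ∘L onMode i A := by
  refine ext_tmul₃ fun f g k => ?_
  fin_cases i <;> fin_cases j <;> first | exact absurd rfl hij | skip
  all_goals simp [onMode, on1_tmul, on2_tmul, on3_tmul]

theorem isTracePreserving_on12 {κ : Type} {K : κ → L2 (ℝ × ℝ) →L[ℂ] L2 (ℝ × ℝ)} (hK : IsTracePreserving K) :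
    IsTracePreserving fun j => on12 (K j) := hK.opTensor_left

theorem isTracePreserving_on23 {κ : Type} {K : κ → L2 (ℝ × ℝ) →L[ℂ] L2 (ℝ × ℝ)} (hK : IsTracePreserving K) :
    IsTracePreserving fun j => on23 (K j) := by
  intro ψ
  have h := hK.opTensor_right (X := ℝ) (assoc ψ)
  have h1 : ∀ Φ, ‖ContinuousLinearMap.adjoint assoc Φ‖ = ‖Φ‖ := by
    rw [ContinuousLinearMap.norm_map_iff_adjoint_comp_self, ContinuousLinearMap.adjoint_adjoint]
    exact assoc_comp_adjoint
  have h2 : ‖assoc ψ‖ = ‖ψ‖ := LinearIsometry.norm_map _ ψ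
  rw [h2] at h
  simpa only [on23, ContinuousLinearMap.comp_apply, h1] using h

theorem isTracePreserving_onMode (i : Fin 3) {K : ℕ → L2 ℝ →L[ℂ] L2 ℝ} (hK : IsTracePreserving K) :
    IsTracePreserving fun j => onMode i (K j) := by
  fin_cases i
  · exact isTracePreserving_on12 hK.opTensor_left
  · exact isTracePreserving_on12 hK.opTensor_right
  · exact hK.opTensor_right

end ThreeModes

/-- The Hilbert space of three modes. -/
abbrev H₃ : Type := L2 ((ℝ × ℝ) × ℝ)

/-! ### Good subspaces and noise stages of the circuit. -/

section Good

/-- The binned position of one of three modes. -/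
def posOn (i : Fin 3) (b : ZMod 2) (r : ℝ) : H₃ →L[ℂ] H₃ := onMode i (posOp b r)

/-- The binned momentum of one of three modes. -/
def momOn (i : Fin 3) (b : ZMod 2) (r : ℝ) : H₃ →L[ℂ] H₃ := onMode i (momOp b r)

/-- The logical `Z` of one of three modes. -/
def zOn (i : Fin 3) : H₃ →L[ℂ] H₃ := onMode i logicalZ

/-- The logical `X` of one of three modes. -/
def xOn (i : Fin 3) : H₃ →L[ℂ] H₃ := onMode i logicalX

theorem isBinned_posOn (i : Fin 3) : IsBinned (posOn i) := (isRep_onMode i).isBinned isBinned_posOp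

theorem isBinned_momOn (i : Fin 3) : IsBinned (momOn i) := (isRep_onMode i).isBinned isBinned_momOp

theorem signOp_posOn (i : Fin 3) : signOp (posOn i) = zOn i := by
  rw [zOn, ← signOp_posOp]; exact (isRep_onMode i).signOp_eq posOp

theorem signOp_momOn (i : Fin 3) : signOp (momOn i) = xOn i := by
  rw [xOn, ← signOp_momOp]; exact (isRep_onMode i).signOp_eq momOp

/-- The three-mode vectors whose positions and momenta are within the given distances of
multiples of `c`. -/
def good (q p : Fin 3 → ℝ) : Submodule ℂ H₃ :=
  ⨅ i, supported (posOn i) (q i) ⊓ supported (momOn i) (p i)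

theorem mem_good {q p : Fin 3 → ℝ} {v : H₃} :
    v ∈ good q p ↔ ∀ i, v ∈ supported (posOn i) (q i) ∧ v ∈ supported (momOn i) (p i) := by
  simp [good, Submodule.mem_iInf]

/-- The filter sums over both parities, so it commutes with anything that merely permutes them. -/
theorem commute_filterOp_of_flip {E : Type} [NormedAddCommGroup E] [InnerProductSpace ℂ E]
    {P : ZMod 2 → ℝ → E →L[ℂ] E} {A : E →L[ℂ] E} {r : ℝ} (d : ZMod 2)
    (h : ∀ b, A ∘L P b r = P (b + d) r ∘L A) : A ∘L filterOp P r = filterOp P r ∘L A := by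
  rw [filterOp, ContinuousLinearMap.comp_add, ContinuousLinearMap.add_comp, h, h]
  rcases (by decide : ∀ b : ZMod 2, b = 0 ∨ b = 1) d with rfl | rfl
  · rw [add_zero, add_zero]
  · rw [zero_add, show (1 + 1 : ZMod 2) = 0 from rfl, add_comm]

theorem posOp_comm (b b' : ZMod 2) (r r' : ℝ) : posOp b r ∘L posOp b' r' = posOp b' r' ∘L posOp b r := by
  rw [posOp, posOp, binOp, binOp, indOp_comp, indOp_comp]
  exact indOp_congr _ _ (.of_forall fun x => and_comm)

theorem momOp_comm (b b' : ZMod 2) (r r' : ℝ) : momOp b r ∘L momOp b' r' = momOp b' r' ∘L momOp b r := by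
  rw [momOp_comp_momOp, momOp_comp_momOp, posOp_comm]

theorem logicalZ_comp_posOp (b : ZMod 2) (r : ℝ) : logicalZ ∘L posOp b r = posOp b r ∘L logicalZ := by
  rw [← signOp_posOp, signOp, ContinuousLinearMap.sub_comp, ContinuousLinearMap.comp_sub,
    posOp_comm 0, posOp_comm 1]

theorem logicalX_comp_momOp (b : ZMod 2) (r : ℝ) : logicalX ∘L momOp b r = momOp b r ∘L logicalX := by
  rw [← signOp_momOp, signOp, ContinuousLinearMap.sub_comp, ContinuousLinearMap.comp_sub,
    momOp_comm 0, momOp_comm 1]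

theorem onMode_comp_filterOp {P : ZMod 2 → ℝ → L2 ℝ →L[ℂ] L2 ℝ} {A : L2 ℝ →L[ℂ] L2 ℝ} {r : ℝ}
    (h : A ∘L filterOp P r = filterOp P r ∘L A) (i j : Fin 3) :
    onMode i A ∘L filterOp (fun b r => onMode j (P b r)) r =
      filterOp (fun b r => onMode j (P b r)) r ∘L onMode i A := by
  rw [(isRep_onMode j).filterOp_eq]
  by_cases hij : i = j
  · subst hij
    rw [← (isRep_onMode i).map_comp, ← (isRep_onMode i).map_comp, h]
  · exact onMode_comp_onMode hij _ _

/-- The logical Z commutes with position bins and exchanges momentum bins of equal radius.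
Invariance of the good subspaces is what allows pull-backs of several logical operators to be
composed. -/
theorem zOn_mem_good {q p : Fin 3 → ℝ} (h0 : ∀ i, 0 ≤ p i) (h1 : ∀ i, p i ≤ c) {v : H₃}
    (hv : v ∈ good q p) (i : Fin 3) : zOn i v ∈ good q p := by
  rw [mem_good] at hv ⊢
  refine fun j => ⟨mem_supported_of_commute (onMode_comp_filterOp ?_ i j) (hv j).1,
    mem_supported_of_commute (onMode_comp_filterOp ?_ i j) (hv j).2⟩
  · exact commute_filterOp_of_flip 0 fun b => by rw [add_zero, logicalZ_comp_posOp]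
  · exact commute_filterOp_of_flip 1 fun b => logicalZ_comp_momOp b (h0 j) (h1 j)

theorem xOn_mem_good {q p : Fin 3 → ℝ} (h0 : ∀ i, 0 ≤ q i) (h1 : ∀ i, q i ≤ c) {v : H₃}
    (hv : v ∈ good q p) (i : Fin 3) : xOn i v ∈ good q p := by
  rw [mem_good] at hv ⊢
  refine fun j => ⟨mem_supported_of_commute (onMode_comp_filterOp ?_ i j) (hv j).1,
    mem_supported_of_commute (onMode_comp_filterOp ?_ i j) (hv j).2⟩
  · exact commute_filterOp_of_flip 1 fun b => logicalX_comp_posOp b (h0 j) (h1 j)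
  · exact commute_filterOp_of_flip 0 fun b => by rw [add_zero, logicalX_comp_momOp]

/-- `W` maps good vectors to good vectors, pulling the logical operators back as given. -/
structure IsStage (W : H₃ →L[ℂ] H₃) (q p q' p' : Fin 3 → ℝ) (Z X : Fin 3 → H₃ →L[ℂ] H₃) : Prop where
  mem : ∀ v ∈ good q p, W v ∈ good q' p'
  z : ∀ v ∈ good q p, ∀ i, zOn i (W v) = W (Z i v)
  x : ∀ v ∈ good q p, ∀ i, xOn i (W v) = W (X i v)

theorem isStage_of_forall {W : H₃ →L[ℂ] H₃} {q p q' p' : Fin 3 → ℝ} {Z X : Fin 3 → H₃ →L[ℂ] H₃}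
    (h : ∀ v ∈ good q p, ∀ i,
      (W v ∈ supported (posOn i) (q' i) ∧ zOn i (W v) = W (Z i v)) ∧
      (W v ∈ supported (momOn i) (p' i) ∧ xOn i (W v) = W (X i v))) :
    IsStage W q p q' p' Z X where
  mem v hv := mem_good.2 fun i => ⟨(h v hv i).1.1, (h v hv i).2.1⟩
  z v hv i := (h v hv i).1.2
  x v hv i := (h v hv i).2.2

theorem isStage_of_carries {W : H₃ →L[ℂ] H₃} {q p q' p' : Fin 3 → ℝ}
    (hq : ∀ i, q i ≤ c / 2) (hp : ∀ i, p i ≤ c / 2) (hq' : ∀ i, q' i ≤ c / 2)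
    (hp' : ∀ i, p' i ≤ c / 2) (h : ∀ i, Carries W (posOn i) (posOn i) (q i) (q' i))
    (h' : ∀ i, Carries W (momOn i) (momOn i) (p i) (p' i)) :
    IsStage W q p q' p' zOn xOn := by
  refine isStage_of_forall fun v hv i => ?_
  rw [mem_good] at hv
  rw [← signOp_posOn, ← signOp_momOn]
  exact ⟨(h i).map_supported (isBinned_posOn i) (isBinned_posOn i) (hq i) (hq' i) (hv i).1,
    (h' i).map_supported (isBinned_momOn i) (isBinned_momOn i) (hp i) (hp' i) (hv i).2⟩

theorem carries_onMode {P : ZMod 2 → ℝ → L2 ℝ →L[ℂ] L2 ℝ} (hP : IsBinned P) {K : L2 ℝ →L[ℂ] L2 ℝ}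
    {s : ℝ} {i j : Fin 3} {r r' : ℝ} (h : Carries K P P r (r + s)) (hr : r ≤ r')
    (hi : j = i → r + s ≤ r') :
    Carries (onMode i K) (fun b r => onMode j (P b r)) (fun b r => onMode j (P b r)) r r' := by
  by_cases hij : j = i
  · subst hij
    exact ((isRep_onMode j).carries h).mono ((isRep_onMode j).isBinned hP) (hi rfl)
  · exact (carries_of_commute ((isRep_onMode j).isBinned hP)
      fun b => onMode_comp_onMode (Ne.symm hij) _ _).mono ((isRep_onMode j).isBinned hP) hr

variable {s : ℝ} {q p q' p' : Fin 3 → ℝ}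

/-- Distances that are nonnegative and at most half the lattice spacing. -/
def Small (q : Fin 3 → ℝ) : Prop := ∀ i, 0 ≤ q i ∧ q i ≤ c / 2

theorem half_c_le : c / 2 ≤ c := by have := c_pos; linarith

/-- Displacement noise preserves all parities, so logical operators pull back to themselves, and
only the radii of mode i have to grow. -/
theorem isStage_onMode {K : L2 ℝ →L[ℂ] L2 ℝ} (hK : K ∈ closedSpan (smallDisp s)) (i : Fin 3)
    (hq : Small q) (hp : Small p) (hq' : Small q') (hp' : Small p')
    (h1 : ∀ j, q j ≤ q' j) (h2 : ∀ j, p j ≤ p' j) (h3 : q i + s ≤ q' i) (h4 : p i + s ≤ p' i) :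
    IsStage (onMode i K) q p q' p' zOn xOn :=
  isStage_of_carries (fun i => (hq i).2) (fun i => (hp i).2) (fun i => (hq' i).2)
    (fun i => (hp' i).2)
    (fun j => carries_onMode isBinned_posOp
      (carries_posOp hK (hq j).1 ((hq j).2.trans half_c_le)) (h1 j) (by rintro rfl; exact h3))
    (fun j => carries_onMode isBinned_momOp
      (carries_momOp hK (hp j).1 ((hp j).2.trans half_c_le)) (h2 j) (by rintro rfl; exact h4))

theorem isStage_on12 {K : L2 (ℝ × ℝ) →L[ℂ] L2 (ℝ × ℝ)} (hK : K ∈ closedSpan (smallDisp₂ s))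
    (hq : Small q) (hp : Small p) (hq' : Small q') (hp' : Small p')
    (h1 : q 0 + s ≤ q' 0 ∧ q 1 + s ≤ q' 1 ∧ q 2 ≤ q' 2)
    (h2 : p 0 + s ≤ p' 0 ∧ p 1 + s ≤ p' 1 ∧ p 2 ≤ p' 2) :
    IsStage (on12 K) q p q' p' zOn xOn := by
  have hpos := fun i A hA => carries_posOp (mem_closedSpan_of_mem (S := smallDisp s) (A := A) hA)
    (hq i).1 ((hq i).2.trans half_c_le)
  have hmom := fun i A hA => carries_momOp (mem_closedSpan_of_mem (S := smallDisp s) (A := A) hA)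
    (hp i).1 ((hp i).2.trans half_c_le)
  refine isStage_of_carries (fun i => (hq i).2) (fun i => (hp i).2) (fun i => (hq' i).2)
    (fun i => (hp' i).2) (fun i => ?_) fun i => ?_
  · fin_cases i
    · exact (isRep_on12.carries (carries_left (hpos 0) hK)).mono (isBinned_posOn 0) h1.1
    · exact (isRep_on12.carries (carries_right (hpos 1) hK)).mono (isBinned_posOn 1) h1.2.1
    · exact (carries_of_commute (isBinned_posOn 2) fun b => on12_comp_on3 _ _).mono
        (isBinned_posOn 2) h1.2.2
  · fin_cases i
    · exact (isRep_on12.carries (carries_left (hmom 0) hK)).mono (isBinned_momOn 0) h2.1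
    · exact (isRep_on12.carries (carries_right (hmom 1) hK)).mono (isBinned_momOn 1) h2.2.1
    · exact (carries_of_commute (isBinned_momOn 2) fun b => on12_comp_on3 _ _).mono
        (isBinned_momOn 2) h2.2.2

theorem on23_left₂ (P : ZMod 2 → ℝ → L2 ℝ →L[ℂ] L2 ℝ) :
    (fun b r => on23 (left₂ P b r)) = fun b r => onMode 1 (P b r) := by
  funext b r; exact on23_left _

theorem on23_right₂ (P : ZMod 2 → ℝ → L2 ℝ →L[ℂ] L2 ℝ) :
    (fun b r => on23 (right₂ P b r)) = fun b r => onMode 2 (P b r) := by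
  funext b r; exact on23_right _

theorem carries_on23_one {P : ZMod 2 → ℝ → L2 ℝ →L[ℂ] L2 ℝ} {r r' : ℝ}
    (h : ∀ A ∈ smallDisp s, Carries A P P r r') {K : L2 (ℝ × ℝ) →L[ℂ] L2 (ℝ × ℝ)}
    (hK : K ∈ closedSpan (smallDisp₂ s)) :
    Carries (on23 K) (fun b r => onMode 1 (P b r)) (fun b r => onMode 1 (P b r)) r r' := by
  have := isRep_on23.carries (carries_left h hK)
  rwa [on23_left₂] at this

theorem carries_on23_two {P : ZMod 2 → ℝ → L2 ℝ →L[ℂ] L2 ℝ} {r r' : ℝ}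
    (h : ∀ A ∈ smallDisp s, Carries A P P r r') {K : L2 (ℝ × ℝ) →L[ℂ] L2 (ℝ × ℝ)}
    (hK : K ∈ closedSpan (smallDisp₂ s)) :
    Carries (on23 K) (fun b r => onMode 2 (P b r)) (fun b r => onMode 2 (P b r)) r r' := by
  have := isRep_on23.carries (carries_right h hK)
  rwa [on23_right₂] at this

theorem isStage_on23 {K : L2 (ℝ × ℝ) →L[ℂ] L2 (ℝ × ℝ)} (hK : K ∈ closedSpan (smallDisp₂ s))
    (hq : Small q) (hp : Small p) (hq' : Small q') (hp' : Small p')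
    (h1 : q 0 ≤ q' 0 ∧ q 1 + s ≤ q' 1 ∧ q 2 + s ≤ q' 2)
    (h2 : p 0 ≤ p' 0 ∧ p 1 + s ≤ p' 1 ∧ p 2 + s ≤ p' 2) :
    IsStage (on23 K) q p q' p' zOn xOn := by
  have hpos := fun i A hA => carries_posOp (mem_closedSpan_of_mem (S := smallDisp s) (A := A) hA)
    (hq i).1 ((hq i).2.trans half_c_le)
  have hmom := fun i A hA => carries_momOp (mem_closedSpan_of_mem (S := smallDisp s) (A := A) hA)
    (hp i).1 ((hp i).2.trans half_c_le)
  refine isStage_of_carries (fun i => (hq i).2) (fun i => (hp i).2) (fun i => (hq' i).2)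
    (fun i => (hp' i).2) (fun i => ?_) fun i => ?_
  · fin_cases i
    · exact (carries_of_commute (isBinned_posOn 0) fun b => on23_comp_on1 _ _).mono
        (isBinned_posOn 0) h1.1
    · exact (carries_on23_one (hpos 1) hK).mono (isBinned_posOn 1) h1.2.1
    · exact (carries_on23_two (hpos 2) hK).mono (isBinned_posOn 2) h1.2.2
  · fin_cases i
    · exact (carries_of_commute (isBinned_momOn 0) fun b => on23_comp_on1 _ _).mono
        (isBinned_momOn 0) h2.1
    · exact (carries_on23_one (hmom 1) hK).mono (isBinned_momOn 1) h2.2.1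
    · exact (carries_on23_two (hmom 2) hK).mono (isBinned_momOn 2) h2.2.2

end Good

/-! ### SUM gates as stages of the circuit. -/

section SumStage
variable {q p q' p' : Fin 3 → ℝ}

/-- With control i and target j, the position of the target and the momentum of the control become
sums modulo parity. Hence Z of the target and X of the control pull back to products, the others to
themselves. -/
theorem isStage_of_carriesSum {W : H₃ →L[ℂ] H₃} {i j : Fin 3} (hij : i ≠ j)
    (hq : Small q) (hp : Small p) (hq' : Small q') (hp' : Small p')
    (hQ : ∀ l ≠ j, Carries W (posOn l) (posOn l) (q l) (q' l))
    (hQs : CarriesSum W (posOn i) (posOn j) (posOn j) (q i) (q j) (q' j))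
    (hP : ∀ l ≠ i, Carries W (momOn l) (momOn l) (p l) (p' l))
    (hPs : CarriesSum W (momOn i) (momOn j) (momOn i) (p i) (p j) (p' i)) :
    IsStage W q p q' p' (fun l => if l = j then zOn i ∘L zOn j else zOn l)
      (fun l => if l = i then xOn i ∘L xOn j else xOn l) := by
  refine isStage_of_forall fun v hv l => ?_
  rw [mem_good] at hv
  constructor
  · by_cases hl : l = j
    · subst hl
      rw [if_pos rfl, ← signOp_posOn, ← signOp_posOn]
      exact hQs.map_supported (isBinned_posOn i) (isBinned_posOn l) (isBinned_posOn l) (hq i).2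
        (hq l).2 (hq' l).2 (fun b b' => onMode_comp_onMode hij _ _) (hv i).1 (hv l).1
    · rw [if_neg hl, ← signOp_posOn]
      exact (hQ l hl).map_supported (isBinned_posOn l) (isBinned_posOn l) (hq l).2 (hq' l).2 (hv l).1
  · by_cases hl : l = i
    · subst hl
      rw [if_pos rfl, ← signOp_momOn, ← signOp_momOn]
      exact hPs.map_supported (isBinned_momOn l) (isBinned_momOn j) (isBinned_momOn l) (hp l).2
        (hp j).2 (hp' l).2 (fun b b' => onMode_comp_onMode hij _ _) (hv l).2 (hv j).2
    · rw [if_neg hl, ← signOp_momOn]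
      exact (hP l hl).map_supported (isBinned_momOn l) (isBinned_momOn l) (hp l).2 (hp' l).2 (hv l).2

theorem carries_on12_sumGate_posOn {l : Fin 3} (hl : l ≠ 1) {r r' : ℝ} (h0 : 0 ≤ r) (hr : r ≤ c)
    (h : r ≤ r') : Carries (on12 sumGate) (posOn l) (posOn l) r r' := by
  refine (carries_of_commute (isBinned_posOn l) fun b => ?_).mono (isBinned_posOn l) h
  fin_cases l
  · exact (isRep_on12.map_comp _ _).symm.trans ((congrArg on12 (sumGate_comp_left_posOp b h0 hr)).trans
      (isRep_on12.map_comp _ _))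
  · exact absurd rfl hl
  · exact on12_comp_on3 _ _

theorem carries_on12_sumGate_momOn {l : Fin 3} (hl : l ≠ 0) {r r' : ℝ} (h0 : 0 ≤ r) (hr : r ≤ c)
    (h : r ≤ r') : Carries (on12 sumGate) (momOn l) (momOn l) r r' := by
  refine (carries_of_commute (isBinned_momOn l) fun b => ?_).mono (isBinned_momOn l) h
  fin_cases l
  · exact absurd rfl hl
  · exact (isRep_on12.map_comp _ _).symm.trans ((congrArg on12 (sumGate_comp_right_momOp b h0 hr)).trans
      (isRep_on12.map_comp _ _))
  · exact on12_comp_on3 _ _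

theorem carries_on23_sumGate_posOn {l : Fin 3} (hl : l ≠ 2) {r r' : ℝ} (h0 : 0 ≤ r) (hr : r ≤ c)
    (h : r ≤ r') : Carries (on23 sumGate) (posOn l) (posOn l) r r' := by
  refine (carries_of_commute (isBinned_posOn l) fun b => ?_).mono (isBinned_posOn l) h
  fin_cases l
  · exact on23_comp_on1 _ _
  · have := (isRep_on23.map_comp _ _).symm.trans ((congrArg on23 (sumGate_comp_left_posOp b h0 hr)).trans
      (isRep_on23.map_comp _ _))
    rwa [left₂, on23_left] at this
  · exact absurd rfl hl

theorem carries_on23_sumGate_momOn {l : Fin 3} (hl : l ≠ 1) {r r' : ℝ} (h0 : 0 ≤ r) (hr : r ≤ c)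
    (h : r ≤ r') : Carries (on23 sumGate) (momOn l) (momOn l) r r' := by
  refine (carries_of_commute (isBinned_momOn l) fun b => ?_).mono (isBinned_momOn l) h
  fin_cases l
  · exact on23_comp_on1 _ _
  · exact absurd rfl hl
  · have := (isRep_on23.map_comp _ _).symm.trans ((congrArg on23 (sumGate_comp_right_momOp b h0 hr)).trans
      (isRep_on23.map_comp _ _))
    rwa [right₂, on23_right] at this

theorem carriesSum_on23_posOn {r r' r'' : ℝ} (h0 : 0 ≤ r + r') (hr : r + r' ≤ c) (h : r + r' ≤ r'') :
    CarriesSum (on23 sumGate) (posOn 1) (posOn 2) (posOn 2) r r' r'' := by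
  have := isRep_on23.carriesSum (sumGate_carriesSum_posOp h0 hr)
  rw [on23_left₂, on23_right₂] at this
  exact this.mono (isBinned_posOn 2) h

theorem carriesSum_on23_momOn {r r' r'' : ℝ} (h0 : 0 ≤ r + r') (hr : r + r' ≤ c) (h : r + r' ≤ r'') :
    CarriesSum (on23 sumGate) (momOn 1) (momOn 2) (momOn 1) r r' r'' := by
  have := isRep_on23.carriesSum (sumGate_carriesSum_momOp h0 hr)
  rw [on23_left₂, on23_right₂] at this
  exact this.mono (isBinned_momOn 1) h

theorem isStage_on12_sumGate (hq : Small q) (hp : Small p) (hq' : Small q') (hp' : Small p')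
    (h1 : q 0 ≤ q' 0 ∧ q 0 + q 1 ≤ q' 1 ∧ q 2 ≤ q' 2)
    (h2 : p 0 + p 1 ≤ p' 0 ∧ p 1 ≤ p' 1 ∧ p 2 ≤ p' 2) :
    IsStage (on12 sumGate) q p q' p' (fun l => if l = 1 then zOn 0 ∘L zOn 1 else zOn l)
      (fun l => if l = 0 then xOn 0 ∘L xOn 1 else xOn l) := by
  refine isStage_of_carriesSum (by decide) hq hp hq' hp' (fun l hl => ?_) ?_ (fun l hl => ?_) ?_
  · refine carries_on12_sumGate_posOn hl (hq l).1 ((hq l).2.trans half_c_le) ?_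
    fin_cases l
    exacts [h1.1, absurd rfl hl, h1.2.2]
  · exact (isRep_on12.carriesSum (sumGate_carriesSum_posOp (add_nonneg (hq 0).1 (hq 1).1)
      ((h1.2.1.trans (hq' 1).2).trans half_c_le))).mono (isBinned_posOn 1) h1.2.1
  · refine carries_on12_sumGate_momOn hl (hp l).1 ((hp l).2.trans half_c_le) ?_
    fin_cases l
    exacts [absurd rfl hl, h2.2.1, h2.2.2]
  · exact (isRep_on12.carriesSum (sumGate_carriesSum_momOp (add_nonneg (hp 0).1 (hp 1).1)
      ((h2.1.trans (hp' 0).2).trans half_c_le))).mono (isBinned_momOn 0) h2.1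

theorem isStage_on23_sumGate (hq : Small q) (hp : Small p) (hq' : Small q') (hp' : Small p')
    (h1 : q 0 ≤ q' 0 ∧ q 1 ≤ q' 1 ∧ q 1 + q 2 ≤ q' 2)
    (h2 : p 0 ≤ p' 0 ∧ p 1 + p 2 ≤ p' 1 ∧ p 2 ≤ p' 2) :
    IsStage (on23 sumGate) q p q' p' (fun l => if l = 2 then zOn 1 ∘L zOn 2 else zOn l)
      (fun l => if l = 1 then xOn 1 ∘L xOn 2 else xOn l) := by
  refine isStage_of_carriesSum (by decide) hq hp hq' hp' (fun l hl => ?_) ?_ (fun l hl => ?_) ?_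
  · refine carries_on23_sumGate_posOn hl (hq l).1 ((hq l).2.trans half_c_le) ?_
    fin_cases l
    exacts [h1.1, h1.2.1, absurd rfl hl]
  · exact carriesSum_on23_posOn (add_nonneg (hq 1).1 (hq 2).1)
      ((h1.2.2.trans (hq' 2).2).trans half_c_le) h1.2.2
  · refine carries_on23_sumGate_momOn hl (hp l).1 ((hp l).2.trans half_c_le) ?_
    fin_cases l
    exacts [h2.1, absurd rfl hl, h2.2.2]
  · exact carriesSum_on23_momOn (add_nonneg (hp 1).1 (hp 2).1)
      ((h2.2.1.trans (hp' 1).2).trans half_c_le) h2.2.1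

end SumStage

/-! ### Pull-back of observables on tracked states. -/

section Pull
variable {E F : Type} [NormedAddCommGroup E] [InnerProductSpace ℂ E]
  [NormedAddCommGroup F] [InnerProductSpace ℂ F]

/-- `(1 + a O) / 2`. -/
def halfOp (a : ℝ) (O : E →L[ℂ] E) : E →L[ℂ] E :=
  (1 / 2 : ℂ) • (ContinuousLinearMap.id ℂ E + (a : ℂ) • O)

/-- `O ^ b`. -/
def powOp (b : ZMod 2) (O : E →L[ℂ] E) : E →L[ℂ] E := if b = 0 then ContinuousLinearMap.id ℂ E else O

/-- The product of three spectral projections of involutions and a power of an involution. -/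
def prodOp (a b ν γ : ZMod 2) (A B C D : E →L[ℂ] E) : E →L[ℂ] E :=
  halfOp (sgn a) A ∘L halfOp (sgn b) B ∘L halfOp (sgn ν) C ∘L powOp γ D

/-- On `G`, the operator `O'` is the pull-back of `O` along `W`. -/
def Pull (G : Submodule ℂ E) (W : E →L[ℂ] F) (O : F →L[ℂ] F) (O' : E →L[ℂ] E) : Prop :=
  ∀ v ∈ G, O' v ∈ G ∧ O (W v) = W (O' v)

namespace Pull
variable {G : Submodule ℂ E} {W : E →L[ℂ] F} {O O₁ : F →L[ℂ] F} {O' O₁' : E →L[ℂ] E}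

/-- Invariance of G under O₁' is what lets the other pull-back be applied at the vector O₁' v. -/
theorem comp (h : Pull G W O O') (h₁ : Pull G W O₁ O₁') : Pull G W (O ∘L O₁) (O' ∘L O₁') :=
  fun v hv => ⟨(h _ (h₁ v hv).1).1, by
    rw [ContinuousLinearMap.comp_apply, (h₁ v hv).2, (h _ (h₁ v hv).1).2]; rfl⟩

theorem halfOp (h : Pull G W O O') (a : ℝ) : Pull G W (halfOp a O) (halfOp a O') :=
  fun v hv => ⟨G.smul_mem _ (G.add_mem hv (G.smul_mem _ (h v hv).1)), by
    simp [GKP.halfOp, (h v hv).2]⟩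

theorem powOp (h : Pull G W O O') (b : ZMod 2) : Pull G W (powOp b O) (powOp b O') := fun v hv => by
  unfold GKP.powOp
  split_ifs
  · exact ⟨hv, rfl⟩
  · exact h v hv

theorem prodOp {A B C D : F →L[ℂ] F} {A' B' C' D' : E →L[ℂ] E} (hA : Pull G W A A')
    (hB : Pull G W B B') (hC : Pull G W C C') (hD : Pull G W D D') (a b ν γ : ZMod 2) :
    Pull G W (prodOp a b ν γ A B C D) (prodOp a b ν γ A' B' C' D') :=
  (hA.halfOp _).comp ((hB.halfOp _).comp ((hC.halfOp _).comp (hD.powOp _)))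

end Pull

variable [CompleteSpace E] [CompleteSpace F]

/-- `σ` is a countable sum of pure states from `G`. -/
def IsTracked (σ : E →L[ℂ] E) (G : Submodule ℂ E) : Prop :=
  ∃ (ι : Type) (v : ι → E), IsEnsemble σ v ∧ ∀ i, v i ∈ G

variable {σ : E →L[ℂ] E} {G : Submodule ℂ E} {G' : Submodule ℂ F}

theorem IsTracked.conj (h : IsTracked σ G) {A : E →L[ℂ] F} (hA : ∀ v ∈ G, A v ∈ G') :
    IsTracked (GKP.conj A σ) G' := by
  obtain ⟨ι, v, hv, hG⟩ := h
  exact ⟨ι, _, hv.conj A, fun i => hA _ (hG i)⟩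

theorem IsTracked.kraus {G' : Submodule ℂ E} (h : IsTracked σ G) {K : ℕ → E →L[ℂ] E}
    (hK : IsTracePreserving K) (hG' : ∀ j, ∀ v ∈ G, K j v ∈ G') : IsTracked (kraus K σ) G' := by
  obtain ⟨ι, v, hv, hG⟩ := h
  exact ⟨ι × ℕ, _, hv.kraus hK, fun p => hG' _ _ (hG _)⟩

theorem IsEnsemble.opTrace_comp {ι : Type} {v : ι → E} (h : IsEnsemble σ v) (O : E →L[ℂ] E) :
    opTrace (O ∘L σ) = expect v O := by
  have := h.opTrace_eq O (ContinuousLinearMap.id ℂ E)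
  rwa [ContinuousLinearMap.comp_id, ContinuousLinearMap.id_comp] at this

theorem IsTracked.opTrace_conj (h : IsTracked σ G) {U : E →L[ℂ] F} (hU : ∀ x, ‖U x‖ = ‖x‖)
    {O : F →L[ℂ] F} {O' : E →L[ℂ] E} (hO : Pull G U O O') :
    opTrace (O ∘L GKP.conj U σ) = opTrace (O' ∘L σ) := by
  obtain ⟨ι, v, hv, hG⟩ := h
  rw [(hv.conj U).opTrace_comp, hv.opTrace_comp]
  exact expect_isometry hU fun i => (hO _ (hG i)).2

theorem IsTracked.opTrace_kraus (h : IsTracked σ G) {K : ℕ → E →L[ℂ] E}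
    (hK : IsTracePreserving K) {O O' : E →L[ℂ] E} (hO : ∀ j, Pull G (K j) O O') :
    opTrace (O ∘L GKP.kraus K σ) = opTrace (O' ∘L σ) := by
  obtain ⟨ι, v, hv, hG⟩ := h
  rw [(hv.kraus hK).opTrace_comp, hv.opTrace_comp]
  exact expect_kraus hv.1 hK fun i j => (hO j _ (hG i)).2

end Pull

/-! ### The momentum of superpositions of displaced codewords. -/

section Preparation
variable {f g : ℝ × ℝ → ℂ} {γ : ZMod 2 → ℂ}

theorem gkpWave_of_support (hf : Function.support f ⊆ patch) (x : ℝ) :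
    gkpWave γ f x = (√c : ℂ)⁻¹ * (γ (bin x) *
      ∫ z₂ : ℝ, Complex.exp (((z₂ * (x + c * bin x) / 2 : ℝ) : ℂ) * Complex.I) *
        f (x - c * bin x, z₂)) := by
  have h := gkpWave_eq γ f x
  rwa [Set.indicator_eq_self.2 hf] at h

theorem gkpWave_const_mul (a : ℂ) (x : ℝ) :
    gkpWave γ (fun z => a * f z) x = a * gkpWave γ f x := by
  simp only [gkpWave, mul_left_comm _ a, integral_const_mul, tsum_mul_left]

theorem ae_integrable_slice (hf : Integrable f) :
    ∀ᵐ x : ℝ, Integrable fun z₂ : ℝ => f (x - c * bin x, z₂) := by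
  have h : ∀ᵐ z₁ : ℝ, Integrable fun z₂ : ℝ => f (z₁, z₂) := hf.prod_right_ae
  exact ae_shift h

theorem gkpWave_add (hf : Integrable f) (hg : Integrable g) (hf' : Function.support f ⊆ patch)
    (hg' : Function.support g ⊆ patch) :
    ∀ᵐ x : ℝ, gkpWave γ (fun z => f z + g z) x = gkpWave γ f x + gkpWave γ g x := by
  have hfg : Function.support (fun z => f z + g z) ⊆ patch :=
    (Function.support_add f g).trans (Set.union_subset hf' hg')
  filter_upwards [ae_integrable_slice hf, ae_integrable_slice hg] with x h1 h2
  rw [gkpWave_of_support hf', gkpWave_of_support hg', gkpWave_of_support hfg, ← mul_add, ← mul_add,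
    ← integral_add (integrable_phase_mul h1 _) (integrable_phase_mul h2 _)]
  simp only [mul_add]

/-- Re-indexing the lattice sum by an even shift leaves γ unchanged and turns the translation into a
phase in z₂ on the weight f. -/
theorem gkpWave_sub (m : ℤ) (x : ℝ) : gkpWave γ f (x - 2 * c * m) =
    gkpWave γ (fun z => Complex.exp (((-(2 * c * m * z.2) : ℝ) : ℂ) * Complex.I) * f z) x := by
  rw [gkpWave, gkpWave, ← (Equiv.addRight (-(2 * m))).tsum_eq]
  congr 1
  refine tsum_congr fun n => ?_
  have e1 : ((n + -(2 * m) : ℤ) : ZMod 2) = n := by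
    push_cast
    rw [show (2 : ZMod 2) = 0 from rfl]
    ring
  simp only [Equiv.coe_addRight, e1]
  congr 1
  refine integral_congr_ae (.of_forall fun z => ?_)
  have e2 : x - 2 * c * m - c * ((n + -(2 * m) : ℤ) : ℝ) = x - c * n := by push_cast; ring
  simp only [e2]
  rw [← mul_assoc, ← Complex.exp_add]
  congr 2
  push_cast
  ring

theorem integrable_bdd_mul {m : ℝ × ℝ → ℂ} (hm : Measurable m) {B : ℝ} (hB : ∀ z, ‖m z‖ ≤ B)
    (hf : Integrable f) : Integrable fun z => m z * f z :=
  hf.bdd_mul (c := B) hm.aestronglyMeasurable (.of_forall hB)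

theorem support_mul_subset {m : ℝ × ℝ → ℂ} {S : Set (ℝ × ℝ)} (hf : Function.support f ⊆ S) :
    Function.support (fun z => m z * f z) ⊆ S :=
  (Function.support_mul_subset_right m f).trans hf

/-- Multiplication of momentum-space wave functions by `cos (2 c p)`. -/
def momCos : L2 ℝ →L[ℂ] L2 ℝ := (1 / 2 : ℂ) •
  (phaseOp (fun x => -(2 * c * x)) (by fun_prop) + phaseOp (fun x => -(-(2 * c) * x)) (by fun_prop))

theorem coeFn_momCos (ψ : L2 ℝ) :
    momCos ψ =ᵐ[volume] fun y => ((Real.cos (2 * c * y) : ℝ) : ℂ) * ψ y := by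
  have e : momCos ψ = (1 / 2 : ℂ) • (phaseOp (fun x => -(2 * c * x)) (by fun_prop) ψ +
    phaseOp (fun x => -(-(2 * c) * x)) (by fun_prop) ψ) := rfl
  rw [e]
  filter_upwards [Lp.coeFn_smul (1 / 2 : ℂ) (phaseOp (fun x => -(2 * c * x)) (by fun_prop) ψ +
    phaseOp (fun x => -(-(2 * c) * x)) (by fun_prop) ψ),
    Lp.coeFn_add (phaseOp (fun x => -(2 * c * x)) (by fun_prop) ψ)
      (phaseOp (fun x => -(-(2 * c) * x)) (by fun_prop) ψ),
    coeFn_phaseOp (fun x => -(2 * c * x)) (by fun_prop) ψ,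
    coeFn_phaseOp (fun x => -(-(2 * c) * x)) (by fun_prop) ψ] with x h1 h2 h3 h4
  rw [h1, Pi.smul_apply, h2, Pi.add_apply, h3, h4, Complex.ofReal_cos, Complex.cos, smul_eq_mul]
  push_cast
  ring_nf

theorem fourierGate_phaseOp_apply (a : ℝ) (φ : L2 ℝ) :
    fourierGate (phaseOp (fun x => -(a * x)) (by fun_prop)
      (ContinuousLinearMap.adjoint fourierGate φ)) = translation a φ := by
  have h := congr($(translation_comp_fourierGate a) (ContinuousLinearMap.adjoint fourierGate φ))
  simp only [ContinuousLinearMap.comp_apply, fourierGate_adjoint_apply] at h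
  exact h.symm

/-- cos(2cp) is the mean of the translations by 2c and -2c, and these multiply the weight by e^{-2ic
z₂} and e^{2ic z₂}. -/
theorem gkpWave_momCos (hf : Integrable f) (hf' : Function.support f ⊆ patch) {φ : L2 ℝ}
    (hφ : φ =ᵐ[volume] gkpWave γ f) :
    fourierGate (momCos (ContinuousLinearMap.adjoint fourierGate φ)) =ᵐ[volume]
      gkpWave γ (fun z => ((Real.cos (2 * c * z.2) : ℝ) : ℂ) * f z) := by
  have e : fourierGate (momCos (ContinuousLinearMap.adjoint fourierGate φ)) =
      (1 / 2 : ℂ) • (translation (2 * c) φ + translation (-(2 * c)) φ) := by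
    rw [← fourierGate_phaseOp_apply, ← fourierGate_phaseOp_apply, ← map_add, ← map_smul]
    rfl
  have hs : ∀ m : ℤ, translation (2 * c * m) φ =ᵐ[volume]
      gkpWave γ (fun z => Complex.exp (((-(2 * c * m * z.2) : ℝ) : ℂ) * Complex.I) * f z) := by
    intro m
    filter_upwards [coeFn_translation (2 * c * m) φ,
      (measurePreserving_sub_right volume (2 * c * m)).quasiMeasurePreserving.ae hφ] with x h1 h2
    rw [h1, h2, gkpWave_sub]
  have h1 := hs 1
  have h2 := hs (-1)
  rw [show 2 * c * ((1 : ℤ) : ℝ) = 2 * c by push_cast; ring] at h1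
  rw [show 2 * c * ((-1 : ℤ) : ℝ) = -(2 * c) by push_cast; ring] at h2
  have hi : ∀ a : ℝ, Integrable fun z : ℝ × ℝ =>
      Complex.exp (((-(a * z.2) : ℝ) : ℂ) * Complex.I) * f z := fun a =>
    integrable_bdd_mul (by fun_prop) (fun z => (Complex.norm_exp_ofReal_mul_I _).le) hf
  rw [e]
  filter_upwards [Lp.coeFn_smul (1 / 2 : ℂ) (translation (2 * c) φ + translation (-(2 * c)) φ),
    Lp.coeFn_add (translation (2 * c) φ) (translation (-(2 * c)) φ), h1, h2,
    gkpWave_add (γ := γ) (hi (2 * c)) (hi (-(2 * c))) (support_mul_subset hf')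
      (support_mul_subset hf')] with x e1 e2 e3 e4 e5
  rw [e1, Pi.smul_apply, e2, Pi.add_apply, e3, e4, ← e5, smul_eq_mul, ← gkpWave_const_mul]
  congr 1
  funext z
  rw [Complex.ofReal_cos, Complex.cos]
  push_cast
  ring_nf

/-- The weight f is only integrable, so the L² synthesis map is not available. Instead polynomials
in cos(2cp) are transported to polynomials in cos(2c z₂) on the wave functions themselves, one
operator serving all weights. -/
theorem gkpWave_polynomial (p : Polynomial ℝ) : ∃ A : L2 ℝ →L[ℂ] L2 ℝ,
    (∀ ψ, A ψ =ᵐ[volume] fun y => ((p.eval (Real.cos (2 * c * y)) : ℝ) : ℂ) * ψ y) ∧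
    ∀ f : ℝ × ℝ → ℂ, Integrable f → Function.support f ⊆ patch → ∀ φ : L2 ℝ,
      φ =ᵐ[volume] gkpWave γ f →
      (Integrable fun z => ((p.eval (Real.cos (2 * c * z.2)) : ℝ) : ℂ) * f z) ∧
      fourierGate (A (ContinuousLinearMap.adjoint fourierGate φ)) =ᵐ[volume]
        gkpWave γ (fun z => ((p.eval (Real.cos (2 * c * z.2)) : ℝ) : ℂ) * f z) := by
  induction p using Polynomial.induction_on' with
  | add p q hp hq =>
    obtain ⟨A, h1, h2⟩ := hp
    obtain ⟨A', h1', h2'⟩ := hq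
    refine ⟨A + A', fun ψ => ?_, fun f hf hf' φ hφ => ?_⟩
    · filter_upwards [Lp.coeFn_add (A ψ) (A' ψ), h1 ψ, h1' ψ] with x e1 e2 e3
      rw [add_apply, e1, Pi.add_apply, e2, e3, Polynomial.eval_add]
      push_cast; ring
    · obtain ⟨hi, hw⟩ := h2 f hf hf' φ hφ
      obtain ⟨hi', hw'⟩ := h2' f hf hf' φ hφ
      simp only [Polynomial.eval_add, Complex.ofReal_add, add_mul]
      refine ⟨hi.add hi', ?_⟩
      rw [add_apply, map_add]
      filter_upwards [Lp.coeFn_add (fourierGate (A (ContinuousLinearMap.adjoint fourierGate φ)))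
        (fourierGate (A' (ContinuousLinearMap.adjoint fourierGate φ))), hw, hw',
        gkpWave_add (γ := γ) hi hi' (support_mul_subset hf') (support_mul_subset hf')]
        with x e1 e2 e3 e4
      rw [e1, Pi.add_apply, e2, e3, e4]
  | monomial n a =>
    induction n with
    | zero =>
      refine ⟨(a : ℂ) • ContinuousLinearMap.id ℂ (L2 ℝ), fun ψ => ?_, fun f hf hf' φ hφ => ?_⟩
      · filter_upwards [Lp.coeFn_smul (a : ℂ) ψ] with x e1
        refine e1.trans ?_
        simp
      · simp only [Polynomial.eval_monomial, pow_zero, mul_one]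
        refine ⟨hf.const_mul _, ?_⟩
        have e : fourierGate (((a : ℂ) • ContinuousLinearMap.id ℂ (L2 ℝ))
            (ContinuousLinearMap.adjoint fourierGate φ)) = (a : ℂ) • φ := by
          rw [smul_apply, map_smul, ContinuousLinearMap.id_apply, fourierGate_adjoint_apply]
        rw [e]
        filter_upwards [Lp.coeFn_smul (a : ℂ) φ, hφ] with x e1 e2
        rw [e1, Pi.smul_apply, e2, smul_eq_mul, gkpWave_const_mul]
    | succ n ih =>
      obtain ⟨A, h1, h2⟩ := ih
      refine ⟨momCos ∘L A, fun ψ => ?_, fun f hf hf' φ hφ => ?_⟩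
      · rw [ContinuousLinearMap.comp_apply]
        filter_upwards [coeFn_momCos (A ψ), h1 ψ] with x e1 e2
        rw [e1, e2]
        simp only [Polynomial.eval_monomial]
        push_cast; ring
      · obtain ⟨hi, hw⟩ := h2 f hf hf' φ hφ
        have e : ∀ z : ℝ × ℝ, (((Polynomial.monomial (n + 1) a).eval
            (Real.cos (2 * c * z.2)) : ℝ) : ℂ) * f z = ((Real.cos (2 * c * z.2) : ℝ) : ℂ) *
            ((((Polynomial.monomial n a).eval (Real.cos (2 * c * z.2)) : ℝ) : ℂ) * f z) := by
          intro z
          simp only [Polynomial.eval_monomial]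
          push_cast; ring
        simp only [e]
        refine ⟨integrable_bdd_mul (B := 1) (by fun_prop) (fun z => by
          rw [Complex.norm_real]; exact Real.abs_cos_le_one _) hi, ?_⟩
        have := gkpWave_momCos hi (support_mul_subset hf') hw
        rwa [adjoint_fourierGate_apply] at this

end Preparation

/-! ### Prepared vectors lie in the bins. -/

section PreparedVectors
variable {s : ℝ} {f : ℝ × ℝ → ℂ} {φ : L2 ℝ}

theorem square_subset_patch (hs : s ≤ c / 2) : Set.Ico (-s) s ×ˢ Set.Ico (-s) s ⊆ patch :=
  Set.prod_mono (Set.Ico_subset_Ico (by linarith) hs) (Set.Ico_subset_Ico (by linarith) hs)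

theorem ae_abs_sub_bin_ne (s : ℝ) : ∀ᵐ x : ℝ, |x - c * bin x| ≠ s := by
  have h : ∀ᵐ x : ℝ, |x| ≠ s := by
    have h1 : ∀ᵐ x : ℝ, x ≠ s := by rw [ae_iff]; simp
    have h2 : ∀ᵐ x : ℝ, x ≠ -s := by rw [ae_iff]; simp
    filter_upwards [h1, h2] with x e1 e2 e
    rcases eq_or_eq_neg_of_abs_eq e with e | e
    exacts [e1 e, e2 e]
  exact ae_shift h

theorem posOp_of_param (hs : s ≤ c / 2)
    (hf : Function.support f ⊆ Set.Ico (-s) s ×ˢ Set.Ico (-s) s)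
    (hφ : φ =ᵐ[volume] gkpWave (Pi.single 0 1) f) : posOp 0 s φ = φ := by
  refine Lp.ext ?_
  filter_upwards [coeFn_posOp 0 s φ, hφ, ae_abs_sub_bin_ne s] with x h1 h2 h3
  by_cases hx : x ∈ binSet 0 s
  · exact h1.1 hx
  · rw [h1.2 hx, h2, gkpWave_of_support (hf.trans (square_subset_patch hs))]
    by_cases hb : (bin x : ZMod 2) = 0
    · have h0 : ∀ z₂, f (x - c * bin x, z₂) = 0 := by
        intro z₂
        by_contra h
        have hz : x - c * bin x ∈ Set.Ico (-s) s := (hf h).1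
        exact hx ((mem_binSet_iff hs).2 ⟨hb, lt_of_le_of_ne (abs_le.2 ⟨hz.1, hz.2.le⟩) h3⟩)
      simp [h0]
    · rw [Pi.single_eq_of_ne hb, zero_mul, mul_zero]

theorem cos_two_c_le {w : ℝ} (hs : s ≤ c / 2) (hw : |w| ≤ s) :
    Real.cos (2 * c * s) ≤ Real.cos (2 * c * w) := by
  have hc := c_pos
  have h1 : 2 * c * s ≤ Real.pi := by rw [← c_mul_c]; nlinarith
  rw [← Real.cos_abs (2 * c * w), abs_mul, abs_of_pos (show 0 < 2 * c by positivity)]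
  exact Real.cos_le_cos_of_nonneg_of_le_pi (by positivity) h1
    (mul_le_mul_of_nonneg_left hw (by positivity))

theorem abs_le_of_cos_two_c_le {w : ℝ} (h0 : 0 ≤ s) (hw : |w| ≤ c / 2)
    (h : Real.cos (2 * c * s) ≤ Real.cos (2 * c * w)) : |w| ≤ s := by
  have hc := c_pos
  by_contra! hlt
  have h1 : 2 * c * |w| ≤ Real.pi := by rw [← c_mul_c]; nlinarith
  rw [← Real.cos_abs (2 * c * w), abs_mul, abs_of_pos (show 0 < 2 * c by positivity)] at h
  exact absurd h (not_le.2 (Real.cos_lt_cos_of_nonneg_of_le_pi (by positivity) h1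
    (mul_lt_mul_of_pos_left hlt (by positivity))))

theorem cos_two_c_sub (y : ℝ) : Real.cos (2 * c * (y - c * bin y)) = Real.cos (2 * c * y) := by
  have : 2 * c * (y - c * bin y) = 2 * c * y - bin y * (2 * Real.pi) := by rw [← c_mul_c]; ring
  rw [this, Real.cos_sub_int_mul_two_pi]

/-- A pointwise bound linear in the size of the multiplier on the support of f; it converts uniform
approximation of multipliers into pointwise convergence of wave functions. -/
theorem norm_gkpWave_mul_le {γ : ZMod 2 → ℂ} (hγ : ∀ μ, ‖γ μ‖ ≤ 1)
    (hf' : Function.support f ⊆ patch) {m : ℝ × ℝ → ℂ}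
    {ε : ℝ} (hm : ∀ z, f z ≠ 0 → ‖m z‖ ≤ ε) {x : ℝ}
    (hx : Integrable fun z₂ : ℝ => f (x - c * bin x, z₂)) :
    ‖gkpWave γ (fun z => m z * f z) x‖ ≤
      ε * (‖(√c : ℂ)⁻¹‖ * ∫ z₂ : ℝ, ‖f (x - c * bin x, z₂)‖) := by
  rw [gkpWave_of_support (support_mul_subset hf'), norm_mul, norm_mul, mul_left_comm ε]
  refine mul_le_mul_of_nonneg_left ?_ (norm_nonneg _)
  rw [← integral_const_mul]
  refine le_trans (mul_le_of_le_one_left (norm_nonneg _) (hγ _)) ?_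
  refine norm_integral_le_of_norm_le (hx.norm.const_mul ε) (.of_forall fun z => ?_)
  rw [norm_mul, Complex.norm_exp_ofReal_mul_I, one_mul, norm_mul]
  by_cases hz : f (x - c * bin x, z) = 0
  · simp [hz]
  · exact mul_le_mul_of_nonneg_right (hm _ hz) (norm_nonneg _)

theorem norm_fourierGate (ψ : L2 ℝ) : ‖fourierGate ψ‖ = ‖ψ‖ :=
  (ContinuousLinearMap.norm_map_iff_adjoint_comp_self fourierGate).2 adjoint_comp_fourierGate ψ

/-- Choose G continuous, zero on t ≥ cos(2cs) and positive below, and polynomials pₙ → G uniformly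
on [-1, 1]. Then pₙ(cos 2cp) φ tends to G(cos 2cp) φ in L². It is also the wave function with weight
pₙ(cos 2c z₂) f, which tends to zero pointwise because |z₂| ≤ s on the support. So G(cos 2cp) φ = 0.
-/
theorem adjoint_fourierGate_eq_zero (hs : s ≤ c / 2) (hfi : Integrable f)
    (hf : Function.support f ⊆ Set.Ico (-s) s ×ˢ Set.Ico (-s) s)
    (hφ : φ =ᵐ[volume] gkpWave (Pi.single 0 1) f) :
    ∀ᵐ y : ℝ, Real.cos (2 * c * y) < Real.cos (2 * c * s) →
      ContinuousLinearMap.adjoint fourierGate φ y = 0 := by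
  set ψ := ContinuousLinearMap.adjoint fourierGate φ with hψ
  set a := Real.cos (2 * c * s) with ha
  set G : ℝ → ℝ := fun t => max 0 (min 1 (a - t)) with hGdef
  have hG : Continuous G := by fun_prop
  have hb : ∀ t, |G t| ≤ 1 := fun t => by
    rw [abs_of_nonneg (le_max_left _ _)]
    exact max_le zero_le_one (min_le_left _ _)
  have hG0 : ∀ t, a ≤ t → G t = 0 := fun t ht =>
    max_eq_left ((min_le_right _ _).trans (by linarith))
  have hf' := hf.trans (square_subset_patch hs)
  have hγ : ∀ ν : ZMod 2, ‖(Pi.single 0 1 : ZMod 2 → ℂ) ν‖ ≤ 1 := fun ν => by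
    by_cases h : ν = 0
    · subst h; simp
    · simp [h]
  have hex : ∀ n : ℕ, ∃ p : Polynomial ℝ, ∀ t ∈ Set.Icc (-1 : ℝ) 1, |p.eval t - G t| < 1 / (n + 1) :=
    fun n => exists_polynomial_near_of_continuousOn (-1) 1 G hG.continuousOn _ (by positivity)
  choose p hp using hex
  choose A hA hA' using fun n => gkpWave_polynomial (γ := Pi.single 0 1) (p n)
  have hlim0 : Filter.Tendsto (fun n : ℕ => 1 / ((n : ℝ) + 1)) .atTop (nhds 0) :=
    tendsto_one_div_add_atTop_nhds_zero_nat
  set D := cosOp G hG.measurable hb (fun y => 2 * c * y) (by fun_prop) ψ with hD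
  have h1 : Filter.Tendsto (fun n => fourierGate (A n ψ)) .atTop (nhds (fourierGate D)) := by
    rw [tendsto_iff_norm_sub_tendsto_zero]
    refine squeeze_zero (fun n => norm_nonneg _) (fun n => ?_) (by
      have := hlim0.mul_const ‖ψ‖
      rwa [zero_mul] at this)
    rw [← map_sub, norm_fourierGate]
    exact norm_sub_cosOp_le hG.measurable hb (by fun_prop) (hp n) (hA n ψ)
  -- L² convergence gives almost everywhere convergence along a subsequence, enough for comparison
  -- with the pointwise limit.
  obtain ⟨ns, hns, h2⟩ := (tendstoInMeasure_of_tendsto_Lp h1).exists_seq_tendsto_ae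
  have h3 : fourierGate D = 0 := by
    refine Lp.ext ?_
    filter_upwards [h2, Lp.coeFn_zero ℂ 2 (volume : Measure ℝ), ae_integrable_slice hfi,
      ae_all_iff.2 fun n => (hA' n f hfi hf' φ hφ).2] with x e1 e2 e3 e4
    rw [e2]
    have e5 := (hlim0.comp hns.tendsto_atTop).mul_const
      (‖(√c : ℂ)⁻¹‖ * ∫ z₂ : ℝ, ‖f (x - c * bin x, z₂)‖)
    rw [zero_mul] at e5
    refine tendsto_nhds_unique e1 (squeeze_zero_norm (fun n => ?_) e5)
    rw [e4]
    refine norm_gkpWave_mul_le hγ hf' (fun z hz => ?_) e3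
    have hz2 : z.2 ∈ Set.Ico (-s) s := (hf hz).2
    have h5 := hp (ns n) (Real.cos (2 * c * z.2)) ⟨Real.neg_one_le_cos _, Real.cos_le_one _⟩
    rw [hG0 _ (cos_two_c_le hs (abs_le.2 ⟨hz2.1, hz2.2.le⟩)), sub_zero] at h5
    rw [Complex.norm_real]
    exact h5.le
  have h4 : D = 0 := by rw [← norm_eq_zero, ← norm_fourierGate, h3, norm_zero]
  filter_upwards [coeFn_mulOp (fun y : ℝ => ((G (Real.cos (2 * c * y)) : ℝ) : ℂ)) (by fun_prop)
    (fun x => by rw [Complex.norm_real]; exact hb _) ψ, Lp.coeFn_zero ℂ 2 (volume : Measure ℝ)]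
    with y e1 e2 hy
  have e3 : (D : ℝ → ℂ) y = G (Real.cos (2 * c * y)) * ψ y := e1
  rw [h4, e2] at e3
  have hpos : 0 < G (Real.cos (2 * c * y)) :=
    lt_max_of_lt_right (lt_min one_pos (sub_pos.2 hy))
  rcases mul_eq_zero.1 e3.symm with h | h
  · exact absurd (Complex.ofReal_eq_zero.1 h) hpos.ne'
  · exact h

/-- Where the momentum wave function does not vanish, cos(2cp) ≥ cos(2cs). As cos(2cp) has period c
in p, this places p within s of a multiple of c of either parity; equality happens on a null set. -/
theorem mem_supported_momOp_of_param (h0 : 0 ≤ s) (hs : s ≤ c / 2) (hfi : Integrable f)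
    (hf : Function.support f ⊆ Set.Ico (-s) s ×ˢ Set.Ico (-s) s)
    (hφ : φ =ᵐ[volume] gkpWave (Pi.single 0 1) f) : φ ∈ supported momOp s := by
  set ψ := ContinuousLinearMap.adjoint fourierGate φ with hψ
  have key : posOp 0 s ψ + posOp 1 s ψ = ψ := by
    refine Lp.ext ?_
    filter_upwards [Lp.coeFn_add (posOp 0 s ψ) (posOp 1 s ψ), coeFn_posOp 0 s ψ, coeFn_posOp 1 s ψ,
      adjoint_fourierGate_eq_zero hs hfi hf hφ, ae_abs_sub_bin_ne s, ae_abs_sub_bin_lt]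
      with y e1 e2 e3 e4 e5 e6
    rw [e1, Pi.add_apply]
    by_cases hy : ψ y = 0
    · have h1 : ∀ b, (y ∈ binSet b s → posOp b s ψ y = ψ y) ∧ (y ∉ binSet b s → posOp b s ψ y = 0) →
          posOp b s ψ y = 0 := fun b h => by
        by_cases hb : y ∈ binSet b s
        · rw [h.1 hb, hy]
        · exact h.2 hb
      rw [h1 0 e2, h1 1 e3, hy, add_zero]
    · have h1 : Real.cos (2 * c * s) ≤ Real.cos (2 * c * y) := not_lt.1 fun h => hy (e4 h)
      rw [← cos_two_c_sub y] at h1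
      have h2 := lt_of_le_of_ne (abs_le_of_cos_two_c_le h0 e6.le h1) e5
      rcases (by decide : ∀ b : ZMod 2, b = 0 ∨ b = 1) (bin y) with hb | hb
      · rw [e2.1 ((mem_binSet_iff hs).2 ⟨hb, h2⟩),
          e3.2 (fun h => zero_ne_one (hb.symm.trans ((mem_binSet_iff hs).1 h).1)), add_zero]
      · rw [e3.1 ((mem_binSet_iff hs).2 ⟨hb, h2⟩),
          e2.2 (fun h => one_ne_zero (hb.symm.trans ((mem_binSet_iff hs).1 h).1)), zero_add]
  rw [mem_supported]
  have := congr(fourierGate $key)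
  rwa [map_add, hψ, fourierGate_adjoint_apply] at this

/-- For s ≤ 0 the half-open square is empty, so the vector would be zero rather than normalized. -/
theorem IsParamGKPVector.pos (h : IsParamGKPVector (Pi.single 0 1) s φ) : 0 < s := by
  obtain ⟨h1, f, -, hf, hφ⟩ := h
  by_contra! hs
  have h0 : f = 0 := by
    rw [← Function.support_eq_empty_iff, ← Set.subset_empty_iff]
    rwa [Set.Ico_eq_empty (by linarith), Set.empty_prod] at hf
  have h2 : φ = 0 := by
    refine Lp.ext ?_
    filter_upwards [hφ, Lp.coeFn_zero ℂ 2 (volume : Measure ℝ)] with x e1 e2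
    rw [e1, e2, h0]
    simp [gkpWave]
  rw [h2, norm_zero] at h1
  exact zero_ne_one h1

/-- The square of the Fourier gate reflects positions, and bins are symmetric under reflection. -/
theorem fourierGate_comp_momOp (b : ZMod 2) {r : ℝ} (h0 : 0 ≤ r) (hr : r ≤ c) :
    fourierGate ∘L momOp b r = posOp b r ∘L fourierGate := by
  have hU : (fourierGate ∘L fourierGate) ∘L phaseOp (fun x => -(c * id x)) (by fun_prop) =
      phaseOp (fun x => -(c * -x)) (by fun_prop) ∘L fourierGate ∘L fourierGate := by
    have h1 := translation_comp_fourierGate c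
    have h2 := fourierGate_comp_translation c
    rw [phaseOp_congr (α := fun x : ℝ => -(c * -x)) _ (by fun_prop : Measurable fun x : ℝ => c * x)
      (by funext x; ring), ← ContinuousLinearMap.comp_assoc (phaseOp _ _), ← h2,
      ContinuousLinearMap.comp_assoc, ContinuousLinearMap.comp_assoc, h1]
    rfl
  have h := intertwine_binOp_of_neg (φ := id) (φ' := fun x => -x) measurable_id (by fun_prop)
    hU b h0 hr
  have e : (binOp (fun x => -x) (by fun_prop) b r : L2 ℝ →L[ℂ] L2 ℝ) = posOp b r := by
    rw [posOp, binOp, binOp]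
    exact indOp_congr _ _ (.of_forall fun x => neg_mem_binSet)
  rw [e] at h
  ext1 ψ
  have h2 := congr($h (ContinuousLinearMap.adjoint fourierGate ψ))
  simp only [ContinuousLinearMap.comp_apply, fourierGate_adjoint_apply] at h2
  exact h2

/-- The prepared approximations of the logical zero. -/
theorem IsParamGKPVector.supported (h : IsParamGKPVector (Pi.single 0 1) s φ) (hs : s ≤ c / 2) :
    φ ∈ supported posOp s ∧ φ ∈ supported momOp s ∧ logicalZ φ = φ := by
  have h0 := h.pos.le
  obtain ⟨-, f, hfi, hf, hφ⟩ := h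
  have h1 := posOp_of_param hs hf hφ
  refine ⟨isBinned_posOp.mem_supported_of_apply hs h1,
    mem_supported_momOp_of_param h0 hs hfi hf hφ, ?_⟩
  rw [← signOp_posOp, isBinned_posOp.signOp_of_apply hs h1, sgn_zero]
  simp

/-- The Fourier transforms of the prepared approximations of the logical zero. -/
theorem IsParamGKPVector.supported_fourierGate (h : IsParamGKPVector (Pi.single 0 1) s φ)
    (hs : s ≤ c / 2) : fourierGate φ ∈ GKP.supported posOp s ∧
      fourierGate φ ∈ GKP.supported momOp s ∧ logicalX (fourierGate φ) = fourierGate φ := by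
  have h0 := h.pos.le
  obtain ⟨-, f, hfi, hf, hφ⟩ := h
  have h1 : momOp 0 s (fourierGate φ) = fourierGate φ := by
    simp only [momOp, ContinuousLinearMap.comp_apply, adjoint_fourierGate_apply,
      posOp_of_param hs hf hφ]
  have h2 := mem_supported.1 (mem_supported_momOp_of_param h0 hs hfi hf hφ)
  refine ⟨?_, isBinned_momOp.mem_supported_of_apply hs h1, ?_⟩
  · rw [mem_supported]
    have e : ∀ b, posOp b s (fourierGate φ) = fourierGate (momOp b s φ) := fun b =>
      congr($(fourierGate_comp_momOp b h0 (hs.trans half_c_le)) φ).symm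
    rw [e, e, ← map_add, h2]
  · rw [← signOp_momOp, isBinned_momOp.signOp_of_apply hs h1, sgn_zero]
    simp

end PreparedVectors

/-! ### Algebra of the logical operators, and the central expectation value. -/

section LogicalAlgebra

theorem half_c_nonneg : 0 ≤ c / 2 := by have := c_pos; positivity

theorem measX_add : measX 0 + measX 1 = ContinuousLinearMap.id ℂ (L2 ℝ) := by
  ext1 f
  have h := congr(fourierGate ($measZ_add (ContinuousLinearMap.adjoint fourierGate f)))
  rw [add_apply, map_add, ContinuousLinearMap.id_apply, fourierGate_adjoint_apply] at h
  exact h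

theorem eq_halfOp_of_add {E : Type} [NormedAddCommGroup E] [InnerProductSpace ℂ E]
    [CompleteSpace E] {M : ZMod 2 → E →L[ℂ] E} (h : M 0 + M 1 = ContinuousLinearMap.id ℂ E)
    (b : ZMod 2) : M b = halfOp (sgn b) (M 0 - M 1) := by
  rw [halfOp, ← h]
  rcases (by decide : ∀ b : ZMod 2, b = 0 ∨ b = 1) b with rfl | rfl
  · rw [sgn_zero]; push_cast; module
  · rw [sgn_one]; push_cast; module

theorem measZ_eq_halfOp (b : ZMod 2) : measZ b = halfOp (sgn b) logicalZ :=
  eq_halfOp_of_add measZ_add b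

theorem measX_eq_halfOp (a : ZMod 2) : measX a = halfOp (sgn a) logicalX :=
  eq_halfOp_of_add measX_add a

theorem sub_apply_sub_apply {E : Type} [NormedAddCommGroup E] [InnerProductSpace ℂ E]
    {P : ZMod 2 → ℝ → E →L[ℂ] E} (hP : IsBinned P)
    (h : P 0 (c / 2) + P 1 (c / 2) = ContinuousLinearMap.id ℂ E) (v : E) :
    signOp P (signOp P v) = v := by
  have e : ∀ b, signOp P (P b (c / 2) v) = (sgn b : ℂ) • P b (c / 2) v := fun b =>
    hP.signOp_of_apply le_rfl (hP.apply_apply b _ v)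
  have h1 : signOp P v = P 0 (c / 2) v - P 1 (c / 2) v := rfl
  rw [h1, map_sub, e, e, sgn_zero, sgn_one]
  have h2 : P 0 (c / 2) v + P 1 (c / 2) v = v := congr($h v)
  nth_rewrite 3 [← h2]
  push_cast
  module

theorem logicalZ_logicalZ (v : L2 ℝ) : logicalZ (logicalZ v) = v := by
  rw [← signOp_posOp]
  exact sub_apply_sub_apply isBinned_posOp (by rw [← measZ_eq, ← measZ_eq, measZ_add]) v

theorem logicalX_logicalX (v : L2 ℝ) : logicalX (logicalX v) = v := by
  rw [← signOp_momOp]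
  exact sub_apply_sub_apply isBinned_momOp (by rw [← measX_eq, ← measX_eq, measX_add]) v

theorem logicalX_logicalZ (v : L2 ℝ) : logicalX (logicalZ v) = -logicalZ (logicalX v) := by
  have h : ∀ b, logicalX (measZ b v) = measZ (b + 1) (logicalX v) := fun b => by
    rw [measZ_eq, measZ_eq]
    exact congr($(logicalX_comp_posOp b half_c_nonneg half_c_le) v)
  rw [show logicalZ v = measZ 0 v - measZ 1 v from rfl, map_sub, h, h,
    show logicalZ (logicalX v) = measZ 0 (logicalX v) - measZ 1 (logicalX v) from rfl, zero_add,
    show (1 + 1 : ZMod 2) = 0 from rfl, neg_sub]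

theorem adjoint_logicalZ : ContinuousLinearMap.adjoint logicalZ = logicalZ := by
  rw [logicalZ, map_sub, measZ_eq, measZ_eq, adjoint_posOp, adjoint_posOp]

theorem adjoint_logicalX : ContinuousLinearMap.adjoint logicalX = logicalX := by
  rw [logicalX, map_sub, measX_eq, measX_eq, adjoint_momOp, adjoint_momOp]

/-- Anticommutation of X and Z makes the expectation value equal to its own negative. -/
theorem inner_logicalZ_of_logicalX {w : L2 ℝ} (hw : logicalX w = w) :
    inner ℂ w (logicalZ w) = 0 := by
  have h : inner ℂ w (logicalZ w) = -inner ℂ w (logicalZ w) := by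
    nth_rewrite 1 [← hw]
    rw [← ContinuousLinearMap.adjoint_inner_right, adjoint_logicalX, logicalX_logicalZ, hw,
      inner_neg_right]
  exact self_eq_neg.1 h

theorem inner_logicalX_of_logicalZ {u : L2 ℝ} (hu : logicalZ u = u) :
    inner ℂ u (logicalX u) = 0 := by
  have h : inner ℂ u (logicalX u) = -inner ℂ u (logicalX u) := by
    nth_rewrite 1 [← hu]
    rw [← ContinuousLinearMap.adjoint_inner_right, adjoint_logicalZ]
    have := logicalX_logicalZ u
    rw [hu] at this
    rw [neg_eq_iff_eq_neg.1 this.symm, inner_neg_right]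
  exact self_eq_neg.1 h

theorem zOn_zero_tmul (f g k : L2 ℝ) : zOn 0 (tmul (tmul f g) k) = tmul (tmul (logicalZ f) g) k :=
  on1_tmul _ _ _ _

theorem zOn_one_tmul (f g k : L2 ℝ) : zOn 1 (tmul (tmul f g) k) = tmul (tmul f (logicalZ g)) k :=
  on2_tmul _ _ _ _

theorem zOn_two_tmul (f g k : L2 ℝ) : zOn 2 (tmul (tmul f g) k) = tmul (tmul f g) (logicalZ k) :=
  on3_tmul _ _ _ _

theorem xOn_zero_tmul (f g k : L2 ℝ) : xOn 0 (tmul (tmul f g) k) = tmul (tmul (logicalX f) g) k :=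
  on1_tmul _ _ _ _

theorem xOn_one_tmul (f g k : L2 ℝ) : xOn 1 (tmul (tmul f g) k) = tmul (tmul f (logicalX g)) k :=
  on2_tmul _ _ _ _

theorem xOn_two_tmul (f g k : L2 ℝ) : xOn 2 (tmul (tmul f g) k) = tmul (tmul f g) (logicalX k) :=
  on3_tmul _ _ _ _

/-- `e ^ γ`. -/
def powSign (γ : ZMod 2) (e : ℝ) : ℝ := if γ = 0 then 1 else e

/-- Expand the three projections. A term survives only if it contains an even number of factors Z on
the second mode and an even number of factors X on the third. For γ = 0 this selects 1 and the
product of Z₁Z₂ with Z₂Z₃, which acts as (-1)^{ν+b} Z₁. For γ = 1 the term of X₁X₂X₃ must cancel the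
extra X₃, which leaves X₁ and the sign (-1)^a. One factor 1/2 remains in the projection on v, and
the other two give 1/4. -/
theorem inner_prodOp_tmul (a b ν γ : ZMod 2) {v w u : L2 ℝ} (hw : logicalX w = w)
    (hu : logicalZ u = u) :
    inner ℂ (tmul (tmul v w) u) (prodOp a b ν γ (xOn 0 ∘L xOn 1 ∘L xOn 2) (zOn 0 ∘L zOn 1)
      (zOn 1 ∘L zOn 2) (xOn 2) (tmul (tmul v w) u)) =
    (1 / 4 * powSign γ (sgn a) : ℂ) * inner ℂ v (halfOp (sgn (ν + b)) logicalZ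
      (powOp γ logicalX v)) * inner ℂ w w * inner ℂ u u := by
  have hwZ := inner_logicalZ_of_logicalX hw
  have huX := inner_logicalX_of_logicalZ hu
  have hwXZ : logicalX (logicalZ w) = -logicalZ w := by rw [logicalX_logicalZ, hw]
  have huZX : logicalZ (logicalX u) = -logicalX u := by
    rw [← neg_eq_iff_eq_neg, ← logicalX_logicalZ, hu]
  have hs := sgn_add ν b
  rcases (by decide : ∀ b : ZMod 2, b = 0 ∨ b = 1) γ with rfl | rfl
  · simp only [prodOp, halfOp, powOp, powSign, if_true, ContinuousLinearMap.comp_apply,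
      ContinuousLinearMap.id_apply, smul_apply, add_apply, map_add, map_smul, zOn_zero_tmul,
      zOn_one_tmul, zOn_two_tmul, xOn_zero_tmul, xOn_one_tmul, xOn_two_tmul, hw, hu, hwXZ,
      logicalZ_logicalZ, inner_add_right, inner_smul_right, inner_tmul, hwZ, huX, hs,
      inner_neg_right]
    push_cast
    ring
  · simp only [prodOp, halfOp, powOp, powSign, one_ne_zero, if_false, ContinuousLinearMap.comp_apply,
      ContinuousLinearMap.id_apply, smul_apply, add_apply, map_add, map_smul, map_neg, zOn_zero_tmul,
      zOn_one_tmul, zOn_two_tmul, xOn_zero_tmul, xOn_one_tmul, xOn_two_tmul, hw, hwXZ, huZX,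
      logicalZ_logicalZ, logicalX_logicalX, inner_add_right, inner_smul_right, inner_tmul, hwZ, huX,
      hs, inner_neg_right, logicalX_logicalZ v]
    push_cast
    ring

end LogicalAlgebra

/-! ### Traces of tracked states under tensor products and partial traces. -/

section Traces
variable {X Y : Type} [MeasureSpace X] [MeasureSpace Y]
  [SigmaFinite (volume : Measure X)] [SigmaFinite (volume : Measure Y)]

theorem IsTracked.opTensor {σ : L2 X →L[ℂ] L2 X} {τ : L2 Y →L[ℂ] L2 Y} {G : Submodule ℂ (L2 X)}
    {G' : Submodule ℂ (L2 Y)} {K : Submodule ℂ (L2 (X × Y))} (hσ : IsTracked σ G)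
    (hτ : IsTracked τ G') (h : ∀ v ∈ G, ∀ w ∈ G', tmul v w ∈ K) :
    IsTracked (GKP.opTensor σ τ) K := by
  obtain ⟨ι, v, hv, hG⟩ := hσ
  obtain ⟨κ, w, hw, hG'⟩ := hτ
  exact ⟨ι × κ, _, hv.opTensor hw, fun p => h _ (hG _) _ (hG' _)⟩

theorem IsTracked.partialTraceLeft {σ : L2 (X × Y) →L[ℂ] L2 (X × Y)}
    {G : Submodule ℂ (L2 (X × Y))} {G' : Submodule ℂ (L2 Y)} (h : IsTracked σ G)
    (hG : ∀ Φ ∈ G, ∀ f : L2 X, ContinuousLinearMap.adjoint (tmulLeft f) Φ ∈ G') :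
    IsTracked (GKP.partialTraceLeft σ) G' := by
  obtain ⟨ι, v, hv, hvG⟩ := h
  exact ⟨ι × onbIndex (L2 X), _, hv.partialTraceLeft, fun p => hG _ (hvG _) _⟩

theorem IsTracked.mono {E : Type} [NormedAddCommGroup E] [InnerProductSpace ℂ E] [CompleteSpace E]
    {σ : E →L[ℂ] E} {G G' : Submodule ℂ E} (h : IsTracked σ G) (hG : G ≤ G') : IsTracked σ G' := by
  obtain ⟨ι, v, hv, hvG⟩ := h
  exact ⟨ι, v, hv, fun i => hG (hvG i)⟩

theorem IsTracked.conj_eq_self {E : Type} [NormedAddCommGroup E] [InnerProductSpace ℂ E]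
    [CompleteSpace E] {σ : E →L[ℂ] E} {G : Submodule ℂ E} (h : IsTracked σ G) {A : E →L[ℂ] E}
    (hA : ∀ v ∈ G, A v = v) : GKP.conj A σ = σ := by
  obtain ⟨ι, v, hv, hvG⟩ := h
  have h2 := (hv.conj A).2
  simp only [fun i => hA _ (hvG i)] at h2
  exact h2.unique hv.2

/-- Slicing is a trace-preserving family and O passes through each slice, so the partial trace is
dual to O ↦ 1 ⊗ O. -/
theorem opTrace_partialTraceLeft {σ : L2 (X × Y) →L[ℂ] L2 (X × Y)} (h : IsTracked σ ⊤)
    (O : L2 Y →L[ℂ] L2 Y) : opTrace (O ∘L partialTraceLeft σ) =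
      opTrace (opTensor (ContinuousLinearMap.id ℂ (L2 X)) O ∘L σ) := by
  obtain ⟨ι, v, hv, -⟩ := h
  rw [hv.partialTraceLeft.opTrace_comp, hv.opTrace_comp]
  exact expect_kraus hv.1 isTracePreserving_slice fun i j => (slice_opTensor _ _ _).symm

theorem opTrace_conj {E : Type} [NormedAddCommGroup E] [InnerProductSpace ℂ E] [CompleteSpace E]
    {σ : E →L[ℂ] E} (h : IsTracked σ ⊤) (A O : E →L[ℂ] E) :
    opTrace (O ∘L conj A σ) = opTrace ((ContinuousLinearMap.adjoint A ∘L O ∘L A) ∘L σ) := by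
  obtain ⟨ι, v, hv, -⟩ := h
  rw [(hv.conj A).opTrace_comp, hv.opTrace_comp, expect, expect]
  refine tsum_congr fun i => ?_
  rw [ContinuousLinearMap.comp_apply, ContinuousLinearMap.adjoint_inner_right]
  rfl

theorem opTrace_opTensor {σ : L2 X →L[ℂ] L2 X} {τ : L2 Y →L[ℂ] L2 Y} {G : Submodule ℂ (L2 X)}
    {G' : Submodule ℂ (L2 Y)} (hσ : IsTracked σ G) (hτ : IsTracked τ G')
    (A : L2 X →L[ℂ] L2 X) (B : L2 Y →L[ℂ] L2 Y) :
    opTrace (opTensor A B ∘L opTensor σ τ) = opTrace (A ∘L σ) * opTrace (B ∘L τ) := by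
  obtain ⟨ι, v, hv, -⟩ := hσ
  obtain ⟨κ, w, hw, -⟩ := hτ
  have hA := summable_inner_of_sq hv.1 (hv.conj A).1
  have hB := summable_inner_of_sq hw.1 (hw.conj B).1
  rw [(hv.opTensor hw).opTrace_comp, hv.opTrace_comp, hw.opTrace_comp, expect, expect, expect,
    tsum_mul_tsum_of_summable_norm hA.norm hB.norm]
  refine tsum_congr fun p => ?_
  rw [opTensor_tmul, inner_tmul]

end Traces

/-! ### Decoder entries as traces against logical operators. -/

section Decoder

theorem sssSynth_comp_adjoint_eq (μ ν : ZMod 2) :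
    sssSynth ν ∘L ContinuousLinearMap.adjoint (sssSynth μ) =
      measZ ν ∘L powOp (μ + ν) logicalX := by
  by_cases h : μ = ν
  · subst h
    rw [powOp, if_pos (CharTwo.add_self_eq_zero μ), sssSynth_comp_adjoint,
      ContinuousLinearMap.comp_id]
  · have h1 : μ = ν + 1 := (by decide : ∀ μ ν : ZMod 2, μ ≠ ν → μ = ν + 1) μ ν h
    have h2 : μ + ν ≠ 0 := (by decide : ∀ μ ν : ZMod 2, μ ≠ ν → μ + ν ≠ 0) μ ν h
    rw [powOp, if_neg h2, h1, sssSynth_comp_adjoint_add_one]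

/-- Cyclicity of the trace brings the synthesis map for ν next to the adjoint of that for μ;
completeness evaluates the product. -/
theorem gkpDecoder_apply {τ : L2 ℝ →L[ℂ] L2 ℝ} (h : IsTracked τ ⊤) (μ ν : ZMod 2) :
    gkpDecoder τ μ ν = opTrace ((halfOp (sgn ν) logicalZ ∘L powOp (μ + ν) logicalX) ∘L τ) := by
  obtain ⟨ι, v, hv, -⟩ := h
  rw [hv.opTrace_comp, ← measZ_eq_halfOp, ← sssSynth_comp_adjoint_eq]
  exact hv.opTrace_eq _ _

theorem IsRep.map_halfOp {E F : Type} [NormedAddCommGroup E] [InnerProductSpace ℂ E]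
    [CompleteSpace E] [NormedAddCommGroup F] [InnerProductSpace ℂ F] [CompleteSpace F]
    {π : (E →L[ℂ] E) → (F →L[ℂ] F)} (h : IsRep π) (a : ℝ) (O : E →L[ℂ] E) :
    π (halfOp a O) = halfOp a (π O) := by
  rw [halfOp, h.map_smul, h.map_add, h.map_id, h.map_smul]; rfl

theorem IsRep.map_powOp {E F : Type} [NormedAddCommGroup E] [InnerProductSpace ℂ E]
    [CompleteSpace E] [NormedAddCommGroup F] [InnerProductSpace ℂ F] [CompleteSpace F]
    {π : (E →L[ℂ] E) → (F →L[ℂ] F)} (h : IsRep π) (γ : ZMod 2) (O : E →L[ℂ] E) :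
    π (powOp γ O) = powOp γ (π O) := by
  unfold powOp
  split_ifs
  · exact h.map_id
  · rfl

theorem measX_measX (a : ZMod 2) : measX a ∘L measX a = measX a := by
  rw [measX_eq]; exact isBinned_momOp.mono a le_rfl

theorem measZ_measZ (b : ZMod 2) : measZ b ∘L measZ b = measZ b := by
  rw [measZ_eq]; exact isBinned_posOp.mono b le_rfl

/-- The projection onto the outcomes `a`, `b` of the two measurements. -/
def measOp (a b : ZMod 2) : H₃ →L[ℂ] H₃ := on1 (measX a) ∘L on2 (measZ b)

theorem measOp_eq (a b : ZMod 2) :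
    measOp a b = opTensor (opTensor (measX a) (measZ b)) (ContinuousLinearMap.id ℂ (L2 ℝ)) := by
  rw [measOp, on1, on2, opTensor_comp, opTensor_comp]
  simp

theorem adjoint_measOp (a b : ZMod 2) : ContinuousLinearMap.adjoint (measOp a b) = measOp a b := by
  rw [measOp_eq, adjoint_opTensor, adjoint_opTensor, measX_eq, measZ_eq, adjoint_momOp,
    adjoint_posOp, ContinuousLinearMap.adjoint_id]

theorem measOp_comp_self (a b : ZMod 2) : measOp a b ∘L measOp a b = measOp a b := by
  rw [measOp_eq, opTensor_comp, opTensor_comp, measX_measX, measZ_measZ,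
    ContinuousLinearMap.id_comp]

theorem measOp_comp_on3 (a b : ZMod 2) (A : L2 ℝ →L[ℂ] L2 ℝ) :
    measOp a b ∘L on3 A = on3 A ∘L measOp a b := by
  rw [measOp_eq]
  exact on12_comp_on3 _ _

/-- The measurement projections are idempotent, self-adjoint and commute with mode 3, so conjugation
by them amounts to one factor in the observable. -/
theorem gkpDecoder_partialTraceLeft {σ : H₃ →L[ℂ] H₃} (h : IsTracked σ ⊤) (a b μ ν : ZMod 2) :
    gkpDecoder (partialTraceLeft (conj (on1 (measX a) ∘L on2 (measZ b)) σ)) μ ν =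
      opTrace (prodOp a b ν (μ + ν) (xOn 0) (zOn 1) (zOn 2) (xOn 2) ∘L σ) := by
  have h1 : IsTracked (conj (measOp a b) σ) ⊤ := h.conj fun _ _ => Submodule.mem_top
  have h2 : IsTracked (partialTraceLeft (conj (measOp a b) σ)) ⊤ :=
    h1.partialTraceLeft fun _ _ _ => Submodule.mem_top
  rw [← measOp, gkpDecoder_apply h2, opTrace_partialTraceLeft h1, opTrace_conj h, adjoint_measOp]
  congr 2
  rw [← on3, ← ContinuousLinearMap.comp_assoc, measOp_comp_on3, ContinuousLinearMap.comp_assoc,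
    measOp_comp_self, ← measOp_comp_on3, measOp, measX_eq_halfOp, measZ_eq_halfOp,
    isRep_on1.map_halfOp, isRep_on2.map_halfOp, isRep_on3.map_comp, isRep_on3.map_halfOp,
    isRep_on3.map_powOp, prodOp, show xOn 0 = on1 logicalX from rfl,
    show zOn 1 = on2 logicalZ from rfl, show zOn 2 = on3 logicalZ from rfl,
    show xOn 2 = on3 logicalX from rfl, ContinuousLinearMap.comp_assoc]

end Decoder

/-! ### The Pauli frame in matrix entries. -/

section PauliFrame

theorem pauliZ_pow (a : ZMod 2) :
    pauliZ ^ a.val = Matrix.diagonal fun μ => ((powSign μ (sgn a) : ℝ) : ℂ) := by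
  rcases (by decide : ∀ b : ZMod 2, b = 0 ∨ b = 1) a with rfl | rfl
  · rw [ZMod.val_zero, pow_zero, ← Matrix.diagonal_one]
    congr 1
    funext μ
    simp [powSign, sgn_zero]
  · rw [ZMod.val_one, pow_one, pauliZ]
    congr 1
    funext μ
    rcases (by decide : ∀ b : ZMod 2, b = 0 ∨ b = 1) μ with rfl | rfl
    · simp [powSign]
    · simp [powSign, sgn_one, ZMod.val_one]

theorem pauliX_pow (b : ZMod 2) :
    pauliX ^ b.val = Matrix.of fun μ ν => if μ + b = ν then (1 : ℂ) else 0 := by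
  ext μ ν
  rcases (by decide : ∀ b : ZMod 2, b = 0 ∨ b = 1) b with rfl | rfl
  · rw [ZMod.val_zero, pow_zero, Matrix.of_apply, add_zero, Matrix.one_apply]
  · rw [ZMod.val_one, pow_one, pauliX, Matrix.of_apply, Matrix.of_apply]
    simp only [(by decide : ∀ μ ν : ZMod 2, μ = ν + 1 ↔ μ + 1 = ν) μ ν]

theorem pauliFrame_apply (a b μ ν : ZMod 2) :
    pauliFrame a b μ ν = if μ + b = ν then ((powSign ν (sgn a) : ℝ) : ℂ) else 0 := by
  rw [pauliFrame, pauliX_pow, pauliZ_pow, Matrix.mul_diagonal, Matrix.of_apply]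
  split_ifs <;> simp

theorem powSign_mul (a b μ ν : ZMod 2) : powSign (μ + b) (sgn a) * powSign (ν + b) (sgn a) =
    powSign (μ + ν) (sgn a) := by
  have h := sgn_mul_self a
  rcases (by decide : ∀ b : ZMod 2, b = 0 ∨ b = 1) b with rfl | rfl <;>
  rcases (by decide : ∀ b : ZMod 2, b = 0 ∨ b = 1) μ with rfl | rfl <;>
  rcases (by decide : ∀ b : ZMod 2, b = 0 ∨ b = 1) ν with rfl | rfl <;>
  simp [powSign, show (1 + 1 : ZMod 2) = 0 from rfl, h]

/-- The frame is a signed permutation: conjugation shifts both indices by b, and the two signs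
combine into one that depends on μ + ν only, as the shifts by b cancel modulo 2. -/
theorem pauliFrame_conj_apply (a b μ ν : ZMod 2) (D : Matrix (ZMod 2) (ZMod 2) ℂ) :
    (pauliFrame a b * D * (pauliFrame a b).conjTranspose) μ ν =
      powSign (μ + ν) (sgn a) * D (μ + b) (ν + b) := by
  rw [← powSign_mul a b]
  simp only [Matrix.mul_apply, Matrix.conjTranspose_apply, pauliFrame_apply, ite_mul, zero_mul,
    Finset.sum_ite_eq, Finset.mem_univ, if_true, apply_ite star, star_zero, mul_ite, mul_zero]
  rw [Complex.star_def, Complex.conj_ofReal]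
  push_cast
  ring

theorem pauliFrame_conjTranspose_mul (a b : ZMod 2) :
    (pauliFrame a b).conjTranspose * pauliFrame a b = 1 := by
  have h : pauliFrame a b * (pauliFrame a b).conjTranspose = 1 := by
    ext μ ν
    have := pauliFrame_conj_apply a b μ ν 1
    rw [mul_one] at this
    rw [this, Matrix.one_apply, Matrix.one_apply]
    by_cases hμ : μ = ν
    · subst hμ
      simp [powSign, CharTwo.add_self_eq_zero]
    · rw [if_neg hμ, if_neg fun h => hμ (add_right_cancel h), mul_zero]
  exact mul_eq_one_comm.1 h

end PauliFrame

/-! ### The range of the filter. -/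

section Filter

/-- For r ≤ c/2 both filters are cut-offs in the independent syndrome coordinates z₁ and z₂, hence
they commute. -/
theorem posFilter_comp_momFilter {r : ℝ} (h0 : 0 ≤ r) (hr : r ≤ c / 2) :
    posFilter r ∘L momFilter r = momFilter r ∘L posFilter r := by
  have hbox : fstBox r ∘L sndBox r = sndBox r ∘L fstBox r := by
    rw [fstBox, sndBox, indOp_comp, indOp_comp]
    exact indOp_congr _ _ (.of_forall fun z => and_comm)
  have h : ∀ μ, posFilter r ∘L momFilter r ∘L measZ μ = momFilter r ∘L posFilter r ∘L measZ μ := by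
    intro μ
    rw [← sssSynth_comp_adjoint μ]
    have e : posFilter r ∘L momFilter r ∘L sssSynth μ = momFilter r ∘L posFilter r ∘L sssSynth μ := by
      rw [momFilter_comp_sssSynth h0 hr, posFilter_comp_sssSynth hr,
        ← ContinuousLinearMap.comp_assoc, ← ContinuousLinearMap.comp_assoc,
        momFilter_comp_sssSynth h0 hr, posFilter_comp_sssSynth hr, ContinuousLinearMap.comp_assoc,
        ContinuousLinearMap.comp_assoc, hbox]
    exact congrArg (· ∘L ContinuousLinearMap.adjoint (sssSynth μ)) e
  have h2 := congrArg₂ (· + ·) (h 0) (h 1)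
  simpa only [← ContinuousLinearMap.comp_add, measZ_add, ContinuousLinearMap.comp_id] using h2

theorem IsBinned.filterOp_mem {E : Type} [NormedAddCommGroup E] [InnerProductSpace ℂ E]
    {P : ZMod 2 → ℝ → E →L[ℂ] E} (hP : IsBinned P) {r : ℝ} (hr : r ≤ c / 2) (v : E) :
    filterOp P r v ∈ supported P r :=
  add_mem (hP.mem_supported_of_apply hr (hP.apply_apply 0 r v))
    (hP.mem_supported_of_apply hr (hP.apply_apply 1 r v))

theorem sssFilter_mem {r : ℝ} (h0 : 0 ≤ r) (hr : r ≤ c / 2) (v : L2 ℝ) :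
    sssFilter r v ∈ supported posOp r ⊓ supported momOp r := by
  refine ⟨?_, ?_⟩
  · rw [sssFilter_eq h0 hr]
    exact isBinned_posOp.filterOp_mem hr _
  · rw [sssFilter_eq h0 hr, posFilter_comp_momFilter h0 hr]
    exact isBinned_momOp.filterOp_mem hr _

theorem sssFilter_of_mem {r : ℝ} (h0 : 0 ≤ r) (hr : r ≤ c / 2) {v : L2 ℝ}
    (hv : v ∈ supported posOp r ⊓ supported momOp r) : sssFilter r v = v := by
  rw [sssFilter_eq h0 hr, ContinuousLinearMap.comp_apply,
    show momFilter r v = v from hv.2, show posFilter r v = v from hv.1]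

end Filter

/-! ### Single locations: noise channels and preparations. -/

section Locations

/-- The closed span of the empty set is zero, and zero Kraus operators do not preserve norms. This
is how the noise strengths are seen to be nonnegative. -/
theorem NoiseChannel.nonempty {E : Type} [NormedAddCommGroup E] [InnerProductSpace ℂ E]
    [CompleteSpace E] {S : Set (E →L[ℂ] E)} (N : NoiseChannel S) {ψ : E} (hψ : ‖ψ‖ = 1) :
    S.Nonempty := by
  by_contra hS
  rw [Set.not_nonempty_iff_eq_empty] at hS
  have h0 : ∀ j, N.op j = 0 := fun j => by
    have := comp_eq_zero_of_mem_closedSpan (A := ContinuousLinearMap.id ℂ E)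
      (B := ContinuousLinearMap.id ℂ E) (fun V hV => by rw [hS] at hV; exact hV.elim) (N.mem j)
    simpa using this
  have h1 := N.trace_preserving ψ
  simp only [h0, zero_apply, norm_zero, hψ] at h1
  have h2 : (fun _ : ℕ => (0 : ℝ) ^ 2) = fun _ => 0 := by funext; norm_num
  rw [h2] at h1
  have h3 := h1.unique hasSum_zero
  norm_num at h3

theorem nonneg_of_mem_smallDisp {s : ℝ} {V : L2 ℝ →L[ℂ] L2 ℝ} (h : V ∈ smallDisp s) : 0 ≤ s := by
  obtain ⟨z, hz, -⟩ := h
  linarith [hz.1, hz.2]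

theorem NoiseChannel.nonneg {s : ℝ} (N : NoiseChannel (smallDisp s)) {ψ : L2 ℝ} (hψ : ‖ψ‖ = 1) :
    0 ≤ s := by
  obtain ⟨V, hV⟩ := N.nonempty hψ
  exact nonneg_of_mem_smallDisp hV

theorem NoiseChannel.nonneg₂ {s : ℝ} (N : NoiseChannel (smallDisp₂ s)) {ψ : L2 ℝ} (hψ : ‖ψ‖ = 1) :
    0 ≤ s := by
  obtain ⟨V, A, hA, -⟩ := N.nonempty (ψ := tmul ψ ψ) (by rw [norm_tmul, hψ, mul_one])
  exact nonneg_of_mem_smallDisp hA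

/-- The vectors fixed by an operator. -/
def fixed (A : L2 ℝ →L[ℂ] L2 ℝ) : Submodule ℂ (L2 ℝ) :=
  LinearMap.eqLocus A.toLinearMap LinearMap.id

/-- The vectors whose position and momentum are within `s` of multiples of `c`. -/
def near (s : ℝ) : Submodule ℂ (L2 ℝ) := supported posOp s ⊓ supported momOp s

variable {s s' : ℝ}

theorem map_near {K : L2 ℝ →L[ℂ] L2 ℝ} (hK : K ∈ closedSpan (smallDisp s')) (h0 : 0 ≤ s)
    (hs : s ≤ c / 2) (hs' : s + s' ≤ c / 2) {v : L2 ℝ} (hv : v ∈ near s) :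
    K v ∈ near (s + s') ∧ logicalX (K v) = K (logicalX v) := by
  have h1 := (carries_posOp hK h0 (hs.trans half_c_le)).map_supported isBinned_posOp isBinned_posOp
    hs hs' hv.1
  have h2 := (carries_momOp hK h0 (hs.trans half_c_le)).map_supported isBinned_momOp isBinned_momOp
    hs hs' hv.2
  rw [signOp_momOp] at h2
  exact ⟨⟨h1.1, h2.1⟩, h2.2⟩

variable (P : Preparation (Pi.single 0 1) s)

theorem Preparation.isTracked (hs : s ≤ c / 2) : IsTracked P.state (near s ⊓ fixed logicalZ) :=
  ⟨ℕ, _, P.isEnsemble, fun i => Submodule.smul_mem _ _ <| by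
    obtain ⟨h1, h2, h3⟩ := (P.vec_param i).supported hs
    exact ⟨⟨h1, h2⟩, h3⟩⟩

theorem Preparation.isTracked_fourierGate (hs : s ≤ c / 2) :
    IsTracked (conj fourierGate P.state) (near s ⊓ fixed logicalX) :=
  ⟨ℕ, _, P.isEnsemble.conj fourierGate, fun i => by
    obtain ⟨h1, h2, h3⟩ := (P.vec_param i).supported_fourierGate hs
    rw [map_smul]
    exact Submodule.smul_mem _ _ ⟨⟨h1, h2⟩, h3⟩⟩

theorem Preparation.opTrace_state : opTrace (ContinuousLinearMap.id ℂ _ ∘L P.state) = 1 := by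
  rw [P.isEnsemble.opTrace_comp, expect]
  have h : ∀ i, inner ℂ (((√(P.prob i) : ℝ) : ℂ) • P.vec i) (ContinuousLinearMap.id ℂ (L2 ℝ)
      (((√(P.prob i) : ℝ) : ℂ) • P.vec i)) = (P.prob i : ℂ) := fun i => by
    rw [ContinuousLinearMap.id_apply, inner_self_eq_norm_sq_to_K, norm_smul, (P.vec_param i).1,
      mul_one, Complex.norm_real, Real.norm_eq_abs, abs_of_nonneg (Real.sqrt_nonneg _)]
    rw [RCLike.ofReal_eq_complex_ofReal, ← Complex.ofReal_pow, Real.sq_sqrt (P.prob_nonneg i)]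
  simp only [h]
  exact_mod_cast P.prob_sum.tsum_eq

theorem pull_id {E F : Type} [NormedAddCommGroup E] [InnerProductSpace ℂ E] [CompleteSpace E]
    [NormedAddCommGroup F] [InnerProductSpace ℂ F] [CompleteSpace F] (G : Submodule ℂ E)
    (W : E →L[ℂ] F) : Pull G W (ContinuousLinearMap.id ℂ F) (ContinuousLinearMap.id ℂ E) :=
  fun _ hv => ⟨hv, rfl⟩

end Locations

/-! ### The ancilla in the logical plus state. -/

section Gadget
variable {s₀ sH sSum sX sZ sI : ℝ} (G : ECGadget s₀ sH sSum sX sZ sI)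
namespace ECGadget

/-- The state prepared in mode 2. -/
def plusState : L2 ℝ →L[ℂ] L2 ℝ := kraus G.noiseH.op (conj fourierGate G.prep₂.state)

theorem pos_prep (G : ECGadget s₀ sH sSum sX sZ sI) : 0 < s₀ := (G.prep₂.vec_param 0).pos

/-- The noise after the Fourier gate preserves the parity of momentum bins, so the state remains an
exact eigenstate of the logical X while its radii grow by sH. -/
theorem isTracked_plusState (hs : s₀ + sH ≤ c / 2) :
    IsTracked G.plusState (near (s₀ + sH) ⊓ fixed logicalX) := by
  have hH := G.noiseH.nonneg (G.prep₂.vec_param 0).1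
  have h0 := G.pos_prep
  refine (G.prep₂.isTracked_fourierGate (by linarith)).kraus G.noiseH.trace_preserving
    fun j v hv => ?_
  obtain ⟨h1, h2⟩ := map_near (G.noiseH.mem j) h0.le (by linarith) hs hv.1
  exact ⟨h1, h2.trans (congrArg _ hv.2)⟩

theorem opTrace_plusState (hs : s₀ ≤ c / 2) :
    opTrace (ContinuousLinearMap.id ℂ _ ∘L G.plusState) = 1 := by
  rw [plusState, (G.prep₂.isTracked_fourierGate hs).opTrace_kraus G.noiseH.trace_preserving
    fun j => pull_id _ _, (G.prep₂.isTracked hs).opTrace_conj norm_fourierGate (pull_id _ _),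
    G.prep₂.opTrace_state]

end ECGadget
end Gadget

/-! ### Radii of mode 3 alone. -/

section ThirdMode

theorem tmul_mem_supported {P : ZMod 2 → ℝ → L2 ℝ →L[ℂ] L2 ℝ} {r : ℝ} {v w u : L2 ℝ} :
    (v ∈ supported P r → tmul (tmul v w) u ∈ supported (fun b r => onMode 0 (P b r)) r) ∧
    (w ∈ supported P r → tmul (tmul v w) u ∈ supported (fun b r => onMode 1 (P b r)) r) ∧
    (u ∈ supported P r → tmul (tmul v w) u ∈ supported (fun b r => onMode 2 (P b r)) r) := by
  have h : ∀ i, filterOp (fun b r => onMode i (P b r)) r = onMode i (filterOp P r) := fun i =>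
    (isRep_onMode i).filterOp_eq P r
  refine ⟨fun hv => ?_, fun hv => ?_, fun hv => ?_⟩
  · show filterOp (fun b r => onMode 0 (P b r)) r _ = _
    rw [h]
    exact (on1_tmul _ _ _ _).trans (by rw [show filterOp P r v = v from hv])
  · show filterOp (fun b r => onMode 1 (P b r)) r _ = _
    rw [h]
    exact (on2_tmul _ _ _ _).trans (by rw [show filterOp P r w = w from hv])
  · show filterOp (fun b r => onMode 2 (P b r)) r _ = _
    rw [h]
    exact (on3_tmul _ _ _ _).trans (by rw [show filterOp P r u = u from hv])

theorem tmul_mem_good {q p : Fin 3 → ℝ} {v w u : L2 ℝ}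
    (hv : v ∈ supported posOp (q 0) ⊓ supported momOp (p 0))
    (hw : w ∈ supported posOp (q 1) ⊓ supported momOp (p 1))
    (hu : u ∈ supported posOp (q 2) ⊓ supported momOp (p 2)) :
    tmul (tmul v w) u ∈ good q p := by
  rw [mem_good]
  intro i
  fin_cases i
  · exact ⟨tmul_mem_supported.1 hv.1, tmul_mem_supported.1 hv.2⟩
  · exact ⟨tmul_mem_supported.2.1 hw.1, tmul_mem_supported.2.1 hw.2⟩
  · exact ⟨tmul_mem_supported.2.2 hu.1, tmul_mem_supported.2.2 hu.2⟩

/-- The three-mode vectors whose third position and momentum are within `q` and `p` of multiples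
of `c`. -/
def third (q p : ℝ) : Submodule ℂ H₃ := supported (posOn 2) q ⊓ supported (momOn 2) p

variable {q p s : ℝ}

theorem third_mono {q' p' : ℝ} (hq : q ≤ q') (hp : p ≤ p') (hq' : q' ≤ c / 2) (hp' : p' ≤ c / 2) :
    third q p ≤ third q' p' :=
  inf_le_inf ((isBinned_posOn 2).supported_mono hq hq') ((isBinned_momOn 2).supported_mono hp hp')

theorem mem_third_of_commute {A : H₃ →L[ℂ] H₃} (hA : ∀ B, A ∘L on3 B = on3 B ∘L A) {v : H₃}
    (hv : v ∈ third q p) : A v ∈ third q p := by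
  have h : ∀ (P : ZMod 2 → ℝ → L2 ℝ →L[ℂ] L2 ℝ) (r : ℝ),
      A ∘L filterOp (fun b r => onMode 2 (P b r)) r =
        filterOp (fun b r => onMode 2 (P b r)) r ∘L A := fun P r => by
    rw [(isRep_onMode 2).filterOp_eq]; exact hA _
  exact ⟨mem_supported_of_commute (h posOp q) hv.1, mem_supported_of_commute (h momOp p) hv.2⟩

theorem on3_mem_third {K : L2 ℝ →L[ℂ] L2 ℝ} (hK : K ∈ closedSpan (smallDisp s)) (hs : 0 ≤ s)
    (hq0 : 0 ≤ q) (hp0 : 0 ≤ p) (hq : q + s ≤ c / 2) (hp : p + s ≤ c / 2) {v : H₃}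
    (hv : v ∈ third q p) : on3 K v ∈ third (q + s) (p + s) := by
  have hc := half_c_le
  refine ⟨?_, ?_⟩
  · exact ((isRep_on3.carries (carries_posOp hK hq0 (by linarith))).map_supported (isBinned_posOn 2)
      (isBinned_posOn 2) (by linarith) hq hv.1).1
  · exact ((isRep_on3.carries (carries_momOp hK hp0 (by linarith))).map_supported (isBinned_momOn 2)
      (isBinned_momOn 2) (by linarith) hp hv.2).1

theorem on23_mem_third {K : L2 (ℝ × ℝ) →L[ℂ] L2 (ℝ × ℝ)} (hK : K ∈ closedSpan (smallDisp₂ s))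
    (hs : 0 ≤ s) (hq0 : 0 ≤ q) (hp0 : 0 ≤ p) (hq : q + s ≤ c / 2) (hp : p + s ≤ c / 2) {v : H₃}
    (hv : v ∈ third q p) : on23 K v ∈ third (q + s) (p + s) := by
  have hc := half_c_le
  refine ⟨?_, ?_⟩
  · exact ((carries_on23_two (fun A hA => carries_posOp (mem_closedSpan_of_mem hA) hq0
      (by linarith)) hK).map_supported (isBinned_posOn 2) (isBinned_posOn 2) (by linarith) hq hv.1).1
  · exact ((carries_on23_two (fun A hA => carries_momOp (mem_closedSpan_of_mem hA) hp0
      (by linarith)) hK).map_supported (isBinned_momOn 2) (isBinned_momOn 2) (by linarith) hp hv.2).1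

/-- Only the position of mode 2 flows into mode 3; the momentum of mode 3 is untouched. So nothing
need be known about mode 1 or the momentum of mode 2. -/
theorem on23_sumGate_mem_third {r : ℝ} (hr0 : 0 ≤ r) (hq0 : 0 ≤ q) (hp0 : 0 ≤ p)
    (hq : r + q ≤ c / 2) (hp : p ≤ c / 2) {v : H₃} (hr : v ∈ supported (posOn 1) r)
    (hv : v ∈ third q p) : on23 sumGate v ∈ third (r + q) p := by
  have hc := half_c_le
  refine ⟨?_, ?_⟩
  · exact ((carriesSum_on23_posOn (add_nonneg hr0 hq0) (hq.trans hc) le_rfl).map_supported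
      (isBinned_posOn 1) (isBinned_posOn 2) (isBinned_posOn 2) (by linarith) (by linarith) hq
      (fun b b' => onMode_comp_onMode (by decide) _ _) hr hv.1).1
  · exact ((carries_on23_sumGate_momOn (l := 2) (by decide) hp0 (hp.trans hc)
      le_rfl).map_supported (isBinned_momOn 2) (isBinned_momOn 2) hp hp hv.2).1

theorem slice_mem_near {Φ : H₃} (h : Φ ∈ third s s) (f : L2 (ℝ × ℝ)) :
    ContinuousLinearMap.adjoint (tmulLeft f) Φ ∈ near s := by
  have key : ∀ P : ZMod 2 → ℝ → L2 ℝ →L[ℂ] L2 ℝ,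
      Φ ∈ supported (fun b r => onMode 2 (P b r)) s →
      ContinuousLinearMap.adjoint (tmulLeft f) Φ ∈ supported P s := fun P hΦ => by
    have h1 : on3 (filterOp P s) Φ = Φ := by
      have h2 : filterOp (fun b r => onMode 2 (P b r)) s Φ = Φ := hΦ
      rw [(isRep_onMode 2).filterOp_eq] at h2
      exact h2
    show filterOp P s _ = _
    rw [← slice_opTensor]
    exact congrArg _ h1
  exact ⟨key posOp h.1, key momOp h.2⟩

end ThirdMode

/-! ### The output lies in the filtered subspace: part (A). -/

section Output
variable {s₀ sH sSum sX sZ sI : ℝ} (G : ECGadget s₀ sH sSum sX sZ sI)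
namespace ECGadget

/-- The initial state of the three modes. -/
def initial (ρ : L2 ℝ →L[ℂ] L2 ℝ) : H₃ →L[ℂ] H₃ :=
  opTensor (opTensor ρ G.plusState) G.prep₃.state

/-- The state after the first waiting step. -/
def afterFirstWait (ρ : L2 ℝ →L[ℂ] L2 ℝ) : H₃ →L[ℂ] H₃ :=
  kraus (fun j => on3 (G.noiseI.op j))
    (kraus (fun j => on23 (G.noiseSum₂₃.op j)) (conj (on23 sumGate) (G.initial ρ)))

theorem nonneg (G : ECGadget s₀ sH sSum sX sZ sI) : 0 ≤ sH ∧ 0 ≤ sSum ∧ 0 ≤ sX ∧ 0 ≤ sZ ∧ 0 ≤ sI :=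
  have h := (G.prep₂.vec_param 0).1
  ⟨G.noiseH.nonneg h, G.noiseSum₂₃.nonneg₂ h, G.noiseX.nonneg h, G.noiseZ.nonneg h, G.noiseI.nonneg h⟩

theorem isTracked_afterFirstWait {ρ : L2 ℝ →L[ℂ] L2 ℝ} (hρ : IsTracked ρ ⊤)
    (h : 2 * s₀ + sH + sSum + sI ≤ c / 2) : IsTracked (G.afterFirstWait ρ)
      (third (s₀ + sH + s₀ + sSum + sI) (s₀ + sSum + sI)) := by
  have h0 := G.pos_prep
  obtain ⟨hH, hSum, hX, hZ, hI⟩ := G.nonneg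
  have h1 : IsTracked (G.initial ρ) (supported (posOn 1) (s₀ + sH) ⊓ third s₀ s₀) := by
    -- The tensor product is built in two steps. The intermediate subspace collects the two-mode
    -- vectors whose product with every admissible third vector is as required.
    refine (hρ.opTensor (K := ⨅ u : near s₀, (supported (posOn 1) (s₀ + sH) ⊓ third s₀ s₀).comap
      (tmulRight u.1).toLinearMap) (G.isTracked_plusState (by linarith))
      fun v _ w hw => ?_).opTensor (G.prep₃.isTracked (by linarith)) fun Φ hΦ u hu => ?_
    · rw [Submodule.mem_iInf]
      rintro ⟨u, hu⟩
      exact ⟨tmul_mem_supported.2.1 hw.1.1, tmul_mem_supported.2.2 hu.1,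
        tmul_mem_supported.2.2 hu.2⟩
    · exact (Submodule.mem_iInf _).1 hΦ ⟨u, hu.1⟩
  have h2 : IsTracked (conj (on23 sumGate) (G.initial ρ)) (third (s₀ + sH + s₀) s₀) :=
    h1.conj fun v hv => on23_sumGate_mem_third (by linarith) h0.le h0.le (by linarith)
      (by linarith) hv.1 hv.2
  have h3 := h2.kraus (G' := third (s₀ + sH + s₀ + sSum) (s₀ + sSum))
    (isTracePreserving_on23 G.noiseSum₂₃.trace_preserving)
    fun j v hv => on23_mem_third (G.noiseSum₂₃.mem j) hSum (by linarith) h0.le (by linarith)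
      (by linarith) hv
  exact h3.kraus (isTracePreserving_onMode 2 G.noiseI.trace_preserving)
    fun j v hv => on3_mem_third (G.noiseI.mem j) hI (by linarith) (by linarith) (by linarith)
      (by linarith) hv

/-- After the first wait, only the second wait acts on mode 3. The second SUM gate, its noise and
the measurements commute with mode 3, so the input and the measurement noise leave no trace in the
bound. -/
theorem isTracked_output {ρ : L2 ℝ →L[ℂ] L2 ℝ} (hρ : IsTracked ρ ⊤) {s : ℝ}
    (h : 2 * s₀ + sH + sSum + 2 * sI ≤ s) (hs : s ≤ c / 2) (a b : ZMod 2) :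
    IsTracked (G.output a b ρ) (near s) := by
  have h0 := G.pos_prep
  obtain ⟨hH, hSum, hX, hZ, hI⟩ := G.nonneg
  have h3 := ((G.isTracked_afterFirstWait hρ (by linarith)).conj
    (fun v hv => mem_third_of_commute (A := on12 sumGate) (on12_comp_on3 _) hv)).kraus
    (isTracePreserving_on12 G.noiseSum₁₂.trace_preserving)
    (fun j v hv => mem_third_of_commute (on12_comp_on3 _) hv)
  have h4 := ((h3.kraus (isTracePreserving_onMode 2 G.noiseI'.trace_preserving)
    fun j v hv => on3_mem_third (G.noiseI'.mem j) hI (by linarith) (by linarith) (by linarith)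
      (by linarith) hv).kraus (isTracePreserving_onMode 0 G.noiseX.trace_preserving)
    (fun j v hv => mem_third_of_commute (on12_comp_on3 _) hv)).kraus
    (isTracePreserving_onMode 1 G.noiseZ.trace_preserving)
    (fun j v hv => mem_third_of_commute (on12_comp_on3 _) hv)
  have h5 := (h4.conj (A := measOp a b) (G' := third s s) fun v hv =>
    third_mono (by linarith) (by linarith) hs hs
      (mem_third_of_commute (measOp_comp_on3 a b) hv))
  exact h5.partialTraceLeft fun Φ hΦ f => slice_mem_near hΦ f

end ECGadget
end Output

/-! ### Pulling the decoder observable back through the circuit. -/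

section Pullback
variable {q p q' p' : Fin 3 → ℝ} {W : H₃ →L[ℂ] H₃} {Z X : Fin 3 → H₃ →L[ℂ] H₃}

/-- The logical observable read off from the measured outcomes and the output mode. -/
def outObs (a b ν γ : ZMod 2) : H₃ →L[ℂ] H₃ := prodOp a b ν γ (xOn 0) (zOn 1) (zOn 2) (xOn 2)

/-- The observable `outObs` pulled back through the second SUM gate. -/
def midObs (a b ν γ : ZMod 2) : H₃ →L[ℂ] H₃ :=
  prodOp a b ν γ (xOn 0 ∘L xOn 1) (zOn 0 ∘L zOn 1) (zOn 2) (xOn 2)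

/-- The observable `midObs` pulled back through the first SUM gate. -/
def inObs (a b ν γ : ZMod 2) : H₃ →L[ℂ] H₃ :=
  prodOp a b ν γ (xOn 0 ∘L xOn 1 ∘L xOn 2) (zOn 0 ∘L zOn 1) (zOn 1 ∘L zOn 2) (xOn 2)

theorem Small.le_c (hq : Small q) (i : Fin 3) : q i ≤ c := (hq i).2.trans half_c_le

theorem IsStage.pull_z (h : IsStage W q p q' p' Z X) {i : Fin 3}
    (hZ : ∀ v ∈ good q p, Z i v ∈ good q p) : Pull (good q p) W (zOn i) (Z i) :=
  fun v hv => ⟨hZ v hv, h.z v hv i⟩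

theorem IsStage.pull_x (h : IsStage W q p q' p' Z X) {i : Fin 3}
    (hX : ∀ v ∈ good q p, X i v ∈ good q p) : Pull (good q p) W (xOn i) (X i) :=
  fun v hv => ⟨hX v hv, h.x v hv i⟩

theorem zOn_mem (hp : Small p) (i : Fin 3) : ∀ v ∈ good q p, zOn i v ∈ good q p :=
  fun _ hv => zOn_mem_good (fun i => (hp i).1) hp.le_c hv i

theorem xOn_mem (hq : Small q) (i : Fin 3) : ∀ v ∈ good q p, xOn i v ∈ good q p :=
  fun _ hv => xOn_mem_good (fun i => (hq i).1) hq.le_c hv i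

theorem IsStage.pull_outObs (hq : Small q) (hp : Small p) (h : IsStage W q p q' p' zOn xOn)
    (a b ν γ : ZMod 2) : Pull (good q p) W (outObs a b ν γ) (outObs a b ν γ) :=
  .prodOp (h.pull_x (xOn_mem hq 0)) (h.pull_z (zOn_mem hp 1)) (h.pull_z (zOn_mem hp 2))
    (h.pull_x (xOn_mem hq 2)) a b ν γ

theorem IsStage.pull_midObs (hq : Small q) (hp : Small p) (h : IsStage W q p q' p' zOn xOn)
    (a b ν γ : ZMod 2) : Pull (good q p) W (midObs a b ν γ) (midObs a b ν γ) :=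
  .prodOp ((h.pull_x (xOn_mem hq 0)).comp (h.pull_x (xOn_mem hq 1)))
    ((h.pull_z (zOn_mem hp 0)).comp (h.pull_z (zOn_mem hp 1))) (h.pull_z (zOn_mem hp 2))
    (h.pull_x (xOn_mem hq 2)) a b ν γ

theorem mem_of_comp {E : Type} [NormedAddCommGroup E] [InnerProductSpace ℂ E] {G : Submodule ℂ E}
    {A B : E →L[ℂ] E} (hA : ∀ v ∈ G, A v ∈ G) (hB : ∀ v ∈ G, B v ∈ G) :
    ∀ v ∈ G, (A ∘L B) v ∈ G := fun v hv => hA _ (hB v hv)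

theorem IsStage.pull_outObs_midObs (hq : Small q) (hp : Small p) (h : IsStage W q p q' p' Z X)
    (hX0 : X 0 = xOn 0 ∘L xOn 1) (hX2 : X 2 = xOn 2) (hZ1 : Z 1 = zOn 0 ∘L zOn 1)
    (hZ2 : Z 2 = zOn 2) (a b ν γ : ZMod 2) :
    Pull (good q p) W (outObs a b ν γ) (midObs a b ν γ) := by
  have hA := h.pull_x (i := 0) (by rw [hX0]; exact mem_of_comp (xOn_mem hq 0) (xOn_mem hq 1))
  have hB := h.pull_z (i := 1) (by rw [hZ1]; exact mem_of_comp (zOn_mem hp 0) (zOn_mem hp 1))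
  have hC := h.pull_z (i := 2) (by rw [hZ2]; exact zOn_mem hp 2)
  have hD := h.pull_x (i := 2) (by rw [hX2]; exact xOn_mem hq 2)
  rw [hX0] at hA
  rw [hZ1] at hB
  rw [hZ2] at hC
  rw [hX2] at hD
  exact hA.prodOp hB hC hD a b ν γ

theorem IsStage.pull_midObs_inObs (hq : Small q) (hp : Small p) (h : IsStage W q p q' p' Z X)
    (hX0 : X 0 = xOn 0) (hX1 : X 1 = xOn 1 ∘L xOn 2) (hX2 : X 2 = xOn 2) (hZ0 : Z 0 = zOn 0)
    (hZ1 : Z 1 = zOn 1) (hZ2 : Z 2 = zOn 1 ∘L zOn 2) (a b ν γ : ZMod 2) :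
    Pull (good q p) W (midObs a b ν γ) (inObs a b ν γ) := by
  have hx0 := h.pull_x (i := 0) (by rw [hX0]; exact xOn_mem hq 0)
  have hx1 := h.pull_x (i := 1) (by rw [hX1]; exact mem_of_comp (xOn_mem hq 1) (xOn_mem hq 2))
  have hx2 := h.pull_x (i := 2) (by rw [hX2]; exact xOn_mem hq 2)
  have hz0 := h.pull_z (i := 0) (by rw [hZ0]; exact zOn_mem hp 0)
  have hz1 := h.pull_z (i := 1) (by rw [hZ1]; exact zOn_mem hp 1)
  have hz2 := h.pull_z (i := 2) (by rw [hZ2]; exact mem_of_comp (zOn_mem hp 1) (zOn_mem hp 2))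
  rw [hX0] at hx0
  rw [hX1] at hx1
  rw [hX2] at hx2
  rw [hZ0] at hz0
  rw [hZ1] at hz1
  rw [hZ2] at hz2
  exact (hx0.comp hx1).prodOp (hz0.comp hz1) hz2 hx2 a b ν γ

theorem isTracePreserving_unit {E : Type} [NormedAddCommGroup E] [InnerProductSpace ℂ E]
    {U : E →L[ℂ] E} : (IsTracePreserving fun _ : Unit => U) ↔ ∀ x, ‖U x‖ = ‖x‖ := by
  refine ⟨fun h x => ?_, fun h x => by rw [← h x]; exact hasSum_unique _⟩
  have := (hasSum_unique fun _ : Unit => ‖U x‖ ^ 2).unique (h x)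
  exact (pow_left_inj₀ (norm_nonneg _) (norm_nonneg _) two_ne_zero).1 this

theorem norm_sumGate (x : L2 (ℝ × ℝ)) : ‖sumGate x‖ = ‖x‖ := LinearIsometry.norm_map _ x

theorem norm_on12_sumGate (x : H₃) : ‖on12 sumGate x‖ = ‖x‖ :=
  isTracePreserving_unit.1 (isTracePreserving_on12 (isTracePreserving_unit.2 norm_sumGate)) x

theorem norm_on23_sumGate (x : H₃) : ‖on23 sumGate x‖ = ‖x‖ :=
  isTracePreserving_unit.1 (isTracePreserving_on23 (isTracePreserving_unit.2 norm_sumGate)) x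

/-- The expectation value on product vectors, summed over the three ensembles; the ancillas
contribute only their traces. -/
theorem opTrace_inObs {ρ τ κ : L2 ℝ →L[ℂ] L2 ℝ} (hρ : IsTracked ρ ⊤)
    (hτ : IsTracked τ (fixed logicalX)) (hκ : IsTracked κ (fixed logicalZ)) (a b ν γ : ZMod 2) :
    opTrace (inObs a b ν γ ∘L opTensor (opTensor ρ τ) κ) =
      (1 / 4 * powSign γ (sgn a) : ℂ) *
        opTrace ((halfOp (sgn (ν + b)) logicalZ ∘L powOp γ logicalX) ∘L ρ) *
        opTrace (ContinuousLinearMap.id ℂ _ ∘L τ) * opTrace (ContinuousLinearMap.id ℂ _ ∘L κ) := by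
  have hρτ : IsTracked (opTensor ρ τ) ⊤ := hρ.opTensor hτ fun _ _ _ _ => Submodule.mem_top
  have e : ∀ x y z w : ℂ, x * y * z * w = x * (y * z * w) := fun x y z w => by ring
  rw [e, ← opTrace_opTensor hρ hτ, ← opTrace_opTensor hρτ hκ]
  obtain ⟨ι, v, hv, -⟩ := hρ
  obtain ⟨ι', w, hw, hwX⟩ := hτ
  obtain ⟨ι'', u, hu, huZ⟩ := hκ
  have h := (hv.opTensor hw).opTensor hu
  rw [h.opTrace_comp, h.opTrace_comp, expect, expect, ← tsum_mul_left]
  refine tsum_congr fun i => ?_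
  rw [inObs, inner_prodOp_tmul a b ν γ (hwX _) (huZ _), opTensor_tmul, opTensor_tmul, inner_tmul,
    inner_tmul]
  simp only [ContinuousLinearMap.comp_apply, ContinuousLinearMap.id_apply]
  ring

end Pullback

/-! ### The decoded output: part (B). -/

section Correction
variable {s₀ sH sSum sX sZ sI : ℝ} (G : ECGadget s₀ sH sSum sX sZ sI)
namespace ECGadget

theorem small_of {x y z : ℝ} (hx : 0 ≤ x ∧ x ≤ c / 2) (hy : 0 ≤ y ∧ y ≤ c / 2)
    (hz : 0 ≤ z ∧ z ≤ c / 2) : Small ![x, y, z] := by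
  intro i
  fin_cases i
  exacts [hx, hy, hz]

theorem isTracked_preMeasurement {ρ : L2 ℝ →L[ℂ] L2 ℝ} (hρ : IsTracked ρ ⊤)
    (h : s₀ + sH ≤ c / 2) : IsTracked (G.preMeasurement ρ) ⊤ := by
  have h0 := G.pos_prep
  obtain ⟨hH, -⟩ := G.nonneg
  have top : ∀ {A : H₃ →L[ℂ] H₃}, ∀ v ∈ (⊤ : Submodule ℂ H₃), A v ∈ (⊤ : Submodule ℂ H₃) :=
    fun _ _ => Submodule.mem_top
  have T0 : IsTracked (G.initial ρ) ⊤ :=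
    (hρ.opTensor (K := ⊤) (G.isTracked_plusState h) fun _ _ _ _ => Submodule.mem_top).opTensor
      (G.prep₃.isTracked (by linarith)) fun _ _ _ _ => Submodule.mem_top
  have T3 := ((T0.conj (A := on23 sumGate) top).kraus
    (isTracePreserving_on23 G.noiseSum₂₃.trace_preserving) fun j => top).kraus
    (isTracePreserving_onMode 2 G.noiseI.trace_preserving) fun j => top
  have T6 := ((T3.conj (A := on12 sumGate) top).kraus
    (isTracePreserving_on12 G.noiseSum₁₂.trace_preserving) fun j => top).kraus
    (isTracePreserving_onMode 2 G.noiseI'.trace_preserving) fun j => top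
  exact (T6.kraus (isTracePreserving_onMode 0 G.noiseX.trace_preserving) fun j => top).kraus
    (isTracePreserving_onMode 1 G.noiseZ.trace_preserving) fun j => top

/-- The radii of every stage are listed explicitly and stay at most c/2, so each stage pulls the
observable back exactly: noise leaves it unchanged and the two SUM gates turn `outObs` into `midObs`
and then `inObs`, which is evaluated on the initial product state. -/
theorem opTrace_outObs {r : ℝ} (hr : 0 < r)
    (h : r + (2 * s₀ + sH + sSum + max (sSum + max sX sZ) (2 * sI)) ≤ c / 2) {ρ : L2 ℝ →L[ℂ] L2 ℝ}
    (hρ : IsTracked ρ (near r)) (a b ν γ : ZMod 2) :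
    opTrace (outObs a b ν γ ∘L G.preMeasurement ρ) =
      (1 / 4 * powSign γ (sgn a) : ℂ) *
        opTrace ((halfOp (sgn (ν + b)) logicalZ ∘L powOp γ logicalX) ∘L ρ) := by
  have h0 := G.pos_prep
  obtain ⟨hH, hSum, hX, hZ, hI⟩ := G.nonneg
  -- The branches of the maxima: measured mode 1, whose momentum collects r, both ancillas, two SUM
  -- noises and sX; measured mode 2 with sZ; and the output mode with its two waits.
  have b1 : r + 2 * s₀ + sH + 2 * sSum + sX ≤ c / 2 := by
    linarith [le_max_left (sSum + max sX sZ) (2 * sI), le_max_left sX sZ]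
  have b2 : r + 2 * s₀ + sH + 2 * sSum + sZ ≤ c / 2 := by
    linarith [le_max_left (sSum + max sX sZ) (2 * sI), le_max_right sX sZ]
  have b3 : r + 2 * s₀ + sH + sSum + 2 * sI ≤ c / 2 := by
    linarith [le_max_right (sSum + max sX sZ) (2 * sI)]
  clear h
  -- The radius of mode 2 after the noisy Fourier gate, kept opaque so that the sums of radii match
  -- as written.
  obtain ⟨t, ht⟩ : ∃ t, t = s₀ + sH := ⟨_, rfl⟩
  have m0 : Small ![r, t, s₀] := small_of (by constructor <;> linarith)
    (by constructor <;> linarith) (by constructor <;> linarith)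
  have q1 : Small ![r, t, t + s₀] := small_of (by constructor <;> linarith)
    (by constructor <;> linarith) (by constructor <;> linarith)
  have p1 : Small ![r, t + s₀, s₀] := small_of (by constructor <;> linarith)
    (by constructor <;> linarith) (by constructor <;> linarith)
  have q2 : Small ![r, t + sSum, t + s₀ + sSum] := small_of (by constructor <;> linarith)
    (by constructor <;> linarith) (by constructor <;> linarith)
  have p2 : Small ![r, t + s₀ + sSum, s₀ + sSum] := small_of (by constructor <;> linarith)
    (by constructor <;> linarith) (by constructor <;> linarith)
  have q3 : Small ![r, t + sSum, t + s₀ + sSum + sI] := small_of (by constructor <;> linarith)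
    (by constructor <;> linarith) (by constructor <;> linarith)
  have p3 : Small ![r, t + s₀ + sSum, s₀ + sSum + sI] := small_of (by constructor <;> linarith)
    (by constructor <;> linarith) (by constructor <;> linarith)
  have q4 : Small ![r, r + (t + sSum), t + s₀ + sSum + sI] := small_of
    (by constructor <;> linarith) (by constructor <;> linarith) (by constructor <;> linarith)
  have p4 : Small ![r + (t + s₀ + sSum), t + s₀ + sSum, s₀ + sSum + sI] := small_of
    (by constructor <;> linarith) (by constructor <;> linarith) (by constructor <;> linarith)
  have q5 : Small ![r + sSum, r + (t + sSum) + sSum, t + s₀ + sSum + sI] := small_of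
    (by constructor <;> linarith) (by constructor <;> linarith) (by constructor <;> linarith)
  have p5 : Small ![r + (t + s₀ + sSum) + sSum, t + s₀ + sSum + sSum, s₀ + sSum + sI] := small_of
    (by constructor <;> linarith) (by constructor <;> linarith) (by constructor <;> linarith)
  have q6 : Small ![r + sSum, r + (t + sSum) + sSum, t + s₀ + sSum + sI + sI] := small_of
    (by constructor <;> linarith) (by constructor <;> linarith) (by constructor <;> linarith)
  have p6 : Small ![r + (t + s₀ + sSum) + sSum, t + s₀ + sSum + sSum, s₀ + sSum + sI + sI] :=
    small_of (by constructor <;> linarith) (by constructor <;> linarith)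
      (by constructor <;> linarith)
  have q7 : Small ![r + sSum + sX, r + (t + sSum) + sSum, t + s₀ + sSum + sI + sI] := small_of
    (by constructor <;> linarith) (by constructor <;> linarith) (by constructor <;> linarith)
  have p7 : Small ![r + (t + s₀ + sSum) + sSum + sX, t + s₀ + sSum + sSum, s₀ + sSum + sI + sI] :=
    small_of (by constructor <;> linarith) (by constructor <;> linarith)
      (by constructor <;> linarith)
  have q8 : Small ![r + sSum + sX, r + (t + sSum) + sSum + sZ, t + s₀ + sSum + sI + sI] := small_of
    (by constructor <;> linarith) (by constructor <;> linarith) (by constructor <;> linarith)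
  have p8 : Small ![r + (t + s₀ + sSum) + sSum + sX, t + s₀ + sSum + sSum + sZ,
      s₀ + sSum + sI + sI] := small_of (by constructor <;> linarith) (by constructor <;> linarith)
      (by constructor <;> linarith)
  have S1 := isStage_on23_sumGate m0 m0 q1 p1 (by simp) (by simp)
  have S2 := fun j => isStage_on23 (G.noiseSum₂₃.mem j) q1 p1 q2 p2 (by simp) (by simp)
  have S3 := fun j => isStage_onMode (G.noiseI.mem j) 2 q2 p2 q3 p3
    (by intro j; fin_cases j <;> simp [hI]) (by intro j; fin_cases j <;> simp [hI])
    (by simp) (by simp)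
  have S4 := isStage_on12_sumGate q3 p3 q4 p4 (by simp) (by simp)
  have S5 := fun j => isStage_on12 (G.noiseSum₁₂.mem j) q4 p4 q5 p5 (by simp) (by simp)
  have S6 := fun j => isStage_onMode (G.noiseI'.mem j) 2 q5 p5 q6 p6
    (by intro j; fin_cases j <;> simp [hI]) (by intro j; fin_cases j <;> simp [hI])
    (by simp) (by simp)
  have S7 := fun j => isStage_onMode (G.noiseX.mem j) 0 q6 p6 q7 p7
    (by intro j; fin_cases j <;> simp [hX]) (by intro j; fin_cases j <;> simp [hX])
    (by simp) (by simp)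
  have S8 := fun j => isStage_onMode (G.noiseZ.mem j) 1 q7 p7 q8 p8
    (by intro j; fin_cases j <;> simp [hZ]) (by intro j; fin_cases j <;> simp [hZ])
    (by simp) (by simp)
  have hplus := G.isTracked_plusState (by linarith)
  rw [← ht] at hplus
  have hzero := G.prep₃.isTracked (by linarith)
  have T0 : IsTracked (G.initial ρ) (good ![r, t, s₀] ![r, t, s₀]) := by
    refine (hρ.opTensor (K := ⨅ u : near s₀, (good ![r, t, s₀] ![r, t, s₀]).comap
      (tmulRight u.1).toLinearMap) hplus fun v hv w hw => ?_).opTensor hzero fun Φ hΦ u hu => ?_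
    · rw [Submodule.mem_iInf]
      exact fun u => tmul_mem_good hv hw.1 u.2
    · exact (Submodule.mem_iInf _).1 hΦ ⟨u, hu.1⟩
  have K2 := isTracePreserving_on23 G.noiseSum₂₃.trace_preserving
  have K3 := isTracePreserving_onMode 2 G.noiseI.trace_preserving
  have K5 := isTracePreserving_on12 G.noiseSum₁₂.trace_preserving
  have K6 := isTracePreserving_onMode 2 G.noiseI'.trace_preserving
  have K7 := isTracePreserving_onMode 0 G.noiseX.trace_preserving
  have K8 := isTracePreserving_onMode 1 G.noiseZ.trace_preserving
  have T1 := T0.conj S1.mem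
  have T2 := T1.kraus K2 fun j => (S2 j).mem
  have T3 := T2.kraus K3 fun j => (S3 j).mem
  have T4 := T3.conj S4.mem
  have T5 := T4.kraus K5 fun j => (S5 j).mem
  have T6 := T5.kraus K6 fun j => (S6 j).mem
  have T7 := T6.kraus K7 fun j => (S7 j).mem
  have E8 := T7.opTrace_kraus K8 fun j => (S8 j).pull_outObs q7 p7 a b ν γ
  have E7 := T6.opTrace_kraus K7 fun j => (S7 j).pull_outObs q6 p6 a b ν γ
  have E6 := T5.opTrace_kraus K6 fun j => (S6 j).pull_outObs q5 p5 a b ν γ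
  have E5 := T4.opTrace_kraus K5 fun j => (S5 j).pull_outObs q4 p4 a b ν γ
  have E4 := T3.opTrace_conj norm_on12_sumGate (S4.pull_outObs_midObs q3 p3 (if_pos rfl)
    (if_neg (by decide)) (if_pos rfl) (if_neg (by decide)) a b ν γ)
  have E3 := T2.opTrace_kraus K3 fun j => (S3 j).pull_midObs q2 p2 a b ν γ
  have E2 := T1.opTrace_kraus K2 fun j => (S2 j).pull_midObs q1 p1 a b ν γ
  have E1 := T0.opTrace_conj norm_on23_sumGate (S1.pull_midObs_inObs m0 m0 (if_neg (by decide))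
    (if_pos rfl) (if_neg (by decide)) (if_neg (by decide)) (if_neg (by decide)) (if_pos rfl) a b ν γ)
  have E0 := opTrace_inObs (hρ.mono le_top) (hplus.mono inf_le_right) (hzero.mono inf_le_right)
    a b ν γ
  rw [G.opTrace_plusState (by linarith), G.prep₃.opTrace_state, mul_one, mul_one] at E0
  exact E8.trans <| E7.trans <| E6.trans <| E5.trans <| E4.trans <| E3.trans <| E2.trans <|
    E1.trans E0

theorem gkpDecoder_output {r : ℝ} (hr : 0 < r)
    (h : r + (2 * s₀ + sH + sSum + max (sSum + max sX sZ) (2 * sI)) ≤ c / 2) {ρ : L2 ℝ →L[ℂ] L2 ℝ}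
    (hρ : IsTracked ρ (near r)) (a b : ZMod 2) :
    gkpDecoder (G.output a b ρ) = (1 / 4 : ℂ) • (pauliFrame a b * gkpDecoder ρ *
      (pauliFrame a b).conjTranspose) := by
  have h0 := G.pos_prep
  obtain ⟨hH, hSum, hX, hZ, hI⟩ := G.nonneg
  ext μ ν
  have e := gkpDecoder_partialTraceLeft (G.isTracked_preMeasurement (hρ.mono le_top) (by
    linarith [le_max_right (sSum + max sX sZ) (2 * sI)])) a b μ ν
  rw [Matrix.smul_apply, pauliFrame_conj_apply, gkpDecoder_apply (hρ.mono le_top),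
    show μ + b + (ν + b) = μ + ν by
      rw [add_add_add_comm, CharTwo.add_self_eq_zero, add_zero]]
  refine (e.trans (G.opTrace_outObs hr h hρ a b ν (μ + ν))).trans ?_
  rw [smul_eq_mul, mul_assoc]

end ECGadget
end Correction
end
end GKP

theorem mainTheorem5 (s₀ sH sSum sX sZ sI s : ℝ)
    (hs : s = 2 * s₀ + sH + sSum + max (sSum + max sX sZ) (2 * sI))
    (G : GKP.ECGadget s₀ sH sSum sX sZ sI) :
    (s < √Real.pi / 2 →
      ∀ ρ : GKP.L2 ℝ →L[ℂ] GKP.L2 ℝ, GKP.IsDensityOperator ρ → ∀ a b : ZMod 2,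
        GKP.conj (GKP.sssFilter s) (G.output a b ρ) = G.output a b ρ) ∧
    (∀ r : ℝ, 0 < r → r + s < √Real.pi / 2 →
      ∀ ρ : GKP.L2 ℝ →L[ℂ] GKP.L2 ℝ, GKP.IsDensityOperator ρ →
        (∀ a b : ZMod 2,
          GKP.gkpDecoder (G.output a b (GKP.conj (GKP.sssFilter r) ρ)) =
            (1 / 4 : ℂ) • (GKP.pauliFrame a b * GKP.gkpDecoder (GKP.conj (GKP.sssFilter r) ρ) *
              (GKP.pauliFrame a b).conjTranspose)) ∧
        ∑ a : ZMod 2, ∑ b : ZMod 2, (GKP.pauliFrame a b).conjTranspose *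
            GKP.gkpDecoder (G.output a b (GKP.conj (GKP.sssFilter r) ρ)) * GKP.pauliFrame a b =
          GKP.gkpDecoder (GKP.conj (GKP.sssFilter r) ρ)) := by
  have h0 := G.pos_prep
  obtain ⟨hH, hSum, hX, hZ, hI⟩ := G.nonneg
  have hmax := le_max_right (sSum + max sX sZ) (2 * sI)
  have hs0 : 0 ≤ s := by linarith
  have tracked : ∀ ρ : GKP.L2 ℝ →L[ℂ] GKP.L2 ℝ, GKP.IsDensityOperator ρ → GKP.IsTracked ρ ⊤ :=
    fun ρ hρ => by
      obtain ⟨v, hv⟩ := hρ.exists_isEnsemble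
      exact ⟨_, v, hv, fun _ => Submodule.mem_top⟩
  refine ⟨fun hlt ρ hρ a b => ?_, fun r hr hlt ρ hρ => ?_⟩
  · exact (G.isTracked_output (tracked ρ hρ) (by linarith) hlt.le a b).conj_eq_self
      fun v hv => GKP.sssFilter_of_mem hs0 hlt.le hv
  · have hc : r + s ≤ GKP.c / 2 := hlt.le
    have key := G.gkpDecoder_output hr (by rw [← hs]; exact hc) ((tracked ρ hρ).conj
      fun v _ => GKP.sssFilter_mem hr.le (by linarith) v)
    refine ⟨key, ?_⟩
    have e : ∀ a b : ZMod 2, (GKP.pauliFrame a b).conjTranspose *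
        GKP.gkpDecoder (G.output a b (GKP.conj (GKP.sssFilter r) ρ)) * GKP.pauliFrame a b =
        (1 / 4 : ℂ) • GKP.gkpDecoder (GKP.conj (GKP.sssFilter r) ρ) := fun a b => by
      have h1 := GKP.pauliFrame_conjTranspose_mul a b
      rw [key, Matrix.mul_smul, Matrix.smul_mul]
      congr 1
      rw [Matrix.mul_assoc, Matrix.mul_assoc, Matrix.mul_assoc, h1, Matrix.mul_one,
        ← Matrix.mul_assoc, h1, Matrix.one_mul]
    -- Each of the four outcomes contributes a quarter of the decoded input.
    simp only [e, Finset.sum_const, Finset.card_univ, ZMod.card]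
    module
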